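/- Let $k\ge 1$ and $\tau\in\mathbb C$. Let $GL(k,\mathbb C)$ act on quadruples $(A,B,i,j)\in M_{k,k}\times M_{k,k}\times M_{k,2}\times M_{2,k}$ of complex matrices by $g\cdot(A,B,i,j)=(gAg^{-1},gBg^{-1},gi,jg^{-1})$, with symplectic form $\operatorname{tr} dA\wedge dB+\operatorname{tr} dj\wedge di$ and moment map $[A,B]-ij$, and let $N_{k,\tau}=\{[A,B]-ij=\tau\cdot 1\}/\!/GL(k,\mathbb C)$ be the affine symplectic quotient, with its Poisson algebra $\mathbb C[N_{k,\tau}]$ of restrictions of $GL(k,\mathbb C)$-invariant polynomials. Let $N_{k,\tau}\times\mathbb C^2$ be the product with the standard symplectic plane with coordinates $(\Lambda,M)$, $\{\Lambda,M\}=1$. With $i_1$ the first column of $i$ and $j_2$ the second row of $j$, put $\widehat A=\begin{pmatrix}A&i_1\\ j_2&\Lambda\end{pmatrix}$, a $(k+1)\times(k+1)$ matrix, with $\Lambda=0$ on $N_{k,\tau}$. (i) $N_{k,\tau}$ is algebraically completely integrable (in the sense that does not require compact level sets): $\dim N_{k,\tau}=4k$; the functions $\Phi_i=\operatorname{tr}A^i$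 $(1\le i\le k)$ and $\widehat\Phi_j=\operatorname{tr}\widehat A^j$ $(1\le j\le k+1)$ in $\mathbb C[N_{k,\tau}]$ pairwise Poisson commute; the ideal of polynomial relations among these $2k+1$ functions is generated by $\Phi_1=\widehat\Phi_1$; and the Hamiltonian vector fields of the $2k$ functions $\Phi_1,\dots,\Phi_k,\widehat\Phi_2,\dots,\widehat\Phi_{k+1}$ are linearly independent on a dense open subset (there are functions $g_1,\dots,g_{2k}\in\mathbb C[N_{k,\tau}]$ for which the determinant of their Poisson brackets with these $2k$ functions is not a zero divisor). (ii) The Poisson algebra $\mathbb C[N_{k,\tau}\times\mathbb C^2]$ is isomorphic, up to localisation, to $T=\mathbb C[T^*\mathbb C^k]^{S_k}\otimes\mathbb C[T^*\mathbb C^{k+1}]^{S_{k+1}}$, where $T^*\mathbb C^n$ has its canonical Poisson structure. More precisely, let $\lambda_i$ and $\widehat\lambda_j$ denote the eigenvalues of $A$ and of $\widehat A$ on the one side, and the base coordinates of $T^*\mathbb C^k$ and of $T^*\mathbb C^{k+1}$ on the other side, and put $$\Delta=\prod_{i\ne j}(\lambda_i-\lambda_j)\prod_{m\neq n}(\widehat\lambda_m-\widehat\lambda_n),\qquad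 R=\prod_{i=1}^{k}\prod_{j=1}^{k+1}(\lambda_i-\widehat\lambda_j),$$ elements of both algebras. Then $\Delta R$ is not a zero divisor in $\mathbb C[N_{k,\tau}\times\mathbb C^2]$, and there is an isomorphism of Poisson algebras $\psi:\mathbb C[N_{k,\tau}\times\mathbb C^2]_{\Delta R}\to T_{\Delta R}$ with $\psi(\operatorname{tr}A^i)=\sum_a\lambda_a^i$ and $\psi(\operatorname{tr}\widehat A^j)=\sum_b\widehat\lambda_b^j$ for all $i,j\geq 0$, which maps $\mathbb C[N_{k,\tau}\times\mathbb C^2]$ into $T_\Delta$. -/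

import Mathlib

open MvPolynomial
open scoped TensorProduct

noncomputable section

namespace Instanton

/-- A biderivation `{f, g} = β f g` of a commutative `ℂ`-algebra. All brackets used below are
built explicitly from the canonical bracket of a polynomial ring by restriction to a subalgebra,
passage to a quotient, tensor product and localisation. -/
abbrev PoissonBracket (R : Type) [CommRing R] [Algebra ℂ R] : Type :=
  Derivation ℂ R (Derivation ℂ R R)

/-- The Poisson bracket of the symplectic form `∑ dq_x ∧ dp_x` on `ℂ[q_x, p_x : x ∈ Q]`:
`{q_x, p_y} = δ_{xy}`, `{q_x, q_y} = {p_x, p_y} = 0`. Here `q_x = X (inl x)`, `p_x = X (inr x)`. -/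
def canonicalBracket (Q : Type) : PoissonBracket (MvPolynomial (Q ⊕ Q) ℂ) :=
  mkDerivation ℂ (Sum.elim (fun x => pderiv (Sum.inr x)) (fun x => -pderiv (Sum.inl x)))

section General

variable {R : Type} [CommRing R] [Algebra ℂ R]

/-- The restriction of a bracket to a subalgebra closed under it. -/
def restrictBracket (β : PoissonBracket R) (S : Subalgebra ℂ R)
    (hS : ∀ f ∈ S, ∀ g ∈ S, β f g ∈ S) : PoissonBracket S :=
  Derivation.mk'
    { toFun := fun f => Derivation.mk'
        { toFun := fun g => ⟨β f g, hS f f.2 g g.2⟩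
          map_add' := fun _ _ => Subtype.ext (by simp)
          map_smul' := fun _ _ => Subtype.ext (by simp) }
        (fun _ _ => Subtype.ext (by simp))
      map_add' := fun _ _ => by ext; simp
      map_smul' := fun _ _ => by ext; simp }
    (fun _ _ => by ext; simp)

/-- The bracket induced on the quotient by a Poisson ideal. -/
def quotientBracket (β : PoissonBracket R) (J : Ideal R)
    (hJ : ∀ f : R, ∀ x ∈ J, β f x ∈ J ∧ β x f ∈ J) : PoissonBracket (R ⧸ J) :=
  have key : ∀ a b c d : R, Ideal.Quotient.mk J a = Ideal.Quotient.mk J c →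
      Ideal.Quotient.mk J b = Ideal.Quotient.mk J d →
      Ideal.Quotient.mk J (β a b) = Ideal.Quotient.mk J (β c d) := by
    intro a b c d h1 h2
    rw [Ideal.Quotient.eq] at *
    have e : β a b - β c d = β (a - c) b + β c (b - d) := by simp
    rw [e]
    exact J.add_mem (hJ _ _ h1).2 (hJ _ _ h2).1
  have out : ∀ a : R ⧸ J, Ideal.Quotient.mk J (Quotient.out a) = a := fun a =>
    Quotient.out_eq a
  Derivation.mk'
    { toFun := fun f => Derivation.mk'
        { toFun := fun g => Ideal.Quotient.mk J (β (Quotient.out f) (Quotient.out g))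
          map_add' := fun g h => by
            rw [← map_add, ← map_add]
            exact key _ _ _ _ rfl (by simp [out])
          map_smul' := fun c g => by
            have := key (Quotient.out f) (Quotient.out (c • g)) (Quotient.out f)
              (c • Quotient.out g) rfl (by
                rw [out]; exact (congrArg (c • ·) (out g)).symm)
            rw [this, Derivation.map_smul]; rfl }
        (fun g h => by
          have := key (Quotient.out f) (Quotient.out (g * h)) (Quotient.out f)
              (Quotient.out g * Quotient.out h) rfl (by simp [out])
          simp only [LinearMap.coe_mk, AddHom.coe_mk]
          rw [this]; simp [out])
      map_add' := fun f g => by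
        ext x
        have := key (Quotient.out (f + g)) (Quotient.out x) (Quotient.out f + Quotient.out g)
          (Quotient.out x) (by simp [out]) rfl
        simp [this]
      map_smul' := fun c f => by
        ext x
        have := key (Quotient.out (c • f)) (Quotient.out x) (c • Quotient.out f)
          (Quotient.out x) (by rw [out]; exact (congrArg (c • ·) (out f)).symm) rfl
        simp [this]; rfl }
    (fun f g => by
        ext x
        have := key (Quotient.out (f * g)) (Quotient.out x) (Quotient.out f * Quotient.out g)
          (Quotient.out x) (by simp [out]) rfl
        simp [this, out])

theorem quotientBracket_mk (β : PoissonBracket R) (J : Ideal R)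
    (hJ : ∀ f : R, ∀ x ∈ J, β f x ∈ J ∧ β x f ∈ J) (f g : R) :
    quotientBracket β J hJ (Ideal.Quotient.mk J f) (Ideal.Quotient.mk J g) =
      Ideal.Quotient.mk J (β f g) := by
  have out : ∀ a : R ⧸ J, Ideal.Quotient.mk J (Quotient.out a) = a := fun a =>
    Quotient.out_eq a
  change Ideal.Quotient.mk J (β (Quotient.out (Ideal.Quotient.mk J f))
    (Quotient.out (Ideal.Quotient.mk J g))) = _
  have h1 := Ideal.Quotient.eq.1 (out (Ideal.Quotient.mk J f))
  have h2 := Ideal.Quotient.eq.1 (out (Ideal.Quotient.mk J g))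
  rw [Ideal.Quotient.eq]
  have e : ∀ a b c d : R, β a b - β c d = β (a - c) b + β c (b - d) := by
    intro a b c d; simp
  rw [e]
  exact J.add_mem (hJ _ _ h1).2 (hJ _ _ h2).1

/-- The unique extension of a derivation to the localisation at `d`
(see `extendDerivation_algebraMap` and `derivation_localization_ext`). -/
def extendDerivation (d : R) (M : Type) [AddCommGroup M] [Module ℂ M] [Module R M]
    [Module (Localization.Away d) M] [IsScalarTower R (Localization.Away d) M]
    [IsScalarTower ℂ R M]  [IsScalarTower ℂ (Localization.Away d) M]
    (D : Derivation ℂ R M) : Derivation ℂ (Localization.Away d) M :=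
  have := Algebra.FormallyEtale.of_isLocalization (Rₘ := Localization.Away d) (Submonoid.powers d)
  ((KaehlerDifferential.isBaseChange_of_formallyEtale ℂ R (Localization.Away d)).lift
    D.liftKaehlerDifferential).compDer (KaehlerDifferential.D ℂ (Localization.Away d))

theorem extendDerivation_algebraMap (d : R) (M : Type) [AddCommGroup M] [Module ℂ M] [Module R M]
    [Module (Localization.Away d) M] [IsScalarTower R (Localization.Away d) M]
    [IsScalarTower ℂ R M]  [IsScalarTower ℂ (Localization.Away d) M]
    (D : Derivation ℂ R M) (f : R) :
    extendDerivation d M D (algebraMap R _ f) = D f := by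
  have := Algebra.FormallyEtale.of_isLocalization (Rₘ := Localization.Away d) (Submonoid.powers d)
  have h := (KaehlerDifferential.isBaseChange_of_formallyEtale ℂ R (Localization.Away d)).lift_eq
    D.liftKaehlerDifferential (KaehlerDifferential.D ℂ R f)
  rw [KaehlerDifferential.map_D, Derivation.liftKaehlerDifferential_comp_D] at h
  exact h

theorem derivation_localization_ext (d : R) (M : Type) [AddCommGroup M] [Module ℂ M]
    [Module (Localization.Away d) M]
    (D E : Derivation ℂ (Localization.Away d) M)
    (h : ∀ f : R, D (algebraMap R _ f) = E (algebraMap R _ f)) : D = E := by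
  ext x
  obtain ⟨⟨f, s⟩, hs⟩ := IsLocalization.surj (Submonoid.powers d) x
  have hu := IsLocalization.map_units (Localization.Away d) s
  have h1 := congrArg D hs
  have h2 := congrArg E hs
  rw [Derivation.leibniz] at h1 h2
  simp only [h] at h1 h2
  have h3 := add_left_cancel (h1.trans h2.symm)
  exact hu.smul_left_cancel.1 h3

/-- The unique extension of a bracket to a biderivation of the localisation at `d`. -/
def localizeBracket (β : PoissonBracket R) (d : R) : PoissonBracket (Localization.Away d) :=
  extendDerivation d (Derivation ℂ (Localization.Away d) (Localization.Away d))
    (LinearMap.compDer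
      { toFun := fun D => extendDerivation d (Localization.Away d)
          ((Algebra.linearMap R (Localization.Away d)).compDer D)
        map_add' := fun D E => derivation_localization_ext d _ _ _ (fun f => by
          simp [extendDerivation_algebraMap])
        map_smul' := fun r D => derivation_localization_ext d _ _ _ (fun f => by
          simp [extendDerivation_algebraMap]) } β)

theorem localizeBracket_algebraMap (β : PoissonBracket R) (d f g : R) :
    localizeBracket β d (algebraMap R _ f) (algebraMap R _ g) = algebraMap R _ (β f g) := by
  simp [localizeBracket, extendDerivation_algebraMap]

variable {S : Type} [CommRing S] [Algebra ℂ S]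

/-- The bilinear map `{a ⊗ b, a' ⊗ b'} = {a, a'} ⊗ b b' + a a' ⊗ {b, b'}`. -/
def tensorBilin (β : PoissonBracket R) (γ : PoissonBracket S) :
    (R ⊗[ℂ] S) →ₗ[ℂ] (R ⊗[ℂ] S) →ₗ[ℂ] (R ⊗[ℂ] S) :=
  TensorProduct.map₂
    (LinearMap.mk₂ ℂ (fun f g => β f g) (by simp) (by simp) (by simp) (by simp))
    (LinearMap.mul ℂ S) +
  TensorProduct.map₂ (LinearMap.mul ℂ R)
    (LinearMap.mk₂ ℂ (fun f g => γ f g) (by simp) (by simp) (by simp) (by simp))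

theorem tensorBilin_tmul (β : PoissonBracket R) (γ : PoissonBracket S) (a a' : R) (b b' : S) :
    tensorBilin β γ (a ⊗ₜ b) (a' ⊗ₜ b') = (β a a') ⊗ₜ (b * b') + (a * a') ⊗ₜ (γ b b') := by
  simp [tensorBilin]

theorem tensorBilin_mul_right (β : PoissonBracket R) (γ : PoissonBracket S) (x y z : R ⊗[ℂ] S) :
    tensorBilin β γ x (y * z) = y * tensorBilin β γ x z + z * tensorBilin β γ x y := by
  induction x with
  | zero => simp
  | add x x' hx hx' => simp only [map_add, LinearMap.add_apply, hx, hx']; ring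
  | tmul a b =>
    induction y with
    | zero => simp
    | add y y' hy hy' => simp only [map_add, add_mul, hy, hy']; ring
    | tmul a' b' =>
      induction z with
      | zero => simp
      | add z z' hz hz' => simp only [map_add, mul_add, hz, hz']; ring
      | tmul a'' b'' =>
        simp only [Algebra.TensorProduct.tmul_mul_tmul, tensorBilin_tmul, Derivation.leibniz,
          smul_eq_mul, mul_add, TensorProduct.add_tmul, TensorProduct.tmul_add]
        have e1 : b * (b' * b'') = b' * (b * b'') := by ring
        have e2 : b'' * (b * b') = b' * (b * b'') := by ring
        have e3 : a * (a' * a'') = a' * (a * a'') := by ring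
        have e4 : a'' * (a * a') = a' * (a * a'') := by ring
        rw [e1, e2, e3, e4]; abel

theorem tensorBilin_mul_left (β : PoissonBracket R) (γ : PoissonBracket S) (x y z : R ⊗[ℂ] S) :
    tensorBilin β γ (x * y) z = x * tensorBilin β γ y z + y * tensorBilin β γ x z := by
  induction z with
  | zero => simp
  | add z z' hz hz' => simp only [map_add, hz, hz']; ring
  | tmul a'' b'' =>
    induction x with
    | zero => simp
    | add x x' hx hx' => simp only [map_add, add_mul, LinearMap.add_apply, hx, hx']; ring
    | tmul a b =>
      induction y with
      | zero => simp
      | add y y' hy hy' => simp only [map_add, mul_add, LinearMap.add_apply, hy, hy']; ring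
      | tmul a' b' =>
        simp only [Algebra.TensorProduct.tmul_mul_tmul, tensorBilin_tmul, Derivation.leibniz,
          Derivation.add_apply, Derivation.smul_apply,
          smul_eq_mul, mul_add, TensorProduct.add_tmul, TensorProduct.tmul_add]
        have e1 : b' * (b * b'') = b * (b' * b'') := by ring
        have e2 : b * b' * b'' = b * (b' * b'') := by ring
        have e3 : a' * (a * a'') = a * (a' * a'') := by ring
        have e4 : a * a' * a'' = a * (a' * a'') := by ring
        rw [e1, e2, e3, e4]; abel

/-- The bracket of the tensor product of two Poisson algebras, i.e. of the product of two
Poisson varieties. -/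
def tensorBracket (β : PoissonBracket R) (γ : PoissonBracket S) : PoissonBracket (R ⊗[ℂ] S) :=
  Derivation.mk'
    { toFun := fun x => Derivation.mk' (tensorBilin β γ x) (tensorBilin_mul_right β γ x)
      map_add' := fun _ _ => by ext1; simp
      map_smul' := fun _ _ => by ext1; simp }
    (fun x y => by ext1 z; simpa using tensorBilin_mul_left β γ x y z)

end General
theorem bracket_sum_left {R : Type} [CommRing R] [Algebra ℂ R] (β : PoissonBracket R)
    {ι : Type} (s : Finset ι) (f : ι → R) (g : R) :
    β (∑ i ∈ s, f i) g = ∑ i ∈ s, β (f i) g := by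
  classical
  induction s using Finset.induction_on with
  | empty => simp
  | insert a s ha ih =>
    rw [Finset.sum_insert ha, Finset.sum_insert ha, map_add, Derivation.add_apply, ih]

section Canonical

variable {Q : Type}

theorem canonical_qq (x y : Q) : canonicalBracket Q (X (Sum.inl x)) (X (Sum.inl y)) = 0 := by
  classical
  simp [canonicalBracket, mkDerivation_X, pderiv_X]

theorem canonical_pp (x y : Q) : canonicalBracket Q (X (Sum.inr x)) (X (Sum.inr y)) = 0 := by
  classical
  simp [canonicalBracket, mkDerivation_X, pderiv_X]

theorem canonical_qp [DecidableEq Q] (x y : Q) :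
    canonicalBracket Q (X (Sum.inl x)) (X (Sum.inr y)) = if x = y then 1 else 0 := by
  classical
  simp [canonicalBracket, mkDerivation_X, pderiv_X, Pi.single_apply, eq_comm]

theorem canonical_pq [DecidableEq Q] (x y : Q) :
    canonicalBracket Q (X (Sum.inr x)) (X (Sum.inl y)) = if x = y then -1 else 0 := by
  classical
  simp only [canonicalBracket, mkDerivation_X, pderiv_X, Sum.elim_inr, Derivation.neg_apply,
    Pi.single_apply, Sum.inl.injEq, eq_comm]
  split_ifs <;> simp

/-- An algebra homomorphism is compatible with two brackets as soon as it is so on generators. -/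
theorem bracket_map {σ : Type} {R : Type} [CommRing R] [Algebra ℂ R]
    (β : PoissonBracket (MvPolynomial σ ℂ)) (γ : PoissonBracket R)
    (φ : MvPolynomial σ ℂ →ₐ[ℂ] R)
    (h : ∀ x y, γ (φ (X x)) (φ (X y)) = φ (β (X x) (X y))) (f g : MvPolynomial σ ℂ) :
    γ (φ f) (φ g) = φ (β f g) := by
  have h1 : ∀ x, γ (φ (X x)) (φ g) = φ (β (X x) g) := by
    intro x
    induction g using MvPolynomial.induction_on with
    | C a =>
      rw [← MvPolynomial.algebraMap_eq, AlgHom.commutes, Derivation.map_algebraMap,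
        Derivation.map_algebraMap, map_zero]
    | add p q hp hq => simp [hp, hq]
    | mul_X p i hp => simp [hp, h]
  induction f using MvPolynomial.induction_on with
  | C a =>
    rw [← MvPolynomial.algebraMap_eq, AlgHom.commutes, Derivation.map_algebraMap,
      Derivation.map_algebraMap]
    simp
  | add p q hp hq => simp [hp, hq]
  | mul_X p i hp => simp [hp, h1]

theorem canonicalBracket_skew (f g : MvPolynomial (Q ⊕ Q) ℂ) :
    canonicalBracket Q f g = -canonicalBracket Q g f := by
  classical
  have h1 : ∀ x, canonicalBracket Q (X x) g = -canonicalBracket Q g (X x) := by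
    intro x
    induction g using MvPolynomial.induction_on with
    | C a =>
      rw [← MvPolynomial.algebraMap_eq, Derivation.map_algebraMap,
        Derivation.map_algebraMap]
      simp
    | add p q hp hq => simp [hp, hq]; ring
    | mul_X p i hp =>
      have : canonicalBracket Q (X x) (X i) = -canonicalBracket Q (X i) (X x) := by
        rcases x with x | x <;> rcases i with i | i <;>
          simp [canonical_qq, canonical_pp, canonical_qp, canonical_pq, eq_comm]
        all_goals split_ifs <;> simp
      simp [hp, this]; ring
  induction f using MvPolynomial.induction_on with
  | C a =>
    rw [← MvPolynomial.algebraMap_eq, Derivation.map_algebraMap,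
      Derivation.map_algebraMap]
    simp
  | add p q hp hq => simp [hp, hq]; ring
  | mul_X p i hp => simp [hp, h1]; ring

/-- Linear cotangent lifts preserve the canonical bracket. -/
theorem canonical_linear [Fintype Q] [DecidableEq Q]
    (φ : MvPolynomial (Q ⊕ Q) ℂ →ₐ[ℂ] MvPolynomial (Q ⊕ Q) ℂ)
    (M N : Q → Q → ℂ)
    (hM : ∀ x, φ (X (Sum.inl x)) = ∑ y, C (M x y) * X (Sum.inl y))
    (hN : ∀ x, φ (X (Sum.inr x)) = ∑ y, C (N x y) * X (Sum.inr y))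
    (hMN : ∀ x z, ∑ y, M x y * N z y = if x = z then 1 else 0)
    (f g : MvPolynomial (Q ⊕ Q) ℂ) :
    canonicalBracket Q (φ f) (φ g) = φ (canonicalBracket Q f g) := by
  have hqp : ∀ x z, canonicalBracket Q (φ (X (Sum.inl x))) (φ (X (Sum.inr z))) =
      φ (canonicalBracket Q (X (Sum.inl x)) (X (Sum.inr z))) := by
    intro x z
    have : C (∑ y, M x y * N z y) = (if x = z then 1 else 0 : MvPolynomial (Q ⊕ Q) ℂ) := by
      rw [hMN]; split_ifs <;> simp
    rw [canonical_qp, hM, hN, bracket_sum_left]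
    simp only [map_sum, ← MvPolynomial.smul_eq_C_mul, Derivation.map_smul,
      Derivation.smul_apply, canonical_qp]
    rw [apply_ite φ, map_one, map_zero, ← this]
    simp only [MvPolynomial.smul_eq_C_mul, mul_ite, mul_one, mul_zero, Finset.sum_ite_eq,
      Finset.mem_univ, if_true, map_sum, map_mul]
    exact Finset.sum_congr rfl fun _ _ => mul_comm _ _
  apply bracket_map
  rintro (x | x) (z | z)
  · rw [canonical_qq, hM, hM, bracket_sum_left]
    simp [← MvPolynomial.smul_eq_C_mul, canonical_qq]
  · exact hqp x z
  · rw [canonicalBracket_skew, hqp, canonicalBracket_skew (X (Sum.inr x)), map_neg]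
  · rw [canonical_pp, hN, hN, bracket_sum_left]
    simp [← MvPolynomial.smul_eq_C_mul, canonical_pp]

end Canonical

/-- A derivation that preserves an ideal preserves its radical. -/
theorem derivation_radical {R : Type} [CommRing R] [Algebra ℂ R] (D : Derivation ℂ R R)
    (I : Ideal R) (hI : ∀ x ∈ I, D x ∈ I) : ∀ x ∈ I.radical, D x ∈ I.radical := by
  rintro a ⟨n, hn⟩
  have key : ∀ i ≤ n, a ^ (n - i) * (D a) ^ (2 * i) ∈ I := by
    intro i
    induction i with
    | zero => intro _; simpa using hn
    | succ i ih =>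
      intro hi
      obtain ⟨m, hm⟩ : ∃ m, n - i = m + 1 := ⟨n - (i + 1), by omega⟩
      have hm' : n - (i + 1) = m := by omega
      have h0 := ih (by omega)
      rw [hm] at h0
      rw [hm']
      have h1 := hI _ h0
      rw [Derivation.leibniz, Derivation.leibniz_pow, Derivation.leibniz_pow] at h1
      simp only [smul_eq_mul, nsmul_eq_mul, Nat.add_sub_cancel] at h1
      have h2 := I.mul_mem_right (D a) h1
      have h3 : ((m + 1 : ℕ) : R) * (a ^ m * D a ^ (2 * (i + 1))) ∈ I := by
        rcases Nat.eq_zero_or_pos i with rfl | hpos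
        · convert h2 using 1; simp; ring
        · have h4 := I.mul_mem_right (((2 * i : ℕ) : R) * D (D a)) h0
          convert I.sub_mem h2 h4 using 1
          obtain ⟨j, rfl⟩ : ∃ j, i = j + 1 := ⟨i - 1, by omega⟩
          have : 2 * (j + 1) - 1 = 2 * j + 1 := by omega
          rw [this]; push_cast; ring
      have h5 := I.mul_mem_left (algebraMap ℂ R ((m + 1 : ℕ) : ℂ)⁻¹) h3
      rw [← mul_assoc, ← map_natCast (algebraMap ℂ R), ← map_mul,
        inv_mul_cancel₀ (by exact_mod_cast Nat.succ_ne_zero m), map_one, one_mul] at h5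
      exact h5
  exact ⟨2 * n, by simpa using key n le_rfl⟩

theorem derivation_span {R : Type} [CommRing R] [Algebra ℂ R] (D : Derivation ℂ R R)
    (s : Set R) (hs : ∀ x ∈ s, D x = 0) : ∀ x ∈ Ideal.span s, D x ∈ Ideal.span s := by
  intro x hx
  induction hx using Submodule.span_induction with
  | mem x h => rw [hs x h]; exact zero_mem _
  | zero => simp
  | add x y _ _ hx hy => rw [map_add]; exact add_mem hx hy
  | smul a x h hx =>
    rw [smul_eq_mul, Derivation.leibniz]
    exact add_mem (Ideal.mul_mem_left _ _ hx) (Ideal.mul_mem_right _ _ h)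

section Space

variable (k m : ℕ)

/-- Position coordinates on `T^* R_k × (T^* ℂ)^m`, where `R_k = M_{k,k} × M_{2,k}`: the entries
of `A`, the entries of `j`, and `m` further coordinates. -/
abbrev Pos : Type := (Fin k × Fin k) ⊕ (Fin 2 × Fin k) ⊕ Fin m

/-- The polynomial functions on `T^* R_k × (T^* ℂ)^m`. With the canonical bracket, the momentum
dual to `A_{ab}` is `B_{ba}`, the momentum dual to `j_{αs}` is `i_{sα}`, so that the symplectic form
is `tr dA ∧ dB + tr dj ∧ di`, plus the standard form on `(T^* ℂ)^m`. -/
abbrev Coord : Type := MvPolynomial (Pos k m ⊕ Pos k m) ℂ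

def matA : Matrix (Fin k) (Fin k) (Coord k m) :=
  Matrix.of fun a b => X (Sum.inl (Sum.inl (a, b)))

def matB : Matrix (Fin k) (Fin k) (Coord k m) :=
  Matrix.of fun a b => X (Sum.inr (Sum.inl (b, a)))

def matj : Matrix (Fin 2) (Fin k) (Coord k m) :=
  Matrix.of fun α s => X (Sum.inl (Sum.inr (Sum.inl (α, s))))

def mati : Matrix (Fin k) (Fin 2) (Coord k m) :=
  Matrix.of fun s α => X (Sum.inr (Sum.inr (Sum.inl (α, s))))

/-- The lower right corner `Λ` of `Â`: it is `0` for `m = 0`, the coordinate itself for `m = 1`. -/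
def corner : Coord k m := ∑ e : Fin m, X (Sum.inl (Sum.inr (Sum.inr e)))

/-- The matrix `Â` with blocks `A`, `i_1` (first column of `i`), `j_2` (second row of `j`), `Λ`. -/
def hatA : Matrix (Fin k ⊕ Unit) (Fin k ⊕ Unit) (Coord k m) :=
  Matrix.fromBlocks (matA k m) (Matrix.of fun s _ => mati k m s 0)
    (Matrix.of fun _ s => matj k m 1 s) (Matrix.of fun _ _ => corner k m)

/-- The moment map `[A, B] - i j`. -/
def momentMap : Matrix (Fin k) (Fin k) (Coord k m) :=
  matA k m * matB k m - matB k m * matA k m - mati k m * matj k m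

/-- The ideal generated by the entries of `[A, B] - i j - τ · 1`. -/
def momentIdeal (τ : ℂ) : Ideal (Coord k m) :=
  Ideal.span (Set.range fun x : Fin k × Fin k =>
    momentMap k m x.1 x.2 - if x.1 = x.2 then C τ else 0)

/-- A complex matrix as a matrix of constant functions. -/
def constMat (L : Matrix (Fin k) (Fin k) ℂ) : Matrix (Fin k) (Fin k) (Coord k m) :=
  Matrix.of fun a b => C (L a b)

/-- The substitution `A ↦ L A L'`, `B ↦ L B L'`, `i ↦ L i`, `j ↦ j L'`. -/
def substitution (L L' : Matrix (Fin k) (Fin k) ℂ) : Coord k m →ₐ[ℂ] Coord k m :=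
  aeval (Sum.elim
    (Sum.elim (fun x => (constMat k m L * matA k m * constMat k m L') x.1 x.2)
      (Sum.elim (fun x => (matj k m * constMat k m L') x.1 x.2)
        (fun e => X (Sum.inl (Sum.inr (Sum.inr e))))))
    (Sum.elim (fun x => (constMat k m L * matB k m * constMat k m L') x.2 x.1)
      (Sum.elim (fun x => (constMat k m L * mati k m) x.2 x.1)
        (fun e => X (Sum.inr (Sum.inr (Sum.inr e)))))))

/-- The action of `g ∈ GL(k, ℂ)` on functions, by the substitution
`A ↦ g A g⁻¹`, `B ↦ g B g⁻¹`, `i ↦ g i`, `j ↦ j g⁻¹`. -/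
def act (g : GL (Fin k) ℂ) : Coord k m →ₐ[ℂ] Coord k m :=
  substitution k m (g : Matrix (Fin k) (Fin k) ℂ) ((g⁻¹ : GL (Fin k) ℂ) : Matrix (Fin k) (Fin k) ℂ)

/-- The `GL(k, ℂ)`-invariant polynomial functions. -/
def invariants : Subalgebra ℂ (Coord k m) where
  carrier := {f | ∀ g : GL (Fin k) ℂ, act k m g f = f}
  mul_mem' := fun ha hb g => by rw [map_mul, ha g, hb g]
  add_mem' := fun ha hb g => by rw [map_add, ha g, hb g]
  algebraMap_mem' := fun c g => AlgHom.commutes _ c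

theorem act_bracket (g : GL (Fin k) ℂ) (f h : Coord k m) :
    canonicalBracket (Pos k m) (act k m g f) (act k m g h) =
      act k m g (canonicalBracket (Pos k m) f h) := by
  have hg : ∀ a b, ∑ r, (g : Matrix (Fin k) (Fin k) ℂ) a r *
      ((g⁻¹ : GL (Fin k) ℂ) : Matrix (Fin k) (Fin k) ℂ) r b = if a = b then 1 else 0 := by
    intro a b
    rw [← Matrix.mul_apply, ← Units.val_mul, mul_inv_cancel, Units.val_one, Matrix.one_apply]
  have hg' : ∀ a b, ∑ r, ((g⁻¹ : GL (Fin k) ℂ) : Matrix (Fin k) (Fin k) ℂ) a r *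
      (g : Matrix (Fin k) (Fin k) ℂ) r b = if a = b then 1 else 0 := by
    intro a b
    rw [← Matrix.mul_apply, ← Units.val_mul, inv_mul_cancel, Units.val_one, Matrix.one_apply]
  generalize hG : (g : Matrix (Fin k) (Fin k) ℂ) = G at hg hg'
  generalize hH : ((g⁻¹ : GL (Fin k) ℂ) : Matrix (Fin k) (Fin k) ℂ) = H at hg hg'
  refine canonical_linear (act k m g)
    (Sum.elim (fun x => Sum.elim (fun y => G x.1 y.1 * H y.2 x.2) (fun _ => 0))
      (Sum.elim
        (fun x => Sum.elim (fun _ => 0)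
          (Sum.elim (fun y => if x.1 = y.1 then H y.2 x.2 else 0) (fun _ => 0)))
        (fun e => Sum.elim (fun _ => 0) (Sum.elim (fun _ => 0) (fun e' => if e = e' then 1 else 0)))))
    (Sum.elim (fun x => Sum.elim (fun y => G x.2 y.2 * H y.1 x.1) (fun _ => 0))
      (Sum.elim
        (fun x => Sum.elim (fun _ => 0)
          (Sum.elim (fun y => if x.1 = y.1 then G x.2 y.2 else 0) (fun _ => 0)))
        (fun e => Sum.elim (fun _ => 0) (Sum.elim (fun _ => 0) (fun e' => if e = e' then 1 else 0)))))
    ?_ ?_ ?_ f h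
  · rintro (⟨a, b⟩ | ⟨α, s⟩ | e)
    · simp only [act, substitution, constMat, hG, hH, aeval_X, Sum.elim_inl, Fintype.sum_sum_type, Fintype.sum_prod_type,
        Matrix.mul_apply, matA, Matrix.of_apply, Sum.elim_inr, map_zero, zero_mul,
        Finset.sum_const_zero, add_zero, map_mul, Finset.sum_mul]
      rw [Finset.sum_comm]
      exact Finset.sum_congr rfl fun _ _ => Finset.sum_congr rfl fun _ _ => by ring
    · have e : ∀ (γ : Fin 2) (r : Fin k), C (if α = γ then H r s else 0) *
          (X (Sum.inl (Sum.inr (Sum.inl (γ, r)))) : Coord k m) =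
          if α = γ then X (Sum.inl (Sum.inr (Sum.inl (γ, r)))) * C (H r s) else 0 := by
        intro γ r; split_ifs <;> simp [mul_comm]
      simp only [act, substitution, constMat, hG, hH, aeval_X, Sum.elim_inl, Fintype.sum_sum_type, Fintype.sum_prod_type,
        Matrix.mul_apply, matj, Matrix.of_apply, Sum.elim_inr, map_zero, zero_mul,
        Finset.sum_const_zero, add_zero, zero_add, e]
      rw [Finset.sum_comm]
      simp
    · simp [act, substitution, Fintype.sum_sum_type, apply_ite]
  · rintro (⟨a, b⟩ | ⟨α, s⟩ | e)
    · simp only [act, substitution, constMat, hG, hH, aeval_X, Sum.elim_inl, Fintype.sum_sum_type, Fintype.sum_prod_type,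
        Matrix.mul_apply, matB, Matrix.of_apply, Sum.elim_inr, map_zero, zero_mul,
        Finset.sum_const_zero, add_zero, map_mul, Finset.sum_mul]
      exact Finset.sum_congr rfl fun _ _ => Finset.sum_congr rfl fun _ _ => by ring
    · have e : ∀ (γ : Fin 2) (r : Fin k), C (if α = γ then G s r else 0) *
          (X (Sum.inr (Sum.inr (Sum.inl (γ, r)))) : Coord k m) =
          if α = γ then C (G s r) * X (Sum.inr (Sum.inr (Sum.inl (γ, r)))) else 0 := by
        intro γ r; split_ifs <;> simp
      simp only [act, substitution, constMat, hG, hH, aeval_X, Sum.elim_inl, Fintype.sum_sum_type, Fintype.sum_prod_type,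
        Matrix.mul_apply, mati, Matrix.of_apply, Sum.elim_inr, map_zero, zero_mul,
        Finset.sum_const_zero, add_zero, zero_add, e]
      rw [Finset.sum_comm]
      simp
    · simp [act, substitution, Fintype.sum_sum_type, apply_ite]
  · rintro (⟨a, b⟩ | ⟨α, s⟩ | e) (⟨c, d⟩ | ⟨β, t⟩ | e')
    · simp only [Sum.elim_inl, Fintype.sum_sum_type, Fintype.sum_prod_type, Sum.elim_inr,
        mul_zero, Finset.sum_const_zero, add_zero]
      have : ∀ r s, G a r * H s b * (G d s * H r c) = (G a r * H r c) * (G d s * H s b) := by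
        intros; ring
      simp only [this, ← Finset.mul_sum, ← Finset.sum_mul, hg, Sum.inl.injEq, Prod.mk.injEq]
      by_cases h1 : a = c <;> by_cases h2 : b = d <;> simp [h1, h2, eq_comm]
    · simp
    · simp
    · simp
    · simp only [Sum.elim_inl, Fintype.sum_sum_type, Fintype.sum_prod_type, Sum.elim_inr,
        mul_zero, Finset.sum_const_zero, add_zero, zero_add, Sum.inl.injEq, Sum.inr.injEq,
        Prod.mk.injEq]
      have : ∀ r, H r s * G t r = G t r * H r s := fun _ => mul_comm _ _
      by_cases h1 : α = β
      · subst h1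
        simp [this, hg, eq_comm]
      · have : ∀ γ, ¬ (α = γ ∧ β = γ) := by rintro γ ⟨rfl, h⟩; exact h1 h.symm
        simp only [h1, false_and, if_false]
        apply Finset.sum_eq_zero; intro γ _
        apply Finset.sum_eq_zero; intro r _
        have := this γ
        by_cases h2 : α = γ <;> by_cases h3 : β = γ <;> simp_all
    · simp
    · simp
    · simp
    · simp [Fintype.sum_sum_type]

theorem moment_entry (a b : Fin k) : momentMap k m a b =
    ∑ s, X (Sum.inl (Sum.inl (a, s))) * X (Sum.inr (Sum.inl (b, s))) -
    ∑ s, X (Sum.inr (Sum.inl (s, a))) * X (Sum.inl (Sum.inl (s, b))) -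
    ∑ α, X (Sum.inr (Sum.inr (Sum.inl (α, a)))) * X (Sum.inl (Sum.inr (Sum.inl (α, b)))) := by
  simp [momentMap, Matrix.mul_apply, matA, matB, mati, matj]

theorem moment_bracket_X (a b : Fin k) (v : Pos k m ⊕ Pos k m) :
    canonicalBracket (Pos k m) (momentMap k m a b) (X v) =
      Sum.elim
        (Sum.elim (fun x => (if x.2 = a then matA k m x.1 b else 0) -
            (if x.1 = b then matA k m a x.2 else 0))
          (Sum.elim (fun x => if x.2 = a then matj k m x.1 b else 0) (fun _ => 0)))
        (Sum.elim (fun x => (if x.1 = a then matB k m x.2 b else 0) -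
            (if x.2 = b then matB k m a x.1 else 0))
          (Sum.elim (fun x => if x.2 = b then -mati k m a x.1 else 0) (fun _ => 0))) v := by
  rw [moment_entry]
  simp only [map_sub, Derivation.sub_apply, bracket_sum_left, Derivation.leibniz,
    Derivation.add_apply, Derivation.smul_apply, smul_eq_mul]
  rcases v with (⟨c, d⟩ | ⟨α, s⟩ | e) | (⟨c, d⟩ | ⟨α, s⟩ | e)
  · simp only [canonical_qq, canonical_pq, Sum.inl.injEq, Prod.mk.injEq, reduceCtorEq, if_false,
      mul_zero, add_zero, zero_add, Finset.sum_const_zero, sub_zero, Sum.elim_inl, matA,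
      Matrix.of_apply]
    by_cases h1 : d = a <;> by_cases h2 : c = b <;>
      simp [h1, h2, @eq_comm _ a d, @eq_comm _ b c, sub_eq_add_neg, add_comm]
  · simp only [canonical_qq, canonical_pq, Sum.inl.injEq, Sum.inr.injEq, Prod.mk.injEq,
      reduceCtorEq, if_false,
      mul_zero, add_zero, zero_add, Finset.sum_const_zero, sub_zero, Sum.elim_inl, Sum.elim_inr, matj,
      Matrix.of_apply]
    by_cases h1 : s = a <;> simp [h1, @eq_comm _ a s]
  · simp [canonical_qq, canonical_pq]
  · simp only [canonical_pp, canonical_qp, Sum.inl.injEq, Prod.mk.injEq, reduceCtorEq, if_false,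
      mul_zero, add_zero, zero_add, Finset.sum_const_zero, sub_zero, Sum.elim_inl, Sum.elim_inr, matB,
      Matrix.of_apply]
    by_cases h1 : c = a <;> by_cases h2 : d = b <;>
      simp [h1, h2, @eq_comm _ a c, @eq_comm _ b d, sub_eq_add_neg, add_comm]
  · simp only [canonical_pp, canonical_qp, Sum.inl.injEq, Sum.inr.injEq, Prod.mk.injEq,
      reduceCtorEq, if_false,
      mul_zero, add_zero, Finset.sum_const_zero, sub_zero, Sum.elim_inl, Sum.elim_inr, mati,
      Matrix.of_apply]
    by_cases h1 : s = b <;> simp [h1, @eq_comm _ b s]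
  · simp [canonical_pp, canonical_qp]

theorem substitution_one : substitution k m 1 1 = AlgHom.id ℂ (Coord k m) := by
  have h1 : constMat k m (1 : Matrix (Fin k) (Fin k) ℂ) = 1 := by
    ext a b : 2
    simp only [constMat, Matrix.of_apply, Matrix.one_apply]
    split_ifs <;> simp
  apply MvPolynomial.algHom_ext
  rintro ((⟨c, d⟩ | ⟨α, s⟩ | e) | (⟨c, d⟩ | ⟨α, s⟩ | e)) <;>
    simp [substitution, h1, matA, matB, mati, matj]

theorem deriv_substitution (a b : Fin k) (p : Pos k m ⊕ Pos k m → ℂ)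
    (G H : ℂ → Matrix (Fin k) (Fin k) ℂ) (hG0 : G 0 = 1) (hH0 : H 0 = 1)
    (hG : ∀ c d, HasDerivAt (fun t => G t c d) (if c = b ∧ d = a then 1 else 0) 0)
    (hH : ∀ c d, HasDerivAt (fun t => H t c d) (if c = b ∧ d = a then -1 else 0) 0)
    (f : Coord k m) :
    HasDerivAt (fun t => eval p (substitution k m (G t) (H t) f))
      (-eval p (canonicalBracket (Pos k m) (momentMap k m a b) f)) 0 := by
  induction f using MvPolynomial.induction_on with
  | C c =>
    rw [← MvPolynomial.algebraMap_eq, Derivation.map_algebraMap]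
    simpa using hasDerivAt_const (0 : ℂ) c
  | add f g hf hg =>
    have h := hf.fun_add hg
    refine (h.congr_deriv ?_).congr_of_eventuallyEq (.of_forall fun t => ?_)
    · simp; ring
    · simp
  | mul_X f v hf =>
    have hv : HasDerivAt (fun t => eval p (substitution k m (G t) (H t) (X v)))
      (-eval p (canonicalBracket (Pos k m) (momentMap k m a b) (X v))) 0 := by
      rw [moment_bracket_X]
      have key : ∀ (M : Matrix (Fin k) (Fin k) (Coord k m)) (c d : Fin k), HasDerivAt
          (fun t : ℂ => eval p ((constMat k m (G t) * M * constMat k m (H t)) c d))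
          (-eval p ((if d = a then M c b else 0) - (if c = b then M a d else 0))) 0 := by
        intro M c d
        have : ∀ t : ℂ, eval p ((constMat k m (G t) * M * constMat k m (H t)) c d) =
            ∑ s, (∑ r, G t c r * eval p (M r s)) * H t s d := by
          intro t; simp [constMat, Matrix.mul_apply]
        simp only [this]
        have h := HasDerivAt.fun_sum (u := Finset.univ) fun s _ =>
          (HasDerivAt.fun_sum (u := Finset.univ) fun r _ =>
            (hG c r).mul_const (eval p (M r s))).fun_mul (hH s d)
        refine h.congr_deriv ?_
        simp only [hG0, hH0, Matrix.one_apply, Finset.sum_add_distrib, ite_mul, mul_ite, one_mul,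
          mul_one, zero_mul, mul_zero, mul_neg, Finset.sum_ite_eq, Finset.sum_ite_eq',
          Finset.mem_univ, if_true, ite_and, Finset.sum_ite_irrel, Finset.sum_const_zero]
        by_cases h1 : c = b <;> by_cases h2 : d = a <;> simp [h1, h2, sub_eq_add_neg]
      rcases v with (⟨c, d⟩ | ⟨α, s⟩ | e) | (⟨c, d⟩ | ⟨α, s⟩ | e)
      · simpa [substitution] using key (matA k m) c d
      · have h := HasDerivAt.fun_sum (u := Finset.univ) fun r _ =>
          (hH r s).const_mul (eval p (matj k m α r))
        refine (h.congr_deriv ?_).congr_of_eventuallyEq (.of_forall fun t => ?_)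
        · by_cases h2 : s = a <;> simp [h2]
        · simp [substitution, constMat, Matrix.mul_apply]
      · simpa [substitution] using hasDerivAt_const (0 : ℂ) _
      · simpa [substitution] using key (matB k m) d c
      · have h := HasDerivAt.fun_sum (u := Finset.univ) fun r _ =>
          (hG s r).mul_const (eval p (mati k m r α))
        refine (h.congr_deriv ?_).congr_of_eventuallyEq (.of_forall fun t => ?_)
        · by_cases h2 : s = b <;> simp [h2]
        · simp [substitution, constMat, Matrix.mul_apply]
      · simpa [substitution] using hasDerivAt_const (0 : ℂ) _
    have h := hf.fun_mul hv
    simp only [hG0, hH0, substitution_one, AlgHom.id_apply] at h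
    refine (h.congr_deriv ?_).congr_of_eventuallyEq (.of_forall fun t => ?_)
    · simp; ring
    · simp

/-- Invariant functions Poisson commute with the moment map. -/
theorem moment_bracket_invariant (a b : Fin k) (f : Coord k m) (hf : f ∈ invariants k m) :
    canonicalBracket (Pos k m) (momentMap k m a b) f = 0 := by
  apply MvPolynomial.funext
  intro p
  set E : Matrix (Fin k) (Fin k) ℂ := Matrix.single b a 1 with hE
  set ε : ℂ := if a = b then 1 else 0 with hε
  have hEE : E * E = ε • E := by
    rw [hE, hε]
    split_ifs with h
    · subst h; simp
    · simp [h]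
  have hd : HasDerivAt (fun t : ℂ => t / (1 + t * ε)) 1 0 := by
    have h1 : HasDerivAt (fun t : ℂ => 1 + t * ε) ε 0 := by
      simpa using ((hasDerivAt_id (0 : ℂ)).mul_const ε).const_add 1
    have := (hasDerivAt_id' (0 : ℂ)).fun_div h1 (by simp)
    exact this.congr_deriv (by simp)
  have hder := deriv_substitution k m a b p (fun t => 1 + t • E)
    (fun t => 1 - (t / (1 + t * ε)) • E) (by simp) (by simp) (by
      intro c d
      have := ((hasDerivAt_id (0 : ℂ)).mul_const (E c d)).const_add ((1 : Matrix (Fin k) (Fin k) ℂ) c d)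
      refine this.congr_deriv ?_
      simp [hE, Matrix.single_apply, eq_comm]) (by
      intro c d
      have := (hd.mul_const (E c d)).const_sub ((1 : Matrix (Fin k) (Fin k) ℂ) c d)
      refine this.congr_deriv ?_
      simp only [hE, Matrix.single_apply, eq_comm]
      split_ifs <;> simp) f
  have hev : ∀ᶠ t in nhds (0 : ℂ), 1 + t * ε ≠ 0 := by
    have : ContinuousAt (fun t : ℂ => 1 + t * ε) 0 := by fun_prop
    exact this.eventually_ne (by simp)
  have hconst : (fun t => eval p (substitution k m (1 + t • E) (1 - (t / (1 + t * ε)) • E) f))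
      =ᶠ[nhds 0] fun _ => eval p f := by
    filter_upwards [hev] with t ht
    have h1 : (1 + t • E) * (1 - (t / (1 + t * ε)) • E) = 1 := by
      have : (1 + t • E) * (1 - (t / (1 + t * ε)) • E) =
          1 + (t - t / (1 + t * ε) - t * (t / (1 + t * ε)) * ε) • E := by
        simp only [add_mul, mul_sub, one_mul, mul_one, smul_mul_smul_comm, hEE, smul_smul, sub_smul]
        abel
      rw [this]
      have : t - t / (1 + t * ε) - t * (t / (1 + t * ε)) * ε = 0 := by field_simp; ring
      simp [this]
    have h2 := mul_eq_one_comm.1 h1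
    have := hf ⟨1 + t • E, 1 - (t / (1 + t * ε)) • E, h1, h2⟩
    exact congrArg (eval p) this
  have := hder.unique ((hasDerivAt_const (0 : ℂ) (eval p f)).congr_of_eventuallyEq hconst)
  simpa using this

theorem invariants_bracket : ∀ f ∈ invariants k m, ∀ g ∈ invariants k m,
    canonicalBracket (Pos k m) f g ∈ invariants k m := by
  intro f hf g hg x
  rw [← act_bracket, hf x, hg x]

theorem bracket_momentIdeal (τ : ℂ) (f : Coord k m) (hf : f ∈ invariants k m) :
    ∀ x ∈ (momentIdeal k m τ).radical,
      canonicalBracket (Pos k m) f x ∈ (momentIdeal k m τ).radical := by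
  apply derivation_radical
  apply derivation_span
  rintro _ ⟨⟨a, b⟩, rfl⟩
  rw [map_sub, canonicalBracket_skew, moment_bracket_invariant k m a b f hf]
  dsimp only
  split_ifs
  · rw [← MvPolynomial.algebraMap_eq, Derivation.map_algebraMap]; simp
  · simp

/-- The invariant polynomials that vanish on the variety `[A, B] - i j = τ · 1`
(by the Nullstellensatz, those in the radical of the moment ideal). -/
def reducedIdeal (τ : ℂ) : Ideal (invariants k m) :=
  (momentIdeal k m τ).radical.comap (invariants k m).val

/-- The coordinate ring of `N_{k,τ} × (T^* ℂ)^m`: the restrictions of `GL(k, ℂ)`-invariant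
polynomials to the variety `[A, B] - i j = τ · 1`. The case `m = 0` is `ℂ[N_{k,τ}]`, the case `m = 1`
is `ℂ[N_{k,τ} × ℂ²]`. -/
def InstantonAlgebra (τ : ℂ) : Type := invariants k m ⧸ reducedIdeal k m τ

instance (τ : ℂ) : CommRing (InstantonAlgebra k m τ) :=
  inferInstanceAs (CommRing (invariants k m ⧸ reducedIdeal k m τ))

instance (τ : ℂ) : Algebra ℂ (InstantonAlgebra k m τ) :=
  inferInstanceAs (Algebra ℂ (invariants k m ⧸ reducedIdeal k m τ))

/-- The restriction of an invariant polynomial to the variety `[A, B] - i j = τ · 1`. -/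
def toInstanton (τ : ℂ) : invariants k m →ₐ[ℂ] InstantonAlgebra k m τ :=
  Ideal.Quotient.mkₐ ℂ (reducedIdeal k m τ)

/-- The Poisson bracket of the symplectic quotient: compute on invariant polynomials. -/
def instantonBracket (τ : ℂ) : PoissonBracket (InstantonAlgebra k m τ) :=
  quotientBracket
    (restrictBracket (canonicalBracket (Pos k m)) (invariants k m) (invariants_bracket k m))
    (reducedIdeal k m τ)
    (fun f x hx => ⟨bracket_momentIdeal k m τ f f.2 x hx, by
      change canonicalBracket (Pos k m) x f ∈ (momentIdeal k m τ).radical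
      rw [canonicalBracket_skew]
      exact neg_mem (bracket_momentIdeal k m τ f f.2 x hx)⟩)

theorem instantonBracket_mk (τ : ℂ) (f g : invariants k m) :
    instantonBracket k m τ (toInstanton k m τ f) (toInstanton k m τ g) =
      toInstanton k m τ
        ⟨canonicalBracket (Pos k m) f g, invariants_bracket k m f f.2 g g.2⟩ :=
  quotientBracket_mk _ _ _ f g

theorem constMat_mul (L L' : Matrix (Fin k) (Fin k) ℂ) :
    constMat k m L * constMat k m L' = constMat k m (L * L') := by
  ext a b : 2
  simp [constMat, Matrix.mul_apply]

theorem constMat_one : constMat k m 1 = 1 := by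
  ext a b : 2
  simp only [constMat, Matrix.of_apply, Matrix.one_apply]
  split_ifs <;> simp

theorem matA_act (g : GL (Fin k) ℂ) : ∃ U : (Matrix (Fin k) (Fin k) (Coord k m))ˣ,
    (matA k m).map (act k m g) = U * matA k m * (U⁻¹ : (Matrix (Fin k) (Fin k) (Coord k m))ˣ) := by
  refine ⟨⟨constMat k m g, constMat k m ((g⁻¹ : GL (Fin k) ℂ) : Matrix (Fin k) (Fin k) ℂ), ?_, ?_⟩,
    ?_⟩
  · rw [constMat_mul, ← Units.val_mul, mul_inv_cancel, Units.val_one, constMat_one]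
  · rw [constMat_mul, ← Units.val_mul, inv_mul_cancel, Units.val_one, constMat_one]
  · ext a b : 2
    simp [act, substitution, matA]

theorem hatA_act (g : GL (Fin k) ℂ) :
    ∃ U : (Matrix (Fin k ⊕ Unit) (Fin k ⊕ Unit) (Coord k m))ˣ,
    (hatA k m).map (act k m g) =
      U * hatA k m * (U⁻¹ : (Matrix (Fin k ⊕ Unit) (Fin k ⊕ Unit) (Coord k m))ˣ) := by
  refine ⟨⟨Matrix.fromBlocks (constMat k m g) 0 0 1, Matrix.fromBlocks
    (constMat k m ((g⁻¹ : GL (Fin k) ℂ) : Matrix (Fin k) (Fin k) ℂ)) 0 0 1, ?_, ?_⟩,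
    ?_⟩
  · simp only [Matrix.fromBlocks_multiply, Matrix.mul_zero, Matrix.zero_mul, add_zero, zero_add,
      Matrix.mul_one]
    rw [constMat_mul, ← Units.val_mul, mul_inv_cancel, Units.val_one, constMat_one,
      Matrix.fromBlocks_one]
  · simp only [Matrix.fromBlocks_multiply, Matrix.mul_zero, Matrix.zero_mul, add_zero, zero_add,
      Matrix.mul_one]
    rw [constMat_mul, ← Units.val_mul, inv_mul_cancel, Units.val_one, constMat_one,
      Matrix.fromBlocks_one]
  · simp only [hatA, Units.inv_mk, Matrix.fromBlocks_multiply, Matrix.fromBlocks_map,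
      Matrix.mul_zero, Matrix.zero_mul, add_zero, zero_add, Matrix.mul_one, Matrix.one_mul]
    congr 1 <;> ext a b : 2
    · simp [act, substitution, matA]
    · simp [act, substitution, mati, Matrix.mul_apply, constMat]
    · simp [act, substitution, matj, Matrix.mul_apply, constMat]
    · simp [act, substitution, corner]

theorem trace_pow_map {n : Type} [Fintype n] [DecidableEq n] {R : Type} [CommRing R]
    (M : Matrix n n R) (φ : R →+* R)
    (h : ∃ U : (Matrix n n R)ˣ, M.map φ = U * M * (U⁻¹ : (Matrix n n R)ˣ)) (i : ℕ) :
    φ (M ^ i).trace = (M ^ i).trace := by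
  obtain ⟨U, hU⟩ := h
  have : φ (M ^ i).trace = ((M.map φ) ^ i).trace := by
    rw [← RingHom.mapMatrix_apply, ← map_pow, RingHom.mapMatrix_apply]
    exact AddMonoidHom.map_trace φ.toAddMonoidHom _
  rw [this, hU, Units.conj_pow, Matrix.trace_units_conj]

theorem charpoly_map_eq {n : Type} [Fintype n] [DecidableEq n] {R : Type} [CommRing R]
    (M : Matrix n n R) (φ : R →+* R)
    (h : ∃ U : (Matrix n n R)ˣ, M.map φ = U * M * (U⁻¹ : (Matrix n n R)ˣ)) :
    M.charpoly.map φ = M.charpoly := by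
  obtain ⟨U, hU⟩ := h
  rw [← Matrix.charpoly_map, hU, Matrix.coe_units_inv, Matrix.charpoly_units_conj]

/-- The function `tr A ^ i`. -/
def traceA (τ : ℂ) (i : ℕ) : InstantonAlgebra k m τ :=
  toInstanton k m τ ⟨(matA k m ^ i).trace, fun g =>
    trace_pow_map _ (act k m g : Coord k m →+* Coord k m) (matA_act k m g) i⟩

/-- The function `tr Â ^ i`. -/
def traceHatA (τ : ℂ) (i : ℕ) : InstantonAlgebra k m τ :=
  toInstanton k m τ ⟨(hatA k m ^ i).trace, fun g =>
    trace_pow_map _ (act k m g : Coord k m →+* Coord k m) (hatA_act k m g) i⟩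

/-- The function `Δ = ∏_{i ≠ j} (λ_i - λ_j) · ∏_{m ≠ n} (λ̂_m - λ̂_n)` of the eigenvalues `λ` of
`A` and `λ̂` of `Â`: for the characteristic polynomial `q` of `A` one has
`Res(q, q') = ∏_i q'(λ_i) = ∏_{i ≠ j} (λ_i - λ_j)`, and likewise for `Â`. -/
def discriminant (τ : ℂ) : InstantonAlgebra k m τ :=
  toInstanton k m τ
    ⟨(matA k m).charpoly.resultant (matA k m).charpoly.derivative *
      (hatA k m).charpoly.resultant (hatA k m).charpoly.derivative, fun g => by
      have h1 := charpoly_map_eq _ (act k m g : Coord k m →+* Coord k m) (matA_act k m g)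
      have h2 := charpoly_map_eq _ (act k m g : Coord k m →+* Coord k m) (hatA_act k m g)
      rw [map_mul]
      congr 1
      · refine (Polynomial.resultant_map_map _ _ _ _
          (act k m g : Coord k m →+* Coord k m)).symm.trans ?_
        rw [← Polynomial.derivative_map, h1]
      · refine (Polynomial.resultant_map_map _ _ _ _
          (act k m g : Coord k m →+* Coord k m)).symm.trans ?_
        rw [← Polynomial.derivative_map, h2]⟩

/-- The function `∏_{i, j} (λ_i - λ̂_j)`: the resultant of the characteristic polynomials
of `A` and `Â`. -/
def mixedResultant (τ : ℂ) : InstantonAlgebra k m τ :=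
  toInstanton k m τ
    ⟨(matA k m).charpoly.resultant (hatA k m).charpoly, fun g => by
      have h1 := charpoly_map_eq _ (act k m g : Coord k m →+* Coord k m) (matA_act k m g)
      have h2 := charpoly_map_eq _ (act k m g : Coord k m →+* Coord k m) (hatA_act k m g)
      refine (Polynomial.resultant_map_map _ _ _ _
          (act k m g : Coord k m →+* Coord k m)).symm.trans ?_
      rw [h1, h2]⟩

end Space

section Symmetric

variable (n : ℕ)

/-- The algebra `ℂ[T^* ℂ^n]^{S_n}`; `X (inl a)` and `X (inr a)` are the coordinates on the base
and on the fibre, and `S_n` permutes both simultaneously. -/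
def symInvariants : Subalgebra ℂ (MvPolynomial (Fin n ⊕ Fin n) ℂ) where
  carrier := {f | ∀ σ : Equiv.Perm (Fin n), rename (Sum.map σ σ) f = f}
  mul_mem' := fun ha hb g => by rw [map_mul, ha g, hb g]
  add_mem' := fun ha hb g => by rw [map_add, ha g, hb g]
  algebraMap_mem' := fun c g => AlgHom.commutes _ c

theorem symInvariants_bracket : ∀ f ∈ symInvariants n, ∀ g ∈ symInvariants n,
    canonicalBracket (Fin n) f g ∈ symInvariants n := by
  intro f hf g hg σ
  rw [← bracket_map (canonicalBracket (Fin n)) (canonicalBracket (Fin n)), hf σ, hg σ]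
  rintro (x | x) (y | y)
  · simp [canonical_qq]
  · simp [canonical_qp, apply_ite]
  · simp [canonical_pq, apply_ite]
  · simp [canonical_pp]

/-- The canonical bracket on `ℂ[T^* ℂ^n]^{S_n}`. -/
def symBracket : PoissonBracket (symInvariants n) :=
  restrictBracket (canonicalBracket (Fin n)) (symInvariants n) (symInvariants_bracket n)

/-- The power sum of the base coordinates. -/
def powerSum (i : ℕ) : symInvariants n :=
  ⟨∑ a, X (Sum.inl a) ^ i, fun σ => by
    simp only [map_sum, map_pow, rename_X, Sum.map_inl]
    exact Equiv.sum_comp σ (fun a => (X (Sum.inl a) : MvPolynomial (Fin n ⊕ Fin n) ℂ) ^ i)⟩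

end Symmetric

/-- The algebra `ℂ[T^* ℂ^k]^{S_k} ⊗ ℂ[T^* ℂ^{k+1}]^{S_{k+1}}`. -/
abbrev EigenvalueAlgebra (k : ℕ) : Type := symInvariants k ⊗[ℂ] symInvariants (k + 1)

/-- The power sum `∑ λ_a ^ i`. -/
def powerSumLeft (k i : ℕ) : EigenvalueAlgebra k :=
  powerSum k i ⊗ₜ[ℂ] (1 : symInvariants (k + 1))

/-- The power sum `∑ λ̂_b ^ i`. -/
def powerSumRight (k i : ℕ) : EigenvalueAlgebra k :=
  (1 : symInvariants k) ⊗ₜ[ℂ] powerSum (k + 1) i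

/-- The Poisson bracket of `ℂ[T^* ℂ^k]^{S_k} ⊗ ℂ[T^* ℂ^{k+1}]^{S_{k+1}}`. -/
def eigenvalueBracket (k : ℕ) : PoissonBracket (EigenvalueAlgebra k) :=
  tensorBracket (symBracket k) (symBracket (k + 1))

/-- The inclusion of the tensor product into the polynomial functions on
`T^* ℂ^k × T^* ℂ^{k+1}`; the base coordinates are `X (inl (inl a))` and `X (inr (inl b))`. -/
def toPolynomial (k : ℕ) : EigenvalueAlgebra k →ₐ[ℂ]
    MvPolynomial ((Fin k ⊕ Fin k) ⊕ (Fin (k + 1) ⊕ Fin (k + 1))) ℂ :=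
  Algebra.TensorProduct.lift ((rename Sum.inl).comp (symInvariants k).val)
    ((rename Sum.inr).comp (symInvariants (k + 1)).val) (fun _ _ => Commute.all _ _)

/-- Algebraic complete integrability, in the sense that does not require compact level sets, of an
affine Poisson variety with coordinate ring `R`: if `n` is the number of functions `H a`, the variety
has dimension `2 n`, the `H a` are algebraic functions that Poisson commute, and their Hamiltonian
vector fields are linearly independent on a dense open subset, where some determinant
`det {H a, G b}` does not vanish (so the bracket is also nondegenerate there). -/
structure IsCompletelyIntegrable {R : Type} [CommRing R] [Algebra ℂ R] (β : PoissonBracket R)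
    {ι : Type} [Fintype ι] [DecidableEq ι] (H : ι → R) : Prop where
  dim : ringKrullDim R = ((2 * Fintype.card ι : ℕ) : WithBot ℕ∞)
  commute : ∀ a b, β (H a) (H b) = 0
  independent : ∃ G : ι → R,
    Matrix.det (Matrix.of fun a b => β (H a) (G b)) ∈ nonZeroDivisors R

/-- The functions `Φ_i = tr A ^ i`, `1 ≤ i ≤ k`, and `Φ̂_j = tr Â ^ j`, `1 ≤ j ≤ k + 1`. -/
def hamiltonian (k m : ℕ) (τ : ℂ) : Fin k ⊕ Fin (k + 1) → InstantonAlgebra k m τ :=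
  Sum.elim (fun i => traceA k m τ (i + 1)) (fun j => traceHatA k m τ (j + 1))

/-- All the functions `Φ_i`, `Φ̂_j` except for `Φ̂_1`. -/
def integrals (k m : ℕ) (τ : ℂ) : Fin k ⊕ Fin k → InstantonAlgebra k m τ :=
  Sum.elim (fun i => traceA k m τ (i + 1)) (fun j => traceHatA k m τ (j + 2))

/-- `∏_{i ≠ j} (λ_i - λ_j) · ∏_{m ≠ n} (λ̂_m - λ̂_n)` in the coordinates `λ`, `λ̂`. -/
def eigenvalueDelta (k : ℕ) :
    MvPolynomial ((Fin k ⊕ Fin k) ⊕ (Fin (k + 1) ⊕ Fin (k + 1))) ℂ :=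
  (∏ x ∈ (Finset.univ : Finset (Fin k)).offDiag,
      (X (Sum.inl (Sum.inl x.1)) - X (Sum.inl (Sum.inl x.2)))) *
    ∏ x ∈ (Finset.univ : Finset (Fin (k + 1))).offDiag,
      (X (Sum.inr (Sum.inl x.1)) - X (Sum.inr (Sum.inl x.2)))

/-- `∏_{i, j} (λ_i - λ̂_j)` in the coordinates `λ`, `λ̂`. -/
def eigenvalueResultant (k : ℕ) :
    MvPolynomial ((Fin k ⊕ Fin k) ⊕ (Fin (k + 1) ⊕ Fin (k + 1))) ℂ :=
  ∏ a : Fin k, ∏ b : Fin (k + 1), (X (Sum.inl (Sum.inl a)) - X (Sum.inr (Sum.inl b)))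

/-- The localisation of `ℂ[N_{k,τ} × ℂ²]` at `Δ · ∏_{i, j} (λ_i - λ̂_j)`. -/
abbrev LocalizedInstantonAlgebra (k : ℕ) (τ : ℂ) : Type :=
  Localization.Away (discriminant k 1 τ * mixedResultant k 1 τ)

/-- The localisation homomorphism. -/
def toLocalized (k : ℕ) (τ : ℂ) : InstantonAlgebra k 1 τ →+* LocalizedInstantonAlgebra k τ :=
  algebraMap (InstantonAlgebra k 1 τ)
    (Localization.Away (discriminant k 1 τ * mixedResultant k 1 τ))

/-- The localisation homomorphism of `ℂ[T^* ℂ^k]^{S_k} ⊗ ℂ[T^* ℂ^{k+1}]^{S_{k+1}}` at `d`. -/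
def toLocalizedEigenvalue (k : ℕ) (d : EigenvalueAlgebra k) :
    EigenvalueAlgebra k →+* Localization.Away d :=
  algebraMap (EigenvalueAlgebra k) (Localization.Away d)

/-- The Poisson bracket of the localisation of `ℂ[N_{k,τ} × ℂ²]`. -/
def localizedInstantonBracket (k : ℕ) (τ : ℂ) : PoissonBracket (LocalizedInstantonAlgebra k τ) :=
  localizeBracket (instantonBracket k 1 τ) (discriminant k 1 τ * mixedResultant k 1 τ)

end Instanton

end

/-!
The proof restricts functions to the slice on which `A = diag(λ_1, …, λ_k)` with distinct `λ_a` and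
`i_1 = (1, …, 1)`. There the moment map equation can be solved for `j_1` and for the entries of `B`
off the diagonal, and the slice is an affine space with coordinates `λ_a`, `v_a = (j_2)_a` and
`b_a = B_{aa}`, `u_a = (i_2)_a`, minus the diagonals `λ_a = λ_c`.

* The `GL_k`-orbits of the slice are dense in the level set `[A, B] - i j = τ · 1`
  (`VanishesOnSlice.eq_zero`): every point can be deformed within the level set, in finitely many
  steps, first to make `B` cyclic, then to make its commutant act faithfully on `j`, then to make `B`
  and `A` have distinct eigenvalues, and last to make the entries of `i_1` nonzero. With the
  Nullstellensatz, restriction to the slice is injective on `ℂ[N_{k,τ}]`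
  (`sliceRestrict_injective`), which is therefore an integral domain.
* The coordinates of the slice are Darboux coordinates, and restriction is a Poisson map
  (`sliceHom_bracket`): the Hamiltonian vector field on the slice of the restriction of an invariant
  function differs from the ambient Hamiltonian vector field by an infinitesimal gauge transformation.
* The Hamiltonians commute: the brackets of `tr A ^ i` and `tr Â ^ j` vanish already on the ambient
  space, since no conjugate pair of entries occurs in `A` and `Â`. Their brackets with the functions
  `tr A ^ n B`, `j_2 A ^ n i_2` have a determinant that on the slice is a nonzero constant times
  `∏_{a < c} (λ_c - λ_a) ^ 4 ∏_a v_a` (`bracketDet`, `det_bracket_integrals`). This gives the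
  independence of the Hamiltonian vector fields, and the algebraic independence that determines the
  ideal of relations.
* After `bracketDet` is inverted, the coordinates of the slice are integral over the invariant
  functions (`isIntegral_slice`), so the dimension of `N_{k,τ}` is that of the slice.

For the isomorphism, the positions `(λ, v, Λ)` on the slice of `N_{k,τ} × ℂ²` are written as functions
of the eigenvalues `λ_a` of `A` and `λ̂_b` of `Â`: `v_a` is `-∏_b (λ_a - λ̂_b) / ∏_{c ≠ a} (λ_a - λ_c)`.
The cotangent lift of this change of positions gives Darboux coordinates of the slice as functions
on `T^* (ℂ^k × ℂ^{k+1})` (`isCanonical_eigenSlice`), and with them a Poisson embedding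
`eigenRestrict` of `ℂ[N_{k,τ} × ℂ²]` into the functions on `T^* (ℂ^k × ℂ^{k+1})` with poles on
`Δ R = 0`. The algebra `T` embeds there too, as `eigenvalueHom`. The images of the two localisations
coincide (`exists_away_equiv`). On the one hand, the lift has poles only on `Δ = 0` and is
equivariant under `S_k × S_{k+1}`, so that invariant functions of the matrices go to
`S_k × S_{k+1}`-invariants with poles on `Δ = 0` (`exists_eigenRestrict_mul_eq`). On the other hand,
the functions `tr A ^ n B`, `M`, `j_2 A ^ n i_2` are linear in the momenta, so that the momenta can be
recovered from these functions and their brackets with the Hamiltonians, by inverting `bracketDet`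
(`exists_momenta_eq`, `eigenvalueHom_mem`).
-/

namespace Instanton

/-! ### Cyclic vectors and commutants -/

open scoped Polynomial in
/-- A finite product of the rings `ℂ[x] / I_i`, where `I_i` contains a power of `x - a_i`, is
generated by one element: shift `x` on the factors so that the points `a_i` become distinct, and
apply the Chinese remainder theorem. -/
theorem exists_generator_pi_quotient {ι : Type} [Fintype ι] (a : ι → ℂ) (e : ι → ℕ)
    (I : ι → Ideal ℂ[X]) (hI : ∀ i, (Polynomial.X - Polynomial.C (a i)) ^ e i ∈ I i) :
    ∃ ξ : ∀ i, ℂ[X] ⧸ I i, ∀ y : ∀ i, ℂ[X] ⧸ I i, ∃ p : ℂ[X], Polynomial.aeval ξ p = y := by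
  classical
  let n : ι → ℂ := fun i => (Fintype.equivFin ι i : ℕ)
  have hn : Function.Injective n := fun i j h => by
    simpa [n, Fin.val_inj] using h
  let q : ι → ℂ[X] := fun i => Polynomial.X + Polynomial.C (n i - a i)
  refine ⟨fun i => Ideal.Quotient.mk (I i) (q i), fun y => ?_⟩
  let J : ι → Ideal ℂ[X] := fun i => (I i).comap (Polynomial.compRingHom (q i))
  have hJ : Pairwise (Function.onFun IsCoprime J) := by
    intro i j hij
    have hmem : ∀ i, (Polynomial.X - Polynomial.C (n i)) ^ e i ∈ J i := by
      intro i
      change Polynomial.compRingHom (q i) _ ∈ I i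
      have : Polynomial.compRingHom (q i) ((Polynomial.X - Polynomial.C (n i)) ^ e i) =
          (Polynomial.X - Polynomial.C (a i)) ^ e i := by
        simp only [q, Polynomial.coe_compRingHom_apply, Polynomial.pow_comp, Polynomial.sub_comp,
          Polynomial.X_comp, Polynomial.C_comp, map_sub]
        congr 1
        ring
      rw [this]
      exact hI i
    obtain ⟨u, v, huv⟩ : IsCoprime ((Polynomial.X - Polynomial.C (n i)) ^ e i)
        ((Polynomial.X - Polynomial.C (n j)) ^ e j) :=
      (Polynomial.pairwise_coprime_X_sub_C hn hij).pow
    exact Ideal.isCoprime_iff_exists.2 ⟨_, (J i).mul_mem_left u (hmem i), _,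
      (J j).mul_mem_left v (hmem j), huv⟩
  have hsurj : ∀ i, ∃ r : ℂ[X], Ideal.Quotient.mk (I i) r = y i := fun i =>
    Ideal.Quotient.mk_surjective _
  choose r hr using hsurj
  obtain ⟨p, hp⟩ := Ideal.exists_forall_sub_mem_ideal hJ
    (fun i => (r i).comp (Polynomial.X - Polynomial.C (n i - a i)))
  refine ⟨p, funext fun i => ?_⟩
  have h1 := hp i
  change Polynomial.compRingHom (q i) _ ∈ I i at h1
  have h2 : Ideal.Quotient.mk (I i) (p.comp (q i)) = y i := by
    rw [← hr i, Ideal.Quotient.eq]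
    simpa [q, Polynomial.coe_compRingHom_apply, Polynomial.comp_assoc] using h1
  rw [← h2]
  have h3 := Polynomial.aeval_algHom_apply (Pi.evalAlgHom ℂ (fun i => ℂ[X] ⧸ I i) i)
    (fun i => Ideal.Quotient.mk (I i) (q i)) p
  refine h3.symm.trans ?_
  have h4 := Polynomial.aeval_algHom_apply (Ideal.Quotient.mkₐ ℂ (I i)) (q i) p
  refine h4.trans ?_
  rw [Polynomial.comp, Polynomial.aeval_def]
  rfl

open scoped Polynomial in
/-- Every complex matrix commutes with a matrix that has a cyclic vector: `ℂ^k` is isomorphic to a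
product of rings `ℂ[x] / (x - a_i)^{e_i}` on which the matrix acts as an element, and any
generator of that ring will do. -/
theorem exists_commute_cyclic {k : ℕ} (A : Matrix (Fin k) (Fin k) ℂ) :
    ∃ (M : Matrix (Fin k) (Fin k) ℂ) (w : Fin k → ℂ), A * M = M * A ∧
      ∀ x : Fin k → ℂ, ∃ p : ℂ[X], (Polynomial.aeval M p).mulVec w = x := by
  classical
  have htor : Module.IsTorsion ℂ[X] (Module.AEval' A.mulVecLin) :=
    Module.AEval.isTorsion_of_finiteDimensional ..
  obtain ⟨ι, _, p, hp, e, ⟨l⟩⟩ := Module.equiv_directSum_of_isTorsion htor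
  have hroot : ∀ i, ∃ a, (p i).IsRoot a := fun i =>
    IsAlgClosed.exists_root _ (by rw [IsAlgClosed.degree_eq_one_of_irreducible ℂ (hp i)]; simp)
  choose a ha using hroot
  have hpa : ∀ i, p i ∣ Polynomial.X - Polynomial.C (a i) := fun i =>
    (Polynomial.irreducible_X_sub_C _).dvd_symm (hp i) (Polynomial.dvd_iff_isRoot.2 (ha i))
  obtain ⟨ξ, hξ⟩ := exists_generator_pi_quotient a e (fun i => ℂ[X] ∙ p i ^ e i)
    (fun i => Ideal.mem_span_singleton.2 (pow_dvd_pow_of_dvd (hpa i) _))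
  let ψ := l.trans (DirectSum.linearEquivFunOnFintype ℂ[X] ι (fun i => ℂ[X] ⧸ ℂ[X] ∙ p i ^ e i))
  let φ : (Fin k → ℂ) ≃ₗ[ℂ] (∀ i, ℂ[X] ⧸ ℂ[X] ∙ p i ^ e i) :=
    (Module.AEval'.of A.mulVecLin).trans (ψ.restrictScalars ℂ)
  have hφ : ∀ v, φ (A.mulVec v) = (Polynomial.X : ℂ[X]) • φ v := fun v =>
    (congrArg ψ (Module.AEval'.X_smul_of A.mulVecLin v).symm).trans (map_smul ψ _ _)
  clear_value φ
  let T : (Fin k → ℂ) →ₗ[ℂ] (Fin k → ℂ) :=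
    φ.symm.toLinearMap ∘ₗ (LinearMap.mulLeft ℂ ξ) ∘ₗ φ.toLinearMap
  have hTφ : ∀ v, φ (T v) = ξ * φ v := fun v => by simp [T]
  have hmul : ∀ v, (LinearMap.toMatrix' T).mulVec v = T v := fun v => by
    rw [← Matrix.toLin'_apply, Matrix.toLin'_toMatrix']
  have hAT : ∀ v, A.mulVec (T v) = T (A.mulVec v) := fun v => by
    apply φ.injective
    rw [hφ, hTφ, hTφ, hφ, mul_smul_comm]
  refine ⟨LinearMap.toMatrix' T, φ.symm 1, ?_, ?_⟩
  · apply Matrix.toLin'.injective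
    apply LinearMap.ext
    intro v
    rw [Matrix.toLin'_mul, Matrix.toLin'_mul, Matrix.toLin'_toMatrix']
    exact hAT v
  · have hpow : ∀ p : ℂ[X], φ ((Polynomial.aeval (LinearMap.toMatrix' T) p).mulVec (φ.symm 1)) =
        Polynomial.aeval ξ p := by
      intro p
      induction p using Polynomial.induction_on with
      | C c =>
        rw [Polynomial.aeval_C, Polynomial.aeval_C, Algebra.algebraMap_eq_smul_one,
          Algebra.algebraMap_eq_smul_one, Matrix.smul_mulVec, Matrix.one_mulVec, map_smul,
          LinearEquiv.apply_symm_apply]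
      | add p q hp hq => rw [map_add, Matrix.add_mulVec, map_add, hp, hq, map_add]
      | monomial d c h =>
        rw [pow_succ', mul_comm Polynomial.X, ← mul_assoc, mul_comm, map_mul, Polynomial.aeval_X,
          ← Matrix.mulVec_mulVec, hmul, hTφ, h,
          map_mul (Polynomial.aeval ξ) Polynomial.X, Polynomial.aeval_X]
    intro x
    obtain ⟨p, hp⟩ := hξ (φ x)
    exact ⟨p, φ.injective ((hpow p).trans hp)⟩

open scoped Polynomial in
theorem mul_aeval_comm {k : ℕ} {M X : Matrix (Fin k) (Fin k) ℂ} (h : X * M = M * X) (p : ℂ[X]) :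
    X * Polynomial.aeval M p = Polynomial.aeval M p * X := by
  rw [Polynomial.aeval_eq_sum_range, Finset.mul_sum, Finset.sum_mul]
  refine Finset.sum_congr rfl fun n _ => ?_
  rw [mul_smul_comm, smul_mul_assoc, (show Commute X M from h).pow_right n |>.eq]

/-- The Krylov matrix with columns `w, M w, …, M ^ (k - 1) w`. -/
def krylov {k : ℕ} {R : Type*} [CommRing R] (M : Matrix (Fin k) (Fin k) R) (w : Fin k → R) :
    Matrix (Fin k) (Fin k) R :=
  Matrix.of fun a n => ((M ^ (n : ℕ)).mulVec w) a

open scoped Polynomial in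
theorem krylov_mulVec {k : ℕ} (M : Matrix (Fin k) (Fin k) ℂ) (w c : Fin k → ℂ) :
    (krylov M w).mulVec c = (Polynomial.aeval M (∑ n, Polynomial.C (c n) * Polynomial.X ^ (n : ℕ))).mulVec w := by
  funext a
  simp only [Matrix.mulVec, dotProduct, krylov, Matrix.of_apply, map_sum, map_mul, Polynomial.aeval_C, map_pow,
    Polynomial.aeval_X, Matrix.sum_apply, Finset.sum_mul, Algebra.algebraMap_eq_smul_one,
    smul_mul_assoc, one_mul, Matrix.smul_apply, smul_eq_mul]
  rw [Finset.sum_comm]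
  exact Finset.sum_congr rfl fun _ _ => Finset.sum_congr rfl fun _ _ => by ring

open scoped Polynomial in
theorem exists_aeval_of_krylov {k : ℕ} {M : Matrix (Fin k) (Fin k) ℂ} {w : Fin k → ℂ}
    (h : (krylov M w).det ≠ 0) (x : Fin k → ℂ) : ∃ p : ℂ[X], (Polynomial.aeval M p).mulVec w = x := by
  refine ⟨_, (krylov_mulVec M w ((krylov M w)⁻¹.mulVec x)).symm.trans ?_⟩
  rw [Matrix.mulVec_mulVec, Matrix.mul_nonsing_inv _ (isUnit_iff_ne_zero.2 h), Matrix.one_mulVec]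

open scoped Polynomial in
theorem aeval_mulVec_eq_krylov {k : ℕ} (M : Matrix (Fin k) (Fin k) ℂ) (w : Fin k → ℂ) (p : ℂ[X]) :
    ∃ c : Fin k → ℂ, (krylov M w).mulVec c = (Polynomial.aeval M p).mulVec w ∧
      Polynomial.aeval M (∑ n, Polynomial.C (c n) * Polynomial.X ^ (n : ℕ)) = Polynomial.aeval M p := by
  have hd : (p %ₘ M.charpoly).degree < k := by
    simpa using Polynomial.degree_modByMonic_lt p M.charpoly_monic
  have hp : ∑ n : Fin k, Polynomial.C ((p %ₘ M.charpoly).coeff n) * Polynomial.X ^ (n : ℕ) = p %ₘ M.charpoly := by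
    rw [Fin.sum_univ_eq_sum_range (fun n => Polynomial.C ((p %ₘ M.charpoly).coeff n) * Polynomial.X ^ n)]
    by_cases h0 : p %ₘ M.charpoly = 0
    · simp [h0]
    · exact (Polynomial.as_sum_range_C_mul_X_pow' _
        ((Polynomial.natDegree_lt_iff_degree_lt h0).2 hd)).symm
  refine ⟨fun n => (p %ₘ M.charpoly).coeff n, ?_, ?_⟩
  · rw [krylov_mulVec, hp, ← Matrix.aeval_eq_aeval_mod_charpoly]
  · rw [hp, ← Matrix.aeval_eq_aeval_mod_charpoly]

open scoped Polynomial in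
theorem krylov_det_ne_zero {k : ℕ} {M : Matrix (Fin k) (Fin k) ℂ} {w : Fin k → ℂ}
    (h : ∀ x : Fin k → ℂ, ∃ p : ℂ[X], (Polynomial.aeval M p).mulVec w = x) : (krylov M w).det ≠ 0 := by
  have : Function.Surjective (krylov M w).mulVec := fun x => by
    obtain ⟨p, rfl⟩ := h x
    obtain ⟨c, hc, -⟩ := aeval_mulVec_eq_krylov M w p
    exact ⟨c, hc⟩
  exact ((Matrix.isUnit_iff_isUnit_det _).1 (Matrix.mulVec_surjective_iff_isUnit.1 this)).ne_zero

open scoped Polynomial in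
/-- The commutant of a matrix with a cyclic vector consists of the polynomials in it. -/
theorem eq_aeval_of_commute {k : ℕ} {M X : Matrix (Fin k) (Fin k) ℂ} {w : Fin k → ℂ}
    (h : (krylov M w).det ≠ 0) (hX : X * M = M * X) : ∃ p : ℂ[X], X = Polynomial.aeval M p := by
  obtain ⟨p, hp⟩ := exists_aeval_of_krylov h (X.mulVec w)
  refine ⟨p, ?_⟩
  have hc := mul_aeval_comm hX
  apply Matrix.toLin'.injective
  ext1 v
  apply LinearMap.ext
  intro c
  simp only [LinearMap.comp_apply, Matrix.toLin'_apply]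
  obtain ⟨q, hq⟩ := exists_aeval_of_krylov h (LinearMap.single ℂ (fun _ => ℂ) v c)
  rw [← hq, Matrix.mulVec_mulVec, hc, ← Matrix.mulVec_mulVec, ← hp, Matrix.mulVec_mulVec,
    Matrix.mulVec_mulVec, ← map_mul, ← map_mul, mul_comm]

open scoped Polynomial in
/-- A matrix with a cyclic vector has a covector on which its commutant acts faithfully: the last
coordinate with respect to the Krylov basis. -/
theorem exists_faithful_covector {k : ℕ} {M : Matrix (Fin k) (Fin k) ℂ} {w : Fin k → ℂ}
    (h : (krylov M w).det ≠ 0) : ∃ ξ : Fin k → ℂ, ∀ X : Matrix (Fin k) (Fin k) ℂ,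
      X * M = M * X → Matrix.vecMul ξ X = 0 → X = 0 := by
  rcases Nat.eq_zero_or_pos k with rfl | hk
  · exact ⟨0, fun X _ _ => Subsingleton.elim _ _⟩
  obtain ⟨k, rfl⟩ : ∃ l, k = l + 1 := ⟨k - 1, by omega⟩
  refine ⟨Matrix.vecMul (Pi.single (Fin.last k) 1) (krylov M w)⁻¹, fun X hX h0 => ?_⟩
  set ξ := Matrix.vecMul (Pi.single (Fin.last k) 1) (krylov M w)⁻¹ with hξ
  have hξn : ∀ n : Fin (k + 1), ξ ⬝ᵥ (M ^ (n : ℕ)).mulVec w = if n = Fin.last k then 1 else 0 := by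
    intro n
    have h1 : Matrix.vecMul ξ (krylov M w) = Pi.single (Fin.last k) 1 := by
      rw [hξ, Matrix.vecMul_vecMul, Matrix.nonsing_inv_mul _ (isUnit_iff_ne_zero.2 h),
        Matrix.vecMul_one]
    have h2 := congrFun h1 n
    rw [Pi.single_apply] at h2
    exact h2
  obtain ⟨p, rfl⟩ := eq_aeval_of_commute h hX
  obtain ⟨c, -, hc⟩ := aeval_mulVec_eq_krylov M w p
  rw [← hc] at h0 ⊢
  suffices hz : c = 0 by simp [hz]
  by_contra hne
  -- `d` is the degree of the polynomial with coefficients `c`.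
  obtain ⟨d, hd, hmax⟩ : ∃ d, c d ≠ 0 ∧ ∀ n, d < n → c n = 0 := by
    have hS : (Finset.univ.filter fun n => c n ≠ 0).Nonempty := by
      obtain ⟨n, hn⟩ := Function.ne_iff.1 hne
      exact ⟨n, by simpa using hn⟩
    refine ⟨Finset.max' _ hS, by simpa using Finset.max'_mem _ hS, fun n hn => ?_⟩
    by_contra hcn
    exact absurd (Finset.le_max' _ n (by simpa using hcn)) (not_le.2 hn)
  have h1 : ξ ⬝ᵥ (Polynomial.aeval M (∑ n, Polynomial.C (c n) * Polynomial.X ^ (n : ℕ)) * M ^ (k - d : ℕ)).mulVec w = c d := by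
    have : Polynomial.aeval M (∑ n : Fin (k + 1), Polynomial.C (c n) * Polynomial.X ^ (n : ℕ)) * M ^ (k - d : ℕ) =
        ∑ n : Fin (k + 1), c n • M ^ ((n : ℕ) + (k - d)) := by
      simp only [map_sum, map_mul, Polynomial.aeval_C, map_pow, Polynomial.aeval_X, Finset.sum_mul, pow_add,
        Algebra.algebraMap_eq_smul_one, smul_mul_assoc, one_mul]
    rw [this, Matrix.sum_mulVec, dotProduct_sum, Finset.sum_eq_single d]
    · have := hξn (Fin.last k)
      rw [Matrix.smul_mulVec, dotProduct_smul, show (d : ℕ) + (k - d) = k by omega]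
      simp only [Fin.val_last, if_true] at this
      rw [this, smul_eq_mul, mul_one]
    · intro n _ hnd
      rcases lt_or_gt_of_ne hnd with hlt | hgt
      · have := hξn ⟨(n : ℕ) + (k - d), by omega⟩
        rw [Matrix.smul_mulVec, dotProduct_smul, this, if_neg, smul_zero]
        rw [Fin.ext_iff, Fin.val_last]
        have : (n : ℕ) < d := hlt
        simp only
        omega
      · rw [hmax n hgt]; simp
    · simp
  apply hd
  rw [← h1, ← Matrix.mulVec_mulVec, Matrix.dotProduct_mulVec, h0, zero_dotProduct]

/-- The trace form is nondegenerate: a subspace of matrices is cut out by traces. -/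
theorem exists_trace_ne_zero {n : Type} [Fintype n] [DecidableEq n]
    (W : Submodule ℂ (Matrix n n ℂ)) {Y : Matrix n n ℂ} (hY : Y ∉ W) :
    ∃ X : Matrix n n ℂ, (∀ M ∈ W, (X * M).trace = 0) ∧ (X * Y).trace ≠ 0 := by
  obtain ⟨f, hf, hW⟩ := Submodule.exists_le_ker_of_notMem hY
  have key : ∀ M, ((Matrix.of fun b a => f (Matrix.single a b 1)) * M).trace = f M := by
    intro M
    conv_rhs => rw [Matrix.matrix_eq_sum_single M]
    simp only [map_sum, Matrix.trace, Matrix.diag, Matrix.mul_apply, Matrix.of_apply]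
    rw [Finset.sum_comm]
    refine Finset.sum_congr rfl fun a _ => Finset.sum_congr rfl fun b _ => ?_
    have : Matrix.single a b (M a b) = M a b • Matrix.single a b (1 : ℂ) := by simp
    rw [this, map_smul, smul_eq_mul, mul_comm]
  exact ⟨_, fun M hM => by rw [key]; exact hW hM, by rwa [key]⟩

theorem forall_trace_mul_eq_zero {m n : Type} [Fintype m] [Fintype n]
    {Z : Matrix m n ℂ} (h : ∀ Y : Matrix n m ℂ, (Y * Z).trace = 0) : Z = 0 := by
  classical
  ext a b
  have := h (Matrix.single b a 1)
  rwa [Matrix.trace_single_mul, one_smul] at this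

/-! ### Generic conditions along curves -/

open Filter Topology

/-- A continuous function that vanishes on a punctured neighbourhood vanishes at the point. -/
theorem eq_zero_of_eventually {F : ℂ → ℂ} (hc : ContinuousAt F 0)
    (h : ∀ᶠ t in 𝓝[≠] (0 : ℂ), F t = 0) : F 0 = 0 := by
  have h1 : Tendsto F (𝓝[≠] 0) (𝓝 (F 0)) := hc.tendsto.mono_left nhdsWithin_le_nhds
  have h2 : Tendsto F (𝓝[≠] 0) (𝓝 0) := tendsto_const_nhds.congr' (h.mono fun t ht => ht.symm)
  exact tendsto_nhds_unique h1 h2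

theorem eventually_notMem_of_finite {s : Set ℂ} (hs : s.Finite) :
    ∀ᶠ t in 𝓝[≠] (0 : ℂ), t ∉ s := by
  have : (s \ {0})ᶜ ∈ 𝓝 (0 : ℂ) := (hs.subset Set.sdiff_subset).isClosed.isOpen_compl.mem_nhds (by simp)
  filter_upwards [nhdsWithin_le_nhds this, self_mem_nhdsWithin] with t h1 h2 h3
  exact h1 ⟨h3, h2⟩

theorem eventually_eval_ne_zero {p : Polynomial ℂ} (hp : p ≠ 0) :
    ∀ᶠ t in 𝓝[≠] (0 : ℂ), p.eval t ≠ 0 := by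
  have := eventually_notMem_of_finite (Polynomial.finite_setOfPred_isRoot hp)
  exact this

/-- A Zariski open, scale invariant condition on matrices that holds for `Y` holds for `X + t Y`
for all small `t ≠ 0`: it holds for `s X + Y` for almost all `s`. -/
theorem eventually_pencil {n : Type} (Φ : MvPolynomial (n × n) ℂ)
    (hΦ : ∀ (c : ℂ) (M : Matrix n n ℂ), c ≠ 0 → eval (fun x => (c • M) x.1 x.2) Φ = 0 →
      eval (fun x => M x.1 x.2) Φ = 0)
    (X Y : Matrix n n ℂ) (hY : eval (fun x => Y x.1 x.2) Φ ≠ 0) :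
    ∀ᶠ t in 𝓝[≠] (0 : ℂ), eval (fun x => (X + t • Y) x.1 x.2) Φ ≠ 0 := by
  let line : Matrix n n ℂ → Matrix n n ℂ → Polynomial ℂ := fun X Y =>
    aeval (fun x => Polynomial.C (X x.1 x.2) + Polynomial.X * Polynomial.C (Y x.1 x.2)) Φ
  have hline : ∀ X Y t, (line X Y).eval t = eval (fun x => (X + t • Y) x.1 x.2) Φ := by
    intro X Y t
    have : (Polynomial.evalRingHom t).comp (aeval (R := ℂ) (fun x : n × n =>
        Polynomial.C (X x.1 x.2) + Polynomial.X * Polynomial.C (Y x.1 x.2))).toRingHom =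
        eval (fun x => (X + t • Y) x.1 x.2) := by
      apply MvPolynomial.ringHom_ext
      · intro c; simp
      · intro x; simp; ring
    exact RingHom.congr_fun this Φ
  have hne : line X Y ≠ 0 := by
    intro h0
    have h1 : ∀ s : ℂ, s ≠ 0 → (line Y X).eval s = 0 := by
      intro s hs
      rw [hline]
      refine hΦ s⁻¹ _ (inv_ne_zero hs) ?_
      have : s⁻¹ • (Y + s • X) = X + s⁻¹ • Y := by
        rw [smul_add, smul_smul, inv_mul_cancel₀ hs, one_smul, add_comm]
      rw [this, ← hline, h0, Polynomial.eval_zero]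
    have h2 : (line Y X).eval 0 = 0 :=
      eq_zero_of_eventually (line Y X).continuous.continuousAt
        (eventually_mem_nhdsWithin.mono h1)
    rw [hline] at h2
    simp only [zero_smul, add_zero] at h2
    exact hY h2
  exact (eventually_eval_ne_zero hne).mono fun t ht => by rwa [hline] at ht

/-- Having `w` as a cyclic vector is a generic condition. -/
theorem eventually_krylov {k : ℕ} (X Y : Matrix (Fin k) (Fin k) ℂ) (w : Fin k → ℂ)
    (hY : (krylov Y w).det ≠ 0) :
    ∀ᶠ t in 𝓝[≠] (0 : ℂ), (krylov (X + t • Y) w).det ≠ 0 := by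
  let Φ : MvPolynomial (Fin k × Fin k) ℂ :=
    (krylov (Matrix.mvPolynomialX (Fin k) (Fin k) ℂ) (fun a => C (w a))).det
  have hΦ : ∀ M : Matrix (Fin k) (Fin k) ℂ, eval (fun x => M x.1 x.2) Φ = (krylov M w).det := by
    intro M
    rw [RingHom.map_det]
    congr 1
    ext a n
    simp only [krylov, RingHom.mapMatrix_apply, Matrix.map_apply, Matrix.of_apply,
      RingHom.map_mulVec, Matrix.map_pow]
    have h1 : (Matrix.mvPolynomialX (Fin k) (Fin k) ℂ).map (eval fun x => M x.1 x.2) = M := by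
      ext a b
      simp
    have h2 : (eval fun x : Fin k × Fin k => M x.1 x.2) ∘ (fun a => C (w a)) = w := by
      funext a; simp
    rw [h1, h2]
  have := eventually_pencil Φ (fun c M hc h0 => by
    rw [hΦ] at h0 ⊢
    by_contra hne
    refine absurd h0 (krylov_det_ne_zero fun x => ?_)
    obtain ⟨p, hp⟩ := exists_aeval_of_krylov hne x
    refine ⟨p.comp (Polynomial.C c⁻¹ * Polynomial.X), ?_⟩
    rw [Polynomial.aeval_comp]
    simpa [Algebra.algebraMap_eq_smul_one, smul_smul, hc] using hp) X Y (by rwa [hΦ])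
  simpa only [hΦ] using this

/-- Diagonalisability with distinct eigenvalues. -/
def HasSimpleSpectrum {k : ℕ} (M : Matrix (Fin k) (Fin k) ℂ) : Prop :=
  ∃ (g : GL (Fin k) ℂ) (l : Fin k → ℂ), Function.Injective l ∧
    M = (g : Matrix (Fin k) (Fin k) ℂ) * Matrix.diagonal l *
      ((g⁻¹ : GL (Fin k) ℂ) : Matrix (Fin k) (Fin k) ℂ)

theorem hasSimpleSpectrum_of_separable {k : ℕ} {M : Matrix (Fin k) (Fin k) ℂ}
    (h : M.charpoly.Separable) : HasSimpleSpectrum M := by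
  classical
  have hcard : M.charpoly.roots.toFinset.card = k := by
    rw [Multiset.toFinset_card_of_nodup (Polynomial.nodup_roots h),
      ← (IsAlgClosed.splits M.charpoly).natDegree_eq_card_roots, Matrix.charpoly_natDegree_eq_dim,
      Fintype.card_fin]
  let r := M.charpoly.roots.toFinset.equivFinOfCardEq hcard
  let l : Fin k → ℂ := fun a => (r.symm a : ℂ)
  have hl : Function.Injective l := Subtype.val_injective.comp r.symm.injective
  have hev : ∀ a, ∃ v : Fin k → ℂ, v ≠ 0 ∧ M.mulVec v = l a • v := by
    intro a
    have h1 : M.charpoly.IsRoot (l a) :=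
      Polynomial.isRoot_of_mem_roots (Multiset.mem_toFinset.1 (r.symm a).2)
    have h2 : (Matrix.diagonal (fun _ => l a) - M).det = 0 := by
      rw [← Matrix.scalar_apply, ← Matrix.eval_charpoly]; exact h1
    obtain ⟨v, hv, h3⟩ := Matrix.exists_mulVec_eq_zero_iff.2 h2
    refine ⟨v, hv, ?_⟩
    rw [Matrix.sub_mulVec, sub_eq_zero] at h3
    rw [← h3]
    ext b
    simp [Matrix.mulVec_diagonal]
  choose v hv hMv using hev
  have hli : LinearIndependent ℂ v :=
    Module.End.eigenvectors_linearIndependent' (Matrix.toLin' M) l hl v fun a =>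
      Module.End.hasEigenvector_iff.2 ⟨Module.End.mem_eigenspace_iff.2 (hMv a), hv a⟩
  have hu : IsUnit (Matrix.of v).transpose := by
    rw [Matrix.isUnit_transpose]
    exact Matrix.linearIndependent_rows_iff_isUnit.1 hli
  obtain ⟨g, hg⟩ := hu
  refine ⟨g, l, hl, ?_⟩
  have hMg : M * (g : Matrix (Fin k) (Fin k) ℂ) = g * Matrix.diagonal l := by
    rw [hg]
    ext a b
    rw [Matrix.mul_diagonal]
    have := congrFun (hMv b) a
    simp only [Matrix.mulVec, dotProduct, Pi.smul_apply, smul_eq_mul] at this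
    simpa [Matrix.mul_apply, mul_comm] using this
  rw [← hMg, mul_assoc, ← Units.val_mul, mul_inv_cancel, Units.val_one, mul_one]

theorem separable_charpoly_diagonal {k : ℕ} {l : Fin k → ℂ} (hl : Function.Injective l) :
    (Matrix.diagonal l).charpoly.Separable := by
  rw [Matrix.charpoly_diagonal]
  exact Polynomial.separable_prod_X_sub_C_iff.2 hl

/-- Having distinct eigenvalues is a generic condition, given by the discriminant. -/
theorem eventually_hasSimpleSpectrum {k : ℕ} (X Y : Matrix (Fin k) (Fin k) ℂ)
    (hY : HasSimpleSpectrum Y) : ∀ᶠ t in 𝓝[≠] (0 : ℂ), HasSimpleSpectrum (X + t • Y) := by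
  let Z := Matrix.mvPolynomialX (Fin k) (Fin k) ℂ
  let Φ : MvPolynomial (Fin k × Fin k) ℂ := Z.charpoly.resultant Z.charpoly.derivative k (k - 1)
  have hdeg : ∀ M : Matrix (Fin k) (Fin k) ℂ, M.charpoly.natDegree = k ∧
      M.charpoly.derivative.natDegree = k - 1 := fun M => by
    have h1 : M.charpoly.natDegree = k := by
      rw [Matrix.charpoly_natDegree_eq_dim, Fintype.card_fin]
    exact ⟨h1, by rw [Polynomial.natDegree_derivative, h1]⟩
  have hΦ : ∀ M : Matrix (Fin k) (Fin k) ℂ, eval (fun x => M x.1 x.2) Φ ≠ 0 ↔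
      M.charpoly.Separable := by
    intro M
    have h1 : Z.charpoly.map (eval (fun x => M x.1 x.2)) = M.charpoly := by
      rw [← Matrix.charpoly_map]
      congr 1
      ext a b
      simp [Z]
    rw [← Polynomial.resultant_map_map, ← Polynomial.derivative_map, h1, Ne]
    have h2 := Polynomial.resultant_eq_zero_iff (f := M.charpoly) (g := M.charpoly.derivative)
    rw [(hdeg M).1, (hdeg M).2] at h2
    rw [h2, Polynomial.separable_def]
    have := M.charpoly_monic.ne_zero
    tauto
  have hsep : ∀ M : Matrix (Fin k) (Fin k) ℂ, HasSimpleSpectrum M → M.charpoly.Separable := by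
    rintro M ⟨g, l, hl, rfl⟩
    rw [Matrix.coe_units_inv, Matrix.charpoly_units_conj]
    exact separable_charpoly_diagonal hl
  have := eventually_pencil Φ (fun c M hc h0 => by
    by_contra hne
    refine absurd h0 ((hΦ _).2 (hsep _ ?_))
    obtain ⟨g, l, hl, hM⟩ := hasSimpleSpectrum_of_separable ((hΦ M).1 hne)
    refine ⟨g, fun a => c * l a, fun a b h => hl (mul_left_cancel₀ hc h), ?_⟩
    have : Matrix.diagonal (fun a => c * l a) = c • Matrix.diagonal l := by
      ext a b; simp [Matrix.diagonal_apply]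
    rw [hM, this]
    simp) X Y ((hΦ Y).2 (hsep Y hY))
  exact this.mono fun t ht => hasSimpleSpectrum_of_separable ((hΦ _).1 ht)

/-- If `Ψ` is injective, so is `Φ + t Ψ` for all small `t ≠ 0`. -/
theorem eventually_injective {V W : Type*} [AddCommGroup V] [Module ℂ V] [FiniteDimensional ℂ V]
    [AddCommGroup W] [Module ℂ W] (Φ Ψ : V →ₗ[ℂ] W) (h : Function.Injective Ψ) :
    ∀ᶠ t in 𝓝[≠] (0 : ℂ), Function.Injective (Φ + t • Ψ : V →ₗ[ℂ] W) := by
  obtain ⟨G, hG⟩ := LinearMap.exists_leftInverse_of_injective Ψ (LinearMap.ker_eq_bot.2 h)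
  have hfin := (Module.End.finite_hasEigenvalue (G ∘ₗ Φ)).image (fun z => -z)
  filter_upwards [eventually_notMem_of_finite hfin] with t ht
  rw [← LinearMap.ker_eq_bot, LinearMap.ker_eq_bot']
  intro v hv
  by_contra hne
  refine ht ⟨-t, Module.End.hasEigenvalue_of_hasEigenvector (x := v)
    (Module.End.hasEigenvector_iff.2 ⟨Module.End.mem_eigenspace_iff.2 ?_, hne⟩), neg_neg t⟩
  have h1 := congrArg G hv
  have h2 : G (Ψ v) = v := LinearMap.congr_fun hG v
  simp only [LinearMap.add_apply, LinearMap.smul_apply, map_add, map_smul, h2, map_zero] at h1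
  rw [LinearMap.comp_apply, neg_smul]
  exact eq_neg_of_add_eq_zero_left h1

/-- The equation `y + t N y = t c` has a solution that tends to `0` with `t`. -/
theorem exists_continuous_resolvent {V : Type*} [AddCommGroup V] [Module ℂ V]
    [FiniteDimensional ℂ V] [TopologicalSpace V] [IsTopologicalAddGroup V] [ContinuousSMul ℂ V]
    (N : V →ₗ[ℂ] V) (c : V) :
    ∃ y : ℂ → V, ContinuousAt y 0 ∧ y 0 = 0 ∧ ∀ᶠ t in 𝓝 (0 : ℂ), y t + t • N (y t) = t • c := by
  classical
  let b := Module.finBasis ℂ V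
  let P := LinearMap.toMatrix b b N
  let D : ℂ → Matrix _ _ ℂ := fun t => 1 + t • P
  have hD : Continuous D := by fun_prop
  have hdet : ∀ᶠ t in 𝓝 (0 : ℂ), (D t).det ≠ 0 :=
    (hD.matrix_det.continuousAt).eventually_ne (by simp [D])
  let x : ℂ → (Fin (Module.finrank ℂ V) → ℂ) := fun t =>
    (D t).det⁻¹ • (D t).adjugate.mulVec (t • b.equivFun c)
  have hx : ContinuousAt x 0 := by
    refine ContinuousAt.smul ((hD.matrix_det.continuousAt).inv₀ (by simp [D])) ?_
    exact (Continuous.matrix_mulVec hD.matrix_adjugate (by fun_prop)).continuousAt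
  refine ⟨fun t => b.equivFun.symm (x t), ?_, by simp [x], ?_⟩
  · have hb : Continuous b.equivFun.symm :=
      b.equivFun.symm.toLinearMap.continuous_of_finiteDimensional
    exact hb.continuousAt.comp hx
  · filter_upwards [hdet] with t ht
    have h1 : (D t).mulVec (x t) = t • b.equivFun c := by
      rw [Matrix.mulVec_smul, Matrix.mulVec_mulVec, Matrix.mul_adjugate, Matrix.smul_mulVec,
        Matrix.one_mulVec, smul_smul, inv_mul_cancel₀ ht, one_smul]
    apply b.equivFun.injective
    have h2 : b.equivFun (N (b.equivFun.symm (x t))) = P.mulVec (x t) := by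
      have := LinearMap.toMatrix_mulVec_repr b b N (b.equivFun.symm (x t))
      rw [show (⇑(b.repr (b.equivFun.symm (x t))) : _ → ℂ) = x t from
        b.equivFun.apply_symm_apply (x t)] at this
      rw [this]; rfl
    have h3 : b.equivFun (b.equivFun.symm (x t)) = x t := b.equivFun.apply_symm_apply _
    rw [map_add, map_smul b.equivFun t (N _), h2, h3, map_smul b.equivFun t c, ← h1, Matrix.add_mulVec,
      Matrix.one_mulVec, Matrix.smul_mulVec]

/-! ### Density of the orbits of the slice -/

/-- The variety `[A, B] - i j = τ · 1`. -/
def IsModuliPoint {k : ℕ} (τ : ℂ) (A B : Matrix (Fin k) (Fin k) ℂ) (i : Matrix (Fin k) (Fin 2) ℂ)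
    (j : Matrix (Fin 2) (Fin k) ℂ) : Prop :=
  A * B - B * A - i * j = τ • 1

/-- A continuous `GL_k`-invariant function on quadruples of matrices that vanishes on the slice
`A` diagonal with distinct entries, `i_1 = (1, …, 1)` of the variety `[A, B] - i j = τ · 1`. -/
structure VanishesOnSlice {k : ℕ} (τ : ℂ) (F : Matrix (Fin k) (Fin k) ℂ → Matrix (Fin k) (Fin k) ℂ →
    Matrix (Fin k) (Fin 2) ℂ → Matrix (Fin 2) (Fin k) ℂ → ℂ) : Prop where
  continuous : Continuous fun p : Matrix (Fin k) (Fin k) ℂ × Matrix (Fin k) (Fin k) ℂ ×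
    Matrix (Fin k) (Fin 2) ℂ × Matrix (Fin 2) (Fin k) ℂ => F p.1 p.2.1 p.2.2.1 p.2.2.2
  invariant : ∀ (g : GL (Fin k) ℂ) A B i j,
    F (g.1 * A * g⁻¹.1) (g.1 * B * g⁻¹.1) (g.1 * i) (j * g⁻¹.1) = F A B i j
  slice : ∀ (l : Fin k → ℂ) B i j, Function.Injective l → (∀ a, i a 0 = 1) →
    IsModuliPoint τ (Matrix.diagonal l) B i j → F (Matrix.diagonal l) B i j = 0

theorem IsModuliPoint.conj {k : ℕ} {τ : ℂ} {A B : Matrix (Fin k) (Fin k) ℂ}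
    {i : Matrix (Fin k) (Fin 2) ℂ} {j : Matrix (Fin 2) (Fin k) ℂ} (h : IsModuliPoint τ A B i j)
    (g : GL (Fin k) ℂ) :
    IsModuliPoint τ (g.1 * A * g⁻¹.1) (g.1 * B * g⁻¹.1) (g.1 * i) (j * g⁻¹.1) := by
  have h1 : g⁻¹.1 * g.1 = 1 := by rw [← Units.val_mul, inv_mul_cancel, Units.val_one]
  have h2 : g.1 * g⁻¹.1 = 1 := by rw [← Units.val_mul, mul_inv_cancel, Units.val_one]
  have h3 : g.1 * (A * B - B * A - i * j) * g⁻¹.1 = τ • 1 := by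
    rw [show A * B - B * A - i * j = τ • 1 from h, Matrix.mul_smul, Matrix.smul_mul, mul_one, h2]
  unfold IsModuliPoint
  rw [← h3]
  have e : ∀ X Y : Matrix (Fin k) (Fin k) ℂ,
      g.1 * X * g⁻¹.1 * (g.1 * Y * g⁻¹.1) = g.1 * (X * Y) * g⁻¹.1 := fun X Y => by
    calc _ = g.1 * X * (g⁻¹.1 * g.1) * Y * g⁻¹.1 := by simp only [mul_assoc]
      _ = _ := by rw [h1, mul_one]; simp only [mul_assoc]
  rw [e, e]
  simp only [Matrix.mul_sub, Matrix.sub_mul, Matrix.mul_assoc]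

/-- Through every point of the quadric `x₀ y₀ + x₁ y₁ = c` there is a polynomial curve in the
quadric with `x₀ ≠ 0` away from the point. -/
theorem exists_quadric_curve (x₀ x₁ y₀ y₁ : ℂ) :
    ∃ X₀ X₁ Y₀ Y₁ : ℂ → ℂ, (Continuous X₀ ∧ Continuous X₁ ∧ Continuous Y₀ ∧ Continuous Y₁) ∧
      (X₀ 0 = x₀ ∧ X₁ 0 = x₁ ∧ Y₀ 0 = y₀ ∧ Y₁ 0 = y₁) ∧
      (∀ t, X₀ t * Y₀ t + X₁ t * Y₁ t = x₀ * y₀ + x₁ * y₁) ∧ ∀ᶠ t in 𝓝[≠] 0, X₀ t ≠ 0 := by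
  have hne : ∀ᶠ t in 𝓝[≠] (0 : ℂ), t ≠ 0 := self_mem_nhdsWithin
  by_cases h0 : x₀ = 0
  · subst h0
    by_cases h1 : y₁ = 0
    · subst h1
      by_cases h2 : x₁ = 0
      · subst h2
        refine ⟨fun t => t ^ 2, fun t => -t * y₀, fun _ => y₀, fun t => t,
          ⟨by fun_prop, by fun_prop, by fun_prop, by fun_prop⟩, by simp, fun t => by ring, ?_⟩
        exact hne.mono fun t ht => pow_ne_zero 2 ht
      · refine ⟨fun t => t * x₁, fun _ => x₁, fun _ => y₀, fun t => -t * y₀,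
          ⟨by fun_prop, by fun_prop, by fun_prop, by fun_prop⟩, by simp, fun t => by ring, ?_⟩
        exact hne.mono fun t ht => mul_ne_zero ht h2
    · refine ⟨fun t => t * y₁, fun t => x₁ - t * y₀, fun _ => y₀, fun _ => y₁,
        ⟨by fun_prop, by fun_prop, by fun_prop, by fun_prop⟩, by simp, fun t => by ring, ?_⟩
      exact hne.mono fun t ht => mul_ne_zero ht h1
  · exact ⟨fun _ => x₀, fun _ => x₁, fun _ => y₀, fun _ => y₁, ⟨by fun_prop, by fun_prop,
      by fun_prop, by fun_prop⟩, by simp, fun _ => rfl, .of_forall fun _ => h0⟩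

section

variable {k : ℕ} {τ : ℂ} {F : Matrix (Fin k) (Fin k) ℂ → Matrix (Fin k) (Fin k) ℂ →
    Matrix (Fin k) (Fin 2) ℂ → Matrix (Fin 2) (Fin k) ℂ → ℂ}

/-- To show that `F` vanishes at a point it is enough to deform the point. -/
theorem VanishesOnSlice.of_curve (hF : VanishesOnSlice τ F)
    (A B : ℂ → Matrix (Fin k) (Fin k) ℂ) (i : ℂ → Matrix (Fin k) (Fin 2) ℂ)
    (j : ℂ → Matrix (Fin 2) (Fin k) ℂ) (hA : ContinuousAt A 0) (hB : ContinuousAt B 0)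
    (hi : ContinuousAt i 0) (hj : ContinuousAt j 0)
    (h : ∀ᶠ t in 𝓝[≠] 0, F (A t) (B t) (i t) (j t) = 0) : F (A 0) (B 0) (i 0) (j 0) = 0 :=
  eq_zero_of_eventually (F := fun t => F (A t) (B t) (i t) (j t))
    (hF.continuous.continuousAt.comp (f := fun t => (A t, B t, i t, j t))
      (hA.prodMk (hB.prodMk (hi.prodMk hj)))) h

/-- A diagonal matrix conjugates `i_1` to `(1, …, 1)` if its entries do not vanish. -/
theorem VanishesOnSlice.of_diagonal_ne_zero (hF : VanishesOnSlice τ F) {l : Fin k → ℂ}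
    (hl : Function.Injective l) {B : Matrix (Fin k) (Fin k) ℂ} {i : Matrix (Fin k) (Fin 2) ℂ}
    {j : Matrix (Fin 2) (Fin k) ℂ} (h : IsModuliPoint τ (Matrix.diagonal l) B i j)
    (hi : ∀ a, i a 0 ≠ 0) : F (Matrix.diagonal l) B i j = 0 := by
  let g : GL (Fin k) ℂ := ⟨Matrix.diagonal fun a => (i a 0)⁻¹, Matrix.diagonal fun a => i a 0,
    by simp [Matrix.diagonal_mul_diagonal, hi], by simp [Matrix.diagonal_mul_diagonal, hi]⟩
  have hg : g.1 * Matrix.diagonal l * g⁻¹.1 = Matrix.diagonal l := by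
    change Matrix.diagonal _ * Matrix.diagonal l * Matrix.diagonal _ = _
    simp only [Matrix.diagonal_mul_diagonal]
    congr 1
    funext a
    field_simp [hi a]
  have h1 := h.conj g
  rw [← hF.invariant g]
  rw [hg] at h1 ⊢
  refine hF.slice l _ _ _ hl (fun a => ?_) h1
  change (Matrix.diagonal (fun a => (i a 0)⁻¹) * i) a 0 = 1
  rw [Matrix.diagonal_mul, inv_mul_cancel₀ (hi a)]

/-- For `A` diagonal, the diagonal of the moment map equation is the equation
`i_{a1} j_{1a} + i_{a2} j_{2a} = -τ` for each `a`, and the other entries determine those of `B`. So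
`(i, j)` can be moved on these quadrics to make the entries of `i_1` nonzero. -/
theorem VanishesOnSlice.of_diagonal (hF : VanishesOnSlice τ F) {l : Fin k → ℂ}
    (hl : Function.Injective l) {B : Matrix (Fin k) (Fin k) ℂ} {i : Matrix (Fin k) (Fin 2) ℂ}
    {j : Matrix (Fin 2) (Fin k) ℂ} (h : IsModuliPoint τ (Matrix.diagonal l) B i j) :
    F (Matrix.diagonal l) B i j = 0 := by
  have hent : ∀ a b, l a * B a b - B a b * l b - (i a 0 * j 0 b + i a 1 * j 1 b) =
      if a = b then τ else 0 := by
    intro a b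
    have := congrFun (congrFun h a) b
    rw [Matrix.sub_apply, Matrix.sub_apply, Matrix.diagonal_mul, Matrix.mul_diagonal,
      Matrix.mul_apply, Fin.sum_univ_two] at this
    simpa [Matrix.one_apply] using this
  choose X₀ X₁ Y₀ Y₁ hc h0 hq hne using fun a =>
    exists_quadric_curve (i a 0) (i a 1) (j 0 a) (j 1 a)
  have hX₀ := fun a => (hc a).1
  have hX₁ := fun a => (hc a).2.1
  have hY₀ := fun a => (hc a).2.2.1
  have hY₁ := fun a => (hc a).2.2.2
  let I : ℂ → Matrix (Fin k) (Fin 2) ℂ := fun t => Matrix.of fun a => ![X₀ a t, X₁ a t]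
  let J : ℂ → Matrix (Fin 2) (Fin k) ℂ := fun t => Matrix.of ![fun a => Y₀ a t, fun a => Y₁ a t]
  let B' : ℂ → Matrix (Fin k) (Fin k) ℂ := fun t => Matrix.of fun a b =>
    if a = b then B a b else (X₀ a t * Y₀ b t + X₁ a t * Y₁ b t) / (l a - l b)
  have hI : Continuous I := by
    refine continuous_matrix fun a b => ?_
    fin_cases b
    · exact hX₀ a
    · exact hX₁ a
  have hJ : Continuous J := by
    refine continuous_matrix fun a b => ?_
    fin_cases a
    · exact hY₀ b
    · exact hY₁ b
  have hB' : Continuous B' := by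
    refine continuous_matrix fun a b => ?_
    by_cases hab : a = b
    · simp only [B', Matrix.of_apply, hab, if_true]; fun_prop
    · simp only [B', Matrix.of_apply, hab, if_false]
      exact (((hX₀ a).mul (hY₀ b)).add ((hX₁ a).mul (hY₁ b))).div_const _
  have hI0 : I 0 = i := by
    ext a b
    fin_cases b
    · exact (h0 a).1
    · exact (h0 a).2.1
  have hJ0 : J 0 = j := by
    ext a b
    fin_cases a
    · exact (h0 b).2.2.1
    · exact (h0 b).2.2.2
  have hB0 : B' 0 = B := by
    ext a b
    by_cases hab : a = b
    · simp [B', hab]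
    · have h1 := hent a b
      have h2 : l a - l b ≠ 0 := sub_ne_zero.2 fun h => hab (hl h)
      simp only [B', Matrix.of_apply, hab, if_false, (h0 a).1, (h0 a).2.1, (h0 b).2.2.1,
        (h0 b).2.2.2] at h1 ⊢
      rw [div_eq_iff h2]
      linear_combination -h1
  have key := hF.of_curve (fun _ => Matrix.diagonal l) B' I J continuousAt_const
    hB'.continuousAt hI.continuousAt hJ.continuousAt ?_
  · rwa [hI0, hJ0, hB0] at key
  · have hall : ∀ᶠ t in 𝓝[≠] 0, ∀ a, X₀ a t ≠ 0 := eventually_all.2 hne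
    filter_upwards [hall] with t ht
    refine hF.of_diagonal_ne_zero hl ?_ ht
    unfold IsModuliPoint
    ext a b
    rw [Matrix.sub_apply, Matrix.sub_apply, Matrix.diagonal_mul, Matrix.mul_diagonal,
      Matrix.mul_apply, Fin.sum_univ_two]
    simp only [Matrix.smul_apply, Matrix.one_apply, B', I, J, Matrix.of_apply,
      Matrix.cons_val_zero, Matrix.cons_val_one, smul_eq_mul]
    by_cases hab : a = b
    · subst hab
      have h1 := hent a a
      have h2 := hq a t
      simp only [if_true] at h1 ⊢
      linear_combination h1 - h2
    · have h2 : l a - l b ≠ 0 := sub_ne_zero.2 fun h => hab (hl h)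
      simp only [hab, if_false]
      field_simp
      ring

theorem VanishesOnSlice.of_simpleSpectrum_left (hF : VanishesOnSlice τ F)
    {A B : Matrix (Fin k) (Fin k) ℂ} {i : Matrix (Fin k) (Fin 2) ℂ} {j : Matrix (Fin 2) (Fin k) ℂ}
    (h : IsModuliPoint τ A B i j) (hA : HasSimpleSpectrum A) : F A B i j = 0 := by
  obtain ⟨g, l, hl, rfl⟩ := hA
  have h1 := h.conj g⁻¹
  rw [← hF.invariant g⁻¹]
  have h2 : g⁻¹.1 * (g.1 * Matrix.diagonal l * g⁻¹.1) * g⁻¹⁻¹.1 = Matrix.diagonal l := by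
    have h3 : g⁻¹.1 * g.1 = 1 := by rw [← Units.val_mul, inv_mul_cancel, Units.val_one]
    calc _ = g⁻¹.1 * g.1 * Matrix.diagonal l * (g⁻¹.1 * g.1) := by
          rw [inv_inv]; simp only [mul_assoc]
      _ = _ := by rw [h3, one_mul, mul_one]
  rw [h2] at h1 ⊢
  exact hF.of_diagonal hl h1

/-- The moment map does not change if `t B` is added to `A`. -/
theorem VanishesOnSlice.of_simpleSpectrum_right (hF : VanishesOnSlice τ F)
    {A B : Matrix (Fin k) (Fin k) ℂ} {i : Matrix (Fin k) (Fin 2) ℂ} {j : Matrix (Fin 2) (Fin k) ℂ}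
    (h : IsModuliPoint τ A B i j) (hB : HasSimpleSpectrum B) : F A B i j = 0 := by
  have key := hF.of_curve (fun t => A + t • B) (fun _ => B) (fun _ => i) (fun _ => j)
    (by fun_prop) continuousAt_const continuousAt_const continuousAt_const ?_
  · simpa using key
  · filter_upwards [eventually_hasSimpleSpectrum A B hB] with t ht
    refine hF.of_simpleSpectrum_left ?_ ht
    unfold IsModuliPoint at h ⊢
    rw [← h]
    simp only [add_mul, mul_add, smul_mul_assoc, mul_smul_comm]
    abel

/-- If no nonzero element of the commutant of `B` is killed by `j`, the equation can be solved for
`(A, i)` with `B` replaced by a nearby matrix with distinct eigenvalues. -/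
theorem VanishesOnSlice.of_faithful (hF : VanishesOnSlice τ F)
    {A B : Matrix (Fin k) (Fin k) ℂ} {i : Matrix (Fin k) (Fin 2) ℂ} {j : Matrix (Fin 2) (Fin k) ℂ}
    (h : IsModuliPoint τ A B i j)
    (hj : ∀ X : Matrix (Fin k) (Fin k) ℂ, X * B = B * X → j * X = 0 → X = 0) : F A B i j = 0 := by
  let L : Matrix (Fin k) (Fin k) ℂ × Matrix (Fin k) (Fin 2) ℂ →ₗ[ℂ] Matrix (Fin k) (Fin k) ℂ :=
    { toFun := fun x => x.1 * B - B * x.1 - x.2 * j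
      map_add' := fun x y => by
        simp only [Prod.fst_add, Prod.snd_add, add_mul, mul_add, Matrix.add_mul]
        abel
      map_smul' := fun c x => by simp [smul_sub] }
  have hL : L.range = ⊤ := by
    by_contra hne
    obtain ⟨Y, -, hY⟩ := SetLike.exists_of_lt (lt_top_iff_ne_top.2 hne)
    obtain ⟨X, hX, hXY⟩ := exists_trace_ne_zero _ hY
    have h1 : ∀ (P : Matrix (Fin k) (Fin k) ℂ) (Q : Matrix (Fin k) (Fin 2) ℂ),
        (X * (P * B - B * P - Q * j)).trace = 0 := fun P Q => hX _ ⟨(P, Q), rfl⟩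
    have h2 : B * X - X * B = 0 := by
      refine forall_trace_mul_eq_zero fun P => ?_
      have := h1 P 0
      rw [Matrix.zero_mul, sub_zero, Matrix.mul_sub, Matrix.trace_sub, Matrix.trace_mul_comm X,
        Matrix.trace_mul_comm X, mul_assoc, mul_assoc, Matrix.trace_mul_comm B, mul_assoc] at this
      rwa [Matrix.mul_sub, Matrix.trace_sub]
    have h3 : j * X = 0 := by
      refine forall_trace_mul_eq_zero fun Q => ?_
      have := h1 0 Q
      simp only [Matrix.zero_mul, Matrix.mul_zero, sub_zero, zero_sub, Matrix.mul_neg,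
        Matrix.trace_neg, neg_eq_zero] at this
      rw [← Matrix.mul_assoc, Matrix.trace_mul_comm, this]
    exact hXY (by rw [hj X (sub_eq_zero.1 h2).symm h3, Matrix.zero_mul, Matrix.trace_zero])
  obtain ⟨G, hG⟩ := LinearMap.exists_rightInverse_of_surjective L hL
  have hGa : ∀ x, (G x).1 * B - B * (G x).1 - (G x).2 * j = x := LinearMap.congr_fun hG
  let l : Fin k → ℂ := fun a => (a : ℕ)
  have hl : Function.Injective l := fun a b h => by simpa [l, Fin.val_inj] using h
  let D : Matrix (Fin k) (Fin k) ℂ := Matrix.diagonal l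
  have hD : HasSimpleSpectrum D := ⟨1, l, hl, by simp [D]⟩
  let N : Matrix (Fin k) (Fin k) ℂ →ₗ[ℂ] Matrix (Fin k) (Fin k) ℂ :=
    { toFun := fun x => (G x).1 * D - D * (G x).1
      map_add' := fun x y => by
        simp only [map_add, Prod.fst_add, add_mul, mul_add]
        abel
      map_smul' := fun c x => by simp [smul_sub] }
  obtain ⟨y, hy, hy0, hyt⟩ := exists_continuous_resolvent N (-(A * D - D * A))
  have hGc : Continuous G := G.continuous_of_finiteDimensional
  have key := hF.of_curve (fun t => A + (G (y t)).1) (fun t => B + t • D)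
    (fun t => i + (G (y t)).2) (fun _ => j)
    (continuousAt_const.add (continuous_fst.continuousAt.comp (hGc.continuousAt.comp hy)))
    (by fun_prop)
    (continuousAt_const.add (continuous_snd.continuousAt.comp (hGc.continuousAt.comp hy)))
    continuousAt_const ?_
  · simpa [hy0] using key
  · filter_upwards [eventually_hasSimpleSpectrum B D hD, nhdsWithin_le_nhds hyt] with t h1 h2
    refine hF.of_simpleSpectrum_right ?_ h1
    have h3 := hGa (y t)
    have h4 : y t + t • ((G (y t)).1 * D - D * (G (y t)).1) = t • -(A * D - D * A) := h2
    unfold IsModuliPoint at h ⊢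
    calc _ = (A * B - B * A - i * j) +
          ((G (y t)).1 * B - B * (G (y t)).1 - (G (y t)).2 * j) +
          t • ((G (y t)).1 * D - D * (G (y t)).1) + t • (A * D - D * A) := by
          simp only [add_mul, mul_add, Matrix.add_mul, smul_mul_assoc, mul_smul_comm, smul_sub, smul_add]
          abel
      _ = _ := by
          rw [h, h3, add_assoc (τ • 1), h4, smul_neg]
          abel

open scoped Polynomial in
/-- If `B` has a cyclic vector, `j` can be moved within the variety, with `i` and `B` fixed, so
that the commutant of `B` acts faithfully on it. For `i_α = d c_α(B) w` with `c_1`, `c_2` coprime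
and a faithful covector `ξ`, the direction `e = (ξ c_2(B), -ξ c_1(B))` is faithful, and
`tr (X i e) = 0` for all `X` in the commutant, so that `i e` is a commutator with `B`. -/
theorem VanishesOnSlice.of_krylov (hF : VanishesOnSlice τ F)
    {A B : Matrix (Fin k) (Fin k) ℂ} {i : Matrix (Fin k) (Fin 2) ℂ} {j : Matrix (Fin 2) (Fin k) ℂ}
    (h : IsModuliPoint τ A B i j) {w : Fin k → ℂ} (hw : (krylov B w).det ≠ 0) : F A B i j = 0 := by
  obtain ⟨ξ, hξ⟩ := exists_faithful_covector hw
  obtain ⟨m₀, hm₀⟩ := exists_aeval_of_krylov hw (fun a => i a 0)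
  obtain ⟨m₁, hm₁⟩ := exists_aeval_of_krylov hw (fun a => i a 1)
  obtain ⟨d, c₀, c₁, hc, rfl, rfl⟩ : ∃ d c₀ c₁ : ℂ[X], IsCoprime c₀ c₁ ∧ m₀ = d * c₀ ∧
      m₁ = d * c₁ := by
    by_cases h0 : m₀ = 0 ∧ m₁ = 0
    · exact ⟨0, 1, 0, isCoprime_one_left, by simp [h0.1], by simp [h0.2]⟩
    · have hg : EuclideanDomain.gcd m₀ m₁ ≠ 0 := fun hg => h0 (EuclideanDomain.gcd_eq_zero_iff.1 hg)
      obtain ⟨x, hx⟩ := EuclideanDomain.gcd_dvd_left m₀ m₁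
      obtain ⟨y, hy⟩ := EuclideanDomain.gcd_dvd_right m₀ m₁
      refine ⟨EuclideanDomain.gcd m₀ m₁, x, y, ⟨EuclideanDomain.gcdA m₀ m₁,
        EuclideanDomain.gcdB m₀ m₁, mul_left_cancel₀ hg ?_⟩, hx, hy⟩
      have := EuclideanDomain.gcd_eq_gcd_ab m₀ m₁
      rw [mul_one]
      linear_combination -this - (EuclideanDomain.gcdA m₀ m₁) * hx - (EuclideanDomain.gcdB m₀ m₁) * hy
  let e : Matrix (Fin 2) (Fin k) ℂ :=
    Matrix.of ![Matrix.vecMul ξ (Polynomial.aeval B c₁), -Matrix.vecMul ξ (Polynomial.aeval B c₀)]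
  have hmem : i * e ∈ LinearMap.range (LinearMap.mulRight ℂ B - LinearMap.mulLeft ℂ B) := by
    by_contra hne
    obtain ⟨X, hX, hXY⟩ := exists_trace_ne_zero _ hne
    have h2 : B * X - X * B = 0 := by
      refine forall_trace_mul_eq_zero fun P => ?_
      have : (X * (P * B - B * P)).trace = 0 := hX _ ⟨P, rfl⟩
      rw [Matrix.mul_sub, Matrix.trace_sub, Matrix.trace_mul_comm X,
        Matrix.trace_mul_comm X, mul_assoc, mul_assoc, Matrix.trace_mul_comm B, mul_assoc] at this
      rwa [Matrix.mul_sub, Matrix.trace_sub]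
    obtain ⟨p, rfl⟩ := eq_aeval_of_commute hw (sub_eq_zero.1 h2).symm
    apply hXY
    have h4 : ((Polynomial.aeval B p) * (i * e)).trace =
        (Matrix.vecMul ξ (Polynomial.aeval B c₁)) ⬝ᵥ
          (Polynomial.aeval B p).mulVec ((Polynomial.aeval B (d * c₀)).mulVec w) -
        (Matrix.vecMul ξ (Polynomial.aeval B c₀)) ⬝ᵥ
          (Polynomial.aeval B p).mulVec ((Polynomial.aeval B (d * c₁)).mulVec w) := by
      rw [hm₀, hm₁, ← Matrix.mul_assoc, Matrix.trace_mul_comm, Matrix.trace]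
      rw [Fin.sum_univ_two]
      simp only [Matrix.diag_apply, Matrix.mul_apply, e, Matrix.of_apply, Matrix.cons_val_zero,
        Matrix.cons_val_one, dotProduct, Matrix.mulVec, Pi.neg_apply, neg_mul,
        Finset.sum_neg_distrib, sub_eq_add_neg]
    rw [h4, ← Matrix.dotProduct_mulVec, ← Matrix.dotProduct_mulVec, Matrix.mulVec_mulVec,
      Matrix.mulVec_mulVec, Matrix.mulVec_mulVec, Matrix.mulVec_mulVec, ← map_mul, ← map_mul,
      ← map_mul, ← map_mul, show c₁ * p * (d * c₀) = c₀ * p * (d * c₁) by ring, sub_self]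
  obtain ⟨A', hA'⟩ := hmem
  have hA' : A' * B - B * A' = i * e := hA'
  -- the commutant of `B`
  let Z : Submodule ℂ (Matrix (Fin k) (Fin k) ℂ) :=
    LinearMap.ker (LinearMap.mulRight ℂ B - LinearMap.mulLeft ℂ B)
  have hZ : ∀ X, X ∈ Z ↔ X * B = B * X := fun X => sub_eq_zero
  let Φ : Matrix (Fin 2) (Fin k) ℂ → (Z →ₗ[ℂ] Matrix (Fin 2) (Fin k) ℂ) := fun e =>
    { toFun := fun X => e * X.1
      map_add' := fun X Y => by simp [Matrix.mul_add]
      map_smul' := fun c X => by simp }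
  have hinj : Function.Injective (Φ e) := by
    rw [← LinearMap.ker_eq_bot, LinearMap.ker_eq_bot']
    rintro ⟨X, hXZ⟩ hX
    rw [hZ] at hXZ
    have hX : e * X = 0 := hX
    refine Subtype.ext (hξ X hXZ ?_)
    obtain ⟨a, b, hab⟩ := hc
    have h0 : Matrix.vecMul (Matrix.vecMul ξ (Polynomial.aeval B c₁)) X = 0 := congrFun hX 0
    have h1 : Matrix.vecMul (-Matrix.vecMul ξ (Polynomial.aeval B c₀)) X = 0 := congrFun hX 1
    rw [Matrix.neg_vecMul, neg_eq_zero] at h1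
    rw [Matrix.vecMul_vecMul, ← mul_aeval_comm hXZ] at h0 h1
    calc Matrix.vecMul ξ X = Matrix.vecMul ξ (X * Polynomial.aeval B (a * c₀ + b * c₁)) := by
          rw [hab, map_one, mul_one]
      _ = Matrix.vecMul (Matrix.vecMul ξ (X * Polynomial.aeval B c₀)) (Polynomial.aeval B a) +
          Matrix.vecMul (Matrix.vecMul ξ (X * Polynomial.aeval B c₁)) (Polynomial.aeval B b) := by
          rw [Matrix.vecMul_vecMul, Matrix.vecMul_vecMul, ← Matrix.vecMul_add, map_add,
            mul_comm a, mul_comm b, map_mul, map_mul, mul_add, mul_assoc, mul_assoc]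
      _ = 0 := by rw [h0, h1, Matrix.zero_vecMul, Matrix.zero_vecMul, add_zero]
  have key := hF.of_curve (fun t => A + t • A') (fun _ => B) (fun _ => i) (fun t => j + t • e)
    (by fun_prop) continuousAt_const continuousAt_const (by fun_prop) ?_
  · simpa using key
  · filter_upwards [eventually_injective (Φ j) (Φ e) hinj] with t ht
    refine hF.of_faithful (A := A + t • A') (B := B) (i := i) (j := j + t • e) ?_ fun X hX h0 => ?_
    · unfold IsModuliPoint at h ⊢
      calc _ = (A * B - B * A - i * j) + t • (A' * B - B * A' - i * e) := by
            simp only [add_mul, mul_add, Matrix.mul_add, smul_mul_assoc, mul_smul_comm,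
              Matrix.mul_smul, smul_sub]
            abel
        _ = _ := by rw [h, hA', sub_self, smul_zero, add_zero]
    · have : (Φ j + t • Φ e) ⟨X, (hZ X).2 hX⟩ = (Φ j + t • Φ e) 0 := by
        rw [map_zero, ← h0, Matrix.add_mul, Matrix.smul_mul]
        rfl
      exact congrArg Subtype.val (ht this)

/-- The `GL_k`-orbits of the slice are dense in the variety `[A, B] - i j = τ · 1`. -/
theorem VanishesOnSlice.eq_zero (hF : VanishesOnSlice τ F)
    {A B : Matrix (Fin k) (Fin k) ℂ} {i : Matrix (Fin k) (Fin 2) ℂ} {j : Matrix (Fin 2) (Fin k) ℂ}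
    (h : IsModuliPoint τ A B i j) : F A B i j = 0 := by
  obtain ⟨M, w, hM, hw⟩ := exists_commute_cyclic A
  have key := hF.of_curve (fun _ => A) (fun t => B + t • M) (fun _ => i) (fun _ => j)
    continuousAt_const (by fun_prop) continuousAt_const continuousAt_const ?_
  · simpa using key
  · filter_upwards [eventually_krylov B M w (krylov_det_ne_zero hw)] with t ht
    refine hF.of_krylov ?_ ht
    unfold IsModuliPoint at h ⊢
    rw [← h]
    simp only [add_mul, mul_add, smul_mul_assoc, mul_smul_comm, hM]
    abel

end

/-! ### The slice with `A` diagonal -/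

/-- Positions on the slice: the eigenvalues `λ_a`, the entries `v_a` of `j_2`, and the `m` further
positions. The dual momenta are `b_a = B_{aa}`, the entries `u_a` of `i_2`, and the `m` further
momenta. -/
abbrev SlicePos (k m : ℕ) : Type := Fin k ⊕ Fin k ⊕ Fin m

section

variable {k m : ℕ} {R : Type} [CommRing R] [Algebra ℂ R]

/-- The values of all coordinates at the point of the slice with coordinates `s`: here
`A = diag(λ)`, `i_1 = (1, …, 1)`, and `[A, B] - i j = τ · 1` determines `j_1` and the entries
of `B` off the diagonal. -/
noncomputable def sliceValue (τ : ℂ) (s : SlicePos k m ⊕ SlicePos k m → R) : Pos k m ⊕ Pos k m → R :=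
  Sum.elim
    (Sum.elim (fun x => if x.1 = x.2 then s (Sum.inl (Sum.inl x.1)) else 0)
      (Sum.elim
        (fun x => if x.1 = 0 then -algebraMap ℂ R τ -
          s (Sum.inr (Sum.inr (Sum.inl x.2))) * s (Sum.inl (Sum.inr (Sum.inl x.2)))
          else s (Sum.inl (Sum.inr (Sum.inl x.2))))
        (fun e => s (Sum.inl (Sum.inr (Sum.inr e))))))
    (Sum.elim
      (fun x => if x.1 = x.2 then s (Sum.inr (Sum.inl x.1)) else
        (-algebraMap ℂ R τ -
          s (Sum.inr (Sum.inr (Sum.inl x.1))) * s (Sum.inl (Sum.inr (Sum.inl x.1))) +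
          s (Sum.inr (Sum.inr (Sum.inl x.2))) * s (Sum.inl (Sum.inr (Sum.inl x.1)))) *
          Ring.inverse (s (Sum.inl (Sum.inl x.2)) - s (Sum.inl (Sum.inl x.1))))
      (Sum.elim (fun x => if x.1 = 0 then 1 else s (Sum.inr (Sum.inr (Sum.inl x.2))))
        (fun e => s (Sum.inr (Sum.inr (Sum.inr e))))))

/-- The restriction of polynomial functions to the slice. -/
noncomputable def sliceHom (τ : ℂ) (s : SlicePos k m ⊕ SlicePos k m → R) : Coord k m →ₐ[ℂ] R :=
  aeval (sliceValue τ s)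

/-- The eigenvalues `λ_a` are distinct, uniformly on the slice. -/
def IsSeparated (s : SlicePos k m ⊕ SlicePos k m → R) : Prop :=
  ∀ a b, a ≠ b → IsUnit (s (Sum.inl (Sum.inl a)) - s (Sum.inl (Sum.inl b)))

variable (τ : ℂ) (s : SlicePos k m ⊕ SlicePos k m → R)

theorem sliceHom_A (a b : Fin k) : sliceHom τ s (X (Sum.inl (Sum.inl (a, b)))) =
    if a = b then s (Sum.inl (Sum.inl a)) else 0 := by
  simp [sliceHom, sliceValue]

theorem sliceHom_j_zero (a : Fin k) : sliceHom τ s (X (Sum.inl (Sum.inr (Sum.inl (0, a))))) =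
    -algebraMap ℂ R τ -
      s (Sum.inr (Sum.inr (Sum.inl a))) * s (Sum.inl (Sum.inr (Sum.inl a))) := by
  simp [sliceHom, sliceValue]

theorem sliceHom_j_one (a : Fin k) : sliceHom τ s (X (Sum.inl (Sum.inr (Sum.inl (1, a))))) =
    s (Sum.inl (Sum.inr (Sum.inl a))) := by
  simp [sliceHom, sliceValue]

theorem sliceHom_pos (e : Fin m) : sliceHom τ s (X (Sum.inl (Sum.inr (Sum.inr e)))) =
    s (Sum.inl (Sum.inr (Sum.inr e))) := by
  simp [sliceHom, sliceValue]

theorem sliceHom_B_diag (a : Fin k) : sliceHom τ s (X (Sum.inr (Sum.inl (a, a)))) =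
    s (Sum.inr (Sum.inl a)) := by
  simp [sliceHom, sliceValue]

theorem sliceHom_B {a b : Fin k} (h : a ≠ b) : sliceHom τ s (X (Sum.inr (Sum.inl (b, a)))) =
    (-algebraMap ℂ R τ -
      s (Sum.inr (Sum.inr (Sum.inl b))) * s (Sum.inl (Sum.inr (Sum.inl b))) +
      s (Sum.inr (Sum.inr (Sum.inl a))) * s (Sum.inl (Sum.inr (Sum.inl b)))) *
      Ring.inverse (s (Sum.inl (Sum.inl a)) - s (Sum.inl (Sum.inl b))) := by
  simp [sliceHom, sliceValue, h.symm]

theorem sliceHom_i_zero (a : Fin k) : sliceHom τ s (X (Sum.inr (Sum.inr (Sum.inl (0, a))))) = 1 := by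
  simp [sliceHom, sliceValue]

theorem sliceHom_i_one (a : Fin k) : sliceHom τ s (X (Sum.inr (Sum.inr (Sum.inl (1, a))))) =
    s (Sum.inr (Sum.inr (Sum.inl a))) := by
  simp [sliceHom, sliceValue]

theorem sliceHom_mom (e : Fin m) : sliceHom τ s (X (Sum.inr (Sum.inr (Sum.inr e)))) =
    s (Sum.inr (Sum.inr (Sum.inr e))) := by
  simp [sliceHom, sliceValue]

theorem sliceHom_matA : (matA k m).map (sliceHom τ s) =
    Matrix.diagonal fun a => s (Sum.inl (Sum.inl a)) := by
  ext a b
  simp [matA, sliceHom_A, Matrix.diagonal_apply]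

variable {s}

theorem sliceHom_momentMap (hs : IsSeparated s) (a b : Fin k) :
    sliceHom τ s (momentMap k m a b) = if a = b then algebraMap ℂ R τ else 0 := by
  rw [moment_entry]
  simp only [map_sub, map_add, map_sum, map_mul, sliceHom_A, Fin.sum_univ_two, sliceHom_i_zero,
    sliceHom_i_one, sliceHom_j_zero, sliceHom_j_one, ite_mul, zero_mul, mul_ite, mul_zero,
    Finset.sum_ite_eq, Finset.sum_ite_eq', Finset.mem_univ, if_true]
  by_cases hab : a = b
  · subst hab
    rw [if_pos rfl]
    ring
  · rw [if_neg hab, sliceHom_B τ s hab]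
    have := Ring.mul_inverse_cancel _ (hs a b hab)
    linear_combination (-algebraMap ℂ R τ -
      s (Sum.inr (Sum.inr (Sum.inl b))) * s (Sum.inl (Sum.inr (Sum.inl b))) +
      s (Sum.inr (Sum.inr (Sum.inl a))) * s (Sum.inl (Sum.inr (Sum.inl b)))) * this

theorem sliceHom_momentIdeal (hs : IsSeparated s) :
    momentIdeal k m τ ≤ RingHom.ker (sliceHom τ s) := by
  rw [momentIdeal, Ideal.span_le]
  rintro _ ⟨⟨a, b⟩, rfl⟩
  rw [SetLike.mem_coe, RingHom.mem_ker, map_sub, sliceHom_momentMap τ hs, apply_ite (sliceHom τ s),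
    ← MvPolynomial.algebraMap_eq, AlgHom.commutes, map_zero, sub_self]

theorem map_ringInverse {S : Type} [CommRing S] [Algebra ℂ S] (φ : R →ₐ[ℂ] S) {x : R}
    (hx : IsUnit x) : φ (Ring.inverse x) = Ring.inverse (φ x) := by
  refine (hx.map φ).mul_left_cancel ?_
  rw [← map_mul, Ring.mul_inverse_cancel _ hx, map_one, Ring.mul_inverse_cancel _ (hx.map φ)]

theorem sliceHom_comp {S : Type} [CommRing S] [Algebra ℂ S] (φ : R →ₐ[ℂ] S) (hs : IsSeparated s)
    (f : Coord k m) : φ (sliceHom τ s f) = sliceHom τ (φ ∘ s) f := by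
  rw [sliceHom, sliceHom, ← AlgHom.comp_apply]
  congr 1
  apply MvPolynomial.algHom_ext
  intro v
  rw [AlgHom.comp_apply, aeval_X, aeval_X]
  rcases v with (⟨c, d⟩ | ⟨α, a⟩ | e) | (⟨c, d⟩ | ⟨α, a⟩ | e)
  · simp [sliceValue, apply_ite φ]
  · simp [sliceValue, apply_ite φ]
  · simp [sliceValue]
  · simp only [sliceValue, Sum.elim_inr, Sum.elim_inl, apply_ite φ]
    by_cases h : c = d
    · simp [h]
    · simp only [h, if_false, map_mul, map_ringInverse φ (hs d c (Ne.symm h)), Function.comp]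
      simp
  · simp [sliceValue, apply_ite φ]
  · simp [sliceValue]

/-- A permutation of the slice coordinates by `σ ∈ S_k`. -/
noncomputable def slicePerm (σ : Equiv.Perm (Fin k)) : SlicePos k m ⊕ SlicePos k m → SlicePos k m ⊕ SlicePos k m :=
  Sum.map (Sum.map σ (Sum.map σ id)) (Sum.map σ (Sum.map σ id))

/-- Invariant functions are unchanged when the coordinates of the slice are permuted, because the
permutation is induced by a permutation matrix. -/
theorem sliceHom_perm (σ : Equiv.Perm (Fin k)) {f : Coord k m} (hf : f ∈ invariants k m) :
    sliceHom τ (s ∘ slicePerm σ) f = sliceHom τ s f := by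
  have e1 : (Matrix.of fun a b => if σ a = b then (1 : ℂ) else 0) *
      (Matrix.of fun a b => if a = σ b then (1 : ℂ) else 0) = 1 := by
    ext a b
    simp [Matrix.mul_apply, Matrix.one_apply]
  let g : GL (Fin k) ℂ := ⟨_, _, e1, mul_eq_one_comm.1 e1⟩
  have hg : ∀ a b, g.1 a b = if σ a = b then 1 else 0 := fun _ _ => rfl
  have hg' : ∀ a b, g⁻¹.1 a b = if a = σ b then 1 else 0 := fun _ _ => rfl
  conv_rhs => rw [← hf g]
  rw [← AlgHom.comp_apply]
  congr 1
  apply MvPolynomial.algHom_ext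
  intro v
  have h1 : ∀ (M : Matrix (Fin k) (Fin k) (Coord k m)) c d,
      (constMat k m g.1 * M * constMat k m g⁻¹.1) c d = M (σ c) (σ d) := by
    intro M c d
    simp only [Matrix.mul_apply, constMat, Matrix.of_apply, hg, hg']
    simp [apply_ite C]
  have h2 : ∀ (M : Matrix (Fin 2) (Fin k) (Coord k m)) c d,
      (M * constMat k m g⁻¹.1) c d = M c (σ d) := by
    intro M c d
    simp only [Matrix.mul_apply, constMat, Matrix.of_apply, hg']
    simp [apply_ite C]
  have h3 : ∀ (M : Matrix (Fin k) (Fin 2) (Coord k m)) c d,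
      (constMat k m g.1 * M) c d = M (σ c) d := by
    intro M c d
    simp only [Matrix.mul_apply, constMat, Matrix.of_apply, hg]
    simp [apply_ite C]
  rcases v with (⟨c, d⟩ | ⟨α, a⟩ | e) | (⟨c, d⟩ | ⟨α, a⟩ | e)
  · simp only [AlgHom.comp_apply, act, substitution, aeval_X, Sum.elim_inl]
    rw [h1]
    simp [matA, sliceHom, sliceValue, slicePerm]
  · simp only [AlgHom.comp_apply, act, substitution, aeval_X, Sum.elim_inl, Sum.elim_inr]
    rw [h2]
    simp [matj, sliceHom, sliceValue, slicePerm]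
  · simp [act, substitution, sliceHom, sliceValue, slicePerm]
  · simp only [AlgHom.comp_apply, act, substitution, aeval_X, Sum.elim_inl, Sum.elim_inr]
    rw [h1]
    simp [matB, sliceHom, sliceValue, slicePerm]
  · simp only [AlgHom.comp_apply, act, substitution, aeval_X, Sum.elim_inl, Sum.elim_inr]
    rw [h3]
    simp [mati, sliceHom, sliceValue, slicePerm]
  · simp [act, substitution, sliceHom, sliceValue, slicePerm]

end

/-! ### The slice is a Poisson submanifold transversal to the gauge orbits -/

section

variable {A R : Type} [CommRing A] [Algebra ℂ A] [CommRing R] [Algebra ℂ R]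

/-- A derivation with values in `R`, which is an `A`-module through `Ψ`: a vector field along the
map of spaces corresponding to `Ψ`. -/
noncomputable def IsDerivationAlong (Ψ : A →ₐ[ℂ] R) (δ : A →ₗ[ℂ] R) : Prop :=
  ∀ f g, δ (f * g) = Ψ f * δ g + Ψ g * δ f

theorem IsDerivationAlong.map_algebraMap {Ψ : A →ₐ[ℂ] R} {δ : A →ₗ[ℂ] R}
    (h : IsDerivationAlong Ψ δ) (c : ℂ) : δ (algebraMap ℂ A c) = 0 := by
  have h1 := h 1 1
  rw [mul_one, map_one Ψ, one_mul] at h1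
  rw [Algebra.algebraMap_eq_smul_one, map_smul, left_eq_add.1 h1, smul_zero]

theorem IsDerivationAlong.sub {Ψ : A →ₐ[ℂ] R} {δ ε : A →ₗ[ℂ] R}
    (h : IsDerivationAlong Ψ δ) (h' : IsDerivationAlong Ψ ε) : IsDerivationAlong Ψ (δ - ε) := by
  intro f g
  rw [LinearMap.sub_apply, LinearMap.sub_apply, LinearMap.sub_apply, h, h']
  ring

theorem isDerivationAlong_comp (Ψ : A →ₐ[ℂ] R) (D : Derivation ℂ A A) :
    IsDerivationAlong Ψ (Ψ.toLinearMap ∘ₗ (D : A →ₗ[ℂ] A)) := by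
  intro f g
  simp

theorem isDerivationAlong_comp_left (Ψ : A →ₐ[ℂ] R) (D : Derivation ℂ R R) :
    IsDerivationAlong Ψ ((D : R →ₗ[ℂ] R) ∘ₗ Ψ.toLinearMap) := by
  intro f g
  simp

theorem IsDerivationAlong.chain_rule {σ : Type} [Fintype σ] {Ψ : MvPolynomial σ ℂ →ₐ[ℂ] R}
    {δ : MvPolynomial σ ℂ →ₗ[ℂ] R} (h : IsDerivationAlong Ψ δ) (f : MvPolynomial σ ℂ) :
    δ f = ∑ v, Ψ (pderiv v f) * δ (X v) := by
  classical
  induction f using MvPolynomial.induction_on with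
  | C a => rw [← MvPolynomial.algebraMap_eq, h.map_algebraMap]; simp
  | add p q hp hq => simp [hp, hq, add_mul, Finset.sum_add_distrib]
  | mul_X p i hp =>
    rw [h, hp]
    simp only [Derivation.leibniz, pderiv_X, map_add, smul_eq_mul, map_mul, add_mul,
      Finset.sum_add_distrib, Finset.mul_sum]
    congr 1
    · rw [Finset.sum_eq_single i]
      · simp
      · intro b _ hb
        simp [hb]
      · simp
    · exact Finset.sum_congr rfl fun _ _ => by ring

theorem IsDerivationAlong.eq_zero {σ : Type} [Fintype σ] {Ψ : MvPolynomial σ ℂ →ₐ[ℂ] R}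
    {δ : MvPolynomial σ ℂ →ₗ[ℂ] R} (h : IsDerivationAlong Ψ δ) (h0 : ∀ v, δ (X v) = 0)
    (f : MvPolynomial σ ℂ) : δ f = 0 := by
  rw [h.chain_rule]
  simp [h0]

/-- The symplectic form applied to two vector fields along a map. -/
noncomputable def symplecticPairing {Q : Type} [Fintype Q] (δ ε : MvPolynomial (Q ⊕ Q) ℂ →ₗ[ℂ] R) : R :=
  ∑ x, (δ (X (Sum.inl x)) * ε (X (Sum.inr x)) - δ (X (Sum.inr x)) * ε (X (Sum.inl x)))

theorem canonicalBracket_inl {Q : Type} (f : MvPolynomial (Q ⊕ Q) ℂ) (x : Q) :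
    canonicalBracket Q f (X (Sum.inl x)) = -pderiv (Sum.inr x) f := by
  rw [canonicalBracket_skew]
  simp [canonicalBracket, mkDerivation_X]

theorem canonicalBracket_inr {Q : Type} (f : MvPolynomial (Q ⊕ Q) ℂ) (x : Q) :
    canonicalBracket Q f (X (Sum.inr x)) = pderiv (Sum.inl x) f := by
  rw [canonicalBracket_skew]
  simp [canonicalBracket, mkDerivation_X]

/-- `ω(X_f, ε) = -ε(f)` for the Hamiltonian vector field `X_f`. -/
theorem symplecticPairing_hamiltonian {Q : Type} [Fintype Q] (Ψ : MvPolynomial (Q ⊕ Q) ℂ →ₐ[ℂ] R)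
    {ε : MvPolynomial (Q ⊕ Q) ℂ →ₗ[ℂ] R} (h : IsDerivationAlong Ψ ε) (f : MvPolynomial (Q ⊕ Q) ℂ) :
    symplecticPairing (Ψ.toLinearMap ∘ₗ (canonicalBracket Q f : _ →ₗ[ℂ] _)) ε = -ε f := by
  rw [h.chain_rule, symplecticPairing]
  simp only [LinearMap.comp_apply, Derivation.coeFn_coe, canonicalBracket_inl,
    canonicalBracket_inr, AlgHom.toLinearMap_apply, map_neg, Fintype.sum_sum_type,
    Finset.sum_sub_distrib, neg_mul, Finset.sum_neg_distrib]
  ring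

theorem derivation_matrix_mul {l n o : Type} [Fintype n] (D : Derivation ℂ A A) (M : Matrix l n A)
    (N : Matrix n o A) : (M * N).map D = M.map D * N + M * N.map D := by
  ext a b
  simp only [Matrix.map_apply, Matrix.add_apply, Matrix.mul_apply, map_sum, Derivation.leibniz,
    smul_eq_mul, Finset.sum_add_distrib]
  rw [add_comm]
  congr 1
  exact Finset.sum_congr rfl fun _ _ => mul_comm _ _

end

section

variable {k m : ℕ} {R : Type} [CommRing R] [Algebra ℂ R]

/-- The moment map is equivariant: its entries satisfy the commutation relations of `𝔤𝔩_k`. -/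
theorem moment_bracket_moment (a b : Fin k) :
    (momentMap k m).map (canonicalBracket (Pos k m) (momentMap k m a b)) =
      momentMap k m * Matrix.single b a 1 - Matrix.single b a 1 * momentMap k m := by
  set D := canonicalBracket (Pos k m) (momentMap k m a b) with hD
  have hAB : ∀ M : Matrix (Fin k) (Fin k) (Coord k m),
      (∀ c d, D (M c d) = (if d = a then M c b else 0) - if c = b then M a d else 0) →
      M.map D = M * Matrix.single b a 1 - Matrix.single b a 1 * M := by
    intro M h
    ext c d : 1
    rw [Matrix.map_apply, h, Matrix.sub_apply]
    congr 1
    · by_cases hd : d = a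
      · subst hd; simp
      · rw [Matrix.mul_single_apply_of_ne _ _ _ _ _ hd, if_neg hd]
    · by_cases hc : c = b
      · subst hc; simp
      · rw [Matrix.single_mul_apply_of_ne _ _ _ _ _ hc]; simp [hc]
  have hA := hAB (matA k m) fun c d => by
    rw [matA, Matrix.of_apply, hD, moment_bracket_X]; rfl
  have hB := hAB (matB k m) fun c d => by
    rw [matB, Matrix.of_apply, hD, moment_bracket_X]; rfl
  have hj : (matj k m).map D = matj k m * Matrix.single b a (1 : Coord k m) := by
    ext α d : 1
    rw [Matrix.map_apply, matj, Matrix.of_apply, hD, moment_bracket_X]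
    by_cases hd : d = a
    · subst hd; simp [matj]
    · rw [Matrix.mul_single_apply_of_ne _ _ _ _ _ hd]; simp [hd]
  have hi : (mati k m).map D = -(Matrix.single b a (1 : Coord k m) * mati k m) := by
    ext c α : 1
    rw [Matrix.map_apply, mati, Matrix.of_apply, hD, moment_bracket_X, Matrix.neg_apply]
    by_cases hc : c = b
    · subst hc; simp [mati]
    · rw [Matrix.single_mul_apply_of_ne _ _ _ _ _ hc]; simp [hc]
  have hsub : ∀ M N : Matrix (Fin k) (Fin k) (Coord k m), (M - N).map D = M.map D - N.map D :=
    fun M N => by ext; simp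
  rw [momentMap, hsub, hsub, derivation_matrix_mul, derivation_matrix_mul, derivation_matrix_mul,
    hA, hB, hj, hi]
  simp only [Matrix.sub_mul, Matrix.mul_sub, Matrix.mul_assoc, Matrix.neg_mul]
  abel

/-- An infinitesimal gauge transformation, as a vector field along the slice. -/
noncomputable def gaugeField (Ψ : Coord k m →ₐ[ℂ] R) (ξ : Fin k → Fin k → R) : Coord k m →ₗ[ℂ] R :=
  ∑ a, ∑ b, LinearMap.mulLeft ℂ (ξ a b) ∘ₗ Ψ.toLinearMap ∘ₗ
    (canonicalBracket (Pos k m) (momentMap k m a b) : Coord k m →ₗ[ℂ] Coord k m)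

theorem gaugeField_apply (Ψ : Coord k m →ₐ[ℂ] R) (ξ : Fin k → Fin k → R) (f : Coord k m) :
    gaugeField Ψ ξ f =
      ∑ a, ∑ b, ξ a b * Ψ (canonicalBracket (Pos k m) (momentMap k m a b) f) := by
  simp [gaugeField]

theorem isDerivationAlong_gaugeField (Ψ : Coord k m →ₐ[ℂ] R) (ξ : Fin k → Fin k → R) :
    IsDerivationAlong Ψ (gaugeField Ψ ξ) := by
  intro f g
  simp only [gaugeField_apply, Derivation.leibniz, smul_eq_mul, map_add, map_mul, mul_add,
    Finset.sum_add_distrib, Finset.mul_sum]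
  congr 1 <;>
  exact Finset.sum_congr rfl fun _ _ => Finset.sum_congr rfl fun _ _ => by ring

variable (τ : ℂ) {s : SlicePos k m ⊕ SlicePos k m → R}

theorem gaugeField_momentMap (hs : IsSeparated s) (ξ : Fin k → Fin k → R) (c d : Fin k) :
    gaugeField (sliceHom τ s) ξ (momentMap k m c d) = 0 := by
  rw [gaugeField_apply]
  refine Finset.sum_eq_zero fun a _ => Finset.sum_eq_zero fun b _ => ?_
  have h1 := congrFun (congrFun (moment_bracket_moment (m := m) a b) c) d
  have h2 : (momentMap k m).map (sliceHom τ s) = Matrix.scalar (Fin k) (algebraMap ℂ R τ) := by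
    ext a b
    rw [Matrix.map_apply, sliceHom_momentMap τ hs, Matrix.scalar_apply, Matrix.diagonal_apply]
  rw [Matrix.map_apply] at h1
  rw [h1, ← Matrix.map_apply (f := sliceHom τ s), Matrix.map_sub _ (by simp), Matrix.map_mul,
    Matrix.map_mul, h2, (Matrix.scalar_commute _ (fun _ => Commute.all _ _) _).eq, sub_self]
  simp

theorem gaugeField_A (ξ : Fin k → Fin k → R) (c d : Fin k) :
    gaugeField (sliceHom τ s) ξ (X (Sum.inl (Sum.inl (c, d)))) =
      (s (Sum.inl (Sum.inl c)) - s (Sum.inl (Sum.inl d))) * ξ d c := by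
  rw [gaugeField_apply]
  simp only [moment_bracket_X, Sum.elim_inl, matA, Matrix.of_apply, map_sub, mul_sub,
    apply_ite (sliceHom τ s), sliceHom_A, map_zero, Finset.sum_sub_distrib, mul_ite, mul_zero,
    Finset.sum_ite_eq, Finset.mem_univ, if_true, Finset.sum_ite_irrel, Finset.sum_const_zero]
  simp
  ring

theorem gaugeField_i_zero (ξ : Fin k → Fin k → R) (c : Fin k) :
    gaugeField (sliceHom τ s) ξ (X (Sum.inr (Sum.inr (Sum.inl (0, c))))) = -∑ a, ξ a c := by
  rw [gaugeField_apply]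
  simp [moment_bracket_X, mati, sliceHom_i_zero, apply_ite (sliceHom τ s)]

/-- The symplectic form restricts to the canonical form of the slice. -/
theorem symplecticPairing_slice (d : Derivation ℂ R R) (δ : Coord k m →ₗ[ℂ] R)
    (hA : ∀ a b, a ≠ b → δ (X (Sum.inl (Sum.inl (a, b)))) = 0)
    (hi : ∀ a, δ (X (Sum.inr (Sum.inr (Sum.inl (0, a))))) = 0) :
    symplecticPairing δ ((d : R →ₗ[ℂ] R) ∘ₗ (sliceHom τ s).toLinearMap) =
      ∑ a, (δ (X (Sum.inl (Sum.inl (a, a)))) * d (s (Sum.inr (Sum.inl a))) -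
        δ (X (Sum.inr (Sum.inl (a, a)))) * d (s (Sum.inl (Sum.inl a)))) +
      (∑ a, (δ (X (Sum.inl (Sum.inr (Sum.inl (1, a))))) * d (s (Sum.inr (Sum.inr (Sum.inl a)))) -
        δ (X (Sum.inr (Sum.inr (Sum.inl (1, a))))) * d (s (Sum.inl (Sum.inr (Sum.inl a))))) +
      ∑ e, (δ (X (Sum.inl (Sum.inr (Sum.inr e)))) * d (s (Sum.inr (Sum.inr (Sum.inr e)))) -
        δ (X (Sum.inr (Sum.inr (Sum.inr e)))) * d (s (Sum.inl (Sum.inr (Sum.inr e)))))) := by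
  rw [symplecticPairing, Fintype.sum_sum_type, Fintype.sum_sum_type, Fintype.sum_prod_type,
    Fintype.sum_prod_type, Fin.sum_univ_two]
  simp only [LinearMap.comp_apply, Derivation.coeFn_coe, AlgHom.toLinearMap_apply, hi,
    sliceHom_i_zero, sliceHom_i_one, sliceHom_j_one, sliceHom_pos, sliceHom_mom,
    Derivation.map_one_eq_zero, mul_zero, zero_mul, sub_self, Finset.sum_const_zero, zero_add]
  congr 1
  refine Finset.sum_congr rfl fun a _ => ?_
  rw [Finset.sum_eq_single a]
  · rw [sliceHom_A, if_pos rfl, sliceHom_B_diag]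
  · intro b _ hb
    rw [hA a b hb.symm, sliceHom_A, if_neg hb.symm, map_zero, mul_zero, zero_mul, sub_zero]
  · simp

end

/-- The elements `s` of a Poisson algebra satisfy the canonical commutation relations. -/
structure IsCanonical {Q R : Type} [CommRing R] [Algebra ℂ R] [DecidableEq Q]
    (γ : PoissonBracket R) (s : Q ⊕ Q → R) : Prop where
  skew : ∀ f g, γ f g = -γ g f
  qq : ∀ x y, γ (s (Sum.inl x)) (s (Sum.inl y)) = 0
  pp : ∀ x y, γ (s (Sum.inr x)) (s (Sum.inr y)) = 0
  qp : ∀ x y, γ (s (Sum.inl x)) (s (Sum.inr y)) = if x = y then 1 else 0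

theorem IsCanonical.pq {Q R : Type} [CommRing R] [Algebra ℂ R] [DecidableEq Q]
    {γ : PoissonBracket R} {s : Q ⊕ Q → R} (h : IsCanonical γ s) (x y : Q) :
    γ (s (Sum.inr x)) (s (Sum.inl y)) = if x = y then -1 else 0 := by
  rw [h.skew, h.qp]
  by_cases hxy : x = y
  · simp [hxy]
  · simp [hxy, Ne.symm hxy]

section

variable {k m : ℕ} {R : Type} [CommRing R] [Algebra ℂ R]

/-- The coordinates of the ambient space that restrict to the coordinates of the slice. -/
def sliceIndex : SlicePos k m ⊕ SlicePos k m → Pos k m ⊕ Pos k m :=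
  Sum.map
    (Sum.elim (fun a => Sum.inl (a, a))
      (Sum.elim (fun a => Sum.inr (Sum.inl (1, a))) (fun e => Sum.inr (Sum.inr e))))
    (Sum.elim (fun a => Sum.inl (a, a))
      (Sum.elim (fun a => Sum.inr (Sum.inl (1, a))) (fun e => Sum.inr (Sum.inr e))))

theorem sliceHom_sliceIndex (τ : ℂ) (s : SlicePos k m ⊕ SlicePos k m → R)
    (y : SlicePos k m ⊕ SlicePos k m) : sliceHom τ s (X (sliceIndex y)) = s y := by
  rcases y with (a | a | e) | (a | a | e) <;> simp [sliceIndex, sliceHom, sliceValue]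

variable (τ : ℂ) {s : SlicePos k m ⊕ SlicePos k m → R}

theorem symplecticPairing_slice' (d : Derivation ℂ R R) (δ : Coord k m →ₗ[ℂ] R)
    (hA : ∀ a b, a ≠ b → δ (X (Sum.inl (Sum.inl (a, b)))) = 0)
    (hi : ∀ a, δ (X (Sum.inr (Sum.inr (Sum.inl (0, a))))) = 0) :
    symplecticPairing δ ((d : R →ₗ[ℂ] R) ∘ₗ (sliceHom τ s).toLinearMap) =
      ∑ x, (δ (X (sliceIndex (Sum.inl x))) * d (s (Sum.inr x)) -
        δ (X (sliceIndex (Sum.inr x))) * d (s (Sum.inl x))) := by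
  rw [symplecticPairing_slice τ d δ hA hi, Fintype.sum_sum_type, Fintype.sum_sum_type]
  rfl

/-- The canonical form of the slice is nondegenerate. -/
theorem eq_zero_of_symplecticPairing (γ : PoissonBracket R) (hc : IsCanonical γ s)
    (δ : Coord k m →ₗ[ℂ] R)
    (hA : ∀ a b, a ≠ b → δ (X (Sum.inl (Sum.inl (a, b)))) = 0)
    (hi : ∀ a, δ (X (Sum.inr (Sum.inr (Sum.inl (0, a))))) = 0)
    (h : ∀ y, symplecticPairing δ ((γ (s y) : R →ₗ[ℂ] R) ∘ₗ (sliceHom τ s).toLinearMap) = 0)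
    (y : SlicePos k m ⊕ SlicePos k m) : δ (X (sliceIndex y)) = 0 := by
  simp only [symplecticPairing_slice' τ _ δ hA hi] at h
  rcases y with y | y
  · have := h (Sum.inl y)
    simpa [hc.qq, hc.qp] using this
  · have := h (Sum.inr y)
    simpa [hc.pq, hc.pp] using this

/-- On the slice the moment map equation determines the remaining coordinates, also
infinitesimally. -/
theorem IsDerivationAlong.eq_zero_of_slice (hs : IsSeparated s) {δ : Coord k m →ₗ[ℂ] R}
    (hδ : IsDerivationAlong (sliceHom τ s) δ)
    (hμ : ∀ a b, δ (momentMap k m a b) = 0)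
    (hA : ∀ a b, a ≠ b → δ (X (Sum.inl (Sum.inl (a, b)))) = 0)
    (hi : ∀ a, δ (X (Sum.inr (Sum.inr (Sum.inl (0, a))))) = 0)
    (h : ∀ y, δ (X (sliceIndex y)) = 0) (f : Coord k m) : δ f = 0 := by
  have hA' : ∀ a b, δ (X (Sum.inl (Sum.inl (a, b)))) = 0 := by
    intro a b
    by_cases hab : a = b
    · subst hab
      exact h (Sum.inl (Sum.inl a))
    · exact hA a b hab
  have hi' : ∀ a, δ (X (Sum.inr (Sum.inr (Sum.inl (1, a))))) = 0 := fun a =>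
    h (Sum.inr (Sum.inr (Sum.inl a)))
  have hj' : ∀ a, δ (X (Sum.inl (Sum.inr (Sum.inl (1, a))))) = 0 := fun a =>
    h (Sum.inl (Sum.inr (Sum.inl a)))
  have key : ∀ a b, (s (Sum.inl (Sum.inl a)) - s (Sum.inl (Sum.inl b))) *
      δ (X (Sum.inr (Sum.inl (b, a)))) = δ (X (Sum.inl (Sum.inr (Sum.inl (0, b))))) := by
    intro a b
    have := hμ a b
    rw [moment_entry] at this
    simp only [map_sub, map_add, map_sum, Fin.sum_univ_two, hδ _ _, sliceHom_A, hA', hi, hi', hj',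
      sliceHom_i_zero, sliceHom_i_one, mul_zero, add_zero, zero_add, ite_mul, zero_mul, one_mul,
      Finset.sum_ite_eq, Finset.sum_ite_eq', Finset.mem_univ, if_true] at this
    linear_combination this
  have hj : ∀ a, δ (X (Sum.inl (Sum.inr (Sum.inl (0, a))))) = 0 := by
    intro a
    rw [← key a a, sub_self, zero_mul]
  have hB : ∀ a b, δ (X (Sum.inr (Sum.inl (b, a)))) = 0 := by
    intro a b
    by_cases hab : a = b
    · subst hab
      exact h (Sum.inr (Sum.inl a))
    · have h1 := key a b
      rw [hj] at h1
      exact (hs a b hab).mul_right_eq_zero.1 h1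
  refine hδ.eq_zero ?_ f
  rintro ((⟨c, d⟩ | ⟨α, a⟩ | e) | (⟨c, d⟩ | ⟨α, a⟩ | e))
  · exact hA' c d
  · fin_cases α
    · exact hj a
    · exact hj' a
  · exact h (Sum.inl (Sum.inr (Sum.inr e)))
  · exact hB d c
  · fin_cases α
    · exact hi a
    · exact hi' a
  · exact h (Sum.inr (Sum.inr (Sum.inr e)))

theorem symplecticPairing_sub_left {Q : Type} [Fintype Q] (δ δ' ε : MvPolynomial (Q ⊕ Q) ℂ →ₗ[ℂ] R) :
    symplecticPairing (δ - δ') ε = symplecticPairing δ ε - symplecticPairing δ' ε := by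
  simp only [symplecticPairing, LinearMap.sub_apply, ← Finset.sum_sub_distrib]
  exact Finset.sum_congr rfl fun _ _ => by ring

theorem symplecticPairing_gaugeField (Ψ : Coord k m →ₐ[ℂ] R) (ξ : Fin k → Fin k → R)
    {ε : Coord k m →ₗ[ℂ] R} (hε : IsDerivationAlong Ψ ε) (h : ∀ a b, ε (momentMap k m a b) = 0) :
    symplecticPairing (gaugeField Ψ ξ) ε = 0 := by
  have h1 : symplecticPairing (gaugeField Ψ ξ) ε = ∑ a, ∑ b, ξ a b *
      symplecticPairing (Ψ.toLinearMap ∘ₗ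
        (canonicalBracket (Pos k m) (momentMap k m a b) : _ →ₗ[ℂ] _)) ε := by
    simp only [symplecticPairing, gaugeField_apply, LinearMap.comp_apply, Derivation.coeFn_coe,
      AlgHom.toLinearMap_apply, Finset.sum_mul, ← Finset.sum_sub_distrib, Finset.mul_sum]
    rw [Finset.sum_comm]
    refine Finset.sum_congr rfl fun a _ => ?_
    rw [Finset.sum_comm]
    exact Finset.sum_congr rfl fun b _ => Finset.sum_congr rfl fun x _ => by ring
  rw [h1]
  refine Finset.sum_eq_zero fun a _ => Finset.sum_eq_zero fun b _ => ?_
  rw [symplecticPairing_hamiltonian Ψ hε, h, neg_zero, mul_zero]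

/-- Restriction to the slice is a Poisson map on invariant functions. For an invariant `f`, the
difference `δ` of the Hamiltonian vector field of `f|_slice` and the restriction of the Hamiltonian
vector field of `f` is tangent to the level set of the moment map and symplectically orthogonal to
the slice, so it is an infinitesimal gauge transformation and kills invariant functions. -/
theorem sliceHom_bracket (γ : PoissonBracket R) (hc : IsCanonical γ s) (hs : IsSeparated s)
    {f g : Coord k m} (hf : f ∈ invariants k m) (hg : g ∈ invariants k m) :
    γ (sliceHom τ s f) (sliceHom τ s g) = sliceHom τ s (canonicalBracket (Pos k m) f g) := by
  set Ψ := sliceHom τ s with hΨ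
  let E : Coord k m →ₗ[ℂ] R := (γ (Ψ f) : R →ₗ[ℂ] R) ∘ₗ Ψ.toLinearMap
  let D : Coord k m →ₗ[ℂ] R := Ψ.toLinearMap ∘ₗ (canonicalBracket (Pos k m) f : _ →ₗ[ℂ] _)
  let δ := E - D
  have hδ : IsDerivationAlong Ψ δ :=
    (isDerivationAlong_comp_left Ψ _).sub (isDerivationAlong_comp Ψ _)
  -- derivatives of the moment map in the directions of the slice
  have hconst : ∀ (d : Derivation ℂ R R) a b, d (Ψ (momentMap k m a b)) = 0 := by
    intro d a b
    rw [hΨ, sliceHom_momentMap τ hs]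
    split_ifs <;> simp
  have hδμ : ∀ a b, δ (momentMap k m a b) = 0 := by
    intro a b
    change γ (Ψ f) (Ψ (momentMap k m a b)) - Ψ (canonicalBracket (Pos k m) f (momentMap k m a b)) = 0
    rw [hconst, canonicalBracket_skew, moment_bracket_invariant k m a b f hf, neg_zero, map_zero,
      sub_zero]
  let w : SlicePos k m ⊕ SlicePos k m → (Coord k m →ₗ[ℂ] R) := fun y =>
    (γ (s y) : R →ₗ[ℂ] R) ∘ₗ Ψ.toLinearMap
  have hw : ∀ y, IsDerivationAlong Ψ (w y) := fun y => isDerivationAlong_comp_left Ψ _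
  have hE : ∀ y, symplecticPairing E (w y) = -w y f := by
    intro y
    change symplecticPairing E _ = -γ (s y) (Ψ f)
    have h1 := symplecticPairing_slice' τ (s := s) (γ (s y)) E ?_ ?_
    · refine h1.trans ?_
      change ∑ x, (γ (Ψ f) (sliceHom τ s (X (sliceIndex (Sum.inl x)))) * γ (s y) (s (Sum.inr x)) -
        γ (Ψ f) (sliceHom τ s (X (sliceIndex (Sum.inr x)))) * γ (s y) (s (Sum.inl x))) = _
      simp only [sliceHom_sliceIndex]
      rw [← hc.skew]
      rcases y with y | y
      · simp [hc.qq, hc.qp]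
      · simp [hc.pq, hc.pp]
    · intro a b hab
      change γ (Ψ f) (sliceHom τ s _) = 0
      rw [sliceHom_A, if_neg hab, map_zero]
    · intro a
      change γ (Ψ f) (sliceHom τ s _) = 0
      rw [sliceHom_i_zero, Derivation.map_one_eq_zero]
  have hδw : ∀ y, symplecticPairing δ (w y) = 0 := by
    intro y
    rw [symplecticPairing_sub_left, hE, symplecticPairing_hamiltonian Ψ (hw y), sub_self]
  -- the gauge transformation with the same effect on `i_1` and on `A` off the diagonal
  let ξ₀ : Fin k → Fin k → R := fun a b =>
    δ (X (Sum.inl (Sum.inl (b, a)))) * Ring.inverse (s (Sum.inl (Sum.inl b)) - s (Sum.inl (Sum.inl a)))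
  let ξ : Fin k → Fin k → R := fun a b => if a = b then
    -δ (X (Sum.inr (Sum.inr (Sum.inl (0, b))))) - ∑ c ∈ Finset.univ.erase b, ξ₀ c b else ξ₀ a b
  let δ' := δ - gaugeField Ψ ξ
  have hδ' : IsDerivationAlong Ψ δ' := hδ.sub (isDerivationAlong_gaugeField Ψ ξ)
  have hA : ∀ a b, a ≠ b → δ' (X (Sum.inl (Sum.inl (a, b)))) = 0 := by
    intro a b hab
    change δ _ - gaugeField Ψ ξ _ = 0
    rw [hΨ, gaugeField_A]
    have : ξ b a = ξ₀ b a := if_neg hab.symm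
    rw [this]
    have := Ring.mul_inverse_cancel _ (hs a b hab)
    change _ - _ * (δ (X (Sum.inl (Sum.inl (a, b)))) * _) = 0
    linear_combination -δ (X (Sum.inl (Sum.inl (a, b)))) * this
  have hi : ∀ a, δ' (X (Sum.inr (Sum.inr (Sum.inl (0, a))))) = 0 := by
    intro a
    change δ _ - gaugeField Ψ ξ _ = 0
    rw [hΨ, gaugeField_i_zero, ← Finset.add_sum_erase _ _ (Finset.mem_univ a)]
    have h1 : ∑ x ∈ Finset.univ.erase a, ξ x a = ∑ x ∈ Finset.univ.erase a, ξ₀ x a :=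
      Finset.sum_congr rfl fun x hx => if_neg (Finset.ne_of_mem_erase hx)
    have h2 : ξ a a = -δ (X (Sum.inr (Sum.inr (Sum.inl (0, a))))) -
      ∑ c ∈ Finset.univ.erase a, ξ₀ c a := if_pos rfl
    rw [h1, h2]
    ring
  have hδ'w : ∀ y, symplecticPairing δ' (w y) = 0 := by
    intro y
    rw [symplecticPairing_sub_left, hδw, symplecticPairing_gaugeField Ψ ξ (hw y) fun a b =>
      hconst _ a b, sub_zero]
  have hδ'μ : ∀ a b, δ' (momentMap k m a b) = 0 := by
    intro a b
    change δ _ - gaugeField Ψ ξ _ = 0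
    rw [hδμ, hΨ, gaugeField_momentMap τ hs, sub_zero]
  have hzero := hδ'.eq_zero_of_slice τ hs hδ'μ hA hi
    (eq_zero_of_symplecticPairing τ γ hc δ' hA hi hδ'w) g
  have hgauge : gaugeField Ψ ξ g = 0 := by
    rw [gaugeField_apply]
    refine Finset.sum_eq_zero fun a _ => Finset.sum_eq_zero fun b _ => ?_
    rw [moment_bracket_invariant k m a b g hg, map_zero, mul_zero]
  have h3 : γ (Ψ f) (Ψ g) - Ψ (canonicalBracket (Pos k m) f g) - gaugeField Ψ ξ g = 0 := hzero
  rwa [hgauge, sub_zero, sub_eq_zero] at h3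

end

/-! ### The coordinate ring embeds into functions on the slice -/

theorem exists_away_eq {A : Type} [CommRing A] (d : A) (x : Localization.Away d) :
    ∃ (n : ℕ) (a : A), x * algebraMap A _ (d ^ n) = algebraMap A _ a := by
  obtain ⟨⟨a, ⟨_, n, rfl⟩⟩, h⟩ := IsLocalization.surj (Submonoid.powers d) x
  exact ⟨n, a, h⟩

theorem isUnit_away_pow {A : Type} [CommRing A] (d : A) (n : ℕ) : IsUnit (algebraMap A (Localization.Away d) (d ^ n)) := by
  rw [map_pow]
  exact (IsLocalization.Away.algebraMap_isUnit d).pow n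

section

variable {A R : Type} [CommRing A] [Algebra ℂ A] [CommRing R] [Algebra ℂ R]

/-- The extension of a homomorphism to the localisation at an element with invertible image. -/
noncomputable def awayLift {d : A} (φ : A →ₐ[ℂ] R) (h : IsUnit (φ d)) :
    Localization.Away d →ₐ[ℂ] R :=
  IsLocalization.liftAlgHom (M := Submonoid.powers d) (f := φ) (by
    rintro ⟨_, n, rfl⟩
    rw [map_pow]
    exact h.pow n)

theorem awayLift_algebraMap {d : A} (φ : A →ₐ[ℂ] R) (h : IsUnit (φ d)) (x : A) :
    awayLift φ h (algebraMap A _ x) = φ x := by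
  rw [awayLift, IsLocalization.liftAlgHom_apply, IsLocalization.lift_eq]
  rfl

theorem awayLift_injective {d : A} (φ : A →ₐ[ℂ] R) (h : IsUnit (φ d))
    (hφ : Function.Injective φ) : Function.Injective (awayLift φ h) := by
  rw [injective_iff_map_eq_zero]
  intro x hx
  obtain ⟨n, a, ha⟩ := exists_away_eq d x
  have h1 := congrArg (awayLift φ h) ha
  rw [map_mul, hx, zero_mul, awayLift_algebraMap] at h1
  rw [hφ (h1.symm.trans (map_zero φ).symm), map_zero] at ha
  exact (isUnit_away_pow d n).mul_left_eq_zero.1 ha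

end

section

variable {k m : ℕ}

/-- The product of the differences of the eigenvalues, as a function on the slice. -/
noncomputable def sliceDisc (k m : ℕ) : MvPolynomial (SlicePos k m ⊕ SlicePos k m) ℂ :=
  ∏ x ∈ (Finset.univ : Finset (Fin k)).offDiag,
    (X (Sum.inl (Sum.inl x.1)) - X (Sum.inl (Sum.inl x.2)))

theorem isUnit_aeval_sliceDisc {R : Type} [CommRing R] [Algebra ℂ R]
    {s : SlicePos k m ⊕ SlicePos k m → R} : IsUnit (aeval s (sliceDisc k m)) ↔ IsSeparated s := by
  rw [sliceDisc, map_prod, IsUnit.prod_iff]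
  constructor
  · intro h a b hab
    have := h (a, b) (by simpa using hab)
    simpa using this
  · intro h x hx
    have := h x.1 x.2 (by simpa using hx)
    simpa using this

/-- The quadruple of matrices and the further coordinates `p` as a point of the ambient space. -/
def pointValue (p : Pos k m ⊕ Pos k m → ℂ) (A B : Matrix (Fin k) (Fin k) ℂ)
    (i : Matrix (Fin k) (Fin 2) ℂ) (j : Matrix (Fin 2) (Fin k) ℂ) : Pos k m ⊕ Pos k m → ℂ :=
  Sum.elim
    (Sum.elim (fun x => A x.1 x.2) (Sum.elim (fun x => j x.1 x.2)
      (fun e => p (Sum.inl (Sum.inr (Sum.inr e))))))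
    (Sum.elim (fun x => B x.2 x.1) (Sum.elim (fun x => i x.2 x.1)
      (fun e => p (Sum.inr (Sum.inr (Sum.inr e))))))

theorem continuous_pointValue (p : Pos k m ⊕ Pos k m → ℂ) :
    Continuous fun q : Matrix (Fin k) (Fin k) ℂ × Matrix (Fin k) (Fin k) ℂ ×
      Matrix (Fin k) (Fin 2) ℂ × Matrix (Fin 2) (Fin k) ℂ =>
      pointValue p q.1 q.2.1 q.2.2.1 q.2.2.2 := by
  refine continuous_pi fun v => ?_
  rcases v with (⟨c, d⟩ | ⟨α, a⟩ | e) | (⟨c, d⟩ | ⟨α, a⟩ | e)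
  · exact Continuous.matrix_elem continuous_fst c d
  · exact Continuous.matrix_elem (continuous_snd.comp (continuous_snd.comp continuous_snd)) α a
  · exact continuous_const
  · exact Continuous.matrix_elem (continuous_fst.comp continuous_snd) d c
  · exact Continuous.matrix_elem (continuous_fst.comp (continuous_snd.comp continuous_snd)) a α
  · exact continuous_const

theorem eval_pointValue_conj (p : Pos k m ⊕ Pos k m → ℂ) (g : GL (Fin k) ℂ)
    (A B : Matrix (Fin k) (Fin k) ℂ)
    (i : Matrix (Fin k) (Fin 2) ℂ) (j : Matrix (Fin 2) (Fin k) ℂ) (f : Coord k m) :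
    eval (pointValue p (g.1 * A * g⁻¹.1) (g.1 * B * g⁻¹.1) (g.1 * i) (j * g⁻¹.1)) f =
      eval (pointValue p A B i j) (act k m g f) := by
  have h : (aeval (pointValue p (g.1 * A * g⁻¹.1) (g.1 * B * g⁻¹.1) (g.1 * i) (j * g⁻¹.1)) :
      Coord k m →ₐ[ℂ] ℂ) = (aeval (pointValue p A B i j)).comp (act k m g) := by
    apply MvPolynomial.algHom_ext
    rintro ((⟨c, d⟩ | ⟨α, a⟩ | e) | (⟨c, d⟩ | ⟨α, a⟩ | e)) <;>
    simp [act, substitution, pointValue, Matrix.mul_apply, constMat, matA, matB, mati, matj]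
  have := DFunLike.congr_fun h f
  simpa [aeval_eq_eval] using this

theorem isModuliPoint_iff (τ : ℂ) (p : Pos k m ⊕ Pos k m → ℂ) (A B : Matrix (Fin k) (Fin k) ℂ)
    (i : Matrix (Fin k) (Fin 2) ℂ) (j : Matrix (Fin 2) (Fin k) ℂ) :
    IsModuliPoint τ A B i j ↔ ∀ f ∈ momentIdeal k m τ, eval (pointValue p A B i j) f = 0 := by
  have h1 : ∀ a b, eval (pointValue p A B i j) (momentMap k m a b - if a = b then C τ else 0) =
      (A * B - B * A - i * j - τ • (1 : Matrix (Fin k) (Fin k) ℂ)) a b := by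
    intro a b
    rw [moment_entry]
    by_cases hab : a = b <;> simp [pointValue, Matrix.mul_apply, hab]
  constructor
  · intro h f hf
    have : momentIdeal k m τ ≤ RingHom.ker (eval (pointValue p A B i j)) := by
      rw [momentIdeal, Ideal.span_le]
      rintro _ ⟨⟨a, b⟩, rfl⟩
      rw [SetLike.mem_coe, RingHom.mem_ker, h1, show A * B - B * A - i * j = _ from h, sub_self,
        Matrix.zero_apply]
    exact this hf
  · intro h
    rw [IsModuliPoint, ← sub_eq_zero]
    ext a b
    rw [← h1]
    exact h _ (Ideal.subset_span ⟨(a, b), rfl⟩)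

/-- An invariant function that vanishes on the generic point of the slice vanishes on the whole
variety `[A, B] - i j = τ · 1`. -/
theorem mem_radical_of_sliceHom_eq_zero (τ : ℂ) {R : Type} [CommRing R] [Algebra ℂ R]
    {s : SlicePos k m ⊕ SlicePos k m → R} (hs : IsSeparated s) (hind : AlgebraicIndependent ℂ s)
    {f : Coord k m} (hf : f ∈ invariants k m) (h0 : sliceHom τ s f = 0) :
    f ∈ (momentIdeal k m τ).radical := by
  -- the universal slice
  let s₀ : SlicePos k m ⊕ SlicePos k m → Localization.Away (sliceDisc k m) := fun x =>
    algebraMap (MvPolynomial (SlicePos k m ⊕ SlicePos k m) ℂ) _ (X x)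
  have hs₀ : IsSeparated s₀ := by
    rw [← isUnit_aeval_sliceDisc]
    have : aeval s₀ = IsScalarTower.toAlgHom ℂ (MvPolynomial (SlicePos k m ⊕ SlicePos k m) ℂ)
        (Localization.Away (sliceDisc k m)) := by
      apply MvPolynomial.algHom_ext
      intro x
      simp [s₀]
    rw [this]
    exact IsLocalization.Away.algebraMap_isUnit _
  have hlift : ∀ {R' : Type} [CommRing R'] [Algebra ℂ R'] {s' : SlicePos k m ⊕ SlicePos k m → R'}
      (hs' : IsSeparated s'), awayLift (aeval s') (isUnit_aeval_sliceDisc.2 hs') ∘ s₀ = s' := by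
    intro R' _ _ s' hs'
    funext x
    rw [Function.comp, awayLift_algebraMap, aeval_X]
  have h1 : sliceHom τ s₀ f = 0 := by
    apply awayLift_injective _ (isUnit_aeval_sliceDisc.2 hs) hind
    rw [sliceHom_comp τ _ hs₀, hlift hs, h0, map_zero]
  have h2 : ∀ s' : SlicePos k m ⊕ SlicePos k m → ℂ, IsSeparated s' → sliceHom τ s' f = 0 := by
    intro s' hs'
    rw [← hlift hs', ← sliceHom_comp τ _ hs₀, h1, map_zero]
  rw [← vanishingIdeal_zeroLocus_eq_radical (K := ℂ), mem_vanishingIdeal_iff]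
  intro p hp
  let F := fun A B i j => eval (pointValue p A B i j) f
  have hF : VanishesOnSlice τ F := by
    refine ⟨(MvPolynomial.continuous_eval f).comp (continuous_pointValue p), fun g A B i j => ?_,
      fun l B i j hl hi h => ?_⟩
    · change eval _ f = eval _ f
      rw [eval_pointValue_conj, hf g]
    · let s' : SlicePos k m ⊕ SlicePos k m → ℂ := Sum.elim
        (Sum.elim l (Sum.elim (j 1) fun e => p (Sum.inl (Sum.inr (Sum.inr e)))))
        (Sum.elim (fun a => B a a) (Sum.elim (fun a => i a 1)
          fun e => p (Sum.inr (Sum.inr (Sum.inr e)))))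
      have hne : ∀ a b, a ≠ b → l a - l b ≠ 0 := fun a b hab => sub_ne_zero.2 (hl.ne hab)
      have hs' : IsSeparated s' := fun a b hab => (hne a b hab).isUnit
      have hent : ∀ a b, l a * B a b - B a b * l b - (j 0 b + i a 1 * j 1 b) =
          if a = b then τ else 0 := by
        intro a b
        have := congrFun (congrFun h a) b
        rw [Matrix.sub_apply, Matrix.sub_apply, Matrix.diagonal_mul, Matrix.mul_diagonal,
          Matrix.mul_apply, Fin.sum_univ_two, hi] at this
        simpa [Matrix.one_apply] using this
      have hj : ∀ a, j 0 a = -τ - i a 1 * j 1 a := by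
        intro a
        have := hent a a
        rw [if_pos rfl] at this
        linear_combination -this
      have h3 : sliceValue τ s' = pointValue p (Matrix.diagonal l) B i j := by
        funext v
        rcases v with (⟨c, d⟩ | ⟨α, a⟩ | e) | (⟨c, d⟩ | ⟨α, a⟩ | e)
        · simp [sliceValue, pointValue, s', Matrix.diagonal_apply]
        · fin_cases α
          · simp [sliceValue, pointValue, s', hj]
          · simp [sliceValue, pointValue, s']
        · simp [sliceValue, pointValue, s']
        · by_cases hcd : c = d
          · simp [sliceValue, pointValue, s', hcd]
          · have h4 := hent d c
            have h5 := hne d c (Ne.symm hcd)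
            rw [if_neg (Ne.symm hcd), hj] at h4
            simp only [sliceValue, pointValue, s', hcd, Sum.elim_inl, Sum.elim_inr, if_false,
              Ring.inverse_eq_inv', Algebra.algebraMap_self_apply]
            field_simp
            linear_combination -h4
        · fin_cases α
          · simp [sliceValue, pointValue, s', hi]
          · simp [sliceValue, pointValue, s']
        · simp [sliceValue, pointValue, s']
      have h4 := h2 s' hs'
      rw [sliceHom, h3] at h4
      exact h4
  let A : Matrix (Fin k) (Fin k) ℂ := Matrix.of fun a b => p (Sum.inl (Sum.inl (a, b)))
  let B : Matrix (Fin k) (Fin k) ℂ := Matrix.of fun a b => p (Sum.inr (Sum.inl (b, a)))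
  let i : Matrix (Fin k) (Fin 2) ℂ := Matrix.of fun a α => p (Sum.inr (Sum.inr (Sum.inl (α, a))))
  let j : Matrix (Fin 2) (Fin k) ℂ := Matrix.of fun α a => p (Sum.inl (Sum.inr (Sum.inl (α, a))))
  have hpp : pointValue p A B i j = p := by
    funext v
    rcases v with (⟨c, d⟩ | ⟨α, a⟩ | e) | (⟨c, d⟩ | ⟨α, a⟩ | e) <;> rfl
  have hm : IsModuliPoint τ A B i j := by
    rw [isModuliPoint_iff τ p, hpp]
    exact hp
  have := hF.eq_zero hm
  change eval _ f = 0 at this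
  rwa [hpp] at this

/-- The restriction of functions on `N_{k,τ} × (T^* ℂ)^m` to the slice. -/
noncomputable def sliceRestrict (τ : ℂ) {R : Type} [CommRing R] [Algebra ℂ R] [IsReduced R]
    {s : SlicePos k m ⊕ SlicePos k m → R} (hs : IsSeparated s) : InstantonAlgebra k m τ →ₐ[ℂ] R :=
  Ideal.Quotient.liftₐ (reducedIdeal k m τ) ((sliceHom τ s).comp (invariants k m).val) (by
    rintro f ⟨n, hn⟩
    have h1 := sliceHom_momentIdeal τ hs hn
    rw [RingHom.mem_ker, map_pow] at h1
    exact eq_zero_of_pow_eq_zero h1)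

theorem toInstanton_surjective (τ : ℂ) : Function.Surjective (toInstanton k m τ) :=
  Ideal.Quotient.mk_surjective

section

variable (τ : ℂ) {R : Type} [CommRing R] [Algebra ℂ R] [IsReduced R]
  {s : SlicePos k m ⊕ SlicePos k m → R} (hs : IsSeparated s)

theorem sliceRestrict_toInstanton (f : invariants k m) :
    sliceRestrict τ hs (toInstanton k m τ f) = sliceHom τ s f := rfl

theorem sliceRestrict_injective (hind : AlgebraicIndependent ℂ s) :
    Function.Injective (sliceRestrict τ hs) := by
  rw [injective_iff_map_eq_zero]
  intro x hx
  obtain ⟨f, rfl⟩ := toInstanton_surjective τ x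
  exact Ideal.Quotient.eq_zero_iff_mem.2 (mem_radical_of_sliceHom_eq_zero τ hs hind f.2 hx)

theorem sliceRestrict_bracket (γ : PoissonBracket R) (hc : IsCanonical γ s)
    (x y : InstantonAlgebra k m τ) :
    γ (sliceRestrict τ hs x) (sliceRestrict τ hs y) =
      sliceRestrict τ hs (instantonBracket k m τ x y) := by
  obtain ⟨f, rfl⟩ := toInstanton_surjective τ x
  obtain ⟨g, rfl⟩ := toInstanton_surjective τ y
  rw [instantonBracket_mk, sliceRestrict_toInstanton, sliceRestrict_toInstanton,
    sliceRestrict_toInstanton, sliceHom_bracket τ γ hc hs f.2 g.2]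

end

end

/-! ### Brackets of the Hamiltonians -/

section

variable {R : Type} [CommRing R] [Algebra ℂ R]

theorem eq_C_of_pderiv_eq_zero {σ : Type} {p : MvPolynomial σ ℂ} (h : ∀ i, pderiv i p = 0) :
    p = C (coeff 0 p) := by
  classical
  ext m
  rw [coeff_C]
  split_ifs with hm
  · rw [hm]
  · obtain ⟨i, hi⟩ := Finsupp.ne_iff.1 (Ne.symm hm)
    have h1 : m - Finsupp.single i 1 + Finsupp.single i 1 = m :=
      tsub_add_cancel_of_le (Finsupp.single_le_iff.2 (Nat.one_le_iff_ne_zero.2 hi))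
    have h2 := coeff_pderiv (i := i) p (m - Finsupp.single i 1)
    rw [h, coeff_zero, h1] at h2
    exact (mul_eq_zero.1 h2.symm).resolve_right (Nat.cast_add_one_ne_zero _)

theorem totalDegree_pderiv_le {σ : Type} {p : MvPolynomial σ ℂ} {n : ℕ}
    (h : p.totalDegree ≤ n + 1) (i : σ) : (pderiv i p).totalDegree ≤ n := by
  refine Finset.sup_le fun m hm => ?_
  rw [mem_support_iff, coeff_pderiv] at hm
  have h1 := (le_totalDegree (mem_support_iff.2 (left_ne_zero_of_mul hm))).trans h
  rw [Finsupp.sum_add_index' (fun _ => rfl) (fun _ _ _ => rfl),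
    Finsupp.sum_single_index rfl] at h1
  omega

theorem derivation_aeval {σ : Type} [Fintype σ] (D : Derivation ℂ R R) (x : σ → R)
    (p : MvPolynomial σ ℂ) : D (aeval x p) = ∑ i, aeval x (pderiv i p) * D (x i) := by
  have := (isDerivationAlong_comp_left (aeval x) D).chain_rule p
  simpa using this

/-- The Jacobian criterion, with the Jacobian formed by Poisson brackets. -/
theorem algebraicIndependent_of_det [IsDomain R] {σ : Type} [Fintype σ] [DecidableEq σ]
    (γ : PoissonBracket R) (x y : σ → R) (h : (Matrix.of fun a b => γ (x a) (y b)).det ≠ 0)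
    (hγ : ∀ f g, γ f g = -γ g f) : AlgebraicIndependent ℂ x := by
  rw [algebraicIndependent_iff]
  have key : ∀ (n : ℕ) (p : MvPolynomial σ ℂ), p.totalDegree ≤ n → aeval x p = 0 → p = 0 := by
    have hconst : ∀ p : MvPolynomial σ ℂ, aeval x p = 0 → (∀ i, pderiv i p = 0) → p = 0 := by
      intro p hp h0
      have h1 := eq_C_of_pderiv_eq_zero h0
      rw [h1, ← MvPolynomial.algebraMap_eq, AlgHom.commutes] at hp
      rw [h1, (FaithfulSMul.algebraMap_eq_zero_iff ℂ R).1 hp, map_zero]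
    intro n
    induction n with
    | zero =>
      intro p hd hp
      refine hconst p hp fun i => ?_
      rw [totalDegree_eq_zero_iff_eq_C.1 (Nat.le_zero.1 hd), pderiv_C]
    | succ n ih =>
      intro p hd hp
      refine hconst p hp fun i => ih _ (totalDegree_pderiv_le hd i) ?_
      have h1 : Matrix.vecMul (fun i => aeval x (pderiv i p)) (Matrix.of fun a b => γ (x a) (y b)) =
          0 := by
        funext b
        have h2 := derivation_aeval (γ (y b)) x p
        rw [hp, map_zero] at h2
        rw [Matrix.vecMul, dotProduct, Pi.zero_apply, ← neg_eq_zero, ← Finset.sum_neg_distrib, h2]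
        refine Finset.sum_congr rfl fun a _ => ?_
        rw [Matrix.of_apply, hγ (x a)]
        ring
      exact congrFun (Matrix.eq_zero_of_vecMul_eq_zero h h1) i
  exact fun p => key _ p le_rfl

/-- Canonical commutation relations imply algebraic independence. -/
theorem IsCanonical.algebraicIndependent [IsDomain R] {Q : Type} [Fintype Q] [DecidableEq Q]
    {γ : PoissonBracket R} {s : Q ⊕ Q → R} (h : IsCanonical γ s) : AlgebraicIndependent ℂ s := by
  refine algebraicIndependent_of_det γ s (s ∘ Sum.swap) ?_ h.skew
  have : (Matrix.of fun a b => γ (s a) ((s ∘ Sum.swap) b)) =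
      Matrix.fromBlocks (1 : Matrix Q Q R) 0 0 (-1 : Matrix Q Q R) := by
    ext a b
    rcases a with a | a <;> rcases b with b | b
    · simp [h.qp, Matrix.one_apply]
    · simp [h.qq]
    · simp [h.pp]
    · simp only [Matrix.of_apply, Function.comp, Sum.swap_inr, h.pq, Matrix.fromBlocks_apply₂₂,
        Matrix.neg_apply, Matrix.one_apply]
      split_ifs <;> simp
  rw [this, Matrix.det_fromBlocks_zero₁₂, Matrix.det_one, one_mul, Matrix.det_neg, Matrix.det_one,
    mul_one]
  exact pow_ne_zero _ (neg_ne_zero.2 one_ne_zero)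

theorem derivation_trace {n : Type} [Fintype n] (D : Derivation ℂ R R) (M : Matrix n n R) :
    D M.trace = (M.map D).trace := by
  simp [Matrix.trace]

variable {n : Type} [Fintype n] [DecidableEq n]

theorem derivation_matrix_pow (D : Derivation ℂ R R) {M : Matrix n n R} (h : M.map D = 0) (i : ℕ) :
    (M ^ i).map D = 0 := by
  induction i with
  | zero =>
    ext a b
    rw [pow_zero, Matrix.map_apply, Matrix.one_apply]
    split_ifs <;> simp
  | succ i ih => rw [pow_succ, derivation_matrix_mul, ih, h, Matrix.zero_mul, Matrix.mul_zero, add_zero]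

theorem derivation_trace_pow (D : Derivation ℂ R R) (M : Matrix n n R) (i : ℕ) :
    D (M ^ (i + 1)).trace = (i + 1) * (M ^ i * M.map D).trace := by
  have key : ∀ i j : ℕ, ((M ^ (i + 1)).map D * M ^ j).trace =
      (i + 1) * (M ^ (i + j) * M.map D).trace := by
    intro i
    induction i with
    | zero =>
      intro j
      rw [zero_add, pow_one, Matrix.trace_mul_comm, zero_add]
      simp
    | succ i ih =>
      intro j
      rw [pow_succ, derivation_matrix_mul, add_mul, Matrix.trace_add, mul_assoc, ← pow_succ', ih,
        Matrix.trace_mul_comm (M ^ (i + 1) * M.map D), ← mul_assoc, ← pow_add]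
      rw [show i + (j + 1) = i + 1 + j by ring, show j + (i + 1) = i + 1 + j by ring]
      push_cast
      ring
  rw [derivation_trace]
  simpa using key i 0

theorem trace_bracket (γ : PoissonBracket R) (hγ : ∀ f g, γ f g = -γ g f) (M : Matrix n n R) (i : ℕ)
    (g : R) : γ (M ^ (i + 1)).trace g =
      (i + 1) * (M ^ i * Matrix.of fun x y => γ (M x y) g).trace := by
  have : (Matrix.of fun x y => γ (M x y) g) = -M.map (γ g) := by
    ext x y
    simp [hγ (M x y) g]
  rw [hγ, derivation_trace_pow, this, Matrix.mul_neg, Matrix.trace_neg]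
  ring

end

section

variable (k m : ℕ)

theorem map_act_matA (g : GL (Fin k) ℂ) : (matA k m).map (act k m g) =
    constMat k m g.1 * matA k m * constMat k m g⁻¹.1 := by
  ext a b : 1
  simp [act, substitution, matA]

theorem map_act_matB (g : GL (Fin k) ℂ) : (matB k m).map (act k m g) =
    constMat k m g.1 * matB k m * constMat k m g⁻¹.1 := by
  ext a b : 1
  simp [act, substitution, matB]

theorem map_act_mati (g : GL (Fin k) ℂ) : (mati k m).map (act k m g) =
    constMat k m g.1 * mati k m := by
  ext a b : 1
  simp [act, substitution, mati]

theorem map_act_matj (g : GL (Fin k) ℂ) : (matj k m).map (act k m g) =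
    matj k m * constMat k m g⁻¹.1 := by
  ext a b : 1
  simp [act, substitution, matj]

theorem constMat_inv_mul (g : GL (Fin k) ℂ) : constMat k m g⁻¹.1 * constMat k m g.1 = 1 := by
  rw [constMat_mul, ← Units.val_mul, inv_mul_cancel, Units.val_one, constMat_one]

theorem map_act_matA_pow (g : GL (Fin k) ℂ) (n : ℕ) : (matA k m ^ n).map (act k m g) =
    constMat k m g.1 * matA k m ^ n * constMat k m g⁻¹.1 := by
  have h1 : constMat k m g.1 * constMat k m g⁻¹.1 = 1 := mul_eq_one_comm.1 (constMat_inv_mul k m g)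
  induction n with
  | zero => rw [pow_zero, mul_one, h1, Matrix.map_one _ (map_zero _) (map_one _)]
  | succ n ih =>
    rw [pow_succ, Matrix.map_mul, ih, map_act_matA]
    calc _ = constMat k m g.1 * matA k m ^ n * (constMat k m g⁻¹.1 * constMat k m g.1) * matA k m *
          constMat k m g⁻¹.1 := by simp only [mul_assoc]
      _ = _ := by rw [constMat_inv_mul, mul_one, mul_assoc (constMat k m g.1)]

/-- The function `tr A ^ n B`. -/
noncomputable def traceAB (n : ℕ) : invariants k m :=
  ⟨(matA k m ^ n * matB k m).trace, fun g => by
    have h : act k m g (matA k m ^ n * matB k m).trace =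
        ((matA k m ^ n * matB k m).map (act k m g)).trace :=
      AddMonoidHom.map_trace (act k m g : Coord k m →+ Coord k m) _
    rw [h, Matrix.map_mul, map_act_matA_pow, map_act_matB]
    calc _ = (constMat k m g.1 * matA k m ^ n * (constMat k m g⁻¹.1 * constMat k m g.1) * matB k m *
          constMat k m g⁻¹.1).trace := by simp only [mul_assoc]
      _ = _ := by rw [constMat_inv_mul, mul_one, Matrix.trace_mul_comm, mul_assoc (constMat k m g.1),
                    ← mul_assoc, constMat_inv_mul, one_mul]⟩

/-- The function `j_α A ^ n i_β`. -/
noncomputable def covariant (α β : Fin 2) (n : ℕ) : invariants k m :=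
  ⟨(matj k m * matA k m ^ n * mati k m) α β, fun g => by
    refine congrFun (congrFun (?_ : (matj k m * matA k m ^ n * mati k m).map (act k m g) =
      matj k m * matA k m ^ n * mati k m) α) β
    rw [Matrix.map_mul, Matrix.map_mul, map_act_matA_pow, map_act_matj, map_act_mati]
    calc _ = matj k m * (constMat k m g⁻¹.1 * constMat k m g.1) * matA k m ^ n *
          (constMat k m g⁻¹.1 * constMat k m g.1) * mati k m := by simp only [Matrix.mul_assoc]
      _ = _ := by rw [constMat_inv_mul, Matrix.mul_one, Matrix.mul_one]⟩

/-- The coordinates of `(T^* ℂ)^m`. -/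
noncomputable def freeCoord (e : Fin m ⊕ Fin m) : invariants k m :=
  ⟨X (Sum.map (fun e => Sum.inr (Sum.inr e)) (fun e => Sum.inr (Sum.inr e)) e), fun g => by
    rcases e with e | e <;> simp [act, substitution]⟩

/-- The function `tr A ^ n`. -/
noncomputable def traceInv (n : ℕ) : invariants k m :=
  ⟨(matA k m ^ n).trace, fun g =>
    trace_pow_map _ (act k m g : Coord k m →+* Coord k m) (matA_act k m g) n⟩

/-- The function `tr Â ^ n`. -/
noncomputable def traceHatInv (n : ℕ) : invariants k m :=
  ⟨(hatA k m ^ n).trace, fun g =>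
    trace_pow_map _ (act k m g : Coord k m →+* Coord k m) (hatA_act k m g) n⟩

variable {k m}

theorem hatA_bracket_hatA (x y z w : Fin k ⊕ Unit) :
    canonicalBracket (Pos k m) (hatA k m x y) (hatA k m z w) = 0 := by
  rcases x with x | x <;> rcases y with y | y <;> rcases z with z | z <;> rcases w with w | w <;>
  simp only [hatA, matA, mati, matj, corner, bracket_sum_left, Matrix.of_apply,
    Matrix.fromBlocks_apply₁₁, Matrix.fromBlocks_apply₁₂, Matrix.fromBlocks_apply₂₁,
    Matrix.fromBlocks_apply₂₂] <;>
  simp [canonical_qq, canonical_pp, canonical_qp,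
    canonical_pq]

theorem hatA_bracket_matA (x y : Fin k ⊕ Unit) (z w : Fin k) :
    canonicalBracket (Pos k m) (hatA k m x y) (matA k m z w) = 0 :=
  hatA_bracket_hatA x y (Sum.inl z) (Sum.inl w)

theorem hatA_bracket_traceHat (x y : Fin k ⊕ Unit) (n : ℕ) :
    canonicalBracket (Pos k m) (hatA k m x y) (hatA k m ^ n).trace = 0 := by
  rw [derivation_trace, derivation_matrix_pow, Matrix.trace_zero]
  ext z w : 1
  exact hatA_bracket_hatA x y z w

theorem hatA_bracket_traceA (x y : Fin k ⊕ Unit) (n : ℕ) :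
    canonicalBracket (Pos k m) (hatA k m x y) (matA k m ^ n).trace = 0 := by
  rw [derivation_trace, derivation_matrix_pow, Matrix.trace_zero]
  ext z w : 1
  exact hatA_bracket_matA x y z w

theorem traceHat_bracket_eq_zero {g : Coord k m}
    (h : ∀ x y, canonicalBracket (Pos k m) (hatA k m x y) g = 0) (n : ℕ) :
    canonicalBracket (Pos k m) (hatA k m ^ n).trace g = 0 := by
  rw [canonicalBracket_skew, derivation_trace, derivation_matrix_pow, Matrix.trace_zero, neg_zero]
  ext z w : 1
  rw [Matrix.map_apply, canonicalBracket_skew, h, neg_zero, Matrix.zero_apply]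

theorem traceA_bracket_eq_zero {g : Coord k m}
    (h : ∀ x y, canonicalBracket (Pos k m) (matA k m x y) g = 0) (n : ℕ) :
    canonicalBracket (Pos k m) (matA k m ^ n).trace g = 0 := by
  rw [canonicalBracket_skew, derivation_trace, derivation_matrix_pow, Matrix.trace_zero, neg_zero]
  ext z w : 1
  rw [Matrix.map_apply, canonicalBracket_skew, h, neg_zero, Matrix.zero_apply]

/-- The functions `tr A ^ i` and `tr Â ^ j` Poisson commute. -/
theorem hamiltonian_bracket (τ : ℂ) (a b : Fin k ⊕ Fin (k + 1)) :
    instantonBracket k m τ (hamiltonian k m τ a) (hamiltonian k m τ b) = 0 := by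
  have hA : ∀ (f : invariants k m),
      (∀ x y, canonicalBracket (Pos k m) (hatA k m x y) f.1 = 0) → ∀ c,
      instantonBracket k m τ (hamiltonian k m τ c) (toInstanton k m τ f) = 0 := by
    rintro f hf (c | c)
    · refine (instantonBracket_mk k m τ _ _).trans ?_
      rw [← map_zero (toInstanton k m τ)]
      congr 1
      exact Subtype.ext (traceA_bracket_eq_zero (fun x y => hf (Sum.inl x) (Sum.inl y)) _)
    · refine (instantonBracket_mk k m τ _ _).trans ?_
      rw [← map_zero (toInstanton k m τ)]
      congr 1
      exact Subtype.ext (traceHat_bracket_eq_zero hf _)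
  rcases b with b | b
  · exact hA (traceInv k m _) (fun x y => hatA_bracket_traceA x y _) a
  · exact hA (traceHatInv k m _) (fun x y => hatA_bracket_traceHat x y _) a

theorem canonicalBracket_traceAB (v : Pos k m ⊕ Pos k m)
    (h : ∀ a b, canonicalBracket (Pos k m) (X v) (matA k m a b) = 0) (n : ℕ) :
    canonicalBracket (Pos k m) (X v) (traceAB k m n).1 =
      (matA k m ^ n * (matB k m).map (canonicalBracket (Pos k m) (X v))).trace := by
  have h0 : (matA k m).map (canonicalBracket (Pos k m) (X v)) = 0 := by
    ext a b : 1
    exact h a b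
  rw [traceAB, derivation_trace, derivation_matrix_mul, derivation_matrix_pow _ h0,
    Matrix.zero_mul, zero_add]

theorem matA_bracket_traceAB (a b : Fin k) (n : ℕ) :
    canonicalBracket (Pos k m) (matA k m a b) (traceAB k m n).1 = (matA k m ^ n) a b := by
  have h0 : (matB k m).map (canonicalBracket (Pos k m) (X (Sum.inl (Sum.inl (a, b))))) =
      Matrix.single b a 1 := by
    ext c d : 1
    simp [matB, canonical_qp, Matrix.single_apply, and_comm]
  refine (canonicalBracket_traceAB _ (fun c d => by simp [matA, canonical_qq]) n).trans ?_
  rw [h0, Matrix.trace_mul_single]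
  simp

theorem canonicalBracket_covariant (v : Pos k m ⊕ Pos k m)
    (h : ∀ a b, canonicalBracket (Pos k m) (X v) (matA k m a b) = 0) (α β : Fin 2) (n : ℕ) :
    canonicalBracket (Pos k m) (X v) (covariant k m α β n).1 =
      ((matj k m).map (canonicalBracket (Pos k m) (X v)) * matA k m ^ n * mati k m +
        matj k m * matA k m ^ n * (mati k m).map (canonicalBracket (Pos k m) (X v))) α β := by
  have h0 : (matA k m).map (canonicalBracket (Pos k m) (X v)) = 0 := by
    ext a b : 1
    exact h a b
  rw [covariant, ← Matrix.map_apply (f := canonicalBracket (Pos k m) (X v)), derivation_matrix_mul,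
    derivation_matrix_mul, derivation_matrix_pow _ h0, Matrix.mul_zero, add_zero]

theorem matA_bracket_covariant (a b : Fin k) (α β : Fin 2) (n : ℕ) :
    canonicalBracket (Pos k m) (matA k m a b) (covariant k m α β n).1 = 0 := by
  refine (canonicalBracket_covariant _ (fun c d => by simp [matA, canonical_qq]) α β n).trans ?_
  have h1 : (matj k m).map (canonicalBracket (Pos k m) (X (Sum.inl (Sum.inl (a, b))))) = 0 := by
    ext c d : 1
    simp [matj, canonical_qq]
  have h2 : (mati k m).map (canonicalBracket (Pos k m) (X (Sum.inl (Sum.inl (a, b))))) = 0 := by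
    ext c d : 1
    simp [mati, canonical_qp]
  rw [h1, h2]
  simp

theorem hatA_bracket_covariant (n : ℕ) :
    (Matrix.of fun x y => canonicalBracket (Pos k m) (hatA k m x y) (covariant k m 1 1 n).1) =
      Matrix.fromBlocks 0 0 (Matrix.of fun _ a => (matj k m * matA k m ^ n) 1 a) 0 := by
  ext x y : 1
  rcases x with x | x <;> rcases y with y | y
  · exact matA_bracket_covariant x y 1 1 n
  · refine (canonicalBracket_covariant _ (fun c d => by simp [matA, canonical_pq]) 1 1 n).trans ?_
    have h2 : (mati k m).map
        (canonicalBracket (Pos k m) (X (Sum.inr (Sum.inr (Sum.inl (0, x)))))) = 0 := by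
      ext c d : 1
      simp [mati, canonical_pp]
    rw [h2, Matrix.mul_zero, add_zero, Matrix.mul_assoc, Matrix.mul_apply]
    simp [matj, canonical_pq]
  · refine (canonicalBracket_covariant _ (fun c d => by simp [matA, canonical_qq]) 1 1 n).trans ?_
    have h1 : (matj k m).map
        (canonicalBracket (Pos k m) (X (Sum.inl (Sum.inr (Sum.inl (1, y)))))) = 0 := by
      ext c d : 1
      simp [matj, canonical_qq]
    have h2 : (mati k m).map
        (canonicalBracket (Pos k m) (X (Sum.inl (Sum.inr (Sum.inl (1, y)))))) =
        Matrix.single y 1 1 := by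
      ext c d : 1
      simp [mati, canonical_qp, Matrix.single_apply, and_comm]
    rw [h1, h2, Matrix.zero_mul, Matrix.zero_mul, zero_add, Matrix.mul_single_apply_same]
    simp
  · simp only [hatA, Matrix.of_apply, Matrix.fromBlocks_apply₂₂, corner, bracket_sum_left,
      Matrix.zero_apply]
    refine Finset.sum_eq_zero fun e _ => ?_
    refine (canonicalBracket_covariant _ (fun c d => by simp [matA, canonical_qq]) 1 1 n).trans ?_
    have h1 : (matj k m).map (canonicalBracket (Pos k m) (X (Sum.inl (Sum.inr (Sum.inr e))))) = 0 := by
      ext c d : 1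
      simp [matj, canonical_qq]
    have h2 : (mati k m).map (canonicalBracket (Pos k m) (X (Sum.inl (Sum.inr (Sum.inr e))))) = 0 := by
      ext c d : 1
      simp [mati, canonical_qp]
    rw [h1, h2]
    simp

theorem hatA_bracket_freeCoord (e : Fin m) :
    (Matrix.of fun x y => canonicalBracket (Pos k m) (hatA k m x y)
      (freeCoord k m (Sum.inr e)).1) =
      Matrix.fromBlocks 0 0 0 1 := by
  ext x y : 1
  rcases x with x | x <;> rcases y with y | y <;>
  simp only [hatA, matA, mati, matj, corner, freeCoord, bracket_sum_left, Matrix.of_apply,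
    Matrix.fromBlocks_apply₁₁, Matrix.fromBlocks_apply₁₂, Matrix.fromBlocks_apply₂₁,
    Matrix.fromBlocks_apply₂₂] <;>
  simp [canonical_pp, canonical_qp]

end

/-! ### The determinant of the brackets of the Hamiltonians on the slice -/

section

variable {k : ℕ} {R : Type} [CommRing R]

/-- The vectors `Â ^ n e_0`, for the last basis vector `e_0`, are obtained from the vectors
`A ^ n i_1` by a unitriangular change of basis. -/
theorem det_bordered_krylov (M : Matrix (Fin k) (Fin k) R) (w r : Fin k → R) (c : R)
    (B : Matrix (Fin k ⊕ Unit) (Fin k ⊕ Unit) R)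
    (hB : B = Matrix.fromBlocks M (Matrix.of fun a _ => w a) (Matrix.of fun _ a => r a)
      (Matrix.of fun _ _ => c)) :
    (Matrix.of fun (a : Fin k) (n : Fin k) => (B ^ (n + 1 : ℕ)) (Sum.inl a) (Sum.inr ())).det =
      (krylov M w).det := by
  let q : ℕ → R := fun n => (B ^ n) (Sum.inr ()) (Sum.inr ())
  have hrec : ∀ n a, (B ^ (n + 1)) (Sum.inl a) (Sum.inr ()) =
      (M.mulVec fun b => (B ^ n) (Sum.inl b) (Sum.inr ())) a + q n * w a := by
    intro n a
    have h1 : ∀ b, B (Sum.inl a) (Sum.inl b) = M a b := fun b => by rw [hB]; rfl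
    have h2 : B (Sum.inl a) (Sum.inr ()) = w a := by rw [hB]; rfl
    rw [pow_succ', Matrix.mul_apply, Fintype.sum_sum_type]
    simp only [h1, Finset.univ_unique, Finset.sum_singleton]
    rw [mul_comm (q n), ← h2]
    rfl
  have hsum : ∀ n, (fun a => (B ^ (n + 1)) (Sum.inl a) (Sum.inr ())) =
      ∑ l ∈ Finset.range (n + 1), q (n - l) • (M ^ l).mulVec w := by
    intro n
    induction n with
    | zero =>
      funext a
      rw [hrec]
      have : (fun b => (B ^ 0) (Sum.inl b) (Sum.inr ())) = 0 := by
        funext b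
        simp
      rw [this]
      simp
    | succ n ih =>
      funext a
      rw [hrec, ih, Matrix.mulVec_sum, Finset.sum_range_succ' _ (n + 1)]
      simp only [Matrix.mulVec_smul, Matrix.mulVec_mulVec, ← pow_succ', Nat.add_sub_add_right,
        Nat.sub_zero, pow_zero, Matrix.one_mulVec]
      rfl
  have h1 : (Matrix.of fun (a : Fin k) (n : Fin k) => (B ^ (n + 1 : ℕ)) (Sum.inl a) (Sum.inr ())) =
      krylov M w * Matrix.of fun l n : Fin k => if l ≤ n then q (n - l : ℕ) else 0 := by
    ext a n
    have h2 := congrFun (hsum n) a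
    rw [Matrix.of_apply, h2, Matrix.mul_apply, Finset.sum_apply]
    simp only [krylov, Matrix.of_apply, Pi.smul_apply, smul_eq_mul, mul_ite, mul_zero]
    rw [← Finset.sum_filter]
    refine (Finset.sum_bij (fun (l : Fin k) _ => (l : ℕ)) ?_ ?_ ?_ ?_).symm
    · intro l hl
      simpa [Nat.lt_succ_iff] using hl
    · intro l _ l' _ h
      exact Fin.ext h
    · intro l hl
      rw [Finset.mem_range] at hl
      have := n.2
      refine ⟨⟨l, by omega⟩, Finset.mem_filter.2 ⟨Finset.mem_univ _, ?_⟩, rfl⟩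
      rw [Fin.le_def]
      exact Nat.lt_succ_iff.1 hl
    · intro l _
      rw [mul_comm]
  have h2 : (Matrix.of fun l n : Fin k => if l ≤ n then q (n - l : ℕ) else 0).det = 1 := by
    rw [Matrix.det_of_isUpperTriangular]
    · simp [q]
    · intro l n hln
      have : ¬ l ≤ n := not_le.2 hln
      simp [this]
  rw [h1, Matrix.det_mul, h2, mul_one]

theorem krylov_diagonal (l : Fin k → R) :
    krylov (Matrix.diagonal l) (fun _ => 1) = Matrix.vandermonde l := by
  ext a n
  simp [krylov, Matrix.diagonal_pow, Matrix.mulVec_diagonal]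

end

section

variable {k m : ℕ} {R : Type} [CommRing R] [Algebra ℂ R]

/-- The matrix `Â` on the slice. -/
noncomputable def hatSlice (s : SlicePos k m ⊕ SlicePos k m → R) :
    Matrix (Fin k ⊕ Unit) (Fin k ⊕ Unit) R :=
  Matrix.fromBlocks (Matrix.diagonal fun a => s (Sum.inl (Sum.inl a))) (Matrix.of fun _ _ => 1)
    (Matrix.of fun _ a => s (Sum.inl (Sum.inr (Sum.inl a))))
    (Matrix.of fun _ _ => ∑ e, s (Sum.inl (Sum.inr (Sum.inr e))))

variable (τ : ℂ) (s : SlicePos k m ⊕ SlicePos k m → R)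

theorem sliceHom_hatA : (hatA k m).map (sliceHom τ s) = hatSlice s := by
  rw [hatA, Matrix.fromBlocks_map, sliceHom_matA, hatSlice]
  congr 1 <;> ext a b : 1
  · simp [mati, sliceHom_i_zero]
  · simp [matj, sliceHom_j_one]
  · simp [corner, sliceHom_pos]

theorem sliceHom_matA_pow (n : ℕ) : (matA k m ^ n).map (sliceHom τ s) =
    Matrix.diagonal fun a => s (Sum.inl (Sum.inl a)) ^ n := by
  have h := map_pow (sliceHom τ s : Coord k m →+* R).mapMatrix (matA k m) n
  rw [RingHom.mapMatrix_apply, RingHom.mapMatrix_apply] at h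
  refine h.trans ?_
  refine (congrArg (· ^ n) (sliceHom_matA τ s)).trans ?_
  exact Matrix.diagonal_pow _ n

theorem sliceHom_hatA_pow (n : ℕ) : (hatA k m ^ n).map (sliceHom τ s) = hatSlice s ^ n := by
  have h := map_pow (sliceHom τ s : Coord k m →+* R).mapMatrix (hatA k m) n
  rw [RingHom.mapMatrix_apply, RingHom.mapMatrix_apply] at h
  exact h.trans (congrArg (· ^ n) (sliceHom_hatA τ s))

theorem map_trace_sliceHom {n : Type} [Fintype n] (M : Matrix n n (Coord k m)) :
    sliceHom τ s M.trace = (M.map (sliceHom τ s)).trace :=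
  AddMonoidHom.map_trace (sliceHom τ s : Coord k m →+ R) _

theorem sliceHom_traceInv (n : ℕ) :
    sliceHom τ s (traceInv k m n).1 = ∑ a, s (Sum.inl (Sum.inl a)) ^ n := by
  rw [traceInv, map_trace_sliceHom, sliceHom_matA_pow, Matrix.trace_diagonal]

theorem sliceHom_traceHatInv (n : ℕ) :
    sliceHom τ s (traceHatInv k m n).1 = (hatSlice s ^ n).trace := by
  rw [traceHatInv, map_trace_sliceHom, sliceHom_hatA_pow]

theorem sliceHom_traceAB (n : ℕ) : sliceHom τ s (traceAB k m n).1 =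
    ∑ a, s (Sum.inl (Sum.inl a)) ^ n * s (Sum.inr (Sum.inl a)) := by
  rw [traceAB, map_trace_sliceHom, Matrix.map_mul, sliceHom_matA_pow, Matrix.trace]
  refine Finset.sum_congr rfl fun a _ => ?_
  rw [Matrix.diag_apply, Matrix.diagonal_mul, Matrix.map_apply, matB, Matrix.of_apply,
    sliceHom_B_diag]

theorem sliceHom_covariant (α β : Fin 2) (n : ℕ) : sliceHom τ s (covariant k m α β n).1 =
    ∑ a, sliceHom τ s (matj k m α a) * s (Sum.inl (Sum.inl a)) ^ n *
      sliceHom τ s (mati k m a β) := by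
  rw [covariant, ← Matrix.map_apply (f := sliceHom τ s), Matrix.map_mul, Matrix.map_mul,
    sliceHom_matA_pow, Matrix.mul_apply]
  refine Finset.sum_congr rfl fun a _ => ?_
  rw [Matrix.mul_diagonal, Matrix.map_apply, Matrix.map_apply]

theorem sliceHom_bracket_traceA_traceAB (i n : ℕ) :
    sliceHom τ s (canonicalBracket (Pos k m) (traceInv k m (i + 1)).1 (traceAB k m n).1) =
      (i + 1) * ∑ a, s (Sum.inl (Sum.inl a)) ^ (i + n) := by
  have h0 : (Matrix.of fun x y => canonicalBracket (Pos k m) (matA k m x y) (traceAB k m n).1) =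
      matA k m ^ n := by
    ext x y : 1
    exact matA_bracket_traceAB x y n
  rw [traceInv, trace_bracket _ canonicalBracket_skew, h0, ← pow_add, map_mul, map_trace_sliceHom,
    sliceHom_matA_pow, Matrix.trace_diagonal]
  simp

theorem sliceHom_bracket_traceHat_covariant (j n : ℕ) :
    sliceHom τ s (canonicalBracket (Pos k m) (traceHatInv k m (j + 1)).1 (covariant k m 1 1 n).1) =
      (j + 1) * ∑ a, s (Sum.inl (Sum.inr (Sum.inl a))) * s (Sum.inl (Sum.inl a)) ^ n *
        (hatSlice s ^ j) (Sum.inl a) (Sum.inr ()) := by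
  have h1 : ∀ a, sliceHom τ s ((matj k m * matA k m ^ n) 1 a) =
      s (Sum.inl (Sum.inr (Sum.inl a))) * s (Sum.inl (Sum.inl a)) ^ n := by
    intro a
    rw [← Matrix.map_apply (f := sliceHom τ s), Matrix.map_mul, sliceHom_matA_pow,
      Matrix.mul_diagonal, Matrix.map_apply, matj, Matrix.of_apply, sliceHom_j_one]
  have h2 : (Matrix.fromBlocks 0 0 (Matrix.of fun (_ : Unit) a => (matj k m * matA k m ^ n) 1 a)
      0).map (sliceHom τ s) = Matrix.fromBlocks (0 : Matrix (Fin k) (Fin k) R)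
        (0 : Matrix (Fin k) Unit R) (Matrix.of fun (_ : Unit) a =>
          s (Sum.inl (Sum.inr (Sum.inl a))) * s (Sum.inl (Sum.inl a)) ^ n) 0 := by
    rw [Matrix.fromBlocks_map]
    congr 1
    ext a b : 1
    simp [h1]
  rw [traceHatInv, trace_bracket _ canonicalBracket_skew, hatA_bracket_covariant, map_mul,
    map_trace_sliceHom, Matrix.map_mul, sliceHom_hatA_pow, h2, Matrix.trace_mul_comm, Matrix.trace,
    Fintype.sum_sum_type]
  simp [Matrix.mul_apply]

theorem sliceHom_bracket_traceHat_freeCoord (j : ℕ) (e : Fin m) :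
    sliceHom τ s (canonicalBracket (Pos k m) (traceHatInv k m (j + 1)).1
      (freeCoord k m (Sum.inr e)).1) = (j + 1) * (hatSlice s ^ j) (Sum.inr ()) (Sum.inr ()) := by
  rw [traceHatInv, trace_bracket _ canonicalBracket_skew, hatA_bracket_freeCoord, map_mul,
    map_trace_sliceHom, Matrix.map_mul, sliceHom_hatA_pow, Matrix.trace,
    Fintype.sum_sum_type]
  simp [Matrix.mul_apply, Fintype.sum_sum_type]

theorem traceA_bracket_covariant (i n : ℕ) :
    canonicalBracket (Pos k m) (traceInv k m i).1 (covariant k m 1 1 n).1 = 0 :=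
  traceA_bracket_eq_zero (fun x y => matA_bracket_covariant x y 1 1 n) i

theorem traceA_bracket_freeCoord (i : ℕ) (e : Fin m) :
    canonicalBracket (Pos k m) (traceInv k m i).1 (freeCoord k m (Sum.inr e)).1 = 0 :=
  traceA_bracket_eq_zero (fun x y => by simp [matA, freeCoord, canonical_qp]) i

/-- The functions `tr A ^ n B` (`n < k`) and `j_2 A ^ n i_2` (`n < k`), to be bracketed with the
Hamiltonians. -/
noncomputable def conjugates (k m : ℕ) : Fin k ⊕ Fin k → invariants k m :=
  Sum.elim (fun n => traceAB k m n) (fun n => covariant k m 1 1 n)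

/-- The functions `tr A ^ n B`, `M`, `j_2 A ^ n i_2`. -/
noncomputable def conjugatesFree (k : ℕ) : Fin k ⊕ Fin (k + 1) → invariants k 1 :=
  Sum.elim (fun n => traceAB k 1 n)
    (Fin.cons (freeCoord k 1 (Sum.inr 0)) fun n => covariant k 1 1 1 n)

/-- The functions `tr A ^ i` (`1 ≤ i ≤ k`) and `tr Â ^ j` (`2 ≤ j ≤ k + 1`). -/
noncomputable def integralsInv (k m : ℕ) : Fin k ⊕ Fin k → invariants k m :=
  Sum.elim (fun i => traceInv k m (i + 1)) (fun j => traceHatInv k m (j + 2))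

/-- The functions `tr A ^ i` (`1 ≤ i ≤ k`) and `tr Â ^ j` (`1 ≤ j ≤ k + 1`). -/
noncomputable def hamiltonianInv (k m : ℕ) : Fin k ⊕ Fin (k + 1) → invariants k m :=
  Sum.elim (fun i => traceInv k m (i + 1)) (fun j => traceHatInv k m (j + 1))

/-- The common value of the determinants of the brackets on the slice. -/
noncomputable def bracketDet (s : SlicePos k m ⊕ SlicePos k m → R) : R :=
  (∏ i : Fin k, ((i : ℕ) + 1 : R)) * (∏ i : Fin k, ((i : ℕ) + 2 : R)) *
    (Matrix.vandermonde fun a => s (Sum.inl (Sum.inl a))).det ^ 4 *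
    ∏ a, s (Sum.inl (Sum.inr (Sum.inl a)))

theorem det_bracket_traceA_traceAB : (Matrix.of fun i n : Fin k => sliceHom τ s
    (canonicalBracket (Pos k m) (traceInv k m (i + 1)).1 (traceAB k m n).1)).det =
    (∏ i : Fin k, ((i : ℕ) + 1 : R)) *
      (Matrix.vandermonde fun a => s (Sum.inl (Sum.inl a))).det ^ 2 := by
  have : (Matrix.of fun i n : Fin k => sliceHom τ s
      (canonicalBracket (Pos k m) (traceInv k m (i + 1)).1 (traceAB k m n).1)) =
      Matrix.diagonal (fun i : Fin k => ((i : ℕ) + 1 : R)) *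
        ((Matrix.vandermonde fun a => s (Sum.inl (Sum.inl a))).transpose *
        (Matrix.vandermonde fun a => s (Sum.inl (Sum.inl a)))) := by
    ext i n
    rw [Matrix.of_apply, sliceHom_bracket_traceA_traceAB, Matrix.diagonal_mul, Matrix.mul_apply]
    simp [Matrix.vandermonde_apply, pow_add]
  rw [this, Matrix.det_mul, Matrix.det_mul, Matrix.det_diagonal, Matrix.det_transpose]
  ring

theorem det_bracket_traceHat_covariant : (Matrix.of fun j n : Fin k => sliceHom τ s
    (canonicalBracket (Pos k m) (traceHatInv k m (j + 2)).1 (covariant k m 1 1 n).1)).det =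
    (∏ i : Fin k, ((i : ℕ) + 2 : R)) *
      (Matrix.vandermonde fun a => s (Sum.inl (Sum.inl a))).det ^ 2 *
      ∏ a, s (Sum.inl (Sum.inr (Sum.inl a))) := by
  have : (Matrix.of fun j n : Fin k => sliceHom τ s
      (canonicalBracket (Pos k m) (traceHatInv k m (j + 2)).1 (covariant k m 1 1 n).1)) =
      Matrix.diagonal (fun i : Fin k => ((i : ℕ) + 2 : R)) *
        ((Matrix.of fun (a : Fin k) (n : Fin k) =>
          (hatSlice s ^ (n + 1 : ℕ)) (Sum.inl a) (Sum.inr ())).transpose *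
        (Matrix.diagonal (fun a => s (Sum.inl (Sum.inr (Sum.inl a)))) *
        (Matrix.vandermonde fun a => s (Sum.inl (Sum.inl a))))) := by
    ext i n
    rw [Matrix.of_apply, sliceHom_bracket_traceHat_covariant, Matrix.diagonal_mul, Matrix.mul_apply]
    simp only [Matrix.diagonal_mul, Matrix.vandermonde_apply, Matrix.transpose_apply,
      Matrix.of_apply]
    congr 1
    · push_cast; ring
    · exact Finset.sum_congr rfl fun a _ => by ring
  rw [this, Matrix.det_mul, Matrix.det_mul, Matrix.det_mul, Matrix.det_diagonal,
    Matrix.det_diagonal, Matrix.det_transpose, det_bordered_krylov _ _ _ _ (hatSlice s) rfl,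
    krylov_diagonal]
  ring

theorem det_bracket_integrals : (Matrix.of fun a b => sliceHom τ s
    (canonicalBracket (Pos k m) (integralsInv k m a).1 (conjugates k m b).1)).det =
    bracketDet s := by
  have : (Matrix.of fun a b => sliceHom τ s
      (canonicalBracket (Pos k m) (integralsInv k m a).1 (conjugates k m b).1)) =
      Matrix.fromBlocks (Matrix.of fun i n : Fin k => sliceHom τ s
        (canonicalBracket (Pos k m) (traceInv k m (i + 1)).1 (traceAB k m n).1)) 0
        (Matrix.of fun j n : Fin k => sliceHom τ s
        (canonicalBracket (Pos k m) (traceHatInv k m (j + 2)).1 (traceAB k m n).1))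
        (Matrix.of fun j n : Fin k => sliceHom τ s
        (canonicalBracket (Pos k m) (traceHatInv k m (j + 2)).1 (covariant k m 1 1 n).1)) := by
    ext a b
    rcases a with a | a <;> rcases b with b | b
    · rfl
    · simp only [Matrix.of_apply, integralsInv, conjugates, Sum.elim_inl, Sum.elim_inr,
        Matrix.fromBlocks_apply₁₂, Matrix.zero_apply]
      rw [traceA_bracket_covariant, map_zero]
    · rfl
    · rfl
  rw [this, Matrix.det_fromBlocks_zero₁₂, det_bracket_traceA_traceAB,
    det_bracket_traceHat_covariant, bracketDet]
  ring

theorem det_bracket_hamiltonian (s : SlicePos k 1 ⊕ SlicePos k 1 → R) :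
    (Matrix.of fun a b => sliceHom τ s
      (canonicalBracket (Pos k 1) (hamiltonianInv k 1 a).1 (conjugatesFree k b).1)).det =
    bracketDet s := by
  let Y : Matrix (Fin (k + 1)) (Fin (k + 1)) R := Matrix.of fun j n => sliceHom τ s
    (canonicalBracket (Pos k 1) (traceHatInv k 1 (j + 1)).1 (conjugatesFree k (Sum.inr n)).1)
  have : (Matrix.of fun a b => sliceHom τ s
      (canonicalBracket (Pos k 1) (hamiltonianInv k 1 a).1 (conjugatesFree k b).1)) =
      Matrix.fromBlocks (Matrix.of fun i n : Fin k => sliceHom τ s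
        (canonicalBracket (Pos k 1) (traceInv k 1 (i + 1)).1 (traceAB k 1 n).1)) 0
        (Matrix.of fun (j : Fin (k + 1)) (n : Fin k) => sliceHom τ s
        (canonicalBracket (Pos k 1) (traceHatInv k 1 (j + 1)).1 (traceAB k 1 n).1)) Y := by
    ext a b
    rcases a with a | a <;> rcases b with b | b
    · rfl
    · simp only [Matrix.of_apply, hamiltonianInv, conjugatesFree, Sum.elim_inl, Sum.elim_inr,
        Matrix.fromBlocks_apply₁₂, Matrix.zero_apply]
      refine Fin.cases ?_ (fun n => ?_) b
      · rw [Fin.cons_zero, traceA_bracket_freeCoord, map_zero]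
      · rw [Fin.cons_succ, traceA_bracket_covariant, map_zero]
    · rfl
    · rfl
  have h00 : Y 0 0 = 1 := by
    change sliceHom τ s (canonicalBracket (Pos k 1) (traceHatInv k 1 (0 + 1)).1
      (freeCoord k 1 (Sum.inr 0)).1) = 1
    rw [sliceHom_bracket_traceHat_freeCoord]
    simp
  have h0 : ∀ n : Fin k, Y 0 n.succ = 0 := by
    intro n
    change sliceHom τ s (canonicalBracket (Pos k 1) (traceHatInv k 1 (0 + 1)).1
      (covariant k 1 1 1 n).1) = 0
    rw [sliceHom_bracket_traceHat_covariant]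
    simp
  have hY : Y.det = (Y.submatrix Fin.succ Fin.succ).det := by
    rw [Matrix.det_succ_row_zero, Fin.sum_univ_succ, h00]
    simp only [h0, mul_zero, zero_mul, Finset.sum_const_zero, add_zero, Fin.val_zero, pow_zero,
      one_mul]
    rfl
  have hY' : (Y.submatrix Fin.succ Fin.succ).det = _ := det_bracket_traceHat_covariant τ s
  rw [this, Matrix.det_fromBlocks_zero₁₂, det_bracket_traceA_traceAB, hY, hY', bracketDet]
  ring

end

/-! ### Independence of the Hamiltonians -/

section

variable {k m : ℕ}

theorem isSeparated_of_isUnit_vandermonde {R : Type} [CommRing R]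
    {s : SlicePos k m ⊕ SlicePos k m → R}
    (h : IsUnit (Matrix.vandermonde fun a => s (Sum.inl (Sum.inl a))).det) : IsSeparated s := by
  have key : ∀ a b : Fin k, a < b → IsUnit (s (Sum.inl (Sum.inl b)) - s (Sum.inl (Sum.inl a))) := by
    intro a b hab
    rw [Matrix.det_vandermonde] at h
    refine isUnit_of_dvd_unit ?_ h
    exact (Finset.dvd_prod_of_mem (fun j => s (Sum.inl (Sum.inl j)) - s (Sum.inl (Sum.inl a)))
      (Finset.mem_Ioi.2 hab)).trans
      (Finset.dvd_prod_of_mem (fun i : Fin k => ∏ j ∈ Finset.Ioi i,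
        (s (Sum.inl (Sum.inl j)) - s (Sum.inl (Sum.inl i)))) (Finset.mem_univ a))
  intro a b hab
  rcases lt_or_gt_of_ne hab with h1 | h1
  · rw [← neg_sub]
    exact (key a b h1).neg
  · exact key b a h1

theorem map_det_vandermonde {R S : Type} [CommRing R] [CommRing S] (φ : R →+* S) (l : Fin k → R) :
    φ (Matrix.vandermonde l).det = (Matrix.vandermonde fun a => φ (l a)).det := by
  rw [RingHom.map_det]
  congr 1
  ext a b
  simp [Matrix.vandermonde_apply]

theorem map_bracketDet {R S : Type} [CommRing R] [CommRing S]
    (φ : R →+* S) (s : SlicePos k m ⊕ SlicePos k m → R) :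
    φ (bracketDet s) = bracketDet fun x => φ (s x) := by
  simp only [bracketDet, map_mul, map_prod, map_pow, map_add, map_natCast, map_one, map_ofNat,
    map_det_vandermonde]

theorem bracketDet_X_ne_zero :
    bracketDet (X : SlicePos k m ⊕ SlicePos k m → MvPolynomial (SlicePos k m ⊕ SlicePos k m) ℂ) ≠
      0 := by
  refine mul_ne_zero (mul_ne_zero (mul_ne_zero ?_ ?_) (pow_ne_zero _ ?_)) ?_
  · exact Finset.prod_ne_zero_iff.2 fun i _ => Nat.cast_add_one_ne_zero _
  · refine Finset.prod_ne_zero_iff.2 fun i _ => ?_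
    exact_mod_cast (Nat.succ_ne_zero (i + 1 : ℕ))
  · rw [Matrix.det_vandermonde_ne_zero_iff]
    intro a b h
    simpa using X_injective h
  · exact Finset.prod_ne_zero_iff.2 fun i _ => X_ne_zero _

/-- The functions on the part of the slice where the Hamiltonians are independent. -/
abbrev SliceRing (k m : ℕ) : Type :=
  Localization.Away (bracketDet
    (X : SlicePos k m ⊕ SlicePos k m → MvPolynomial (SlicePos k m ⊕ SlicePos k m) ℂ))

instance : IsDomain (SliceRing k m) :=
  IsLocalization.isDomain_localization
    (powers_le_nonZeroDivisors_of_noZeroDivisors bracketDet_X_ne_zero)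

theorem algebraMap_sliceRing_injective : Function.Injective
    (algebraMap (MvPolynomial (SlicePos k m ⊕ SlicePos k m) ℂ) (SliceRing k m)) :=
  IsLocalization.injective _
    (powers_le_nonZeroDivisors_of_noZeroDivisors bracketDet_X_ne_zero)

/-- The coordinates of the slice, as elements of `SliceRing k m`. -/
noncomputable def sliceGen : SlicePos k m ⊕ SlicePos k m → SliceRing k m := fun x =>
  algebraMap (MvPolynomial (SlicePos k m ⊕ SlicePos k m) ℂ) _ (X x)

theorem isUnit_bracketDet_sliceGen : IsUnit (bracketDet (sliceGen (k := k) (m := m))) := by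
  have h := map_bracketDet (algebraMap (MvPolynomial (SlicePos k m ⊕ SlicePos k m) ℂ)
    (SliceRing k m)) X
  change IsUnit (bracketDet fun x => algebraMap _ _ (X x))
  rw [← h]
  exact IsLocalization.Away.algebraMap_isUnit _

theorem isSeparated_sliceGen : IsSeparated (sliceGen (k := k) (m := m)) := by
  apply isSeparated_of_isUnit_vandermonde
  have h := isUnit_bracketDet_sliceGen (k := k) (m := m)
  unfold bracketDet at h
  exact (isUnit_pow_iff (by norm_num)).1 (isUnit_of_mul_isUnit_right (isUnit_of_mul_isUnit_left h))

theorem aeval_sliceGen (p : MvPolynomial (SlicePos k m ⊕ SlicePos k m) ℂ) :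
    aeval sliceGen p = algebraMap _ (SliceRing k m) p := by
  have : aeval sliceGen = IsScalarTower.toAlgHom ℂ (MvPolynomial (SlicePos k m ⊕ SlicePos k m) ℂ)
      (SliceRing k m) := by
    apply MvPolynomial.algHom_ext
    intro x
    simp [sliceGen]
  rw [this]
  rfl

theorem algebraicIndependent_sliceGen : AlgebraicIndependent ℂ (sliceGen (k := k) (m := m)) := by
  intro p q h
  rw [aeval_sliceGen, aeval_sliceGen] at h
  exact algebraMap_sliceRing_injective h

instance (τ : ℂ) : IsDomain (InstantonAlgebra k m τ) :=
  (sliceRestrict_injective τ isSeparated_sliceGen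
    algebraicIndependent_sliceGen).isDomain (sliceRestrict τ isSeparated_sliceGen).toRingHom

theorem instantonBracket_skew (τ : ℂ) (x y : InstantonAlgebra k m τ) :
    instantonBracket k m τ x y = -instantonBracket k m τ y x := by
  obtain ⟨f, rfl⟩ := toInstanton_surjective τ x
  obtain ⟨g, rfl⟩ := toInstanton_surjective τ y
  rw [instantonBracket_mk, instantonBracket_mk, ← map_neg]
  congr 1
  exact Subtype.ext (canonicalBracket_skew _ _)

theorem integrals_eq (τ : ℂ) (a : Fin k ⊕ Fin k) :
    integrals k m τ a = toInstanton k m τ (integralsInv k m a) := by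
  rcases a with a | a <;> rfl

/-- The determinant of the brackets of the Hamiltonians with the functions `conjugates`. -/
noncomputable def instantonDet (k m : ℕ) (τ : ℂ) : InstantonAlgebra k m τ :=
  (Matrix.of fun a b => instantonBracket k m τ (integrals k m τ a)
    (toInstanton k m τ (conjugates k m b))).det

theorem sliceRestrict_instantonDet (τ : ℂ) {R : Type} [CommRing R] [Algebra ℂ R] [IsReduced R]
    {s : SlicePos k m ⊕ SlicePos k m → R} (hs : IsSeparated s) :
    sliceRestrict τ hs (instantonDet k m τ) = bracketDet s := by
  rw [← det_bracket_integrals τ s, instantonDet, AlgHom.map_det]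
  congr 1
  ext a b
  rw [AlgHom.mapMatrix_apply, Matrix.map_apply, Matrix.of_apply, Matrix.of_apply, integrals_eq,
    instantonBracket_mk]
  rfl

theorem instantonDet_ne_zero (τ : ℂ) : instantonDet k m τ ≠ 0 := by
  intro h
  have h1 := sliceRestrict_instantonDet τ (isSeparated_sliceGen (k := k) (m := m))
  rw [h, map_zero] at h1
  exact (isUnit_bracketDet_sliceGen (k := k) (m := m)).ne_zero h1.symm

theorem algebraicIndependent_integrals (τ : ℂ) : AlgebraicIndependent ℂ (integrals k m τ) :=
  algebraicIndependent_of_det (instantonBracket k m τ) _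
    (fun b => toInstanton k m τ (conjugates k m b)) (instantonDet_ne_zero τ)
    (instantonBracket_skew τ)

theorem integrals_bracket (τ : ℂ) (a b : Fin k ⊕ Fin k) :
    instantonBracket k m τ (integrals k m τ a) (integrals k m τ b) = 0 := by
  have h : ∀ a, integrals k m τ a = hamiltonian k m τ (Sum.map id Fin.succ a) := by
    rintro (a | a) <;> rfl
  rw [h, h, hamiltonian_bracket]

theorem traceA_one_eq (τ : ℂ) : traceA k 0 τ 1 = traceHatA k 0 τ 1 := by
  unfold traceA traceHatA
  congr 1
  apply Subtype.ext
  change (matA k 0 ^ 1).trace = (hatA k 0 ^ 1).trace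
  rw [pow_one, pow_one, hatA, Matrix.trace, Matrix.trace, Fintype.sum_sum_type]
  simp [corner]

/-- The relations among the Hamiltonians are generated by `tr A = tr Â`. -/
theorem ker_aeval_hamiltonian (τ : ℂ) (hk : 1 ≤ k) :
    RingHom.ker (MvPolynomial.aeval (R := ℂ) (hamiltonian k 0 τ)) =
      Ideal.span {X (Sum.inl (⟨0, hk⟩ : Fin k)) - X (Sum.inr (0 : Fin (k + 1)))} := by
  apply le_antisymm
  · intro p hp
    set I : Ideal (MvPolynomial (Fin k ⊕ Fin (k + 1)) ℂ) :=
      Ideal.span {X (Sum.inl (⟨0, hk⟩ : Fin k)) - X (Sum.inr (0 : Fin (k + 1)))} with hI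
    -- eliminate the variable of `tr Â`
    let π : MvPolynomial (Fin k ⊕ Fin (k + 1)) ℂ →ₐ[ℂ] MvPolynomial (Fin k ⊕ Fin k) ℂ :=
      aeval (Sum.elim (fun i => X (Sum.inl i))
        (Fin.cons (X (Sum.inl ⟨0, hk⟩)) fun j => X (Sum.inr j)))
    let ι : MvPolynomial (Fin k ⊕ Fin k) ℂ →ₐ[ℂ] MvPolynomial (Fin k ⊕ Fin (k + 1)) ℂ :=
      rename (Sum.map id Fin.succ)
    have h1 : (Ideal.Quotient.mkₐ ℂ I).comp (ι.comp π) = Ideal.Quotient.mkₐ ℂ I := by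
      apply MvPolynomial.algHom_ext
      rintro (i | j)
      · simp [ι, π]
      · refine Fin.cases ?_ (fun j => ?_) j
        · simp only [AlgHom.comp_apply, π, ι, aeval_X, Sum.elim_inr, Fin.cons_zero, rename_X,
            Sum.map_inl, id]
          exact Ideal.Quotient.eq.2 (Ideal.subset_span rfl)
        · simp [ι, π]
    have h2 : (aeval (integrals k 0 τ)).comp π = aeval (hamiltonian k 0 τ) := by
      apply MvPolynomial.algHom_ext
      rintro (i | j)
      · simp [π, integrals, hamiltonian]
      · refine Fin.cases ?_ (fun j => ?_) j
        · simp only [AlgHom.comp_apply, π, aeval_X, Sum.elim_inr, Fin.cons_zero]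
          exact traceA_one_eq τ
        · simp [π, integrals, hamiltonian]
    have h3 : π p = 0 := by
      apply (injective_iff_map_eq_zero _).1 (algebraicIndependent_integrals τ)
      exact (DFunLike.congr_fun h2 p).trans hp
    have h4 := DFunLike.congr_fun h1 p
    simp only [AlgHom.comp_apply, h3, map_zero] at h4
    exact Ideal.Quotient.eq_zero_iff_mem.1 h4.symm
  · rw [Ideal.span_le, Set.singleton_subset_iff, SetLike.mem_coe, RingHom.mem_ker, map_sub,
      aeval_X, aeval_X, sub_eq_zero]
    exact traceA_one_eq τ

end

/-! ### The dimension -/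

section

/-- If `y ∈ P` and the elements `φ(c)`, `c ≠ 0`, are outside of `P ⊇ P₀`, while `y ∉ P₀`, then `y` is
transcendental modulo `P₀` over the elements `φ(c)`. -/
theorem eval₂_mem_prime {S B : Type} [CommRing S] [CommRing B] (φ : S →+* B) {P₀ P : Ideal B}
    [P₀.IsPrime] (hP : P₀ ≤ P) {y : B} (hy : y ∈ P) (hy₀ : y ∉ P₀)
    (h : ∀ c, φ c ∈ P → c = 0) (f : Polynomial S) (hf : f.eval₂ φ y ∈ P₀) : f = 0 := by
  have key : ∀ (n : ℕ) (f : Polynomial S), f.natDegree ≤ n → f.eval₂ φ y ∈ P₀ → f = 0 := by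
    intro n
    induction n with
    | zero =>
      intro f hn hf
      rw [Polynomial.eq_C_of_natDegree_le_zero hn] at hf ⊢
      rw [Polynomial.eval₂_C] at hf
      rw [h _ (hP hf), map_zero]
    | succ n ih =>
      intro f hn hf
      have h1 := Polynomial.divX_mul_X_add f
      have h2 : f.divX.eval₂ φ y * y + φ (f.coeff 0) ∈ P₀ := by
        rw [← h1] at hf
        simpa using hf
      have h3 : f.coeff 0 = 0 := by
        refine h _ ?_
        have := P.sub_mem (hP h2) (P.mul_mem_left (f.divX.eval₂ φ y) hy)
        simpa using this
      rw [h3, map_zero, add_zero] at h2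
      have h4 := ih f.divX (by rw [Polynomial.natDegree_divX_eq_natDegree_tsub_one]; omega)
        (((inferInstance : P₀.IsPrime).mem_or_mem h2).resolve_right hy₀)
      rw [← h1, h3, h4]
      simp
  exact key _ f le_rfl hf

/-- Elements that witness the strictness of the steps of a chain of primes are algebraically
independent. -/
theorem exists_algebraicIndependent_of_chain {B : Type} [CommRing B] [Algebra ℂ B] (n : ℕ)
    (P : Fin (n + 1) → PrimeSpectrum B) (hP : StrictMono P) :
    ∃ x : Fin n → B, ∀ p : MvPolynomial (Fin n) ℂ, aeval x p ∈ (P 0).asIdeal → p = 0 := by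
  induction n with
  | zero =>
    refine ⟨Fin.elim0, fun p hp => ?_⟩
    rw [eq_C_of_isEmpty p] at hp ⊢
    by_contra h0
    have hc : coeff 0 p ≠ 0 := fun h => h0 (by rw [h, map_zero])
    refine (P 0).isPrime.ne_top (Ideal.eq_top_of_isUnit_mem _ hp ?_)
    rw [aeval_C]
    exact (IsUnit.mk0 _ hc).map _
  | succ n ih =>
    obtain ⟨x, hx⟩ := ih (fun i => P i.succ) fun i j hij => hP (Fin.succ_lt_succ_iff.2 hij)
    have h01 : P 0 < P (Fin.succ 0) := hP (Fin.succ_pos 0)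
    obtain ⟨hle, y, hy, hy₀⟩ := SetLike.lt_iff_le_and_exists.1
      ((PrimeSpectrum.asIdeal_lt_asIdeal _ _).2 h01)
    refine ⟨Fin.cons y x, fun p hp => ?_⟩
    have h1 : ∀ p : MvPolynomial (Fin (n + 1)) ℂ,
        aeval (Fin.cons y x) p = (finSuccEquiv ℂ n p).eval₂ (aeval (R := ℂ) x).toRingHom y := by
      intro p
      induction p using MvPolynomial.induction_on with
      | C a => simp [finSuccEquiv_apply]
      | add p q hp hq => rw [map_add, hp, hq, map_add, Polynomial.eval₂_add]
      | mul_X p i hp =>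
        rw [map_mul, hp, map_mul, Polynomial.eval₂_mul, aeval_X]
        congr 1
        refine Fin.cases ?_ (fun i => ?_) i
        · rw [finSuccEquiv_X_zero, Polynomial.eval₂_X, Fin.cons_zero]
        · rw [finSuccEquiv_X_succ, Polynomial.eval₂_C, Fin.cons_succ]
          simp
    rw [h1] at hp
    have := (P 0).isPrime
    have h2 := eval₂_mem_prime (aeval (R := ℂ) x).toRingHom hle hy hy₀ hx _ hp
    exact (EmbeddingLike.map_eq_zero_iff (f := finSuccEquiv ℂ n)).1 h2

/-- The dimension of a subalgebra of a localised polynomial ring is at most the number of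
variables. -/
theorem ringKrullDim_le_of_injective {σ B : Type} [Fintype σ] [CommRing B] [IsDomain B]
    [Algebra ℂ B] {d : MvPolynomial σ ℂ} (hd : d ≠ 0) (f : B →ₐ[ℂ] Localization.Away d)
    (hf : Function.Injective f) : ringKrullDim B ≤ (Fintype.card σ : ℕ) := by
  have hle := powers_le_nonZeroDivisors_of_noZeroDivisors hd
  have : IsDomain (Localization.Away d) := IsLocalization.isDomain_localization hle
  have hinj := IsLocalization.injective (Localization.Away d) hle
  have : FaithfulSMul (MvPolynomial σ ℂ) (Localization.Away d) :=
    (faithfulSMul_iff_algebraMap_injective _ _).2 hinj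
  have := IsLocalization.isAlgebraic (R := MvPolynomial σ ℂ) (S := Localization.Away d)
    (Submonoid.powers d)
  have htr : Algebra.trdeg ℂ (Localization.Away d) = Cardinal.mk σ :=
    ((IsTranscendenceBasis.mvPolynomial σ ℂ).algebraMap_comp
      (A := Localization.Away d)).cardinalMk_eq_trdeg.symm
  refine iSup_le fun P => ?_
  obtain ⟨x, hx⟩ := exists_algebraicIndependent_of_chain P.length P.toFun P.strictMono
  have hx' : AlgebraicIndependent ℂ (f ∘ x) := by
    rw [algebraicIndependent_iff]
    intro p hp
    apply hx
    rw [show (f ∘ x) = fun i => f (x i) from rfl, ← comp_aeval_apply] at hp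
    rw [hf (hp.trans (map_zero f).symm)]
    exact zero_mem _
  have h1 := hx'.cardinalMk_le_trdeg
  rw [htr, Cardinal.mk_fin, Cardinal.mk_fintype] at h1
  exact_mod_cast h1

/-- The prime ideals `(X_i - c_i : i < j)` survive in the localisation at `d` if `d(c) ≠ 0`. -/
theorem card_le_ringKrullDim_away {σ : Type} [Fintype σ] {d : MvPolynomial σ ℂ} (hd : d ≠ 0) :
    (Fintype.card σ : WithBot ℕ∞) ≤ ringKrullDim (Localization.Away d) := by
  obtain ⟨c, hc⟩ : ∃ c : σ → ℂ, eval c d ≠ 0 := by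
    by_contra! h
    exact hd (MvPolynomial.funext fun c => by rw [h, map_zero])
  let e := Fintype.equivFin σ
  let φ : ℕ → MvPolynomial σ ℂ →ₐ[ℂ] MvPolynomial σ ℂ := fun j =>
    aeval fun i => if (e i : ℕ) < j then C (c i) else X i
  have hφ : ∀ j p, eval c (φ j p) = eval c p := by
    intro j p
    have : (aeval c : MvPolynomial σ ℂ →ₐ[ℂ] ℂ).comp (φ j) = aeval c := by
      apply MvPolynomial.algHom_ext
      intro i
      simp only [AlgHom.comp_apply, φ, aeval_X]
      split_ifs <;> simp
    have := DFunLike.congr_fun this p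
    simpa [aeval_eq_eval] using this
  have hφφ : ∀ j j', j ≤ j' → ∀ p, φ j' (φ j p) = φ j' p := by
    intro j j' hj p
    rw [← AlgHom.comp_apply]
    congr 1
    apply MvPolynomial.algHom_ext
    intro i
    simp only [AlgHom.comp_apply, φ, aeval_X]
    by_cases h : (e i : ℕ) < j
    · simp [h, h.trans_le hj]
    · simp [h]
  have hprime : ∀ j, (RingHom.ker (φ j)).IsPrime := fun j => RingHom.ker_isPrime _
  have hdisj : ∀ j, Disjoint (Submonoid.powers d : Set (MvPolynomial σ ℂ)) (RingHom.ker (φ j)) := by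
    intro j
    rw [Set.disjoint_left]
    rintro _ ⟨n, rfl⟩ h
    have h1 : φ j (d ^ n) = 0 := h
    have h2 := hφ j (d ^ n)
    rw [h1, map_zero, map_pow] at h2
    exact pow_ne_zero n hc h2.symm
  let o := IsLocalization.orderIsoOfPrime (Submonoid.powers d) (Localization.Away d)
  let P : Fin (Fintype.card σ + 1) → PrimeSpectrum (Localization.Away d) := fun j =>
    ⟨(o.symm ⟨RingHom.ker (φ j), hprime j, hdisj j⟩).1,
      (o.symm ⟨RingHom.ker (φ j), hprime j, hdisj j⟩).2⟩
  have hP : StrictMono P := by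
    intro j j' hj
    change (o.symm ⟨RingHom.ker (φ j), hprime j, hdisj j⟩) <
      o.symm ⟨RingHom.ker (φ j'), hprime j', hdisj j'⟩
    rw [o.symm.lt_iff_lt]
    change RingHom.ker (φ j) < RingHom.ker (φ j')
    refine lt_of_le_of_ne (fun p hp => ?_) fun h => ?_
    · rw [RingHom.mem_ker] at hp ⊢
      rw [← hφφ j j' (le_of_lt hj), hp, map_zero]
    · have hj2 : (j : ℕ) < Fintype.card σ := lt_of_lt_of_le hj (Nat.lt_succ_iff.1 j'.2)
      let i := e.symm ⟨j, hj2⟩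
      have hi : (e i : ℕ) = j := by simp [i]
      have h1 : X i - C (c i) ∈ RingHom.ker (φ j') := by
        rw [RingHom.mem_ker, map_sub, ← MvPolynomial.algebraMap_eq, AlgHom.commutes]
        simp only [φ, aeval_X]
        rw [if_pos (by rw [hi]; exact hj), MvPolynomial.algebraMap_eq, sub_self]
      rw [← h, RingHom.mem_ker, map_sub, ← MvPolynomial.algebraMap_eq, AlgHom.commutes] at h1
      simp only [φ, aeval_X] at h1
      rw [if_neg (by rw [hi]; exact lt_irrefl _), sub_eq_zero] at h1
      have h2 := congrArg (eval (fun _ => c i + 1)) h1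
      simp [MvPolynomial.algebraMap_eq] at h2
  exact Order.LTSeries.length_le_krullDim (LTSeries.mk _ P hP)

/-- If all elements of `L` are integral over a subalgebra whose elements become elements of the
image of `B` after multiplication with powers of a unit `f(d)`, the fibres of
`Spec L → Spec B` contain no chains. -/
theorem ringKrullDim_le_of_isIntegral {B L : Type} [CommRing B] [Algebra ℂ B] [CommRing L]
    [Algebra ℂ L] (f : B →ₐ[ℂ] L) {d : B} (hd : IsUnit (f d))
    (h : ∀ x : L, IsIntegral (awayLift f hd).range x) : ringKrullDim L ≤ ringKrullDim B := by
  have : Algebra.IsIntegral (awayLift f hd).range L := ⟨h⟩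
  refine Order.krullDim_le_of_strictMono (fun P => P.comap (f : B →+* L)) fun P Q hPQ => ?_
  have h1 : P.asIdeal.comap (algebraMap (awayLift f hd).range L) <
      Q.asIdeal.comap (algebraMap (awayLift f hd).range L) := by
    have := P.isPrime
    exact Ideal.IsIntegral.comap_lt_comap hPQ
  obtain ⟨hle, ⟨_, y, rfl⟩, hy, hy₀⟩ := SetLike.lt_iff_le_and_exists.1 h1
  have hy : awayLift f hd y ∈ Q.asIdeal := hy
  have hy₀ : awayLift f hd y ∉ P.asIdeal := hy₀
  obtain ⟨n, b, hb⟩ := exists_away_eq d y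
  have h2 := congrArg (awayLift f hd) hb
  rw [map_mul, awayLift_algebraMap, awayLift_algebraMap, map_pow] at h2
  refine lt_of_le_of_ne (fun b hb => hPQ.le hb) fun heq => hy₀ ?_
  have h3 : b ∈ (Q.comap (f : B →+* L)).asIdeal := by
    change f b ∈ Q.asIdeal
    rw [← h2]
    exact Q.asIdeal.mul_mem_right _ hy
  have heq' : P.comap (f : B →+* L) = Q.comap (f : B →+* L) := heq
  rw [← heq'] at h3
  have h4 : f b ∈ P.asIdeal := h3
  rw [← h2] at h4
  exact (P.isPrime.mem_or_mem h4).resolve_right fun h5 =>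
    P.isPrime.ne_top (Ideal.eq_top_of_isUnit_mem _ h5 (hd.pow n))

end

/-! ### Functions of the eigenvalues from their power sums -/

section

variable {n : ℕ} {R : Type} [CommRing R] [Algebra ℂ R] {S : Subalgebra ℂ R} {l : Fin n → R}

/-- By Newton's identities, a subalgebra that contains the power sums contains the elementary
symmetric functions. -/
theorem esymm_mem (hl : ∀ i : ℕ, ∑ a, l a ^ i ∈ S) (i : ℕ) :
    (Finset.univ.val.map l).esymm i ∈ S := by
  rw [← aeval_esymm_eq_multiset_esymm (Fin n) ℂ]
  induction i using Nat.strong_induction_on with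
  | _ i ih =>
    rcases Nat.eq_zero_or_pos i with rfl | hi
    · simp
    · have h1 := congrArg (aeval l) (mul_esymm_eq_sum (Fin n) ℂ i)
      have h2 : (i : R) * aeval l (esymm (Fin n) ℂ i) ∈ S := by
        rw [map_mul, map_natCast] at h1
        rw [h1, map_mul, map_pow, map_neg, map_one, map_sum]
        refine S.mul_mem (S.pow_mem (S.neg_mem S.one_mem) _) (S.sum_mem fun x hx => ?_)
        rw [map_mul, map_mul, map_pow, map_neg, map_one]
        refine S.mul_mem (S.mul_mem (S.pow_mem (S.neg_mem S.one_mem) _)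
          (ih _ (Finset.mem_filter.1 hx).2)) ?_
        simpa [psum] using hl x.2
      have h3 : aeval l (esymm (Fin n) ℂ i) =
          (i : ℂ)⁻¹ • ((i : R) * aeval l (esymm (Fin n) ℂ i)) := by
        have : (i : ℂ) ≠ 0 := Nat.cast_ne_zero.2 hi.ne'
        rw [← map_natCast (algebraMap ℂ R) i, ← Algebra.smul_def, smul_smul, inv_mul_cancel₀ this,
          one_smul]
      rw [h3]
      exact S.smul_mem h2 _

theorem isIntegral_of_powerSum_mem (hl : ∀ i : ℕ, ∑ a, l a ^ i ∈ S) (a : Fin n) :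
    IsIntegral S (l a) := by
  nontriviality R
  set p : Polynomial R := ∏ a, (Polynomial.X - Polynomial.C (l a)) with hp
  have hm : p.Monic := Polynomial.monic_prod_X_sub_C _ _
  have hlift : p ∈ Polynomial.lifts (algebraMap S R) := by
    rw [Polynomial.lifts_iff_coeff_lifts]
    intro i
    have hp' : p = ((Finset.univ.val.map l).map fun t => Polynomial.X - Polynomial.C t).prod := by
      rw [hp, Finset.prod, Multiset.map_map]
      rfl
    by_cases hi : i ≤ n
    · refine ⟨⟨p.coeff i, ?_⟩, rfl⟩
      rw [hp', Multiset.prod_X_sub_C_coeff _ (by simpa using hi)]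
      exact S.mul_mem (S.pow_mem (S.neg_mem S.one_mem) _) (esymm_mem hl _)
    · refine ⟨0, ?_⟩
      rw [map_zero, Polynomial.coeff_eq_zero_of_natDegree_lt]
      rw [hp, Polynomial.natDegree_prod_of_monic _ _ fun i _ => Polynomial.monic_X_sub_C _]
      simpa using hi
  obtain ⟨q, hq, -, hqm⟩ := Polynomial.lifts_and_natDegree_eq_and_monic hlift hm
  refine ⟨q, hqm, ?_⟩
  rw [← Polynomial.eval_map, hq, hp, Polynomial.eval_prod]
  exact Finset.prod_eq_zero (Finset.mem_univ a) (by simp)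

theorem det_mem_of_forall_mem (M : Matrix (Fin n) (Fin n) R) (hM : ∀ i j, M i j ∈ S) :
    M.det ∈ S := by
  rw [Matrix.det_apply]
  refine S.sum_mem fun σ _ => ?_
  rcases Int.units_eq_one_or (Equiv.Perm.sign σ) with h | h <;> rw [h]
  · rw [one_smul]
    exact S.prod_mem fun i _ => hM _ _
  · rw [Units.neg_smul, one_smul]
    exact S.neg_mem (S.prod_mem fun i _ => hM _ _)

theorem vandermonde_gram_det {R : Type} [CommRing R] (l w : Fin n → R) :
    (Matrix.of fun i j : Fin n => ∑ a, l a ^ (i + j : ℕ) * w a).det =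
      (Matrix.vandermonde l).det ^ 2 * ∏ a, w a := by
  have : (Matrix.of fun i j : Fin n => ∑ a, l a ^ (i + j : ℕ) * w a) =
      (Matrix.vandermonde l).transpose * (Matrix.diagonal w * Matrix.vandermonde l) := by
    ext i j
    rw [Matrix.mul_apply]
    simp only [Matrix.diagonal_mul, Matrix.vandermonde_apply, Matrix.transpose_apply,
      Matrix.of_apply]
    exact Finset.sum_congr rfl fun a _ => by ring
  rw [this, Matrix.det_mul, Matrix.det_mul, Matrix.det_transpose, Matrix.det_diagonal]
  ring

/-- If the moments `∑ λ_a ^ i w_a` lie in `S`, the polynomial that interpolates the values `w_a` at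
the points `λ_a` has coefficients in `S`. -/
theorem exists_interpolation (hl : ∀ i : ℕ, ∑ a, l a ^ i ∈ S)
    {t : R} (htS : t ∈ S) (ht : (Matrix.vandermonde l).det ^ 2 * t = 1) {w : Fin n → R}
    (hw : ∀ i : ℕ, ∑ a, l a ^ i * w a ∈ S) :
    ∃ c : Fin n → S, ∀ a, w a = ∑ i, (c i : R) * l a ^ (i : ℕ) := by
  set V := Matrix.vandermonde l with hV
  let G : Matrix (Fin n) (Fin n) S := Matrix.of fun i j => ⟨∑ a, l a ^ (i + j : ℕ), hl _⟩
  let y : Fin n → S := fun i => ⟨∑ a, l a ^ (i : ℕ) * w a, hw _⟩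
  have hG : S.val.toRingHom.mapMatrix G = V.transpose * V := by
    ext i j
    simp [G, hV, Matrix.mul_apply, Matrix.vandermonde_apply, pow_add]
  have hy : (fun i => S.val (y i)) = V.transpose.mulVec w := by
    funext i
    simp [y, hV, Matrix.mulVec, dotProduct, Matrix.vandermonde_apply]
  let c : Fin n → S := (⟨t, htS⟩ : S) • G.adjugate.mulVec y
  have hc : (fun i => S.val (c i)) = t • (V.transpose * V).adjugate.mulVec (V.transpose.mulVec w) := by
    rw [← hG, ← RingHom.map_adjugate, ← hy]
    funext i
    simp [c, Matrix.mulVec, dotProduct]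
  have hdet : IsUnit V.det := by
    refine (isUnit_pow_iff two_ne_zero).1 (IsUnit.of_mul_eq_one _ ht)
  have hinj : Function.Injective V.transpose.mulVec := by
    apply Matrix.mulVec_injective_of_isUnit
    rw [Matrix.isUnit_iff_isUnit_det, Matrix.det_transpose]
    exact hdet
  have h1 : V.mulVec (fun i => S.val (c i)) = w := by
    apply hinj
    rw [hc, Matrix.mulVec_mulVec, Matrix.mulVec_smul, Matrix.mulVec_mulVec, Matrix.mul_adjugate,
      Matrix.det_mul, Matrix.det_transpose, Matrix.smul_mulVec, Matrix.one_mulVec, smul_smul,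
      mul_comm t, ← pow_two, ht, one_smul]
  refine ⟨c, fun a => ?_⟩
  rw [← h1]
  simp [Matrix.mulVec, dotProduct, hV, Matrix.vandermonde_apply, mul_comm]

theorem aeval_mem_of_isSymmetric (hl : ∀ i : ℕ, ∑ a, l a ^ i ∈ S) {G : MvPolynomial (Fin n) S}
    (hG : G.IsSymmetric) : aeval l G ∈ S := by
  obtain ⟨F, hF⟩ := esymmAlgHom_fin_surjective (R := S) (le_refl n) ⟨G, hG⟩
  have h1 : aeval (fun i : Fin n => esymm (Fin n) S (i + 1)) F = G := by
    have := congrArg Subtype.val hF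
    rwa [esymmAlgHom_apply] at this
  rw [← h1, comp_aeval_apply]
  have h2 : ∀ i : Fin n, aeval l (esymm (Fin n) S (i + 1)) =
      algebraMap S R ⟨(Finset.univ.val.map l).esymm (i + 1), esymm_mem hl _⟩ := by
    intro i
    rw [aeval_esymm_eq_multiset_esymm]
    rfl
  have h3 := aeval_algebraMap_apply R
    (fun i : Fin n => (⟨(Finset.univ.val.map l).esymm (i + 1), esymm_mem hl _⟩ : S)) F
  simp only [h2]
  refine Set.mem_of_eq_of_mem h3 ?_
  exact Subtype.coe_prop _

/-- If `S` contains the power sums of the `λ_a` and the coefficients of a polynomial interpolating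
`w_a` at `λ_a`, it contains all invariants of `S_n` in the pairs `(λ_a, w_a)`. -/
theorem aeval_symInvariants_mem (hl : ∀ i : ℕ, ∑ a, l a ^ i ∈ S) {w : Fin n → R}
    {c : Fin n → S} (hc : ∀ a, w a = ∑ i, (c i : R) * l a ^ (i : ℕ))
    {f : MvPolynomial (Fin n ⊕ Fin n) ℂ} (hf : f ∈ symInvariants n) :
    aeval (Sum.elim l w) f ∈ S := by
  let F : MvPolynomial (Fin n) S :=
    aeval (Sum.elim X fun a => ∑ i : Fin n, C (c i) * X a ^ (i : ℕ)) f
  have hF : ∀ σ : Equiv.Perm (Fin n), aeval (l ∘ σ) F = aeval (Sum.elim l w) f := by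
    intro σ
    have h1 : aeval (Sum.elim l w) f = aeval (Sum.elim (l ∘ σ) (w ∘ σ)) f := by
      conv_lhs => rw [← hf σ]
      rw [aeval_rename, Sum.elim_comp_map]
    rw [h1]
    have h2 : ((aeval (l ∘ σ) : MvPolynomial (Fin n) S →ₐ[S] R).restrictScalars ℂ).comp
        (aeval (Sum.elim X fun a => ∑ i : Fin n, C (c i) * X a ^ (i : ℕ))) =
        aeval (Sum.elim (l ∘ σ) (w ∘ σ)) := by
      apply MvPolynomial.algHom_ext
      rintro (a | a)
      · simp
      · simp [hc]
    exact DFunLike.congr_fun h2 f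
  have hG : (∑ σ : Equiv.Perm (Fin n), rename σ F).IsSymmetric := by
    intro ρ
    rw [map_sum]
    simp only [rename_rename]
    exact Fintype.sum_equiv (Equiv.mulLeft ρ) _ _ fun σ => rfl
  have h1 := aeval_mem_of_isSymmetric hl hG
  simp only [map_sum, aeval_rename, hF, Finset.sum_const, Finset.card_univ] at h1
  have h3 : aeval (Sum.elim l w) f = (Fintype.card (Equiv.Perm (Fin n)) : ℂ)⁻¹ •
      (Fintype.card (Equiv.Perm (Fin n)) • aeval (Sum.elim l w) f) := by
    rw [← Nat.cast_smul_eq_nsmul ℂ, smul_smul, inv_mul_cancel₀, one_smul]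
    exact Nat.cast_ne_zero.2 Fintype.card_ne_zero
  rw [h3]
  exact S.smul_mem h1 _

theorem isIntegral_of_interpolation (hl : ∀ i : ℕ, ∑ a, l a ^ i ∈ S) {w : Fin n → R}
    {c : Fin n → S} (hc : ∀ a, w a = ∑ i, (c i : R) * l a ^ (i : ℕ)) (a : Fin n) :
    IsIntegral S (w a) := by
  rw [hc]
  exact IsIntegral.sum _ fun i _ => (isIntegral_algebraMap (x := c i)).mul
    ((isIntegral_of_powerSum_mem hl a).pow _)

end

section

variable {k m : ℕ} {R : Type} [CommRing R] [Algebra ℂ R] (τ : ℂ)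
  {s : SlicePos k m ⊕ SlicePos k m → R} {S : Subalgebra ℂ R}

/-- If `S` contains the invariant functions and the inverse of `bracketDet`, it contains the inverse
of the discriminant of `A`. -/
theorem exists_inverse_vandermonde (hS : ∀ f ∈ invariants k m, sliceHom τ s f ∈ S)
    {t : R} (htS : t ∈ S) (ht : bracketDet s * t = 1) :
    ∃ t' ∈ S, (Matrix.vandermonde fun a => s (Sum.inl (Sum.inl a))).det ^ 2 * t' = 1 := by
  have h1 : (Matrix.vandermonde fun a => s (Sum.inl (Sum.inl a))).det ^ 2 *
      ∏ a, s (Sum.inl (Sum.inr (Sum.inl a))) ∈ S := by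
    rw [← vandermonde_gram_det]
    refine det_mem_of_forall_mem _ fun i j => ?_
    have := hS _ (covariant k m 1 0 (i + j)).2
    rw [sliceHom_covariant] at this
    simpa [mati, matj, sliceHom_i_zero, sliceHom_j_one, mul_comm] using this
  refine ⟨(∏ i : Fin k, ((i : ℕ) + 1 : R)) * (∏ i : Fin k, ((i : ℕ) + 2 : R)) *
    ((Matrix.vandermonde fun a => s (Sum.inl (Sum.inl a))).det ^ 2 *
      ∏ a, s (Sum.inl (Sum.inr (Sum.inl a)))) * t, S.mul_mem (S.mul_mem (S.mul_mem ?_ ?_) h1) htS, ?_⟩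
  · exact S.prod_mem fun i _ => S.add_mem (natCast_mem S _) S.one_mem
  · exact S.prod_mem fun i _ => S.add_mem (natCast_mem S _) (ofNat_mem S 2)
  · refine Eq.trans ?_ ht
    rw [bracketDet]
    ring

theorem powerSum_mem (hS : ∀ f ∈ invariants k m, sliceHom τ s f ∈ S) (i : ℕ) :
    ∑ a, s (Sum.inl (Sum.inl a)) ^ i ∈ S := by
  rw [← sliceHom_traceInv τ]
  exact hS _ (traceInv k m i).2

/-- The coordinates of the slice are integral over an algebra `S` that contains the invariant
functions and the inverse of `bracketDet`. For `w = v`, `b` and `v u`, the moments `∑ λ_a ^ i w_a` are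
invariant functions, so `w_a` is a polynomial in `λ_a` with coefficients in `S`. -/
theorem isIntegral_slice (hS : ∀ f ∈ invariants k m, sliceHom τ s f ∈ S)
    {t : R} (htS : t ∈ S) (ht : bracketDet s * t = 1) (x : SlicePos k m ⊕ SlicePos k m) :
    IsIntegral S (s x) := by
  have hl := powerSum_mem τ hS
  obtain ⟨t', ht'S, ht'⟩ := exists_inverse_vandermonde τ hS htS ht
  have key : ∀ w : Fin k → R, (∀ i : ℕ, ∑ a, s (Sum.inl (Sum.inl a)) ^ i * w a ∈ S) →
      ∀ a, IsIntegral S (w a) := by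
    intro w hw
    obtain ⟨c, hc⟩ := exists_interpolation hl ht'S ht' hw
    exact isIntegral_of_interpolation hl hc
  have hv : ∀ a, IsIntegral S (s (Sum.inl (Sum.inr (Sum.inl a)))) := by
    refine key (fun a => s (Sum.inl (Sum.inr (Sum.inl a)))) fun i => ?_
    have := hS _ (covariant k m 1 0 i).2
    rw [sliceHom_covariant] at this
    simpa [mati, matj, sliceHom_i_zero, sliceHom_j_one, mul_comm] using this
  rcases x with (a | a | e) | (a | a | e)
  · exact isIntegral_of_powerSum_mem hl a
  · exact hv a
  · have : sliceHom τ s (X (Sum.inl (Sum.inr (Sum.inr e)))) ∈ S :=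
      hS _ (freeCoord k m (Sum.inl e)).2
    rw [sliceHom_pos] at this
    exact isIntegral_algebraMap (x := (⟨_, this⟩ : S))
  · refine key (fun a => s (Sum.inr (Sum.inl a))) (fun i => ?_) a
    rw [← sliceHom_traceAB τ]
    exact hS _ (traceAB k m i).2
  · have hu := key (fun a => s (Sum.inl (Sum.inr (Sum.inl a))) * s (Sum.inr (Sum.inr (Sum.inl a))))
      (fun i => by
        have := hS _ (covariant k m 1 1 i).2
        rw [sliceHom_covariant] at this
        simpa [mati, matj, sliceHom_i_one, sliceHom_j_one, mul_comm, mul_left_comm,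
          mul_assoc] using this) a
    have hl' : ∀ a b, IsIntegral S (s (Sum.inl (Sum.inl a)) ^ b) := fun a b =>
      (isIntegral_of_powerSum_mem hl a).pow b
    have hV : IsIntegral S (Matrix.vandermonde fun a => s (Sum.inl (Sum.inl a))).det :=
      IsIntegral.det fun i j => hl' _ _
    -- divide `v_a u_a` by `v_a`, which divides the unit `bracketDet s`
    have h3 : s (Sum.inr (Sum.inr (Sum.inl a))) =
        (s (Sum.inl (Sum.inr (Sum.inl a))) * s (Sum.inr (Sum.inr (Sum.inl a)))) *
        ((∏ i : Fin k, ((i : ℕ) + 1 : R)) * (∏ i : Fin k, ((i : ℕ) + 2 : R)) *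
        (Matrix.vandermonde fun a => s (Sum.inl (Sum.inl a))).det ^ 4 *
        (∏ b ∈ Finset.univ.erase a, s (Sum.inl (Sum.inr (Sum.inl b)))) * t) := by
      have h4 := Finset.mul_prod_erase Finset.univ
        (fun b => s (Sum.inl (Sum.inr (Sum.inl b)))) (Finset.mem_univ a)
      rw [bracketDet, ← h4] at ht
      linear_combination -s (Sum.inr (Sum.inr (Sum.inl a))) * ht
    rw [h3]
    refine hu.mul ((((IsIntegral.mul ?_ ?_).mul (hV.pow 4)).mul
      (IsIntegral.prod _ fun b _ => hv b)).mul (isIntegral_algebraMap (x := (⟨t, htS⟩ : S))))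
    · exact IsIntegral.prod _ fun i _ => (isIntegral_algebraMap (x := ((i : ℕ) + 1 : S)))
    · exact IsIntegral.prod _ fun i _ => (isIntegral_algebraMap (x := ((i : ℕ) + 2 : S)))
  · have : sliceHom τ s (X (Sum.inr (Sum.inr (Sum.inr e)))) ∈ S :=
      hS _ (freeCoord k m (Sum.inr e)).2
    rw [sliceHom_mom] at this
    exact isIntegral_algebraMap (x := (⟨_, this⟩ : S))

end

section

variable {k m : ℕ} (τ : ℂ)

theorem sliceRestrict_mem_range {d : InstantonAlgebra k m τ} {R : Type} [CommRing R] [Algebra ℂ R]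
    [IsReduced R] {s : SlicePos k m ⊕ SlicePos k m → R} (hs : IsSeparated s)
    (hd : IsUnit (sliceRestrict τ hs d)) (f : Coord k m) (hf : f ∈ invariants k m) :
    sliceHom τ s f ∈ (awayLift (sliceRestrict τ hs) hd).range :=
  ⟨algebraMap _ _ (toInstanton k m τ ⟨f, hf⟩), awayLift_algebraMap _ _ _⟩

theorem inverse_mem_range_awayLift {A R : Type} [CommRing A] [Algebra ℂ A] [CommRing R]
    [Algebra ℂ R] {d : A} (φ : A →ₐ[ℂ] R) (h : IsUnit (φ d)) :
    ∃ t ∈ (awayLift φ h).range, φ d * t = 1 := by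
  refine ⟨_, ⟨IsLocalization.Away.invSelf d, rfl⟩, ?_⟩
  change φ d * awayLift φ h (IsLocalization.Away.invSelf d) = 1
  rw [← awayLift_algebraMap φ h, ← map_mul, IsLocalization.Away.mul_invSelf, map_one]

theorem isUnit_sliceRestrict_instantonDet :
    IsUnit (sliceRestrict τ (isSeparated_sliceGen (k := k) (m := m)) (instantonDet k m τ)) := by
  rw [sliceRestrict_instantonDet]
  exact isUnit_bracketDet_sliceGen

/-- The coordinate ring embeds into the functions on an open part of the slice, which are integral
over a localisation of it. -/
theorem ringKrullDim_instantonAlgebra :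
    ringKrullDim (InstantonAlgebra k m τ) = ((2 * (2 * k + m) : ℕ) : WithBot ℕ∞) := by
  have hcard : Fintype.card (SlicePos k m ⊕ SlicePos k m) = 2 * (2 * k + m) := by
    simp only [Fintype.card_sum, Fintype.card_fin]
    ring
  apply le_antisymm
  · rw [← hcard]
    exact ringKrullDim_le_of_injective bracketDet_X_ne_zero _
      (sliceRestrict_injective τ isSeparated_sliceGen algebraicIndependent_sliceGen)
  · rw [← hcard]
    refine (card_le_ringKrullDim_away bracketDet_X_ne_zero).trans
      (ringKrullDim_le_of_isIntegral _ (isUnit_sliceRestrict_instantonDet (k := k) (m := m) τ)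
        fun x => ?_)
    set S := (awayLift (sliceRestrict τ (isSeparated_sliceGen (k := k) (m := m)))
      (isUnit_sliceRestrict_instantonDet τ)).range with hS
    obtain ⟨t, htS, ht⟩ := inverse_mem_range_awayLift
      (sliceRestrict τ (isSeparated_sliceGen (k := k) (m := m)))
      (isUnit_sliceRestrict_instantonDet τ)
    rw [sliceRestrict_instantonDet] at ht
    have hint := isIntegral_slice τ (sliceRestrict_mem_range τ _ _) htS ht
    have hp : ∀ p : MvPolynomial (SlicePos k m ⊕ SlicePos k m) ℂ,
        IsIntegral S (algebraMap _ (SliceRing k m) p) := by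
      intro p
      rw [← aeval_sliceGen]
      induction p using MvPolynomial.induction_on with
      | C a =>
        rw [aeval_C]
        exact isIntegral_algebraMap (x := algebraMap ℂ S a)
      | add p q hp hq => rw [map_add]; exact hp.add hq
      | mul_X p i hp => rw [map_mul, aeval_X]; exact hp.mul (hint i)
    obtain ⟨n, a, ha⟩ := exists_away_eq _ x
    have h1 : x = algebraMap _ (SliceRing k m) a * t ^ n := by
      rw [← ha, map_pow, mul_assoc, ← mul_pow]
      have h2 : algebraMap (MvPolynomial (SlicePos k m ⊕ SlicePos k m) ℂ) (SliceRing k m)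
          (bracketDet X) = bracketDet sliceGen := map_bracketDet _ _
      rw [h2, ht, one_pow, mul_one]
    rw [h1]
    exact (hp a).mul ((isIntegral_algebraMap (x := (⟨t, htS⟩ : S))).pow n)

theorem isCompletelyIntegrable_integrals :
    IsCompletelyIntegrable (instantonBracket k 0 τ) (integrals k 0 τ) where
  dim := by
    rw [ringKrullDim_instantonAlgebra, Fintype.card_sum, Fintype.card_fin]
    congr 2
    ring
  commute := integrals_bracket τ
  independent := ⟨fun b => toInstanton k 0 τ (conjugates k 0 b),
    mem_nonZeroDivisors_of_ne_zero (instantonDet_ne_zero τ)⟩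

end

/-! ### The bordered matrix with prescribed eigenvalues -/

section

variable {n : ℕ} {R : Type} [CommRing R]

/-- The polynomial `∏_{c ≠ a} (X - l_c)`. -/
noncomputable def cofactorPoly (l : Fin n → R) (a : Fin n) : Polynomial R :=
  Lagrange.nodal (Finset.univ.erase a) l

/-- The inverse of `∏_{c ≠ a} (l_a - l_c)`. -/
noncomputable def nodeInv (l : Fin n → R) (a : Fin n) : R :=
  Ring.inverse (∏ c ∈ Finset.univ.erase a, (l a - l c))

theorem eval_cofactorPoly (l : Fin n → R) (a : Fin n) (x : R) :
    (cofactorPoly l a).eval x = ∏ c ∈ Finset.univ.erase a, (x - l c) :=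
  Lagrange.eval_nodal

theorem eval_cofactorPoly_of_ne (l : Fin n → R) {a b : Fin n} (h : b ≠ a) :
    (cofactorPoly l a).eval (l b) = 0 :=
  Lagrange.eval_nodal_at_node (Finset.mem_erase.2 ⟨h, Finset.mem_univ _⟩)

theorem sub_mul_eval_cofactorPoly (l : Fin n → R) (a : Fin n) (x : R) :
    (x - l a) * (cofactorPoly l a).eval x = ∏ c, (x - l c) := by
  rw [eval_cofactorPoly, Finset.mul_prod_erase _ (fun c => x - l c) (Finset.mem_univ a)]

theorem nodeInv_mul {l : Fin n → R} (hl : ∀ a b, a ≠ b → IsUnit (l a - l b)) (a : Fin n) :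
    nodeInv l a * (cofactorPoly l a).eval (l a) = 1 := by
  rw [eval_cofactorPoly, nodeInv, Ring.inverse_mul_cancel]
  exact (IsUnit.prod_iff).2 fun c hc => hl a c (Finset.ne_of_mem_erase hc).symm

theorem natDegree_cofactorPoly [Nontrivial R] (l : Fin n → R) (a : Fin n) :
    (cofactorPoly l a).natDegree = n - 1 := by
  rw [cofactorPoly, Lagrange.natDegree_nodal, Finset.card_erase_of_mem (Finset.mem_univ a),
    Finset.card_univ, Fintype.card_fin]

/-- Lagrange interpolation. -/
theorem eq_sum_cofactorPoly [IsDomain R] {l : Fin n → R}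
    (hl : ∀ a b, a ≠ b → IsUnit (l a - l b)) {f : Polynomial R} (hf : f.degree < n) :
    f = ∑ a, Polynomial.C (f.eval (l a) * nodeInv l a) * cofactorPoly l a := by
  have hinj : Set.InjOn l (Finset.univ : Finset (Fin n)) := by
    intro a _ b _ hab
    by_contra h
    exact (hl a b h).ne_zero (sub_eq_zero.2 hab)
  refine Polynomial.eq_of_degrees_lt_of_eval_index_eq Finset.univ hinj (by simpa using hf) ?_
    fun b _ => ?_
  · refine lt_of_le_of_lt (Polynomial.degree_sum_le _ _) ?_
    rw [Finset.sup_lt_iff (by simp)]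
    intro a _
    refine lt_of_le_of_lt (Polynomial.degree_mul_le _ _) ?_
    refine lt_of_le_of_lt (add_le_add Polynomial.degree_C_le (Polynomial.degree_le_natDegree)) ?_
    rw [natDegree_cofactorPoly, zero_add, Finset.card_univ, Fintype.card_fin]
    have := a.pos
    exact_mod_cast Nat.sub_lt this one_pos
  · rw [Polynomial.eval_finsetSum, Finset.sum_eq_single b]
    · rw [Polynomial.eval_mul, Polynomial.eval_C, mul_assoc, nodeInv_mul hl, mul_one]
    · intro a _ hab
      rw [Polynomial.eval_mul, eval_cofactorPoly_of_ne l hab.symm, mul_zero]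
    · exact fun h => (h (Finset.mem_univ b)).elim

theorem eval_eq_sum_cofactorPoly [IsDomain R] {l : Fin n → R}
    (hl : ∀ a b, a ≠ b → IsUnit (l a - l b)) {f : Polynomial R} (hf : f.degree < n) (x : R) :
    f.eval x = ∑ a, f.eval (l a) * nodeInv l a * (cofactorPoly l a).eval x := by
  conv_lhs => rw [eq_sum_cofactorPoly hl hf]
  simp [Polynomial.eval_finsetSum]

theorem coeff_eq_sum_cofactorPoly [IsDomain R] {l : Fin (n + 1) → R}
    (hl : ∀ a b, a ≠ b → IsUnit (l a - l b)) {f : Polynomial R} (hf : f.degree < (n + 1 : ℕ)) :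
    f.coeff n = ∑ a, f.eval (l a) * nodeInv l a := by
  conv_lhs => rw [eq_sum_cofactorPoly hl hf]
  rw [Polynomial.finsetSum_coeff]
  refine Finset.sum_congr rfl fun a _ => ?_
  have h1 : (cofactorPoly l a).coeff n = 1 := by
    have h := (Lagrange.nodal_monic (s := Finset.univ.erase a) (v := l))
    rw [Polynomial.Monic, Polynomial.leadingCoeff] at h
    have h2 := natDegree_cofactorPoly l a
    rw [cofactorPoly] at h2 ⊢
    rwa [h2] at h
  rw [Polynomial.coeff_C_mul, h1, mul_one]

end

section

variable {k : ℕ} {R : Type} [CommRing R] (l : Fin k → R) (h : Fin (k + 1) → R)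

/-- The entries `v_a` of the last row of `Â` for which `Â` has the eigenvalues `h`. -/
noncomputable def eigenRow (a : Fin k) : R :=
  -(∏ b, (l a - h b)) * nodeInv l a

/-- The matrix of derivatives of `(v, Λ)` with respect to the eigenvalues `h`. -/
noncomputable def eigenJacobian (U : Type) : Matrix (Fin k ⊕ U) (Fin (k + 1)) R :=
  Matrix.of (Sum.elim (fun a b => nodeInv l a * (cofactorPoly h b).eval (l a)) fun _ _ => 1)

/-- The inverse of `eigenJacobian`; its rows are eigenvectors of `Â`. -/
noncomputable def eigenInverse (U : Type) : Matrix (Fin (k + 1)) (Fin k ⊕ U) R :=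
  Matrix.of fun b => Sum.elim (fun a => (cofactorPoly l a).eval (h b) * nodeInv h b)
    fun _ => (∏ a, (h b - l a)) * nodeInv h b

variable {l h}

/-- The entries of the product are sums over the roots of `∏ (x - h_b)`, evaluated by Lagrange
interpolation. -/
theorem eigenJacobian_mul_eigenInverse [IsDomain R] (U : Type) [Unique U] [Fintype U]
    [DecidableEq U]
    (hl : ∀ a b, a ≠ b → IsUnit (l a - l b)) (hh : ∀ a b, a ≠ b → IsUnit (h a - h b)) :
    eigenJacobian l h U * eigenInverse l h U = 1 := by
  have hdeg : ∀ a, (cofactorPoly l a).degree < (k : ℕ) := by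
    intro a
    refine lt_of_le_of_lt Polynomial.degree_le_natDegree ?_
    rw [natDegree_cofactorPoly]
    have := a.pos
    exact_mod_cast Nat.sub_lt this one_pos
  have hk : ((k : ℕ) : WithBot ℕ) < (k + 1 : ℕ) := by exact_mod_cast Nat.lt_succ_self k
  have hdeg' : (Lagrange.nodal Finset.univ l).degree < (k + 1 : ℕ) := by
    rw [Lagrange.degree_nodal, Finset.card_univ, Fintype.card_fin]
    exact hk
  ext i j
  rw [Matrix.mul_apply]
  rcases i with a | u <;> rcases j with c | u'
  · have h1 := eval_eq_sum_cofactorPoly hh ((hdeg c).trans hk) (l a)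
    have h2 : ∑ b, eigenJacobian l h U (Sum.inl a) b * eigenInverse l h U b (Sum.inl c) =
        nodeInv l a * (cofactorPoly l c).eval (l a) := by
      rw [h1, Finset.mul_sum]
      refine Finset.sum_congr rfl fun b _ => ?_
      simp only [eigenJacobian, eigenInverse, Matrix.of_apply, Sum.elim_inl]
      ring
    rw [h2]
    by_cases hac : a = c
    · rw [hac, nodeInv_mul hl, Matrix.one_apply_eq]
    · rw [eval_cofactorPoly_of_ne l hac, mul_zero, Matrix.one_apply_ne (by simpa using hac)]
  · have h1 := eval_eq_sum_cofactorPoly hh hdeg' (l a)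
    have h2 : ∑ b, eigenJacobian l h U (Sum.inl a) b * eigenInverse l h U b (Sum.inr u') =
        nodeInv l a * (Lagrange.nodal Finset.univ l).eval (l a) := by
      rw [h1, Finset.mul_sum]
      refine Finset.sum_congr rfl fun b _ => ?_
      simp only [eigenJacobian, eigenInverse, Matrix.of_apply, Sum.elim_inl, Sum.elim_inr,
        Lagrange.eval_nodal]
      ring
    rw [h2, Lagrange.eval_nodal_at_node (Finset.mem_univ a), mul_zero,
      Matrix.one_apply_ne Sum.inl_ne_inr]
  · have h1 := coeff_eq_sum_cofactorPoly hh ((hdeg c).trans hk)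
    have h2 : ∑ b, eigenJacobian l h U (Sum.inr u) b * eigenInverse l h U b (Sum.inl c) =
        (cofactorPoly l c).coeff k := by
      rw [h1]
      refine Finset.sum_congr rfl fun b _ => ?_
      simp only [eigenJacobian, eigenInverse, Matrix.of_apply, Sum.elim_inl, Sum.elim_inr, one_mul]
    rw [h2, Polynomial.coeff_eq_zero_of_degree_lt (hdeg c), Matrix.one_apply_ne Sum.inr_ne_inl]
  · have h1 := coeff_eq_sum_cofactorPoly hh hdeg'
    have h2 : ∑ b, eigenJacobian l h U (Sum.inr u) b * eigenInverse l h U b (Sum.inr u') =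
        (Lagrange.nodal Finset.univ l).coeff k := by
      rw [h1]
      refine Finset.sum_congr rfl fun b _ => ?_
      simp only [eigenJacobian, eigenInverse, Matrix.of_apply, Sum.elim_inr, one_mul,
        Lagrange.eval_nodal]
    have h3 : (Lagrange.nodal Finset.univ l).coeff k = 1 := by
      have h4 := Lagrange.nodal_monic (s := Finset.univ) (v := l)
      rw [Polynomial.Monic, Polynomial.leadingCoeff, Lagrange.natDegree_nodal, Finset.card_univ,
        Fintype.card_fin] at h4
      exact h4
    rw [h2, h3, Subsingleton.elim u' u, Matrix.one_apply_eq]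

theorem eigenInverse_mul_eigenJacobian [IsDomain R] (U : Type) [Unique U] [Fintype U]
    [DecidableEq U]
    (hl : ∀ a b, a ≠ b → IsUnit (l a - l b)) (hh : ∀ a b, a ≠ b → IsUnit (h a - h b)) :
    eigenInverse l h U * eigenJacobian l h U = 1 := by
  have : Fintype.card (Fin k ⊕ U) = Fintype.card (Fin (k + 1)) := by simp
  exact (Matrix.mul_eq_one_comm_of_equiv (Fintype.equivOfCardEq this)).1
    (eigenJacobian_mul_eigenInverse U hl hh)

/-- The partial fraction expansion of `∏ (x - h_b) / ∏ (x - l_a)`, cleared of denominators. -/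
theorem sum_eigenRow [IsDomain R] (hl : ∀ a b, a ≠ b → IsUnit (l a - l b)) (x : R) :
    ∑ a, eigenRow l h a * (cofactorPoly l a).eval x =
      (x - (∑ b, h b - ∑ a, l a)) * ∏ a, (x - l a) - ∏ b, (x - h b) := by
  set P := Lagrange.nodal Finset.univ l with hP
  set P' := Lagrange.nodal Finset.univ h with hP'
  set f := (Polynomial.X - Polynomial.C (∑ b, h b - ∑ a, l a)) * P - P' with hf
  have hPd : P.natDegree = k := by simp [hP]
  have hP'd : P'.natDegree = k + 1 := by simp [hP']
  have hPm : P.Monic := Lagrange.nodal_monic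
  have hP'm : P'.Monic := Lagrange.nodal_monic
  have hnext : P'.coeff k = -∑ b, h b := by
    have := Polynomial.nextCoeff_of_natDegree_pos (p := P') (by omega)
    rw [hP'd, Nat.add_sub_cancel] at this
    rw [← this, hP', Lagrange.nodal, Polynomial.prod_X_sub_C_nextCoeff]
  have hdeg : f.degree < (k : ℕ) := by
    rw [Polynomial.degree_lt_iff_coeff_zero]
    intro m hm
    rw [hf, Polynomial.coeff_sub]
    rcases lt_trichotomy m (k + 1) with h1 | h1 | h1
    · have hmk : m = k := by omega
      subst hmk
      rw [hnext, sub_mul, Polynomial.coeff_sub, Polynomial.coeff_C_mul]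
      have h2 : P.coeff m = 1 := by
        have := hPm.coeff_natDegree
        rwa [hPd] at this
      have h3 : (Polynomial.X * P).coeff m = -∑ a, l a := by
        rcases m with _ | m
        · simp
        · rw [Polynomial.coeff_X_mul]
          have := Polynomial.nextCoeff_of_natDegree_pos (p := P) (by omega)
          rw [hPd, Nat.add_sub_cancel] at this
          rw [← this, hP, Lagrange.nodal, Polynomial.prod_X_sub_C_nextCoeff]
      rw [h2, h3]
      ring
    · subst h1
      have h2 : P.coeff k = 1 := by
        have := hPm.coeff_natDegree
        rwa [hPd] at this
      have h3 : P'.coeff (k + 1) = 1 := by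
        have := hP'm.coeff_natDegree
        rwa [hP'd] at this
      rw [sub_mul, Polynomial.coeff_sub, Polynomial.coeff_C_mul, Polynomial.coeff_X_mul, h2, h3,
        Polynomial.coeff_eq_zero_of_natDegree_lt (p := P) (by omega)]
      ring
    · rw [Polynomial.coeff_eq_zero_of_natDegree_lt (p := P') (by omega), sub_zero]
      apply Polynomial.coeff_eq_zero_of_natDegree_lt
      refine lt_of_le_of_lt Polynomial.natDegree_mul_le ?_
      rw [hPd, Polynomial.natDegree_X_sub_C]
      omega
  have h1 := eval_eq_sum_cofactorPoly hl hdeg x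
  have h2 : ∀ y, f.eval y =
      (y - (∑ b, h b - ∑ a, l a)) * ∏ a, (y - l a) - ∏ b, (y - h b) := by
    intro y
    simp only [hf, hP, hP', Polynomial.eval_sub, Polynomial.eval_mul, Polynomial.eval_X,
      Polynomial.eval_C, Lagrange.eval_nodal]
  rw [← h2, h1]
  refine Finset.sum_congr rfl fun a _ => ?_
  have h3 : ∏ c, (l a - l c) = 0 := Finset.prod_eq_zero (Finset.mem_univ a) (sub_self _)
  rw [h2, h3, eigenRow]
  ring

/-- The columns of the transpose of `eigenInverse` are eigenvectors of the bordered matrix. -/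
theorem bordered_mul_eigenInverse [IsDomain R] (hl : ∀ a b, a ≠ b → IsUnit (l a - l b))
    {B : Matrix (Fin k ⊕ Unit) (Fin k ⊕ Unit) R}
    (hB : B = Matrix.fromBlocks (Matrix.diagonal l) (Matrix.of fun _ _ => 1)
      (Matrix.of fun _ a => eigenRow l h a) (Matrix.of fun _ _ => ∑ b, h b - ∑ a, l a)) :
    B * (eigenInverse l h Unit).transpose =
      (eigenInverse l h Unit).transpose * Matrix.diagonal h := by
  ext i b
  rw [Matrix.mul_diagonal, Matrix.transpose_apply, Matrix.mul_apply, Fintype.sum_sum_type]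
  rcases i with a | u
  · have h1 : ∀ c, B (Sum.inl a) (Sum.inl c) = if a = c then l a else 0 := fun c => by
      rw [hB, Matrix.fromBlocks_apply₁₁, Matrix.diagonal_apply]
    have h2 : B (Sum.inl a) (Sum.inr ()) = 1 := by rw [hB]; rfl
    simp only [h1, h2, Finset.univ_unique, Finset.sum_singleton, Matrix.transpose_apply, ite_mul,
      zero_mul, Finset.sum_ite_eq, Finset.mem_univ, if_true, one_mul, eigenInverse,
      Matrix.of_apply, Sum.elim_inl, Sum.elim_inr, PUnit.default_eq_unit]
    rw [← sub_mul_eval_cofactorPoly l a]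
    ring
  · have h1 : ∀ c, B (Sum.inr u) (Sum.inl c) = eigenRow l h c := fun c => by
      rw [hB]; rfl
    have h2 : B (Sum.inr u) (Sum.inr ()) = ∑ b, h b - ∑ a, l a := by rw [hB]; rfl
    simp only [h1, h2, Finset.univ_unique, Finset.sum_singleton, Matrix.transpose_apply,
      eigenInverse, Matrix.of_apply, Sum.elim_inl, Sum.elim_inr, PUnit.default_eq_unit]
    have h3 : ∏ b', (h b - h b') = 0 := Finset.prod_eq_zero (Finset.mem_univ b) (sub_self _)
    have h4 := sum_eigenRow (h := h) hl (h b)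
    rw [h3, sub_zero] at h4
    have h5 : ∑ a, eigenRow l h a * ((cofactorPoly l a).eval (h b) * nodeInv h b) =
        (∑ a, eigenRow l h a * (cofactorPoly l a).eval (h b)) * nodeInv h b := by
      rw [Finset.sum_mul]
      exact Finset.sum_congr rfl fun a _ => by ring
    rw [h5, h4]
    ring

theorem trace_bordered_pow [IsDomain R]
    (hl : ∀ a b, a ≠ b → IsUnit (l a - l b)) (hh : ∀ a b, a ≠ b → IsUnit (h a - h b))
    {B : Matrix (Fin k ⊕ Unit) (Fin k ⊕ Unit) R}
    (hB : B = Matrix.fromBlocks (Matrix.diagonal l) (Matrix.of fun _ _ => 1)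
      (Matrix.of fun _ a => eigenRow l h a) (Matrix.of fun _ _ => ∑ b, h b - ∑ a, l a)) (n : ℕ) :
    (B ^ n).trace = ∑ b, h b ^ n := by
  set N := (eigenInverse l h Unit).transpose
  set W := (eigenJacobian l h Unit).transpose
  have h1 : N * W = 1 := by
    rw [← Matrix.transpose_mul, eigenJacobian_mul_eigenInverse Unit hl hh, Matrix.transpose_one]
  have h2 : W * N = 1 := by
    rw [← Matrix.transpose_mul, eigenInverse_mul_eigenJacobian Unit hl hh, Matrix.transpose_one]
  have h3 : B ^ n * N = N * Matrix.diagonal h ^ n := by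
    induction n with
    | zero => simp
    | succ n ih =>
      rw [pow_succ, Matrix.mul_assoc, bordered_mul_eigenInverse hl hB, ← Matrix.mul_assoc, ih,
        Matrix.mul_assoc, ← pow_succ]
  rw [← Matrix.mul_one (B ^ n), ← h1, ← Matrix.mul_assoc, h3, Matrix.mul_assoc,
    Matrix.trace_mul_comm, Matrix.mul_assoc, h2, Matrix.mul_one, Matrix.diagonal_pow,
    Matrix.trace_diagonal]
  rfl

/-- By `bordered_mul_eigenInverse`, the bordered matrix is conjugate to the diagonal matrix of `h`. -/
theorem charpoly_bordered [IsDomain R]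
    (hl : ∀ a b, a ≠ b → IsUnit (l a - l b)) (hh : ∀ a b, a ≠ b → IsUnit (h a - h b))
    {B : Matrix (Fin k ⊕ Unit) (Fin k ⊕ Unit) R}
    (hB : B = Matrix.fromBlocks (Matrix.diagonal l) (Matrix.of fun _ _ => 1)
      (Matrix.of fun _ a => eigenRow l h a) (Matrix.of fun _ _ => ∑ b, h b - ∑ a, l a)) :
    B.charpoly = ∏ b, (Polynomial.X - Polynomial.C (h b)) := by
  set N := (eigenInverse l h Unit).transpose
  set W := (eigenJacobian l h Unit).transpose
  have h1 : N * W = 1 := by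
    rw [← Matrix.transpose_mul, eigenJacobian_mul_eigenInverse Unit hl hh, Matrix.transpose_one]
  have h2 : W * N = 1 := by
    rw [← Matrix.transpose_mul, eigenInverse_mul_eigenJacobian Unit hl hh, Matrix.transpose_one]
  have h3 : B = (N * Matrix.diagonal h) * W := by
    rw [← bordered_mul_eigenInverse hl hB, Matrix.mul_assoc, h1, Matrix.mul_one]
  rw [h3, Matrix.charpoly_mul_comm_of_le _ _ (by simp), ← Matrix.mul_assoc, h2, Matrix.one_mul,
    Matrix.charpoly_diagonal]
  simp

end

/-! ### Cotangent lifts -/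

section

variable {Q : Type}

theorem canonicalBracket_X_X (a b : Q ⊕ Q) :
    ∃ c : ℂ, canonicalBracket Q (X a) (X b) = algebraMap ℂ _ c := by
  classical
  rcases a with a | a <;> rcases b with b | b
  · exact ⟨0, by rw [canonical_qq, map_zero]⟩
  · exact ⟨if a = b then 1 else 0, by rw [canonical_qp]; split_ifs <;> simp⟩
  · exact ⟨if a = b then -1 else 0, by rw [canonical_pq]; split_ifs <;> simp⟩
  · exact ⟨0, by rw [canonical_pp, map_zero]⟩

theorem canonicalBracket_X_comm (a b : Q ⊕ Q) (f : MvPolynomial (Q ⊕ Q) ℂ) :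
    canonicalBracket Q (X a) (canonicalBracket Q (X b) f) =
      canonicalBracket Q (X b) (canonicalBracket Q (X a) f) := by
  have : ⁅canonicalBracket Q (X a), canonicalBracket Q (X b)⁆ = 0 := by
    apply MvPolynomial.derivation_ext
    intro i
    obtain ⟨c, hc⟩ := canonicalBracket_X_X a i
    obtain ⟨c', hc'⟩ := canonicalBracket_X_X b i
    rw [Derivation.commutator_apply, hc, hc', Derivation.map_algebraMap, Derivation.map_algebraMap]
    simp
  have h := DFunLike.congr_fun this f
  rw [Derivation.commutator_apply] at h
  exact sub_eq_zero.1 h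

variable (d : MvPolynomial (Q ⊕ Q) ℂ)

/-- The canonical bracket of the localised polynomial ring. -/
noncomputable abbrev awayBracket : PoissonBracket (Localization.Away d) :=
  localizeBracket (canonicalBracket Q) d

/-- The canonical coordinates of the localised polynomial ring. -/
noncomputable def awayX (a : Q ⊕ Q) : Localization.Away d :=
  algebraMap (MvPolynomial (Q ⊕ Q) ℂ) _ (X a)

theorem awayBracket_X_comm (a b : Q ⊕ Q) (z : Localization.Away d) :
    awayBracket d (awayX d a) (awayBracket d (awayX d b) z) =
      awayBracket d (awayX d b) (awayBracket d (awayX d a) z) := by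
  have : ⁅awayBracket d (awayX d a), awayBracket d (awayX d b)⁆ = 0 := by
    apply derivation_localization_ext
    intro f
    simp only [Derivation.commutator_apply, awayX, localizeBracket_algebraMap]
    rw [canonicalBracket_X_comm, sub_self]
    rfl
  have h := DFunLike.congr_fun this z
  rw [Derivation.commutator_apply] at h
  exact sub_eq_zero.1 h

variable [Fintype Q]

/-- The bracket `∑ ∂_q f ∂_p g - ∂_p f ∂_q g`, for given derivations `∂_p` and `∂_q`. -/
noncomputable def bracketOfPartials {R : Type} [CommRing R] [Algebra ℂ R]
    (D E : Q → Derivation ℂ R R) : PoissonBracket R :=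
  ∑ c, ((LinearMap.toSpanSingleton R (Derivation ℂ R R) (E c)).compDer (D c) -
    (LinearMap.toSpanSingleton R (Derivation ℂ R R) (D c)).compDer (E c))

theorem bracketOfPartials_apply {R : Type} [CommRing R] [Algebra ℂ R]
    (D E : Q → Derivation ℂ R R) (f g : R) :
    bracketOfPartials D E f g = ∑ c, (D c f * E c g - E c f * D c g) := by
  have h : ∀ {M : Type} [AddCommGroup M] [Module R M] [Module ℂ M] (F : Q → Derivation ℂ R M) (z : R),
      (∑ c, F c) z = ∑ c, F c z := fun F z => by
    rw [← Derivation.coeFnAddMonoidHom_apply, map_sum, Finset.sum_apply]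
    rfl
  rw [bracketOfPartials, h, h]
  simp

theorem canonicalBracket_eq (f g : MvPolynomial (Q ⊕ Q) ℂ) :
    canonicalBracket Q f g = ∑ c,
      (canonicalBracket Q (X (Sum.inr c)) g * canonicalBracket Q (X (Sum.inl c)) f -
        canonicalBracket Q (X (Sum.inr c)) f * canonicalBracket Q (X (Sum.inl c)) g) := by
  have : canonicalBracket Q = bracketOfPartials
      (fun c => -canonicalBracket Q (X (Sum.inr c))) fun c => canonicalBracket Q (X (Sum.inl c)) := by
    apply MvPolynomial.derivation_ext
    intro i
    apply MvPolynomial.derivation_ext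
    intro j
    classical
    rw [bracketOfPartials_apply]
    rcases i with i | i <;> rcases j with j | j <;>
      simp [canonical_qq, canonical_pp, canonical_qp, canonical_pq]
    all_goals
      by_cases h : i = j
      · simp [h]
      · simp [h, Ne.symm h]
  rw [this, bracketOfPartials_apply, ← this]
  refine Finset.sum_congr rfl fun c _ => ?_
  simp only [Derivation.neg_apply]
  ring

theorem awayBracket_eq (z w : Localization.Away d) :
    awayBracket d z w = ∑ c,
      (awayBracket d (awayX d (Sum.inr c)) w * awayBracket d (awayX d (Sum.inl c)) z -
        awayBracket d (awayX d (Sum.inr c)) z * awayBracket d (awayX d (Sum.inl c)) w) := by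
  have : awayBracket d = bracketOfPartials (fun c => -awayBracket d (awayX d (Sum.inr c)))
      fun c => awayBracket d (awayX d (Sum.inl c)) := by
    apply derivation_localization_ext
    intro f
    apply derivation_localization_ext
    intro g
    rw [bracketOfPartials_apply]
    simp only [awayX, localizeBracket_algebraMap, Derivation.neg_apply]
    rw [canonicalBracket_eq, map_sum]
    refine Finset.sum_congr rfl fun c _ => ?_
    rw [map_sub, map_mul, map_mul]
    ring
  conv_lhs => rw [this]
  rw [bracketOfPartials_apply]
  refine Finset.sum_congr rfl fun c _ => ?_
  simp only [Derivation.neg_apply]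
  ring

theorem awayBracket_skew (z w : Localization.Away d) :
    awayBracket d z w = -awayBracket d w z := by
  rw [awayBracket_eq, awayBracket_eq d w z, ← Finset.sum_neg_distrib]
  exact Finset.sum_congr rfl fun c _ => by ring

/-- New positions that are functions of the old ones only, together with momenta `y` for which the
canonical one-forms `∑ p_c dq_c` and `∑ y_i dx_i` agree, are canonical. -/
theorem isCanonical_of_oneForm {R I : Type} [CommRing R] [Algebra ℂ R] [Fintype I] [DecidableEq I]
    (γ : PoissonBracket R) {q p : Q → R} {x y : I → R}
    (hγ : ∀ z w, γ z w = ∑ c, (γ (p c) w * γ (q c) z - γ (p c) z * γ (q c) w))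
    (hqp : ∀ c e z, γ (q c) (γ (p e) z) = γ (p e) (γ (q c) z))
    (hpp : ∀ c e z, γ (p c) (γ (p e) z) = γ (p e) (γ (p c) z))
    (hpp0 : ∀ c e, γ (p c) (p e) = 0)
    (N : Q → I → R) (hx : ∀ c i, γ (q c) (x i) = 0)
    (hN : ∀ i j, ∑ c, γ (x i) (p c) * N c j = if i = j then 1 else 0)
    (hy : ∀ c, p c = ∑ i, γ (x i) (p c) * y i) :
    IsCanonical γ (Sum.elim x y) := by
  have hskew : ∀ z w, γ z w = -γ w z := fun z w => by
    rw [hγ, hγ w z, ← Finset.sum_neg_distrib]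
    exact Finset.sum_congr rfl fun c _ => by ring
  have hQ : ∀ z w, (∀ c, γ (q c) z = 0) → (∀ c, γ (q c) w = 0) → γ z w = 0 := by
    intro z w hz hw
    rw [hγ]
    refine Finset.sum_eq_zero fun c _ => ?_
    rw [hz c, hw c, mul_zero, mul_zero, sub_zero]
  obtain ⟨J, hJ⟩ : ∃ J : I → Q → R, ∀ i c, J i c = γ (x i) (p c) := ⟨_, fun _ _ => rfl⟩
  have hJ' : ∀ i c, J i c = -γ (p c) (x i) := fun i c => (hJ i c).trans (hskew _ _)
  simp only [← hJ] at hN hy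
  have hJq : ∀ i c e, γ (q e) (J i c) = 0 := by
    intro i c e
    rw [hJ', map_neg, neg_eq_zero, hqp, hx, map_zero]
  have hJp : ∀ i c e, γ (p e) (J i c) = γ (p c) (J i e) := by
    intro i c e
    rw [hJ', hJ', map_neg, map_neg, hpp]
  have hB : ∀ z e, γ z (p e) = ∑ i, (J i e * γ z (y i) + y i * γ z (J i e)) := by
    intro z e
    conv_lhs => rw [hy e]
    rw [map_sum]
    refine Finset.sum_congr rfl fun i _ => ?_
    rw [Derivation.leibniz, smul_eq_mul, smul_eq_mul]
  have hA : ∀ z e, (∀ c, γ (q c) z = 0) → γ z (p e) = ∑ i, J i e * γ z (y i) := by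
    intro z e hz
    rw [hB]
    refine Finset.sum_congr rfl fun i _ => ?_
    rw [hQ z (J i e) hz (hJq i e), mul_zero, add_zero]
  have hN' : ∀ (u : I → R) (j : I), ∑ c, (∑ i, J i c * u i) * N c j = u j := by
    intro u j
    simp only [Finset.sum_mul]
    rw [Finset.sum_comm]
    have : ∀ i, ∑ c, J i c * u i * N c j = if i = j then u i else 0 := by
      intro i
      have h1 : (if i = j then u i else 0) = u i * if i = j then 1 else 0 := by simp
      rw [h1, ← hN, Finset.mul_sum]
      exact Finset.sum_congr rfl fun c _ => by ring
    simp [this]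
  have key : ∀ c e, ∑ l, J l c * ∑ m, J m e * γ (y l) (y m) = 0 := by
    intro c e
    have h1 : ∑ l, J l c * γ (y l) (p e) = ∑ l, y l * γ (p e) (J l c) := by
      have h := hB (p e) c
      rw [hpp0, Finset.sum_add_distrib] at h
      have h' : ∑ l, J l c * γ (y l) (p e) = -∑ l, J l c * γ (p e) (y l) := by
        rw [← Finset.sum_neg_distrib]
        exact Finset.sum_congr rfl fun l _ => by rw [hskew (y l)]; ring
      rw [h']
      linear_combination h
    have h2 : ∑ l, J l c * ∑ m, y m * γ (y l) (J m e) = ∑ m, y m * γ (p e) (J m c) := by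
      simp only [Finset.mul_sum]
      rw [Finset.sum_comm]
      refine Finset.sum_congr rfl fun m _ => ?_
      rw [hJp, hskew (p c), hA _ _ (hJq m e), ← Finset.sum_neg_distrib, Finset.mul_sum]
      exact Finset.sum_congr rfl fun l _ => by rw [hskew (y l)]; ring
    have h3 : ∑ l, J l c * γ (y l) (p e) = ∑ l, J l c * ∑ m, J m e * γ (y l) (y m) +
        ∑ l, J l c * ∑ m, y m * γ (y l) (J m e) := by
      rw [← Finset.sum_add_distrib]
      refine Finset.sum_congr rfl fun l _ => ?_
      rw [hB, Finset.sum_add_distrib, mul_add]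
    rw [h1, h2] at h3
    linear_combination -h3
  have hyy : ∀ i j, γ (y i) (y j) = 0 := by
    intro i j
    have h1 : ∀ e, ∑ m, J m e * γ (y i) (y m) = 0 := by
      intro e
      rw [← hN' (fun l => ∑ m, J m e * γ (y l) (y m)) i]
      exact Finset.sum_eq_zero fun c _ => by rw [key, zero_mul]
    rw [← hN' (fun m => γ (y i) (y m)) j]
    exact Finset.sum_eq_zero fun c _ => by rw [h1, zero_mul]
  have hxy : ∀ i j, γ (x i) (y j) = if i = j then 1 else 0 := by
    intro i j
    rw [← hN i j, ← hN' (fun m => γ (x i) (y m)) j]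
    refine Finset.sum_congr rfl fun c _ => ?_
    rw [← hA (x i) c fun e => hx e i, hJ]
  exact ⟨hskew, fun i j => hQ _ _ (fun c => hx c i) (fun c => hx c j), hyy, hxy⟩

theorem isCanonical_cotangentLift {I : Type} [Fintype I] [DecidableEq I]
    {x y : I → Localization.Away d} (N : Q → I → Localization.Away d)
    (hx : ∀ c i, awayBracket d (awayX d (Sum.inl c)) (x i) = 0)
    (hN : ∀ i j, ∑ c, awayBracket d (x i) (awayX d (Sum.inr c)) * N c j = if i = j then 1 else 0)
    (hy : ∀ c, awayX d (Sum.inr c) = ∑ i, awayBracket d (x i) (awayX d (Sum.inr c)) * y i) :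
    IsCanonical (awayBracket d) (Sum.elim x y) := by
  refine isCanonical_of_oneForm (awayBracket d) (q := fun c => awayX d (Sum.inl c))
    (p := fun c => awayX d (Sum.inr c)) (awayBracket_eq d)
    (fun c e => awayBracket_X_comm d (Sum.inl c) (Sum.inr e))
    (fun c e => awayBracket_X_comm d (Sum.inr c) (Sum.inr e)) (fun c e => ?_) N hx hN hy
  classical
  rw [awayX, awayX, localizeBracket_algebraMap, canonical_pp, map_zero]

end

/-! ### The generic point of the space of eigenvalues and their momenta -/

section

variable {n : ℕ} {R : Type} [CommRing R]

theorem isUnit_prod_erase {l : Fin n → R} (hl : ∀ a b, a ≠ b → IsUnit (l a - l b)) (a : Fin n) :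
    IsUnit (∏ c ∈ Finset.univ.erase a, (l a - l c)) :=
  IsUnit.prod_iff.2 fun c hc => hl a c (Finset.ne_of_mem_erase hc).symm

theorem prod_erase_comp_perm {M : Type} [CommMonoid M] (σ : Equiv.Perm (Fin n)) (f : Fin n → M)
    (a : Fin n) : ∏ c ∈ Finset.univ.erase a, f (σ c) = ∏ c ∈ Finset.univ.erase (σ a), f c := by
  refine Finset.prod_bij (fun c _ => σ c) (fun c hc => ?_) (fun c _ c' _ h => σ.injective h)
    (fun c hc => ?_) fun c _ => rfl
  · simpa using hc
  · exact ⟨σ.symm c, by simpa [Equiv.symm_apply_eq] using hc, by simp⟩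

theorem nodeInv_comp_perm (σ : Equiv.Perm (Fin n)) (l : Fin n → R) (a : Fin n) :
    nodeInv (l ∘ σ) a = nodeInv l (σ a) := by
  simp only [nodeInv, Function.comp]
  rw [prod_erase_comp_perm σ (fun c => l (σ a) - l c)]

theorem eigenRow_comp_perm {k : ℕ} (σ : Equiv.Perm (Fin k)) (ρ : Equiv.Perm (Fin (k + 1)))
    (l : Fin k → R) (h : Fin (k + 1) → R) (a : Fin k) :
    eigenRow (l ∘ σ) (h ∘ ρ) a = eigenRow l h (σ a) := by
  simp only [eigenRow, nodeInv_comp_perm]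
  congr 2
  exact Equiv.prod_comp ρ fun b => l (σ a) - h b

theorem eigenInverse_comp_perm {k : ℕ} (U : Type) (σ : Equiv.Perm (Fin k))
    (ρ : Equiv.Perm (Fin (k + 1)))
    (l : Fin k → R) (h : Fin (k + 1) → R) (b : Fin (k + 1)) (i : Fin k ⊕ U) :
    eigenInverse (l ∘ σ) (h ∘ ρ) U b i = eigenInverse l h U (ρ b) (Sum.map σ id i) := by
  rcases i with a | u
  · simp only [eigenInverse, Matrix.of_apply, Sum.elim_inl, Sum.map_inl, nodeInv_comp_perm,
      eval_cofactorPoly, Function.comp]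
    rw [prod_erase_comp_perm σ (fun c => h (ρ b) - l c)]
  · simp only [eigenInverse, Matrix.of_apply, Sum.elim_inr, Sum.map_inr, nodeInv_comp_perm,
      Function.comp]
    rw [Equiv.prod_comp σ fun a => h (ρ b) - l a]

variable [Algebra ℂ R] {S : Type} [CommRing S] [Algebra ℂ S] (φ : R →ₐ[ℂ] S)

theorem map_nodeInv {l : Fin n → R} (hl : ∀ a b, a ≠ b → IsUnit (l a - l b)) (a : Fin n) :
    φ (nodeInv l a) = nodeInv (φ ∘ l) a := by
  rw [nodeInv, map_ringInverse φ (isUnit_prod_erase hl a), map_prod, nodeInv]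
  simp

theorem map_eigenRow {k : ℕ} {l : Fin k → R} (h : Fin (k + 1) → R)
    (hl : ∀ a b, a ≠ b → IsUnit (l a - l b)) (a : Fin k) :
    φ (eigenRow l h a) = eigenRow (φ ∘ l) (φ ∘ h) a := by
  simp only [eigenRow, map_mul, map_neg, map_prod, map_sub, map_nodeInv φ hl, Function.comp]

theorem map_eigenInverse {k : ℕ} (U : Type) (l : Fin k → R) {h : Fin (k + 1) → R}
    (hh : ∀ a b, a ≠ b → IsUnit (h a - h b)) (b : Fin (k + 1)) (i : Fin k ⊕ U) :
    φ (eigenInverse l h U b i) = eigenInverse (φ ∘ l) (φ ∘ h) U b i := by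
  rcases i with a | u <;>
    simp only [eigenInverse, Matrix.of_apply, Sum.elim_inl, Sum.elim_inr, map_mul,
      map_nodeInv φ hh, eval_cofactorPoly, map_prod, map_sub, Function.comp]

variable (D : Derivation ℂ R R)

theorem derivation_prod_eq_zero {ι : Type} (s : Finset ι) {f : ι → R} (hf : ∀ i ∈ s, D (f i) = 0) :
    D (∏ i ∈ s, f i) = 0 :=
  Finset.prod_induction f (fun x => D x = 0) (fun a b ha hb => by simp [ha, hb])
    D.map_one_eq_zero hf

theorem derivation_inverse_eq_zero {x : R} (hx : D x = 0) : D (Ring.inverse x) = 0 := by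
  by_cases hu : IsUnit x
  · have h := congrArg D (Ring.mul_inverse_cancel x hu)
    rw [Derivation.leibniz, hx, D.map_one_eq_zero, smul_zero, add_zero, smul_eq_mul] at h
    exact hu.mul_right_eq_zero.1 h
  · rw [Ring.inverse_non_unit x hu, map_zero]

theorem derivation_nodeInv_eq_zero {l : Fin n → R} (hl : ∀ a, D (l a) = 0) (a : Fin n) :
    D (nodeInv l a) = 0 :=
  derivation_inverse_eq_zero D (derivation_prod_eq_zero D _ fun c _ => by simp [hl])

theorem derivation_eigenRow_eq_zero {k : ℕ} {l : Fin k → R} {h : Fin (k + 1) → R}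
    (hl : ∀ a, D (l a) = 0) (hh : ∀ b, D (h b) = 0) (a : Fin k) : D (eigenRow l h a) = 0 := by
  have h1 : D (∏ b, (l a - h b)) = 0 := derivation_prod_eq_zero D _ fun b _ => by simp [hl, hh]
  rw [eigenRow, Derivation.leibniz, derivation_nodeInv_eq_zero D hl, map_neg, h1]
  simp

/-- The derivative of `v_a` with respect to an eigenvalue `h_b`. -/
theorem derivation_eigenRow {k : ℕ} {l : Fin k → R} {h : Fin (k + 1) → R} (U : Type)
    (hl : ∀ a, D (l a) = 0) {b : Fin (k + 1)} (hh : ∀ b', D (h b') = if b' = b then 1 else 0)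
    (a : Fin k) : D (eigenRow l h a) = eigenJacobian l h U (Sum.inl a) b := by
  have h1 : D ((cofactorPoly h b).eval (l a)) = 0 := by
    rw [eval_cofactorPoly]
    refine derivation_prod_eq_zero D _ fun c hc => ?_
    rw [map_sub, hl, hh, if_neg (Finset.ne_of_mem_erase hc), sub_zero]
  rw [eigenRow, ← sub_mul_eval_cofactorPoly h b, Derivation.leibniz, map_neg, Derivation.leibniz,
    derivation_nodeInv_eq_zero D hl, h1, map_sub, hl, hh, if_pos rfl]
  simp only [eigenJacobian, Matrix.of_apply, Sum.elim_inl, smul_eq_mul]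
  ring

end

section

variable (k : ℕ)

/-- The positions on the space of eigenvalues: the eigenvalues of `A` and those of `Â`. -/
abbrev EigenPos (k : ℕ) : Type := Fin k ⊕ Fin (k + 1)

/-- The identification of the coordinates of `T^* ℂ^k × T^* ℂ^{k+1}` and `T^* (ℂ^k × ℂ^{k+1})`. -/
def eigenReindex : (Fin k ⊕ Fin k) ⊕ (Fin (k + 1) ⊕ Fin (k + 1)) ≃ EigenPos k ⊕ EigenPos k :=
  Equiv.sumSumSumComm _ _ _ _

/-- The discriminants `Δ`, as a polynomial on `T^* (ℂ^k × ℂ^{k+1})`. -/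
noncomputable def eigenDelta : MvPolynomial (EigenPos k ⊕ EigenPos k) ℂ :=
  rename (eigenReindex k) (eigenvalueDelta k)

/-- The resultant, as a polynomial on `T^* (ℂ^k × ℂ^{k+1})`. -/
noncomputable def eigenResultant : MvPolynomial (EigenPos k ⊕ EigenPos k) ℂ :=
  rename (eigenReindex k) (eigenvalueResultant k)

theorem eigenDelta_eq : eigenDelta k =
    (∏ x ∈ (Finset.univ : Finset (Fin k)).offDiag,
      (X (Sum.inl (Sum.inl x.1)) - X (Sum.inl (Sum.inl x.2)))) *
    ∏ x ∈ (Finset.univ : Finset (Fin (k + 1))).offDiag,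
      (X (Sum.inl (Sum.inr x.1)) - X (Sum.inl (Sum.inr x.2))) := by
  simp [eigenDelta, eigenvalueDelta, eigenReindex]

theorem eigenResultant_eq : eigenResultant k =
    ∏ a : Fin k, ∏ b : Fin (k + 1), (X (Sum.inl (Sum.inl a)) - X (Sum.inl (Sum.inr b))) := by
  simp [eigenResultant, eigenvalueResultant, eigenReindex]

theorem eigenDelta_mul_eigenResultant_ne_zero : eigenDelta k * eigenResultant k ≠ 0 := by
  rw [eigenDelta_eq, eigenResultant_eq]
  have h : ∀ a b : EigenPos k, a ≠ b →
      (X (Sum.inl a) - X (Sum.inl b) : MvPolynomial (EigenPos k ⊕ EigenPos k) ℂ) ≠ 0 := by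
    intro a b hab h0
    exact hab (Sum.inl_injective (X_injective (sub_eq_zero.1 h0)))
  refine mul_ne_zero (mul_ne_zero ?_ ?_) ?_
  · exact Finset.prod_ne_zero_iff.2 fun x hx => h _ _ (by simpa using hx)
  · exact Finset.prod_ne_zero_iff.2 fun x hx => h _ _ (by simpa using hx)
  · exact Finset.prod_ne_zero_iff.2 fun a _ => Finset.prod_ne_zero_iff.2 fun b _ => h _ _ (by simp)

/-- The functions on the part of `T^* (ℂ^k × ℂ^{k+1})` where all eigenvalues are distinct. -/
abbrev EigenRing : Type := Localization.Away (eigenDelta k * eigenResultant k)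

instance : IsDomain (EigenRing k) :=
  IsLocalization.isDomain_localization
    (powers_le_nonZeroDivisors_of_noZeroDivisors (eigenDelta_mul_eigenResultant_ne_zero k))

/-- The Poisson bracket of `EigenRing k`. -/
noncomputable abbrev eigenBracket : PoissonBracket (EigenRing k) :=
  awayBracket (eigenDelta k * eigenResultant k)

/-- The canonical coordinates. -/
noncomputable abbrev eigenX (x : EigenPos k ⊕ EigenPos k) : EigenRing k :=
  awayX (eigenDelta k * eigenResultant k) x

/-- The eigenvalues of `A`. -/
noncomputable def eigenL (a : Fin k) : EigenRing k := eigenX k (Sum.inl (Sum.inl a))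

/-- The eigenvalues of `Â`. -/
noncomputable def eigenH (b : Fin (k + 1)) : EigenRing k := eigenX k (Sum.inl (Sum.inr b))

/-- The momenta of the eigenvalues of `A`. -/
noncomputable def momL (a : Fin k) : EigenRing k := eigenX k (Sum.inr (Sum.inl a))

/-- The momenta of the eigenvalues of `Â`. -/
noncomputable def momH (b : Fin (k + 1)) : EigenRing k := eigenX k (Sum.inr (Sum.inr b))

variable {k}

theorem isUnit_algebraMap_of_dvd {p : MvPolynomial (EigenPos k ⊕ EigenPos k) ℂ}
    (h : p ∣ eigenDelta k * eigenResultant k) : IsUnit (algebraMap _ (EigenRing k) p) :=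
  isUnit_of_dvd_unit (map_dvd _ h) (IsLocalization.Away.algebraMap_isUnit _)

theorem prod_erase_dvd_prod_offDiag {n : ℕ} {M : Type} [CommMonoid M] (f : Fin n → Fin n → M)
    (a : Fin n) : ∏ c ∈ Finset.univ.erase a, f a c ∣
      ∏ x ∈ (Finset.univ : Finset (Fin n)).offDiag, f x.1 x.2 := by
  classical
  have h : ∏ c ∈ Finset.univ.erase a, f a c =
      ∏ x ∈ (Finset.univ.erase a).map ⟨fun c => (a, c), Prod.mk_right_injective a⟩, f x.1 x.2 := by
    rw [Finset.prod_map]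
    rfl
  rw [h]
  apply Finset.prod_dvd_prod_of_subset
  intro x hx
  simp only [Finset.mem_map, Finset.mem_erase, Finset.mem_univ, and_true,
    Function.Embedding.coeFn_mk] at hx
  obtain ⟨c, hc, rfl⟩ := hx
  simpa using hc.symm

theorem prod_eigenL_dvd (a : Fin k) : (∏ c ∈ Finset.univ.erase a,
    (X (Sum.inl (Sum.inl a)) - X (Sum.inl (Sum.inl c))) :
      MvPolynomial (EigenPos k ⊕ EigenPos k) ℂ) ∣ eigenDelta k := by
  rw [eigenDelta_eq]
  exact dvd_mul_of_dvd_left (prod_erase_dvd_prod_offDiag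
    (fun a c => (X (Sum.inl (Sum.inl a)) - X (Sum.inl (Sum.inl c)) :
      MvPolynomial (EigenPos k ⊕ EigenPos k) ℂ)) a) _

theorem prod_eigenH_dvd (b : Fin (k + 1)) : (∏ c ∈ Finset.univ.erase b,
    (X (Sum.inl (Sum.inr b)) - X (Sum.inl (Sum.inr c))) :
      MvPolynomial (EigenPos k ⊕ EigenPos k) ℂ) ∣ eigenDelta k := by
  rw [eigenDelta_eq]
  exact dvd_mul_of_dvd_right (prod_erase_dvd_prod_offDiag
    (fun a c => (X (Sum.inl (Sum.inr a)) - X (Sum.inl (Sum.inr c)) :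
      MvPolynomial (EigenPos k ⊕ EigenPos k) ℂ)) b) _

theorem sub_eigenL_dvd {a c : Fin k} (h : a ≠ c) :
    (X (Sum.inl (Sum.inl a)) - X (Sum.inl (Sum.inl c)) :
      MvPolynomial (EigenPos k ⊕ EigenPos k) ℂ) ∣ eigenDelta k := by
  have hc : c ∈ Finset.univ.erase a := Finset.mem_erase.2 ⟨h.symm, Finset.mem_univ c⟩
  exact (Finset.dvd_prod_of_mem (fun c => (X (Sum.inl (Sum.inl a)) - X (Sum.inl (Sum.inl c)) :
    MvPolynomial (EigenPos k ⊕ EigenPos k) ℂ)) hc).trans (prod_eigenL_dvd a)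

theorem isUnit_sub_eigenL (a c : Fin k) (h : a ≠ c) : IsUnit (eigenL k a - eigenL k c) := by
  have := isUnit_algebraMap_of_dvd ((sub_eigenL_dvd h).mul_right (eigenResultant k))
  rwa [map_sub] at this

theorem sub_eigenH_dvd {a c : Fin (k + 1)} (h : a ≠ c) :
    (X (Sum.inl (Sum.inr a)) - X (Sum.inl (Sum.inr c)) :
      MvPolynomial (EigenPos k ⊕ EigenPos k) ℂ) ∣ eigenDelta k := by
  have hc : c ∈ Finset.univ.erase a := Finset.mem_erase.2 ⟨h.symm, Finset.mem_univ c⟩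
  exact (Finset.dvd_prod_of_mem (fun c => (X (Sum.inl (Sum.inr a)) - X (Sum.inl (Sum.inr c)) :
    MvPolynomial (EigenPos k ⊕ EigenPos k) ℂ)) hc).trans (prod_eigenH_dvd a)

theorem isUnit_sub_eigenH (a c : Fin (k + 1)) (h : a ≠ c) : IsUnit (eigenH k a - eigenH k c) := by
  have := isUnit_algebraMap_of_dvd ((sub_eigenH_dvd h).mul_right (eigenResultant k))
  rwa [map_sub] at this

theorem eigenBracket_skew (z w : EigenRing k) : eigenBracket k z w = -eigenBracket k w z :=
  awayBracket_skew _ z w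

theorem eigenBracket_qq (x y : EigenPos k) :
    eigenBracket k (eigenX k (Sum.inl x)) (eigenX k (Sum.inl y)) = 0 := by
  rw [eigenX, eigenX, awayX, awayX, localizeBracket_algebraMap, canonical_qq, map_zero]

theorem eigenBracket_pq (x y : EigenPos k) :
    eigenBracket k (eigenX k (Sum.inr x)) (eigenX k (Sum.inl y)) = if x = y then -1 else 0 := by
  rw [eigenX, eigenX, awayX, awayX, localizeBracket_algebraMap, canonical_pq]
  split_ifs <;> simp

variable (k)

/-- The positions `λ_a`, `v_a`, `Λ` on the slice, as functions of the eigenvalues. -/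
noncomputable def eigenSlicePos : SlicePos k 1 → EigenRing k :=
  Sum.elim (eigenL k) (Sum.elim (eigenRow (eigenL k) (eigenH k))
    fun _ => ∑ b, eigenH k b - ∑ a, eigenL k a)

/-- The momenta of `v_a` and `Λ`. -/
noncomputable def eigenSliceMomRow (i : Fin k ⊕ Fin 1) : EigenRing k :=
  ∑ b, momH k b * eigenInverse (eigenL k) (eigenH k) (Fin 1) b i

/-- The momenta of `λ_a`, `v_a`, `Λ`: by duality with `eigenSlicePos`. -/
noncomputable def eigenSliceMom : SlicePos k 1 → EigenRing k :=
  Sum.elim (fun a => momL k a - ∑ i, eigenBracket k (eigenSlicePos k (Sum.inr i)) (momL k a) *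
    eigenSliceMomRow k i) (eigenSliceMomRow k)

/-- The point of the slice with given eigenvalues and momenta. -/
noncomputable def eigenSlice : SlicePos k 1 ⊕ SlicePos k 1 → EigenRing k :=
  Sum.elim (eigenSlicePos k) (eigenSliceMom k)

theorem eigenSlicePos_bracket_momL (a c : Fin k) :
    eigenBracket k (eigenSlicePos k (Sum.inl a)) (momL k c) = if a = c then 1 else 0 := by
  rw [eigenBracket_skew]
  change -eigenBracket k (eigenX k (Sum.inr (Sum.inl c))) (eigenX k (Sum.inl (Sum.inl a))) = _
  rw [eigenBracket_pq]
  by_cases h : a = c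
  · simp [h]
  · simp [h, Ne.symm h]

theorem eigenSlicePos_bracket_momH (i : SlicePos k 1) (b : Fin (k + 1)) :
    eigenBracket k (eigenSlicePos k i) (momH k b) =
      Sum.elim (fun _ => 0) (fun j => eigenJacobian (eigenL k) (eigenH k) (Fin 1) j b) i := by
  have hl : ∀ a, (-eigenBracket k (momH k b)) (eigenL k a) = 0 := by
    intro a
    rw [Derivation.neg_apply]
    change -eigenBracket k (eigenX k (Sum.inr (Sum.inr b))) (eigenX k (Sum.inl (Sum.inl a))) = _
    rw [eigenBracket_pq]
    simp
  have hh : ∀ b', (-eigenBracket k (momH k b)) (eigenH k b') = if b' = b then 1 else 0 := by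
    intro b'
    rw [Derivation.neg_apply]
    change -eigenBracket k (eigenX k (Sum.inr (Sum.inr b))) (eigenX k (Sum.inl (Sum.inr b'))) = _
    rw [eigenBracket_pq]
    by_cases h : b' = b
    · simp [h]
    · simp [h, Ne.symm h]
  rw [eigenBracket_skew, ← Derivation.neg_apply]
  rcases i with a | a | e
  · exact hl a
  · exact derivation_eigenRow _ (Fin 1) hl hh a
  · change (-eigenBracket k (momH k b)) (∑ b, eigenH k b - ∑ a, eigenL k a) = 1
    rw [map_sub, map_sum, map_sum]
    simp only [hl, hh]
    simp

theorem eigenX_bracket_eigenSlicePos (c : EigenPos k) (i : SlicePos k 1) :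
    eigenBracket k (eigenX k (Sum.inl c)) (eigenSlicePos k i) = 0 := by
  have hl : ∀ a, eigenBracket k (eigenX k (Sum.inl c)) (eigenL k a) = 0 := fun a =>
    eigenBracket_qq _ _
  have hh : ∀ b, eigenBracket k (eigenX k (Sum.inl c)) (eigenH k b) = 0 := fun b =>
    eigenBracket_qq _ _
  rcases i with a | a | e
  · exact hl a
  · exact derivation_eigenRow_eq_zero _ hl hh a
  · change eigenBracket k (eigenX k (Sum.inl c)) (∑ b, eigenH k b - ∑ a, eigenL k a) = 0
    rw [map_sub, map_sum, map_sum]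
    simp only [hl, hh, Finset.sum_const_zero, sub_zero]

/-- The coordinates of the slice, as functions of the eigenvalues and their momenta, are the cotangent
lift of `eigenSlicePos`. -/
theorem isCanonical_eigenSlice : IsCanonical (eigenBracket k) (eigenSlice k) := by
  have hWN := eigenJacobian_mul_eigenInverse (Fin 1) (isUnit_sub_eigenL (k := k)) isUnit_sub_eigenH
  have hNW := eigenInverse_mul_eigenJacobian (Fin 1) (isUnit_sub_eigenL (k := k)) isUnit_sub_eigenH
  set W := eigenJacobian (eigenL k) (eigenH k) (Fin 1)
  set N := eigenInverse (eigenL k) (eigenH k) (Fin 1) with hNdef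
  have hWN' : ∀ i j, ∑ b, W i b * N b j = if i = j then 1 else 0 := by
    intro i j
    rw [← Matrix.mul_apply, hWN, Matrix.one_apply]
  have hNW' : ∀ b b', ∑ i, N b i * W i b' = if b = b' then 1 else 0 := by
    intro i j
    rw [← Matrix.mul_apply, hNW, Matrix.one_apply]
  have hW : ∀ i b, eigenBracket k (eigenSlicePos k i) (eigenX k (Sum.inr (Sum.inr b))) =
      Sum.elim (fun _ => 0) (fun j => W j b) i := eigenSlicePos_bracket_momH k
  have hL : ∀ a c, eigenBracket k (eigenSlicePos k (Sum.inl a)) (eigenX k (Sum.inr (Sum.inl c))) =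
      if a = c then 1 else 0 := eigenSlicePos_bracket_momL k
  obtain ⟨V, hV⟩ : ∃ V : Fin k ⊕ Fin 1 → Fin k → EigenRing k, ∀ i a,
      eigenBracket k (eigenSlicePos k (Sum.inr i)) (eigenX k (Sum.inr (Sum.inl a))) = V i a :=
    ⟨_, fun _ _ => rfl⟩
  -- the inverse of the Jacobian of `eigenSlicePos`
  refine isCanonical_cotangentLift _ (Sum.elim
    (fun a => Sum.elim (fun a' => if a = a' then 1 else 0) fun _ => 0)
    (fun b => Sum.elim (fun a' => -∑ i, N b i * V i a') fun i => N b i))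
    (eigenX_bracket_eigenSlicePos k) ?_ ?_
  · intro i j
    rw [Fintype.sum_sum_type]
    rcases i with a | i <;> rcases j with a' | j <;>
      simp only [Sum.elim_inl, Sum.elim_inr, hW, hL, hV, zero_mul, Finset.sum_const_zero, add_zero,
        mul_zero, zero_add, hWN']
    · simp
    · simp
    · have h1 : ∀ b, W i b * -∑ i', N b i' * V i' a' = -∑ i', W i b * N b i' * V i' a' := by
        intro b
        rw [mul_neg, Finset.mul_sum]
        exact congrArg Neg.neg (Finset.sum_congr rfl fun _ _ => by ring)
      simp only [h1, Finset.sum_neg_distrib]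
      rw [Finset.sum_comm]
      simp only [← Finset.sum_mul, hWN']
      simp
    · simp
  · intro c
    rw [Fintype.sum_sum_type]
    rcases c with a | b
    · simp only [hL, hV, eigenSliceMom, Sum.elim_inl, Sum.elim_inr]
      have h1 : ∀ i, eigenBracket k (eigenSlicePos k (Sum.inr i)) (momL k a) = V i a := fun i =>
        hV i a
      simp only [h1, ite_mul, one_mul, zero_mul, Finset.sum_ite_eq', Finset.mem_univ, if_true]
      rw [sub_add_cancel]
      rfl
    · simp only [hW, eigenSliceMom, Sum.elim_inl, Sum.elim_inr, zero_mul, Finset.sum_const_zero,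
        zero_add, eigenSliceMomRow, ← hNdef, Finset.mul_sum]
      rw [Finset.sum_comm]
      have h1 : ∀ b', ∑ i, W i b * (momH k b' * N b' i) = if b' = b then momH k b' else 0 := by
        intro b'
        have h2 : (if b' = b then momH k b' else 0) = momH k b' * if b' = b then 1 else 0 := by simp
        rw [h2, ← hNW', Finset.mul_sum]
        exact Finset.sum_congr rfl fun _ _ => by ring
      simp only [h1, Finset.sum_ite_eq', Finset.mem_univ, if_true]
      rfl

end

/-! ### Functions of the matrices as functions of the eigenvalues -/

section

variable {k : ℕ} (τ : ℂ)

theorem isSeparated_eigenSlice : IsSeparated (eigenSlice k) := isUnit_sub_eigenL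

theorem algebraicIndependent_eigenSlice : AlgebraicIndependent ℂ (eigenSlice k) :=
  (isCanonical_eigenSlice k).algebraicIndependent

/-- The restriction of functions on `N_{k,τ} × ℂ²` to the generic point of the space of
eigenvalues. -/
noncomputable def eigenRestrict (k : ℕ) (τ : ℂ) : InstantonAlgebra k 1 τ →ₐ[ℂ] EigenRing k :=
  sliceRestrict τ isSeparated_eigenSlice

theorem eigenRestrict_toInstanton (f : invariants k 1) :
    eigenRestrict k τ (toInstanton k 1 τ f) = sliceHom τ (eigenSlice k) f := rfl

theorem eigenRestrict_injective : Function.Injective (eigenRestrict k τ) :=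
  sliceRestrict_injective τ isSeparated_eigenSlice algebraicIndependent_eigenSlice

theorem eigenRestrict_bracket (x y : InstantonAlgebra k 1 τ) :
    eigenBracket k (eigenRestrict k τ x) (eigenRestrict k τ y) =
      eigenRestrict k τ (instantonBracket k 1 τ x y) :=
  sliceRestrict_bracket τ _ _ (isCanonical_eigenSlice k) x y

theorem hatSlice_eigenSlice : hatSlice (eigenSlice k) =
    Matrix.fromBlocks (Matrix.diagonal (eigenL k)) (Matrix.of fun _ _ => 1)
      (Matrix.of fun _ a => eigenRow (eigenL k) (eigenH k) a)
      (Matrix.of fun _ _ => ∑ b, eigenH k b - ∑ a, eigenL k a) := by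
  rw [hatSlice]
  congr 1
  ext a b : 1
  rw [Matrix.of_apply, Matrix.of_apply, Fin.sum_univ_one]
  rfl

theorem eigenRestrict_traceA (i : ℕ) :
    eigenRestrict k τ (traceA k 1 τ i) = ∑ a, eigenL k a ^ i :=
  sliceHom_traceInv τ (eigenSlice k) i

theorem eigenRestrict_traceHatA (j : ℕ) :
    eigenRestrict k τ (traceHatA k 1 τ j) = ∑ b, eigenH k b ^ j :=
  (sliceHom_traceHatInv τ (eigenSlice k) j).trans
    (trace_bordered_pow isUnit_sub_eigenL isUnit_sub_eigenH hatSlice_eigenSlice j)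

theorem map_charpoly_matA : (matA k 1).charpoly.map (sliceHom τ (eigenSlice k) : _ →+* EigenRing k) =
    Lagrange.nodal Finset.univ (eigenL k) := by
  rw [← Matrix.charpoly_map]
  refine (congrArg Matrix.charpoly (sliceHom_matA τ (eigenSlice k))).trans ?_
  rw [Matrix.charpoly_diagonal]
  rfl

theorem map_charpoly_hatA : (hatA k 1).charpoly.map (sliceHom τ (eigenSlice k) : _ →+* EigenRing k) =
    Lagrange.nodal Finset.univ (eigenH k) := by
  rw [← Matrix.charpoly_map]
  refine (congrArg Matrix.charpoly (sliceHom_hatA τ (eigenSlice k))).trans ?_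
  rw [charpoly_bordered isUnit_sub_eigenL isUnit_sub_eigenH hatSlice_eigenSlice]
  rfl

theorem resultant_nodal {R : Type} [CommRing R] [IsDomain R] {n : ℕ} (l : Fin n → R)
    (g : Polynomial R) (m : ℕ) (hm : g.natDegree ≤ m) :
    (Lagrange.nodal Finset.univ l).resultant g n m = ∏ a, g.eval (l a) := by
  have h := Polynomial.resultant_prod_left Finset.univ
    (fun a => Polynomial.X - Polynomial.C (l a)) g m (by simp) hm
  have hd := Lagrange.natDegree_nodal (s := Finset.univ) (v := l)
  rw [Finset.card_univ, Fintype.card_fin] at hd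
  rw [Lagrange.nodal] at hd ⊢
  rw [hd] at h
  rw [h]
  refine Finset.prod_congr rfl fun a _ => ?_
  rw [Polynomial.natDegree_X_sub_C, Polynomial.resultant_X_sub_C_left _ _ _ hm]

theorem prod_eval_derivative_nodal {R : Type} [CommRing R] {n : ℕ} (l : Fin n → R) :
    ∏ a, (Lagrange.nodal Finset.univ l).derivative.eval (l a) =
      ∏ x ∈ (Finset.univ : Finset (Fin n)).offDiag, (l x.1 - l x.2) := by
  rw [Finset.prod_congr rfl fun a _ =>
    Lagrange.eval_nodal_derivative_eval_node_eq (Finset.mem_univ a)]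
  simp only [Lagrange.eval_nodal]
  rw [Finset.prod_sigma']
  refine Finset.prod_bij (fun x _ => (x.1, x.2)) (fun x hx => ?_) (fun x _ y _ h => ?_)
    (fun x hx => ?_) fun x _ => rfl
  · have := (Finset.mem_sigma.1 hx).2
    simpa using (Finset.ne_of_mem_erase this).symm
  · rcases x with ⟨x, x'⟩
    rcases y with ⟨y, y'⟩
    simpa using h
  · refine ⟨⟨x.1, x.2⟩, ?_, rfl⟩
    have := (Finset.mem_offDiag.1 hx).2.2
    simpa using this.symm

theorem eigenRestrict_discriminant : eigenRestrict k τ (discriminant k 1 τ) =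
    algebraMap _ (EigenRing k) (eigenDelta k) := by
  let φ : Coord k 1 →+* EigenRing k := sliceHom τ (eigenSlice k)
  have key : ∀ {n : ℕ} {f : Polynomial (Coord k 1)} (l : Fin n → EigenRing k), f.Monic →
      f.map φ = Lagrange.nodal Finset.univ l → φ (f.resultant f.derivative) =
        ∏ x ∈ (Finset.univ : Finset (Fin n)).offDiag, (l x.1 - l x.2) := by
    intro n f l hf hfl
    have hd := Lagrange.natDegree_nodal (s := Finset.univ) (v := l)
    rw [Finset.card_univ, Fintype.card_fin] at hd
    have hfd : f.natDegree = n := by rw [← hf.natDegree_map φ, hfl, hd]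
    rw [← Polynomial.resultant_map_map, ← Polynomial.derivative_map, hfl, hfd, resultant_nodal,
      prod_eval_derivative_nodal]
    rw [← hfl, Polynomial.derivative_map]
    exact Polynomial.natDegree_map_le
  change φ (_ * _) = _
  rw [map_mul, key (eigenL k) (Matrix.charpoly_monic _) (map_charpoly_matA τ),
    key (eigenH k) (Matrix.charpoly_monic _) (map_charpoly_hatA τ)]
  have h := congrArg (algebraMap _ (EigenRing k)) (eigenDelta_eq k)
  rw [map_mul, map_prod, map_prod] at h
  simp only [map_sub] at h
  exact h.symm

theorem eigenRestrict_mixedResultant : eigenRestrict k τ (mixedResultant k 1 τ) =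
    algebraMap _ (EigenRing k) (eigenResultant k) := by
  let φ : Coord k 1 →+* EigenRing k := sliceHom τ (eigenSlice k)
  change φ (Polynomial.resultant _ _) = _
  have hd := Lagrange.natDegree_nodal (s := Finset.univ) (v := eigenL k)
  rw [Finset.card_univ, Fintype.card_fin] at hd
  have hfd : (matA k 1).charpoly.natDegree = k := by
    rw [← (Matrix.charpoly_monic _).natDegree_map φ, map_charpoly_matA, hd]
  rw [← Polynomial.resultant_map_map, map_charpoly_matA, map_charpoly_hatA, hfd, resultant_nodal]
  · have h := congrArg (algebraMap _ (EigenRing k)) (eigenResultant_eq k)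
    simp only [map_prod, map_sub] at h
    simp only [Lagrange.eval_nodal]
    exact h.symm
  · rw [← map_charpoly_hatA τ]
    exact Polynomial.natDegree_map_le

theorem isUnit_eigenRestrict : IsUnit (eigenRestrict k τ
    (discriminant k 1 τ * mixedResultant k 1 τ)) := by
  rw [map_mul, eigenRestrict_discriminant, eigenRestrict_mixedResultant, ← map_mul]
  exact IsLocalization.Away.algebraMap_isUnit _

theorem discriminant_mul_mixedResultant_mem_nonZeroDivisors :
    discriminant k 1 τ * mixedResultant k 1 τ ∈ nonZeroDivisors (InstantonAlgebra k 1 τ) := by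
  refine mem_nonZeroDivisors_of_ne_zero fun h => ?_
  have h1 := isUnit_eigenRestrict (k := k) τ
  rw [h, map_zero] at h1
  exact h1.ne_zero rfl

end

/-! ### Poles -/

section

variable {A : Type} [CommRing A] [Algebra ℂ A] (d δ : A)

/-- The functions whose only poles are on `δ = 0`. -/
def poleSubalgebra : Subalgebra ℂ (Localization.Away d) where
  carrier := {x | ∃ (n : ℕ) (a : A), x * algebraMap A _ (δ ^ n) = algebraMap A _ a}
  mul_mem' := by
    rintro x y ⟨n, a, ha⟩ ⟨m, b, hb⟩
    refine ⟨n + m, a * b, ?_⟩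
    rw [map_mul, ← ha, ← hb, pow_add, map_mul]
    ring
  add_mem' := by
    rintro x y ⟨n, a, ha⟩ ⟨m, b, hb⟩
    refine ⟨n + m, a * δ ^ m + b * δ ^ n, ?_⟩
    rw [map_add, map_mul, map_mul, ← ha, ← hb, pow_add, map_mul]
    ring
  algebraMap_mem' c := ⟨0, algebraMap ℂ A c, by
    rw [pow_zero, map_one, mul_one, ← IsScalarTower.algebraMap_apply]⟩

variable {d δ}

theorem algebraMap_mem_poleSubalgebra (a : A) :
    algebraMap A (Localization.Away d) a ∈ poleSubalgebra d δ := ⟨0, a, by simp⟩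

theorem inverse_mem_poleSubalgebra {a : A} (ha : a ∣ δ)
    (hu : IsUnit (algebraMap A (Localization.Away d) a)) :
    Ring.inverse (algebraMap A (Localization.Away d) a) ∈ poleSubalgebra d δ := by
  obtain ⟨b, hb⟩ := ha
  refine ⟨1, b, ?_⟩
  rw [pow_one, hb, map_mul, ← mul_assoc, Ring.inverse_mul_cancel _ hu, one_mul]

theorem bracket_mem_poleSubalgebra (β : PoissonBracket A) (a : A) {x : Localization.Away d}
    (hx : x ∈ poleSubalgebra d δ) :
    localizeBracket β d (algebraMap A _ a) x ∈ poleSubalgebra d δ := by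
  obtain ⟨n, b, hb⟩ := hx
  refine ⟨n + n, β a b * δ ^ n - b * β a (δ ^ n), ?_⟩
  have h := congrArg (localizeBracket β d (algebraMap A _ a)) hb
  rw [Derivation.leibniz, smul_eq_mul, smul_eq_mul, localizeBracket_algebraMap,
    localizeBracket_algebraMap] at h
  rw [map_sub, map_mul, map_mul, ← h, pow_add, map_mul, ← hb]
  ring

end

section

variable {k : ℕ}

/-- The functions on the space of eigenvalues whose only poles are on `Δ = 0`. -/
noncomputable abbrev deltaPoles (k : ℕ) : Subalgebra ℂ (EigenRing k) :=
  poleSubalgebra (eigenDelta k * eigenResultant k) (eigenDelta k)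

theorem eigenX_mem (x : EigenPos k ⊕ EigenPos k) : eigenX k x ∈ deltaPoles k :=
  algebraMap_mem_poleSubalgebra _

theorem inverse_sub_eigenL_mem {a c : Fin k} (h : a ≠ c) :
    Ring.inverse (eigenL k a - eigenL k c) ∈ deltaPoles k := by
  have h1 := inverse_mem_poleSubalgebra (d := eigenDelta k * eigenResultant k) (sub_eigenL_dvd h)
    (isUnit_algebraMap_of_dvd ((sub_eigenL_dvd h).mul_right _))
  rwa [map_sub] at h1

theorem nodeInv_eigenL_mem (a : Fin k) : nodeInv (eigenL k) a ∈ deltaPoles k := by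
  have h1 := inverse_mem_poleSubalgebra (d := eigenDelta k * eigenResultant k) (prod_eigenL_dvd a)
    (isUnit_algebraMap_of_dvd ((prod_eigenL_dvd a).mul_right _))
  simp only [map_prod, map_sub] at h1
  exact h1

theorem nodeInv_eigenH_mem (b : Fin (k + 1)) : nodeInv (eigenH k) b ∈ deltaPoles k := by
  have h1 := inverse_mem_poleSubalgebra (d := eigenDelta k * eigenResultant k) (prod_eigenH_dvd b)
    (isUnit_algebraMap_of_dvd ((prod_eigenH_dvd b).mul_right _))
  simp only [map_prod, map_sub] at h1
  exact h1

theorem eigenSlicePos_mem (i : SlicePos k 1) : eigenSlicePos k i ∈ deltaPoles k := by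
  have hl : ∀ a, eigenL k a ∈ deltaPoles k := fun a => eigenX_mem _
  have hh : ∀ a, eigenH k a ∈ deltaPoles k := fun a => eigenX_mem _
  rcases i with a | a | e
  · exact hl a
  · exact Subalgebra.mul_mem _ (Subalgebra.neg_mem _ (Subalgebra.prod_mem _ fun b _ =>
      Subalgebra.sub_mem _ (hl a) (hh b))) (nodeInv_eigenL_mem a)
  · exact Subalgebra.sub_mem _ (Subalgebra.sum_mem _ fun b _ => hh b)
      (Subalgebra.sum_mem _ fun a _ => hl a)

theorem eigenSliceMomRow_mem (i : Fin k ⊕ Fin 1) : eigenSliceMomRow k i ∈ deltaPoles k := by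
  have hl : ∀ a, eigenL k a ∈ deltaPoles k := fun a => eigenX_mem _
  have hh : ∀ a, eigenH k a ∈ deltaPoles k := fun a => eigenX_mem _
  refine Subalgebra.sum_mem _ fun b _ => Subalgebra.mul_mem _ (eigenX_mem _) ?_
  rcases i with a | e
  · simp only [eigenInverse, Matrix.of_apply, Sum.elim_inl, eval_cofactorPoly]
    exact Subalgebra.mul_mem _ (Subalgebra.prod_mem _ fun c _ =>
      Subalgebra.sub_mem _ (hh b) (hl c)) (nodeInv_eigenH_mem b)
  · simp only [eigenInverse, Matrix.of_apply, Sum.elim_inr]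
    exact Subalgebra.mul_mem _ (Subalgebra.prod_mem _ fun c _ =>
      Subalgebra.sub_mem _ (hh b) (hl c)) (nodeInv_eigenH_mem b)

theorem eigenSlice_mem (x : SlicePos k 1 ⊕ SlicePos k 1) : eigenSlice k x ∈ deltaPoles k := by
  rcases x with i | a | i
  · exact eigenSlicePos_mem i
  · refine Subalgebra.sub_mem _ (eigenX_mem _) (Subalgebra.sum_mem _ fun i _ =>
      Subalgebra.mul_mem _ ?_ (eigenSliceMomRow_mem i))
    rw [eigenBracket_skew]
    exact Subalgebra.neg_mem _ (bracket_mem_poleSubalgebra _ _ (eigenSlicePos_mem _))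
  · exact eigenSliceMomRow_mem i

/-- The slice is defined over the functions of the eigenvalues and their momenta with poles on `Δ = 0`
only: no denominators `λ_a - λ̂_b` occur. -/
theorem sliceHom_eigenSlice_mem (τ : ℂ) (f : Coord k 1) :
    sliceHom τ (eigenSlice k) f ∈ deltaPoles k := by
  have hs := eigenSlice_mem (k := k)
  have h : ∀ v, sliceHom τ (eigenSlice k) (X v) ∈ deltaPoles k := by
    rintro ((⟨c, e⟩ | ⟨α, a⟩ | e) | (⟨c, e⟩ | ⟨α, a⟩ | e))
    · rw [sliceHom_A]
      split_ifs
      · exact hs _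
      · exact Subalgebra.zero_mem _
    · fin_cases α
      · exact (sliceHom_j_zero τ (eigenSlice k) a).symm ▸ Subalgebra.sub_mem _
          (Subalgebra.neg_mem _ (Subalgebra.algebraMap_mem _ _)) (Subalgebra.mul_mem _ (hs _) (hs _))
      · exact (sliceHom_j_one τ (eigenSlice k) a).symm ▸ hs _
    · rw [sliceHom_pos]
      exact hs _
    · by_cases hce : c = e
      · subst hce
        rw [sliceHom_B_diag]
        exact hs _
      · rw [sliceHom_B τ _ (Ne.symm hce)]
        exact Subalgebra.mul_mem _ (Subalgebra.add_mem _ (Subalgebra.sub_mem _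
          (Subalgebra.neg_mem _ (Subalgebra.algebraMap_mem _ _))
          (Subalgebra.mul_mem _ (hs _) (hs _))) (Subalgebra.mul_mem _ (hs _) (hs _)))
          (inverse_sub_eigenL_mem (Ne.symm hce))
    · fin_cases α
      · exact (sliceHom_i_zero τ (eigenSlice k) a).symm ▸ Subalgebra.one_mem _
      · exact (sliceHom_i_one τ (eigenSlice k) a).symm ▸ hs _
    · rw [sliceHom_mom]
      exact hs _
  induction f using MvPolynomial.induction_on with
  | C a =>
    rw [← MvPolynomial.algebraMap_eq, AlgHom.commutes]
    exact Subalgebra.algebraMap_mem _ _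
  | add p q hp hq => rw [map_add]; exact Subalgebra.add_mem _ hp hq
  | mul_X p i hp => rw [map_mul]; exact Subalgebra.mul_mem _ hp (h i)

end

/-! ### Permutations of the eigenvalues -/

section

/-- A homomorphism from a localisation is compatible with the brackets if it is so before
localisation. -/
theorem bracket_map_away {A R : Type} [CommRing A] [Algebra ℂ A] [CommRing R] [Algebra ℂ R] {d : A}
    (β : PoissonBracket A) (γ : PoissonBracket R) (φ : Localization.Away d →ₐ[ℂ] R)
    (h : ∀ f g, γ (φ (algebraMap A _ f)) (φ (algebraMap A _ g)) = φ (algebraMap A _ (β f g)))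
    (x y : Localization.Away d) : γ (φ x) (φ y) = φ (localizeBracket β d x y) := by
  have h1 : ∀ f y, γ (φ (algebraMap A _ f)) (φ y) = φ (localizeBracket β d (algebraMap A _ f) y) := by
    intro f y
    obtain ⟨n, b, hb⟩ := exists_away_eq d y
    have e1 := congrArg (fun z => γ (φ (algebraMap A _ f)) (φ z)) hb
    have e2 := congrArg (fun z => φ (localizeBracket β d (algebraMap A _ f) z)) hb
    simp only [map_mul, Derivation.leibniz, smul_eq_mul, h, localizeBracket_algebraMap, map_add]
      at e1 e2
    refine ((isUnit_away_pow d n).map φ).mul_left_cancel ?_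
    linear_combination e1 - e2
  obtain ⟨n, b, hb⟩ := exists_away_eq d x
  have e1 := congrArg (fun z => γ (φ z) (φ y)) hb
  have e2 := congrArg (fun z => φ (localizeBracket β d z y)) hb
  simp only [map_mul, Derivation.leibniz, Derivation.add_apply, Derivation.smul_apply, smul_eq_mul,
    h1, map_add] at e1 e2
  refine ((isUnit_away_pow d n).map φ).mul_left_cancel ?_
  linear_combination e1 - e2

variable {k : ℕ} (σ : Equiv.Perm (Fin k)) (ρ : Equiv.Perm (Fin (k + 1)))

theorem rename_eigenDelta : rename (Sum.map (Sum.map σ ρ) (Sum.map σ ρ)) (eigenDelta k) =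
    eigenDelta k := by
  have h : ∀ {n : ℕ} (σ : Equiv.Perm (Fin n)) (f : Fin n → MvPolynomial (EigenPos k ⊕ EigenPos k) ℂ),
      ∏ x ∈ (Finset.univ : Finset (Fin n)).offDiag, (f (σ x.1) - f (σ x.2)) =
      ∏ x ∈ (Finset.univ : Finset (Fin n)).offDiag, (f x.1 - f x.2) := by
    intro n σ f
    refine Finset.prod_equiv (σ.prodCongr σ) (fun x => ?_) fun x _ => rfl
    simp
  rw [eigenDelta_eq, map_mul, map_prod, map_prod]
  simp only [map_sub, rename_X, Sum.map_inl, Sum.map_inr]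
  rw [h σ fun a => X (Sum.inl (Sum.inl a)), h ρ fun a => X (Sum.inl (Sum.inr a))]

theorem rename_eigenResultant : rename (Sum.map (Sum.map σ ρ) (Sum.map σ ρ)) (eigenResultant k) =
    eigenResultant k := by
  rw [eigenResultant_eq, map_prod]
  simp only [map_prod, map_sub, rename_X, Sum.map_inl, Sum.map_inr]
  rw [Equiv.prod_comp σ fun a => ∏ b, ((X (Sum.inl (Sum.inl a)) :
    MvPolynomial (EigenPos k ⊕ EigenPos k) ℂ) - X (Sum.inl (Sum.inr (ρ b))))]
  exact Finset.prod_congr rfl fun a _ => Equiv.prod_comp ρ fun b => _ - X (Sum.inl (Sum.inr b))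

/-- The action of `S_k × S_{k+1}` on the functions on the space of eigenvalues. -/
noncomputable def eigenPerm : EigenRing k →ₐ[ℂ] EigenRing k :=
  awayLift ((IsScalarTower.toAlgHom ℂ (MvPolynomial (EigenPos k ⊕ EigenPos k) ℂ)
    (EigenRing k)).comp (rename (Sum.map (Sum.map σ ρ) (Sum.map σ ρ)))) (by
      rw [AlgHom.comp_apply, map_mul, rename_eigenDelta, rename_eigenResultant]
      exact IsLocalization.Away.algebraMap_isUnit _)

theorem eigenPerm_algebraMap (p : MvPolynomial (EigenPos k ⊕ EigenPos k) ℂ) :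
    eigenPerm σ ρ (algebraMap _ _ p) =
      algebraMap _ _ (rename (Sum.map (Sum.map σ ρ) (Sum.map σ ρ)) p) :=
  awayLift_algebraMap _ _ _

theorem eigenPerm_eigenX (x : EigenPos k ⊕ EigenPos k) :
    eigenPerm σ ρ (eigenX k x) = eigenX k (Sum.map (Sum.map σ ρ) (Sum.map σ ρ) x) := by
  rw [eigenX, awayX, eigenPerm_algebraMap, rename_X]
  rfl

theorem eigenPerm_bracket (x y : EigenRing k) :
    eigenBracket k (eigenPerm σ ρ x) (eigenPerm σ ρ y) = eigenPerm σ ρ (eigenBracket k x y) := by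
  refine bracket_map_away _ _ _ (fun f g => ?_) x y
  rw [eigenPerm_algebraMap, eigenPerm_algebraMap, localizeBracket_algebraMap, eigenPerm_algebraMap]
  congr 1
  refine bracket_map _ _ _ (fun x y => ?_) f g
  have hinj : Function.Injective (Sum.map σ ρ) := σ.injective.sumMap ρ.injective
  rcases x with x | x <;> rcases y with y | y
  · simp only [rename_X, Sum.map_inl, canonical_qq, map_zero]
  · simp only [rename_X, Sum.map_inl, Sum.map_inr, canonical_qp, hinj.eq_iff]
    split_ifs <;> simp
  · simp only [rename_X, Sum.map_inl, Sum.map_inr, canonical_pq, hinj.eq_iff]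
    split_ifs <;> simp
  · simp only [rename_X, Sum.map_inr, canonical_pp, map_zero]

theorem eigenPerm_comp_eigenL : eigenPerm σ ρ ∘ eigenL k = eigenL k ∘ σ :=
  funext fun _ => eigenPerm_eigenX σ ρ _

theorem eigenPerm_comp_eigenH : eigenPerm σ ρ ∘ eigenH k = eigenH k ∘ ρ :=
  funext fun _ => eigenPerm_eigenX σ ρ _

theorem eigenPerm_eigenSlicePos (i : SlicePos k 1) : eigenPerm σ ρ (eigenSlicePos k i) =
    eigenSlicePos k (Sum.map σ (Sum.map σ id) i) := by
  rcases i with a | a | e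
  · exact eigenPerm_eigenX σ ρ _
  · change eigenPerm σ ρ (eigenRow _ _ a) = eigenRow _ _ (σ a)
    rw [map_eigenRow _ _ isUnit_sub_eigenL, eigenPerm_comp_eigenL, eigenPerm_comp_eigenH,
      eigenRow_comp_perm]
  · change eigenPerm σ ρ (∑ b, eigenH k b - ∑ a, eigenL k a) = ∑ b, eigenH k b - ∑ a, eigenL k a
    rw [map_sub, map_sum, map_sum, ← Equiv.sum_comp ρ (eigenH k), ← Equiv.sum_comp σ (eigenL k)]
    exact congrArg₂ _ (Finset.sum_congr rfl fun b _ => congrFun (eigenPerm_comp_eigenH σ ρ) b)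
      (Finset.sum_congr rfl fun a _ => congrFun (eigenPerm_comp_eigenL σ ρ) a)

theorem eigenPerm_eigenSliceMomRow (i : Fin k ⊕ Fin 1) :
    eigenPerm σ ρ (eigenSliceMomRow k i) = eigenSliceMomRow k (Sum.map σ id i) := by
  simp only [eigenSliceMomRow, map_sum, map_mul]
  rw [← Equiv.sum_comp ρ fun b => momH k b * _]
  refine Finset.sum_congr rfl fun b _ => ?_
  rw [map_eigenInverse _ _ _ isUnit_sub_eigenH, eigenPerm_comp_eigenL, eigenPerm_comp_eigenH,
    eigenInverse_comp_perm]
  exact congrArg (· * _) (eigenPerm_eigenX σ ρ _)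

theorem eigenPerm_comp_eigenSlice :
    eigenPerm σ ρ ∘ eigenSlice k = eigenSlice k ∘ slicePerm σ := by
  funext x
  rcases x with i | a | i
  · exact eigenPerm_eigenSlicePos σ ρ i
  · have hL : eigenPerm σ ρ (momL k a) = momL k (σ a) := eigenPerm_eigenX σ ρ _
    change eigenPerm σ ρ (momL k a - ∑ i, eigenBracket k (eigenSlicePos k (Sum.inr i)) (momL k a) *
      eigenSliceMomRow k i) = momL k (σ a) - ∑ i, eigenBracket k (eigenSlicePos k (Sum.inr i))
      (momL k (σ a)) * eigenSliceMomRow k i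
    rw [map_sub, map_sum, hL, ← Equiv.sum_comp (Equiv.sumCongr σ (Equiv.refl (Fin 1))) fun i =>
      eigenBracket k (eigenSlicePos k (Sum.inr i)) (momL k (σ a)) * _]
    refine congrArg _ (Finset.sum_congr rfl fun i _ => ?_)
    rw [map_mul, ← eigenPerm_bracket, eigenPerm_eigenSlicePos, eigenPerm_eigenSliceMomRow, hL]
    rfl
  · exact eigenPerm_eigenSliceMomRow σ ρ i

theorem eigenPerm_eigenRestrict (τ : ℂ) (x : InstantonAlgebra k 1 τ) :
    eigenPerm σ ρ (eigenRestrict k τ x) = eigenRestrict k τ x := by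
  obtain ⟨f, rfl⟩ := toInstanton_surjective τ x
  rw [eigenRestrict_toInstanton, sliceHom_comp τ _ isSeparated_eigenSlice,
    eigenPerm_comp_eigenSlice, sliceHom_perm τ σ f.2]

end

/-! ### Invariants of `S_k × S_{k+1}` -/

section

variable {k : ℕ}

/-- The product `f(x) g(y)` of polynomials in separate variables. -/
noncomputable def separatedProduct (σ ρ : Type) :
    MvPolynomial σ ℂ ⊗[ℂ] MvPolynomial ρ ℂ →ₐ[ℂ] MvPolynomial (σ ⊕ ρ) ℂ :=
  Algebra.TensorProduct.lift (rename Sum.inl) (rename Sum.inr) fun _ _ => Commute.all _ _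

theorem separatedProduct_tmul {σ ρ : Type} (f : MvPolynomial σ ℂ) (g : MvPolynomial ρ ℂ) :
    separatedProduct σ ρ (f ⊗ₜ g) = rename Sum.inl f * rename Sum.inr g :=
  Algebra.TensorProduct.lift_tmul _ _ _ _ _

theorem separatedProduct_bijective (σ ρ : Type) : Function.Bijective (separatedProduct σ ρ) := by
  have h : separatedProduct σ ρ = (tensorEquivSum ℂ σ ρ ℂ : _ →ₐ[ℂ] _) := by
    apply Algebra.TensorProduct.ext
    · apply MvPolynomial.algHom_ext
      intro i
      simp [separatedProduct_tmul]
    · apply MvPolynomial.algHom_ext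
      intro i
      simp [separatedProduct_tmul]
  rw [h]
  exact (tensorEquivSum ℂ σ ρ ℂ).bijective

theorem toPolynomial_tmul (f : symInvariants k) (g : symInvariants (k + 1)) :
    toPolynomial k (f ⊗ₜ g) = rename Sum.inl f.1 * rename Sum.inr g.1 :=
  Algebra.TensorProduct.lift_tmul _ _ _ _ _

theorem toPolynomial_injective (k : ℕ) : Function.Injective (toPolynomial k) := by
  have h : toPolynomial k = (separatedProduct _ _).comp
      (Algebra.TensorProduct.map (symInvariants k).val (symInvariants (k + 1)).val) := by
    apply Algebra.TensorProduct.ext'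
    intro f g
    rw [toPolynomial_tmul, AlgHom.comp_apply, Algebra.TensorProduct.map_tmul,
      separatedProduct_tmul]
    rfl
  rw [h]
  exact (separatedProduct_bijective _ _).1.comp
    (TensorProduct.map_injective_of_flat_flat (symInvariants k).val.toLinearMap
      (symInvariants (k + 1)).val.toLinearMap Subtype.val_injective Subtype.val_injective)

/-- The sum over the orbit under `S_n`. -/
noncomputable def symmetrization {n : ℕ} (f : MvPolynomial (Fin n ⊕ Fin n) ℂ) : symInvariants n :=
  ⟨∑ σ : Equiv.Perm (Fin n), rename (Sum.map σ σ) f, fun ρ => by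
    rw [map_sum]
    refine Fintype.sum_equiv (Equiv.mulLeft ρ) _ _ fun σ => ?_
    rw [rename_rename, Sum.map_comp_map]
    rfl⟩

/-- All invariants of `S_k × S_{k+1}` come from the tensor product of the rings of invariants, by
averaging over the group. -/
theorem exists_toPolynomial_eq
    {p : MvPolynomial ((Fin k ⊕ Fin k) ⊕ (Fin (k + 1) ⊕ Fin (k + 1))) ℂ}
    (hp : ∀ (σ : Equiv.Perm (Fin k)) (ρ : Equiv.Perm (Fin (k + 1))),
      rename (Sum.map (Sum.map σ σ) (Sum.map ρ ρ)) p = p) : ∃ t, toPolynomial k t = p := by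
  have key : ∀ x, ∃ t, toPolynomial k t = ∑ σ : Equiv.Perm (Fin k),
      ∑ ρ : Equiv.Perm (Fin (k + 1)), rename (Sum.map (Sum.map σ σ) (Sum.map ρ ρ))
        (separatedProduct _ _ x) := by
    intro x
    induction x with
    | zero => exact ⟨0, by simp⟩
    | add x y hx hy =>
      obtain ⟨t, ht⟩ := hx
      obtain ⟨u, hu⟩ := hy
      exact ⟨t + u, by simp only [map_add, ht, hu, Finset.sum_add_distrib]⟩
    | tmul f g =>
      refine ⟨symmetrization f ⊗ₜ symmetrization g, ?_⟩
      rw [toPolynomial_tmul, symmetrization, symmetrization, map_sum, map_sum, Finset.sum_mul_sum]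
      refine Finset.sum_congr rfl fun σ _ => Finset.sum_congr rfl fun ρ _ => ?_
      rw [separatedProduct_tmul, map_mul]
      simp only [rename_rename]
      rfl
  obtain ⟨x, hx⟩ := (separatedProduct_bijective _ _).2 p
  obtain ⟨t, ht⟩ := key x
  simp only [hx, hp, Finset.sum_const, Finset.card_univ] at ht
  refine ⟨((Fintype.card (Equiv.Perm (Fin k)) * Fintype.card (Equiv.Perm (Fin (k + 1))) : ℕ) : ℂ)⁻¹ •
    t, ?_⟩
  rw [map_smul, ht, smul_smul, ← Nat.cast_smul_eq_nsmul ℂ, smul_smul, inv_mul_cancel₀, one_smul]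
  exact Nat.cast_ne_zero.2 (Nat.mul_ne_zero Fintype.card_ne_zero Fintype.card_ne_zero)

theorem eigenReindex_comp (σ : Equiv.Perm (Fin k)) (ρ : Equiv.Perm (Fin (k + 1))) :
    eigenReindex k ∘ Sum.map (Sum.map σ σ) (Sum.map ρ ρ) =
      Sum.map (Sum.map σ ρ) (Sum.map σ ρ) ∘ eigenReindex k := by
  funext x
  rcases x with (a | a) | (b | b) <;> rfl

theorem rename_eigenReindex_injective (k : ℕ) :
    Function.Injective (rename (R := ℂ) (eigenReindex k)) :=
  rename_injective _ (eigenReindex k).injective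

/-- An element of the polynomial ring on `T^* (ℂ^k × ℂ^{k+1})` that is invariant under
`S_k × S_{k+1}` comes from the tensor product. -/
theorem exists_rename_toPolynomial_eq {p : MvPolynomial (EigenPos k ⊕ EigenPos k) ℂ}
    (hp : ∀ (σ : Equiv.Perm (Fin k)) (ρ : Equiv.Perm (Fin (k + 1))),
      rename (Sum.map (Sum.map σ ρ) (Sum.map σ ρ)) p = p) :
    ∃ t, rename (eigenReindex k) (toPolynomial k t) = p := by
  have h1 : rename (eigenReindex k) (rename (eigenReindex k).symm p) = p := by
    rw [rename_rename, Equiv.self_comp_symm, rename_id_apply]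
  obtain ⟨t, ht⟩ := exists_toPolynomial_eq (p := rename (eigenReindex k).symm p) fun σ ρ => by
    apply rename_eigenReindex_injective k
    rw [h1, rename_rename, eigenReindex_comp, ← rename_rename, h1, hp]
  exact ⟨t, by rw [ht, h1]⟩

theorem exists_eigenvalueDelta (k : ℕ) : ∃ D, toPolynomial k D = eigenvalueDelta k := by
  obtain ⟨t, ht⟩ := exists_rename_toPolynomial_eq (rename_eigenDelta (k := k))
  exact ⟨t, rename_eigenReindex_injective k ht⟩

theorem exists_eigenvalueResultant (k : ℕ) : ∃ R, toPolynomial k R = eigenvalueResultant k := by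
  obtain ⟨t, ht⟩ := exists_rename_toPolynomial_eq (rename_eigenResultant (k := k))
  exact ⟨t, rename_eigenReindex_injective k ht⟩

/-- The inclusion of the tensor product into the functions on the space of eigenvalues. -/
noncomputable def eigenvalueHom (k : ℕ) : EigenvalueAlgebra k →ₐ[ℂ] EigenRing k :=
  (IsScalarTower.toAlgHom ℂ (MvPolynomial (EigenPos k ⊕ EigenPos k) ℂ) (EigenRing k)).comp
    ((rename (eigenReindex k)).comp (toPolynomial k))

theorem eigenvalueHom_apply (t : EigenvalueAlgebra k) : eigenvalueHom k t =
    algebraMap _ (EigenRing k) (rename (eigenReindex k) (toPolynomial k t)) := rfl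

theorem algebraMap_eigenRing_injective (k : ℕ) :
    Function.Injective (algebraMap (MvPolynomial (EigenPos k ⊕ EigenPos k) ℂ) (EigenRing k)) :=
  IsLocalization.injective _
    (powers_le_nonZeroDivisors_of_noZeroDivisors (eigenDelta_mul_eigenResultant_ne_zero k))

theorem eigenvalueHom_injective (k : ℕ) : Function.Injective (eigenvalueHom k) :=
  (algebraMap_eigenRing_injective k).comp
    ((rename_eigenReindex_injective k).comp (toPolynomial_injective k))

theorem eigenvalueHom_tmul (f : symInvariants k) (g : symInvariants (k + 1)) :
    eigenvalueHom k (f ⊗ₜ g) = aeval (Sum.elim (eigenL k) (momL k)) f.1 *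
      aeval (Sum.elim (eigenH k) (momH k)) g.1 := by
  have h : ∀ {n : ℕ} (e : Fin n ⊕ Fin n → EigenPos k ⊕ EigenPos k)
      (f : MvPolynomial (Fin n ⊕ Fin n) ℂ),
      algebraMap _ (EigenRing k) (rename e f) = aeval (fun x => eigenX k (e x)) f := by
    intro n e f
    have : (IsScalarTower.toAlgHom ℂ (MvPolynomial (EigenPos k ⊕ EigenPos k) ℂ)
        (EigenRing k)).comp (rename e) = aeval fun x => eigenX k (e x) := by
      apply MvPolynomial.algHom_ext
      intro x
      rw [AlgHom.comp_apply, rename_X, aeval_X]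
      rfl
    exact DFunLike.congr_fun this f
  rw [eigenvalueHom_apply, toPolynomial_tmul, map_mul, map_mul, rename_rename, rename_rename, h, h]
  congr 2
  · congr 1
    funext x
    rcases x with a | a <;> rfl
  · congr 1
    funext x
    rcases x with a | a <;> rfl

theorem eigenvalueHom_powerSumLeft (i : ℕ) :
    eigenvalueHom k (powerSumLeft k i) = ∑ a, eigenL k a ^ i := by
  rw [powerSumLeft, eigenvalueHom_tmul]
  simp [powerSum]

theorem eigenvalueHom_powerSumRight (i : ℕ) :
    eigenvalueHom k (powerSumRight k i) = ∑ b, eigenH k b ^ i := by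
  rw [powerSumRight, eigenvalueHom_tmul]
  simp [powerSum]

theorem eigenBracket_eigenX (x y : EigenPos k ⊕ EigenPos k) :
    eigenBracket k (eigenX k x) (eigenX k y) =
      algebraMap _ _ (canonicalBracket (EigenPos k) (X x) (X y)) :=
  localizeBracket_algebraMap _ _ _ _

/-- The embedding of the tensor product respects brackets. -/
theorem eigenvalueHom_bracket (x y : EigenvalueAlgebra k) :
    eigenBracket k (eigenvalueHom k x) (eigenvalueHom k y) =
      eigenvalueHom k (eigenvalueBracket k x y) := by
  have hL : ∀ f g : MvPolynomial (Fin k ⊕ Fin k) ℂ,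
      eigenBracket k (aeval (Sum.elim (eigenL k) (momL k)) f)
        (aeval (Sum.elim (eigenL k) (momL k)) g) =
      aeval (Sum.elim (eigenL k) (momL k)) (canonicalBracket (Fin k) f g) := by
    refine bracket_map _ _ _ fun x y => ?_
    simp only [aeval_X]
    rcases x with x | x <;> rcases y with y | y <;>
      refine (eigenBracket_eigenX _ _).trans ?_ <;>
      simp only [canonical_qq, canonical_pp, canonical_qp, canonical_pq, map_zero, Sum.inl.injEq] <;>
      split_ifs <;> simp
  have hH : ∀ f g : MvPolynomial (Fin (k + 1) ⊕ Fin (k + 1)) ℂ,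
      eigenBracket k (aeval (Sum.elim (eigenH k) (momH k)) f)
        (aeval (Sum.elim (eigenH k) (momH k)) g) =
      aeval (Sum.elim (eigenH k) (momH k)) (canonicalBracket (Fin (k + 1)) f g) := by
    refine bracket_map _ _ _ fun x y => ?_
    simp only [aeval_X]
    rcases x with x | x <;> rcases y with y | y <;>
      refine (eigenBracket_eigenX _ _).trans ?_ <;>
      simp only [canonical_qq, canonical_pp, canonical_qp, canonical_pq, map_zero, Sum.inr.injEq] <;>
      split_ifs <;> simp
  have hLH : ∀ (f : MvPolynomial (Fin k ⊕ Fin k) ℂ) (g : MvPolynomial (Fin (k + 1) ⊕ Fin (k + 1)) ℂ),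
      eigenBracket k (aeval (Sum.elim (eigenL k) (momL k)) f)
        (aeval (Sum.elim (eigenH k) (momH k)) g) = 0 := by
    have h1 : ∀ x y, eigenBracket k (Sum.elim (eigenL k) (momL k) x)
        (Sum.elim (eigenH k) (momH k) y) = 0 := by
      intro x y
      rcases x with x | x <;> rcases y with y | y <;>
        refine (eigenBracket_eigenX _ _).trans ?_ <;>
        simp [canonical_qq, canonical_pp, canonical_qp, canonical_pq]
    intro f g
    have h2 : ∀ x, eigenBracket k (Sum.elim (eigenL k) (momL k) x)
        (aeval (Sum.elim (eigenH k) (momH k)) g) = 0 := by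
      intro x
      induction g using MvPolynomial.induction_on with
      | C a => rw [aeval_C, Derivation.map_algebraMap]
      | add p q hp hq => rw [map_add, map_add, hp, hq, add_zero]
      | mul_X p i hp => rw [map_mul, Derivation.leibniz, hp, aeval_X, h1, smul_zero, smul_zero,
          add_zero]
    induction f using MvPolynomial.induction_on with
    | C a => rw [aeval_C, Derivation.map_algebraMap, Derivation.zero_apply]
    | add p q hp hq => rw [map_add, map_add, Derivation.add_apply, hp, hq, add_zero]
    | mul_X p i hp => rw [map_mul, Derivation.leibniz, Derivation.add_apply, Derivation.smul_apply,
        Derivation.smul_apply, hp, aeval_X, h2, smul_zero, smul_zero, add_zero]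
  induction x using TensorProduct.induction_on with
  | zero => simp
  | add x x' hx hx' => simp only [map_add, Derivation.add_apply, hx, hx']
  | tmul f g =>
    induction y using TensorProduct.induction_on with
    | zero => simp
    | add y y' hy hy' => simp only [map_add, hy, hy']
    | tmul f' g' =>
      have h1 : eigenvalueBracket k (f ⊗ₜ g) (f' ⊗ₜ g') =
          symBracket k f f' ⊗ₜ (g * g') + (f * f') ⊗ₜ symBracket (k + 1) g g' :=
        tensorBilin_tmul _ _ _ _ _ _
      have h2 : (symBracket k f f').1 = canonicalBracket (Fin k) f.1 f'.1 := rfl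
      have h3 : (symBracket (k + 1) g g').1 = canonicalBracket (Fin (k + 1)) g.1 g'.1 := rfl
      rw [h1, map_add, eigenvalueHom_tmul, eigenvalueHom_tmul, eigenvalueHom_tmul,
        eigenvalueHom_tmul, h2, h3, ← hL, ← hH]
      have h4 : ∀ f g, eigenBracket k (aeval (Sum.elim (eigenH k) (momH k)) g)
          (aeval (Sum.elim (eigenL k) (momL k)) f) = 0 := fun f g => by
        rw [eigenBracket_skew, hLH, neg_zero]
      simp only [Derivation.leibniz, Derivation.add_apply, Derivation.smul_apply, smul_eq_mul, hLH,
        h4, mul_zero, add_zero, zero_add, MulMemClass.coe_mul, map_mul]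
      ring

end

/-! ### Functions linear in the momenta -/

section

variable {k : ℕ}

/-- The functions `∑_c f_c p_c`, with `f_c = ∂z / ∂p_c`. -/
def IsLinearInMomenta (z : EigenRing k) : Prop :=
  z = ∑ c, eigenBracket k (eigenX k (Sum.inl c)) z * eigenX k (Sum.inr c)

/-- The functions that do not depend on the momenta. -/
def IsBasic (f : EigenRing k) : Prop := ∀ c, eigenBracket k (eigenX k (Sum.inl c)) f = 0

theorem IsLinearInMomenta.sum {ι : Type} (s : Finset ι) {f : ι → EigenRing k}
    (h : ∀ i ∈ s, IsLinearInMomenta (f i)) : IsLinearInMomenta (∑ i ∈ s, f i) := by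
  rw [IsLinearInMomenta]
  conv_lhs => rw [Finset.sum_congr rfl h]
  rw [Finset.sum_comm]
  refine Finset.sum_congr rfl fun c _ => ?_
  rw [map_sum, Finset.sum_mul]

theorem IsLinearInMomenta.mul {f z : EigenRing k} (hf : IsBasic f) (hz : IsLinearInMomenta z) :
    IsLinearInMomenta (f * z) := by
  rw [IsLinearInMomenta]
  conv_lhs => rw [hz]
  rw [Finset.mul_sum]
  refine Finset.sum_congr rfl fun c _ => ?_
  rw [Derivation.leibniz, hf c, smul_zero, add_zero, smul_eq_mul]
  ring

theorem IsLinearInMomenta.sub {z w : EigenRing k} (hz : IsLinearInMomenta z)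
    (hw : IsLinearInMomenta w) : IsLinearInMomenta (z - w) := by
  rw [IsLinearInMomenta]
  conv_lhs => rw [hz, hw]
  rw [← Finset.sum_sub_distrib]
  refine Finset.sum_congr rfl fun c _ => ?_
  rw [map_sub, sub_mul]

theorem isLinearInMomenta_eigenX (c : EigenPos k) :
    IsLinearInMomenta (eigenX k (Sum.inr c)) := by
  rw [IsLinearInMomenta]
  simp only [eigenBracket_eigenX, canonical_qp]
  simp

theorem isBasic_eigenX (c : EigenPos k) : IsBasic (eigenX k (Sum.inl c)) :=
  fun e => eigenBracket_qq e c

theorem isBasic_eigenSlicePos (i : SlicePos k 1) : IsBasic (eigenSlicePos k i) :=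
  fun c => eigenX_bracket_eigenSlicePos k c i

theorem IsBasic.mul {f g : EigenRing k} (hf : IsBasic f) (hg : IsBasic g) : IsBasic (f * g) :=
  fun c => by rw [Derivation.leibniz, hf c, hg c, smul_zero, smul_zero, add_zero]

theorem IsBasic.pow {f : EigenRing k} (hf : IsBasic f) (n : ℕ) : IsBasic (f ^ n) := by
  induction n with
  | zero => exact fun c => by rw [pow_zero, Derivation.map_one_eq_zero]
  | succ n ih => exact pow_succ f n ▸ ih.mul hf

theorem IsBasic.sum {ι : Type} (s : Finset ι) {f : ι → EigenRing k} (h : ∀ i ∈ s, IsBasic (f i)) :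
    IsBasic (∑ i ∈ s, f i) := fun c => by
  rw [map_sum]
  exact Finset.sum_eq_zero fun i hi => h i hi c

theorem isBasic_bracket {f : EigenRing k} (hf : IsBasic f) (c : EigenPos k) :
    IsBasic (eigenBracket k f (eigenX k (Sum.inr c))) := fun e => by
  rw [eigenBracket_skew f, map_neg, neg_eq_zero]
  refine (awayBracket_X_comm _ (Sum.inl e) (Sum.inr c) f).trans ?_
  have h := hf e
  rw [h, map_zero]

theorem isLinearInMomenta_eigenSliceMomRow (i : Fin k ⊕ Fin 1) :
    IsLinearInMomenta (eigenSliceMomRow k i) := by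
  refine IsLinearInMomenta.sum _ fun b _ => ?_
  rw [mul_comm]
  refine IsLinearInMomenta.mul (fun c => ?_) (isLinearInMomenta_eigenX _)
  set D := eigenBracket k (eigenX k (Sum.inl c))
  have hl : ∀ a, D (eigenL k a) = 0 := fun a => eigenBracket_qq _ _
  have hh : ∀ a, D (eigenH k a) = 0 := fun a => eigenBracket_qq _ _
  rcases i with a | e
  · simp only [eigenInverse, Matrix.of_apply, Sum.elim_inl, eval_cofactorPoly]
    rw [Derivation.leibniz, derivation_nodeInv_eq_zero D hh,
      derivation_prod_eq_zero D _ fun c _ => by rw [map_sub, hl, hh, sub_zero], smul_zero,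
      smul_zero, add_zero]
  · simp only [eigenInverse, Matrix.of_apply, Sum.elim_inr]
    rw [Derivation.leibniz, derivation_nodeInv_eq_zero D hh,
      derivation_prod_eq_zero D _ fun c _ => by rw [map_sub, hl, hh, sub_zero], smul_zero,
      smul_zero, add_zero]

theorem isLinearInMomenta_eigenSliceMom (i : SlicePos k 1) :
    IsLinearInMomenta (eigenSliceMom k i) := by
  rcases i with a | i
  · refine IsLinearInMomenta.sub (isLinearInMomenta_eigenX _) (IsLinearInMomenta.sum _ fun i _ => ?_)
    exact IsLinearInMomenta.mul (isBasic_bracket (isBasic_eigenSlicePos _) _)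
      (isLinearInMomenta_eigenSliceMomRow i)
  · exact isLinearInMomenta_eigenSliceMomRow i

/-- The functions `tr A ^ n B`, `M`, `j_2 A ^ n i_2` are linear in the momenta. -/
theorem isLinearInMomenta_conjugatesFree (τ : ℂ) (α : Fin k ⊕ Fin (k + 1)) :
    IsLinearInMomenta (sliceHom τ (eigenSlice k) (conjugatesFree k α).1) := by
  have hl : ∀ a, IsBasic (eigenSlice k (Sum.inl (Sum.inl a))) := fun a => isBasic_eigenX _
  rcases α with n | n
  · change IsLinearInMomenta (sliceHom τ (eigenSlice k) (traceAB k 1 n).1)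
    rw [sliceHom_traceAB]
    exact IsLinearInMomenta.sum _ fun a _ =>
      IsLinearInMomenta.mul ((hl a).pow _) (isLinearInMomenta_eigenSliceMom (k := k) (Sum.inl a))
  · refine Fin.cases ?_ (fun n => ?_) n
    · change IsLinearInMomenta (sliceHom τ (eigenSlice k) (X (Sum.inr (Sum.inr (Sum.inr 0)))))
      rw [sliceHom_mom]
      exact isLinearInMomenta_eigenSliceMom (k := k) (Sum.inr (Sum.inr 0))
    · change IsLinearInMomenta (sliceHom τ (eigenSlice k) (covariant k 1 1 1 n).1)
      rw [sliceHom_covariant]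
      refine IsLinearInMomenta.sum _ fun a _ => IsLinearInMomenta.mul (IsBasic.mul ?_
        ((hl a).pow _)) ?_
      · rw [matj, Matrix.of_apply, sliceHom_j_one]
        exact isBasic_eigenSlicePos (k := k) (Sum.inr (Sum.inl a))
      · rw [mati, Matrix.of_apply, sliceHom_i_one]
        exact isLinearInMomenta_eigenSliceMom (k := k) (Sum.inr (Sum.inl a))

theorem IsBasic.bracket_eq {f : EigenRing k} (hf : IsBasic f) (z : EigenRing k) :
    eigenBracket k f z = ∑ c, eigenBracket k f (eigenX k (Sum.inr c)) *
      eigenBracket k (eigenX k (Sum.inl c)) z := by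
  refine (awayBracket_eq _ f z).trans (Finset.sum_congr rfl fun c _ => ?_)
  have h : awayBracket (eigenDelta k * eigenResultant k)
      (awayX (eigenDelta k * eigenResultant k) (Sum.inl c)) f = 0 := hf c
  rw [h, eigenBracket_skew f]
  ring

/-- Functions `g_α` that are linear in the momenta determine the momenta: if the matrix of brackets
`{H_x, g_α}` with functions `H_x` of the positions is invertible over `S`, the momenta are
combinations of the derivatives of the `H_x` with coefficients in `S`. -/
theorem exists_momenta_eq {S : Subalgebra ℂ (EigenRing k)} {H g : EigenPos k → EigenRing k}
    (hH : ∀ x, IsBasic (H x)) (hg : ∀ α, IsLinearInMomenta (g α)) (hgS : ∀ α, g α ∈ S)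
    (hS : ∀ x α, eigenBracket k (H x) (g α) ∈ S) {t : EigenRing k} (htS : t ∈ S)
    (ht : (Matrix.of fun x α => eigenBracket k (H x) (g α)).det * t = 1) :
    ∃ y : EigenPos k → S, ∀ c, eigenX k (Sum.inr c) =
      ∑ x, (y x : EigenRing k) * eigenBracket k (H x) (eigenX k (Sum.inr c)) := by
  set Z : Matrix (EigenPos k) (EigenPos k) S := Matrix.of fun x α =>
    ⟨eigenBracket k (H x) (g α), hS x α⟩ with hZ
  set J : Matrix (EigenPos k) (EigenPos k) (EigenRing k) := Matrix.of fun x c =>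
    eigenBracket k (H x) (eigenX k (Sum.inr c)) with hJ
  set Y : Matrix (EigenPos k) (EigenPos k) (EigenRing k) := Matrix.of fun c α =>
    eigenBracket k (eigenX k (Sum.inl c)) (g α) with hY
  have hJY : J * Y = S.val.toRingHom.mapMatrix Z := by
    ext x α
    rw [Matrix.mul_apply]
    exact ((hH x).bracket_eq (g α)).symm
  have hadj : (J * Y) * (t • (J * Y).adjugate) = 1 := by
    have h1 : (J * Y).det = (Matrix.of fun x α => eigenBracket k (H x) (g α)).det := by
      rw [hJY]
      rfl
    rw [Matrix.mul_smul, Matrix.mul_adjugate, h1, smul_smul, mul_comm t _, ht, one_smul]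
  have h2 : (Y * (t • (J * Y).adjugate)) * J = 1 := by
    rw [mul_eq_one_comm, ← Matrix.mul_assoc, hadj]
  let p : EigenPos k → EigenRing k := fun c => eigenX k (Sum.inr c)
  have hpg : Matrix.vecMul p Y = g := by
    funext α
    rw [hg α]
    simp only [Matrix.vecMul, dotProduct, hY, Matrix.of_apply, p]
    exact Finset.sum_congr rfl fun c _ => mul_comm _ _
  have h3 : p = Matrix.vecMul (Matrix.vecMul g (t • (J * Y).adjugate)) J := by
    rw [← hpg, Matrix.vecMul_vecMul, Matrix.vecMul_vecMul, ← Matrix.mul_assoc, h2, Matrix.vecMul_one]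
  refine ⟨fun x => ⟨Matrix.vecMul g (t • (J * Y).adjugate) x, ?_⟩, fun c => ?_⟩
  · rw [hJY, ← RingHom.map_adjugate]
    change ∑ α, g α * (t * (Z.adjugate α x : EigenRing k)) ∈ S
    exact S.sum_mem fun α _ => S.mul_mem (hgS α) (S.mul_mem htS (Z.adjugate α x).2)
  · exact congrFun h3 c

theorem eigenBracket_powerSum {n : ℕ} (e : Fin n → EigenPos k) (i : ℕ)
    (c : EigenPos k) : eigenBracket k (∑ a, eigenX k (Sum.inl (e a)) ^ (i + 1))
      (eigenX k (Sum.inr c)) =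
      ∑ a, if e a = c then ((i + 1 : ℕ) : EigenRing k) * eigenX k (Sum.inl (e a)) ^ i else 0 := by
  rw [eigenBracket_skew, map_sum, ← Finset.sum_neg_distrib]
  refine Finset.sum_congr rfl fun a _ => ?_
  rw [Derivation.leibniz_pow, eigenBracket_pq, Nat.add_sub_cancel]
  by_cases h : e a = c
  · rw [if_pos h.symm, if_pos h]
    simp
  · rw [if_neg (Ne.symm h), if_neg h]
    simp

/-- The discriminant is the square of the Vandermonde determinant up to sign. -/
theorem prod_offDiag_sub {n : ℕ} {R : Type} [CommRing R] (l : Fin n → R) : ∃ m : ℕ,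
    ∏ x ∈ (Finset.univ : Finset (Fin n)).offDiag, (l x.1 - l x.2) =
      (-1) ^ m * (Matrix.vandermonde l).det ^ 2 := by
  have h1 : ∏ x ∈ (Finset.univ : Finset (Fin n)).offDiag with x.1 < x.2, (l x.2 - l x.1) =
      (Matrix.vandermonde l).det := by
    rw [Matrix.det_vandermonde, Finset.prod_sigma']
    refine Finset.prod_bij (fun x _ => ⟨x.1, x.2⟩) (fun x hx => ?_) (fun x _ y _ h => ?_)
      (fun x hx => ?_) fun x _ => rfl
    · simpa using (Finset.mem_filter.1 hx).2
    · rcases x with ⟨x, x'⟩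
      rcases y with ⟨y, y'⟩
      simpa using h
    · have := Finset.mem_Ioi.1 (Finset.mem_sigma.1 hx).2
      exact ⟨(x.1, x.2), by simpa using ⟨this.ne, this⟩, rfl⟩
  have h2 : ∏ x ∈ (Finset.univ : Finset (Fin n)).offDiag with ¬ x.1 < x.2, (l x.1 - l x.2) =
      ∏ x ∈ (Finset.univ : Finset (Fin n)).offDiag with x.1 < x.2, (l x.2 - l x.1) := by
    refine Finset.prod_equiv (Equiv.prodComm _ _) (fun x => ?_) fun x _ => rfl
    simp only [Finset.mem_filter, Finset.mem_offDiag, Finset.mem_univ, true_and, not_lt,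
      Equiv.prodComm_apply, Prod.fst_swap, Prod.snd_swap]
    constructor
    · rintro ⟨h, h'⟩
      exact ⟨h.symm, lt_of_le_of_ne h' h.symm⟩
    · rintro ⟨h, h'⟩
      exact ⟨h.symm, h'.le⟩
  have h3 : ∏ x ∈ (Finset.univ : Finset (Fin n)).offDiag with x.1 < x.2, (l x.1 - l x.2) =
      (-1) ^ ((Finset.univ : Finset (Fin n)).offDiag.filter fun x => x.1 < x.2).card *
      ∏ x ∈ (Finset.univ : Finset (Fin n)).offDiag with x.1 < x.2, (l x.2 - l x.1) := by
    rw [← Finset.prod_const, ← Finset.prod_mul_distrib]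
    exact Finset.prod_congr rfl fun x _ => by ring
  refine ⟨((Finset.univ : Finset (Fin n)).offDiag.filter fun x => x.1 < x.2).card, ?_⟩
  rw [← Finset.prod_filter_mul_prod_filter_not _ (fun x => x.1 < x.2), h2, h3, h1, pow_two,
    mul_assoc]

theorem prod_offDiag_sub_mem {n : ℕ} {R : Type} [CommRing R] [Algebra ℂ R] {S : Subalgebra ℂ R}
    {l : Fin n → R} (hl : ∀ i : ℕ, ∑ a, l a ^ i ∈ S) :
    ∏ x ∈ (Finset.univ : Finset (Fin n)).offDiag, (l x.1 - l x.2) ∈ S := by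
  have h := aeval_mem_of_isSymmetric hl
    (G := ∏ x ∈ (Finset.univ : Finset (Fin n)).offDiag, (X x.1 - X x.2)) fun σ => by
      rw [map_prod]
      simp only [map_sub, rename_X]
      refine Finset.prod_equiv (σ.prodCongr σ) (fun x => ?_) fun x _ => rfl
      simp
  simpa [map_prod] using h

theorem prod_offDiag_mul_prod_nodeInv {n : ℕ} {R : Type} [CommRing R] {l : Fin n → R}
    (hl : ∀ a b, a ≠ b → IsUnit (l a - l b)) :
    (∏ x ∈ (Finset.univ : Finset (Fin n)).offDiag, (l x.1 - l x.2)) * ∏ a, nodeInv l a = 1 := by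
  rw [← prod_eval_derivative_nodal, ← Finset.prod_mul_distrib]
  refine Finset.prod_eq_one fun a _ => ?_
  rw [Lagrange.eval_nodal_derivative_eval_node_eq (Finset.mem_univ a), mul_comm]
  exact nodeInv_mul hl a

/-- If `S` contains the power sums and the inverse of `Δ R`, it contains the inverse of
`bracketDet`, which is a constant times `∏_{a ≠ c} (λ_a - λ_c) · R`. -/
theorem exists_inverse_bracketDet {S : Subalgebra ℂ (EigenRing k)}
    (hh : ∀ i : ℕ, ∑ b, eigenH k b ^ i ∈ S) {t : EigenRing k} (htS : t ∈ S)
    (ht : algebraMap _ (EigenRing k) (eigenDelta k * eigenResultant k) * t = 1) :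
    ∃ t' ∈ S, bracketDet (eigenSlice k) * t' = 1 := by
  have hd := congrArg (algebraMap _ (EigenRing k)) (eigenDelta_eq k)
  have hr := congrArg (algebraMap _ (EigenRing k)) (eigenResultant_eq k)
  simp only [map_mul, map_prod, map_sub] at hd hr
  rw [map_mul, hd, hr] at ht
  have hn := prod_offDiag_mul_prod_nodeInv (isUnit_sub_eigenL (k := k))
  obtain ⟨m, hm⟩ := prod_offDiag_sub (eigenL k)
  have h2 := prod_offDiag_sub_mem hh
  set δ₁ := ∏ x ∈ (Finset.univ : Finset (Fin k)).offDiag, (eigenL k x.1 - eigenL k x.2)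
  set δ₂ := ∏ x ∈ (Finset.univ : Finset (Fin (k + 1))).offDiag, (eigenH k x.1 - eigenH k x.2)
  set r := ∏ a, ∏ b, (eigenL k a - eigenH k b) with hrdef
  replace ht : δ₁ * δ₂ * r * t = 1 := ht
  have hv : ∏ a, eigenSlice k (Sum.inl (Sum.inr (Sum.inl a))) =
      (-1) ^ k * (r * ∏ a, nodeInv (eigenL k) a) := by
    have h3 : ∀ a, eigenSlice k (Sum.inl (Sum.inr (Sum.inl a))) =
        -1 * ((∏ b, (eigenL k a - eigenH k b)) * nodeInv (eigenL k) a) := fun a => by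
      change -(∏ b, (eigenL k a - eigenH k b)) * nodeInv (eigenL k) a = _
      ring
    rw [Finset.prod_congr rfl fun a _ => h3 a, Finset.prod_mul_distrib, Finset.prod_mul_distrib,
      Finset.prod_const, Finset.card_univ, Fintype.card_fin]
  have hV : (Matrix.vandermonde fun a => eigenSlice k (Sum.inl (Sum.inl a))).det ^ 4 = δ₁ ^ 2 := by
    change (Matrix.vandermonde (eigenL k)).det ^ 4 = _
    rw [hm, mul_pow, ← pow_mul, mul_comm m, pow_mul, neg_one_sq, one_pow, one_mul]
    ring
  let c : ℂ := (∏ i : Fin k, ((i : ℕ) + 1 : ℂ)) * (∏ i : Fin k, ((i : ℕ) + 2 : ℂ))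
  have hc : c ≠ 0 := by
    refine mul_ne_zero (Finset.prod_ne_zero_iff.2 fun i _ => Nat.cast_add_one_ne_zero _)
      (Finset.prod_ne_zero_iff.2 fun i _ => ?_)
    exact_mod_cast (Nat.succ_ne_zero (i + 1 : ℕ))
  have hcmap : (∏ i : Fin k, ((i : ℕ) + 1 : EigenRing k)) * (∏ i : Fin k, ((i : ℕ) + 2 : EigenRing k))
      = algebraMap ℂ _ c := by
    simp only [c, map_mul, map_prod, map_add, map_natCast, map_one, map_ofNat]
  have hc' : algebraMap ℂ (EigenRing k) c * algebraMap ℂ (EigenRing k) c⁻¹ = 1 := by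
    rw [← map_mul, mul_inv_cancel₀ hc, map_one]
  have hsign : ((-1 : EigenRing k) ^ k) * (-1) ^ k = 1 := by
    rw [← mul_pow]
    simp
  refine ⟨algebraMap ℂ _ c⁻¹ * (-1) ^ k * (δ₂ * t), S.mul_mem (S.mul_mem (S.algebraMap_mem _)
    (S.pow_mem (S.neg_mem S.one_mem) _)) (S.mul_mem h2 htS), ?_⟩
  rw [bracketDet, hcmap, hV, hv]
  generalize ∏ a, nodeInv (eigenL k) a = ν at hn
  calc algebraMap ℂ (EigenRing k) c * δ₁ ^ 2 * ((-1) ^ k * (r * ν)) *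
      (algebraMap ℂ _ c⁻¹ * (-1) ^ k * (δ₂ * t)) =
      (algebraMap ℂ (EigenRing k) c * algebraMap ℂ (EigenRing k) c⁻¹) * ((-1) ^ k * (-1) ^ k) *
      (δ₁ * ν) * (δ₁ * δ₂ * r * t) := by ring
    _ = 1 := by rw [hc', hsign, hn, ht]; ring

/-- A subalgebra that is closed under the bracket and contains the invariant functions of the
matrices and the inverse of `Δ R` contains all invariants of `S_k × S_{k+1}`. -/
theorem eigenvalueHom_mem (τ : ℂ) {S : Subalgebra ℂ (EigenRing k)}
    (hS : ∀ f ∈ invariants k 1, sliceHom τ (eigenSlice k) f ∈ S) {t : EigenRing k} (htS : t ∈ S)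
    (ht : algebraMap _ (EigenRing k) (eigenDelta k * eigenResultant k) * t = 1)
    (x : EigenvalueAlgebra k) : eigenvalueHom k x ∈ S := by
  have hl : ∀ i : ℕ, ∑ a, eigenL k a ^ i ∈ S := powerSum_mem τ hS
  have hh : ∀ i : ℕ, ∑ b, eigenH k b ^ i ∈ S := fun i => by
    rw [← eigenRestrict_traceHatA τ]
    exact hS _ (traceHatInv k 1 i).2
  obtain ⟨t', ht'S, ht'⟩ := exists_inverse_bracketDet hh htS ht
  let H : EigenPos k → EigenRing k :=
    Sum.elim (fun i => ∑ a, eigenX k (Sum.inl (Sum.inl a)) ^ ((i : ℕ) + 1))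
      fun j => ∑ b, eigenX k (Sum.inl (Sum.inr b)) ^ ((j : ℕ) + 1)
  have hHinv : ∀ x, sliceHom τ (eigenSlice k) (hamiltonianInv k 1 x).1 = H x := by
    rintro (i | j)
    · exact sliceHom_traceInv τ (eigenSlice k) _
    · exact eigenRestrict_traceHatA τ _
  have hbr : ∀ f g : invariants k 1, eigenBracket k (sliceHom τ (eigenSlice k) f.1)
      (sliceHom τ (eigenSlice k) g.1) =
      sliceHom τ (eigenSlice k) (canonicalBracket (Pos k 1) f.1 g.1) := fun f g =>
    sliceHom_bracket τ _ (isCanonical_eigenSlice k) isSeparated_eigenSlice f.2 g.2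
  obtain ⟨y, hy⟩ := exists_momenta_eq (S := S) (H := H)
    (g := fun α => sliceHom τ (eigenSlice k) (conjugatesFree k α).1)
    (by
      rintro (i | j)
      · exact IsBasic.sum _ fun a _ => (isBasic_eigenX _).pow _
      · exact IsBasic.sum _ fun a _ => (isBasic_eigenX _).pow _)
    (isLinearInMomenta_conjugatesFree τ) (fun α => hS _ (conjugatesFree k α).2)
    (fun x α => by
      rw [← hHinv, hbr]
      exact hS _ (invariants_bracket k 1 _ (hamiltonianInv k 1 x).2 _ (conjugatesFree k α).2))
    ht'S (by
      rw [← ht', ← det_bracket_hamiltonian τ (eigenSlice k)]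
      simp only [← hHinv, hbr])
  have hmomL : ∀ a, momL k a = ∑ i : Fin k,
      ((y (Sum.inl i) * ((i + 1 : ℕ) : S) : S) : EigenRing k) * eigenL k a ^ (i : ℕ) := by
    intro a
    refine (hy (Sum.inl a)).trans ?_
    rw [Fintype.sum_sum_type]
    have h1 : ∀ i : Fin k, eigenBracket k (H (Sum.inl i)) (eigenX k (Sum.inr (Sum.inl a))) =
        ((i + 1 : ℕ) : EigenRing k) * eigenL k a ^ (i : ℕ) := fun i => by
      refine (eigenBracket_powerSum Sum.inl i (Sum.inl a)).trans ?_
      simp only [Sum.inl.injEq, Finset.sum_ite_eq', Finset.mem_univ, if_true]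
      rfl
    have h2 : ∀ j, eigenBracket k (H (Sum.inr j)) (eigenX k (Sum.inr (Sum.inl a))) = 0 := fun j => by
      refine (eigenBracket_powerSum Sum.inr j (Sum.inl a)).trans ?_
      simp
    simp only [h1, h2, mul_zero, Finset.sum_const_zero, add_zero]
    exact Finset.sum_congr rfl fun i _ => by push_cast; ring
  have hmomH : ∀ b, momH k b = ∑ j : Fin (k + 1),
      ((y (Sum.inr j) * ((j + 1 : ℕ) : S) : S) : EigenRing k) * eigenH k b ^ (j : ℕ) := by
    intro b
    refine (hy (Sum.inr b)).trans ?_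
    rw [Fintype.sum_sum_type]
    have h1 : ∀ j : Fin (k + 1), eigenBracket k (H (Sum.inr j)) (eigenX k (Sum.inr (Sum.inr b))) =
        ((j + 1 : ℕ) : EigenRing k) * eigenH k b ^ (j : ℕ) := fun j => by
      refine (eigenBracket_powerSum Sum.inr j (Sum.inr b)).trans ?_
      simp only [Sum.inr.injEq, Finset.sum_ite_eq', Finset.mem_univ, if_true]
      rfl
    have h2 : ∀ i, eigenBracket k (H (Sum.inl i)) (eigenX k (Sum.inr (Sum.inr b))) = 0 := fun i => by
      refine (eigenBracket_powerSum Sum.inl i (Sum.inr b)).trans ?_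
      simp
    simp only [h1, h2, mul_zero, Finset.sum_const_zero, zero_add]
    exact Finset.sum_congr rfl fun i _ => by push_cast; ring
  induction x using TensorProduct.induction_on with
  | zero => rw [map_zero]; exact S.zero_mem
  | add x y hx hy => rw [map_add]; exact S.add_mem hx hy
  | tmul f g =>
    rw [eigenvalueHom_tmul]
    exact S.mul_mem (aeval_symInvariants_mem hl hmomL f.2) (aeval_symInvariants_mem hh hmomH g.2)

end

/-! ### The isomorphism of the localisations -/

section

theorem range_awayLift_le {A R : Type} [CommRing A] [Algebra ℂ A] [CommRing R] [Algebra ℂ R] {d : A}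
    (φ : A →ₐ[ℂ] R) (h : IsUnit (φ d)) {S : Subalgebra ℂ R} (hS : ∀ a, φ a ∈ S) {t : R}
    (htS : t ∈ S) (ht : φ d * t = 1) : (awayLift φ h).range ≤ S := by
  rintro _ ⟨x, rfl⟩
  change awayLift φ h x ∈ S
  obtain ⟨n, a, ha⟩ := exists_away_eq d x
  have h1 := congrArg (awayLift φ h) ha
  rw [map_mul, awayLift_algebraMap, awayLift_algebraMap, map_pow] at h1
  have h2 : awayLift φ h x = t ^ n * φ a := by
    rw [← h1, mul_left_comm, ← mul_pow, mul_comm t, ht, one_pow, mul_one]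
  rw [h2]
  exact S.mul_mem (S.pow_mem htS n) (hS a)

/-- Let the Poisson algebras `A` and `A'` be embedded in a Poisson algebra, with the same image of
`d ∈ A` and `d' ∈ A'`. If the image of `A` consists of fractions of elements of `A'` with
denominators `δ ^ n`, where `δ ∣ d'`, and `A'` is contained in the localisation of `A` at `d`, then
the localisations are isomorphic. -/
theorem exists_away_equiv {A A' R : Type} [CommRing A] [Algebra ℂ A] [CommRing A'] [Algebra ℂ A']
    [CommRing R] [Algebra ℂ R] {d : A} {d' δ : A'} (β : PoissonBracket A) (β' : PoissonBracket A')
    (γ : PoissonBracket R) {φ : A →ₐ[ℂ] R} {φ' : A' →ₐ[ℂ] R} (h : IsUnit (φ d))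
    (hd : φ d = φ' d') (hδ : δ ∣ d') (hφ : Function.Injective φ) (hφ' : Function.Injective φ')
    (hβ : ∀ x y, γ (φ x) (φ y) = φ (β x y)) (hβ' : ∀ x y, γ (φ' x) (φ' y) = φ' (β' x y))
    (hA : ∀ a, ∃ (n : ℕ) (b : A'), φ a * φ' (δ ^ n) = φ' b)
    (hA' : ∀ S : Subalgebra ℂ R, (∀ a, φ a ∈ S) → ∀ t ∈ S, φ d * t = 1 → ∀ b, φ' b ∈ S) :
    ∃ ψ : Localization.Away d ≃ₐ[ℂ] Localization.Away d',
      (∀ x y, ψ (localizeBracket β d x y) = localizeBracket β' d' (ψ x) (ψ y)) ∧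
      (∀ a b, φ a = φ' b → ψ (algebraMap _ _ a) = algebraMap _ _ b) ∧
      ∀ a, ∃ (n : ℕ) (b : A'), ψ (algebraMap A _ a) * algebraMap A' _ (δ ^ n) = algebraMap A' _ b := by
  have h' : IsUnit (φ' d') := hd ▸ h
  have hinj := awayLift_injective φ h hφ
  have hinj' := awayLift_injective φ' h' hφ'
  have hrange : (awayLift φ h).range = (awayLift φ' h').range := by
    obtain ⟨t, htS, ht⟩ := inverse_mem_range_awayLift φ h
    obtain ⟨u, huS, hu⟩ := inverse_mem_range_awayLift φ' h'
    have hmem : ∀ a, φ a ∈ (awayLift φ h).range := fun a =>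
      ⟨algebraMap _ _ a, awayLift_algebraMap _ _ _⟩
    have hmem' : ∀ b, φ' b ∈ (awayLift φ' h').range := fun b =>
      ⟨algebraMap _ _ b, awayLift_algebraMap _ _ _⟩
    refine le_antisymm (range_awayLift_le _ _ (fun a => ?_) huS (hd ▸ hu))
      (range_awayLift_le _ _ (hA' _ hmem t htS ht) htS (hd ▸ ht))
    obtain ⟨n, b, hb⟩ := hA a
    obtain ⟨ρ, hρ⟩ := hδ
    have h1 : φ a = φ' b * (φ' ρ * u) ^ n := by
      rw [← hb, map_pow, mul_assoc, ← mul_pow, ← mul_assoc, ← map_mul, ← hρ, hu, one_pow, mul_one]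
    rw [h1]
    exact Subalgebra.mul_mem _ (hmem' b)
      (Subalgebra.pow_mem _ (Subalgebra.mul_mem _ (hmem' ρ) huS) n)
  let ψ : Localization.Away d ≃ₐ[ℂ] Localization.Away d' :=
    (AlgEquiv.ofInjective _ hinj).trans
      ((Subalgebra.equivOfEq _ _ hrange).trans (AlgEquiv.ofInjective _ hinj').symm)
  have hψ : ∀ x, awayLift φ' h' (ψ x) = awayLift φ h x := fun x =>
    congrArg Subtype.val (AlgEquiv.apply_symm_apply (AlgEquiv.ofInjective _ hinj')
      (Subalgebra.equivOfEq _ _ hrange (AlgEquiv.ofInjective _ hinj x)))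
  refine ⟨ψ, fun x y => hinj' ?_, fun a b hab => hinj' ?_, fun a => ?_⟩
  · rw [hψ, ← bracket_map_away β γ (awayLift φ h) (fun f g => by
        simp only [awayLift_algebraMap, hβ]) x y,
      ← bracket_map_away β' γ (awayLift φ' h') (fun f g => by
        simp only [awayLift_algebraMap, hβ']) (ψ x) (ψ y), hψ, hψ]
  · rw [hψ, awayLift_algebraMap, awayLift_algebraMap, hab]
  · obtain ⟨n, b, hb⟩ := hA a
    refine ⟨n, b, hinj' ?_⟩
    rw [map_mul, hψ, awayLift_algebraMap, awayLift_algebraMap, awayLift_algebraMap, hb]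

variable {k : ℕ}

/-- The invariant functions of the matrices are `S_k × S_{k+1}`-invariant functions of the eigenvalues
and their momenta, with poles on `Δ = 0` only. -/
theorem exists_eigenRestrict_mul_eq (τ : ℂ) {D : EigenvalueAlgebra k}
    (hD : toPolynomial k D = eigenvalueDelta k) (f : InstantonAlgebra k 1 τ) :
    ∃ (n : ℕ) (t : EigenvalueAlgebra k),
      eigenRestrict k τ f * eigenvalueHom k (D ^ n) = eigenvalueHom k t := by
  obtain ⟨g, hg⟩ := toInstanton_surjective τ f
  obtain ⟨n, p, hp⟩ := sliceHom_eigenSlice_mem τ (k := k) g.1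
  rw [← eigenRestrict_toInstanton, hg] at hp
  obtain ⟨t, ht⟩ := exists_rename_toPolynomial_eq (p := p) fun σ ρ => by
    apply algebraMap_eigenRing_injective k
    rw [← eigenPerm_algebraMap, ← hp, map_mul, eigenPerm_eigenRestrict, eigenPerm_algebraMap,
      map_pow, rename_eigenDelta]
  refine ⟨n, t, ?_⟩
  rw [eigenvalueHom_apply t, ht, ← hp, eigenvalueHom_apply, map_pow, map_pow, hD]
  rfl

theorem eigenvalueHom_mul_eq {D R : EigenvalueAlgebra k}
    (hD : toPolynomial k D = eigenvalueDelta k) (hR : toPolynomial k R = eigenvalueResultant k) :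
    eigenvalueHom k (D * R) = algebraMap _ (EigenRing k) (eigenDelta k * eigenResultant k) := by
  rw [eigenvalueHom_apply, map_mul, map_mul, hD, hR]
  rfl

theorem eigenRestrict_discriminant_mul_mixedResultant (τ : ℂ) :
    eigenRestrict k τ (discriminant k 1 τ * mixedResultant k 1 τ) =
      algebraMap _ (EigenRing k) (eigenDelta k * eigenResultant k) := by
  rw [map_mul, eigenRestrict_discriminant, eigenRestrict_mixedResultant,
    map_mul (algebraMap _ (EigenRing k))]

end

end Instanton

theorem theorem1 (k : ℕ) (hk : 1 ≤ k) (τ : ℂ) :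
    (Instanton.IsCompletelyIntegrable (Instanton.instantonBracket k 0 τ)
        (Instanton.integrals k 0 τ) ∧
      (∀ a b : Fin k ⊕ Fin (k + 1),
        Instanton.instantonBracket k 0 τ (Instanton.hamiltonian k 0 τ a)
          (Instanton.hamiltonian k 0 τ b) = 0) ∧
      RingHom.ker (MvPolynomial.aeval (R := ℂ) (Instanton.hamiltonian k 0 τ)) =
        Ideal.span {MvPolynomial.X (Sum.inl (⟨0, hk⟩ : Fin k)) -
          MvPolynomial.X (Sum.inr (0 : Fin (k + 1)))}) ∧
    (Instanton.discriminant k 1 τ * Instanton.mixedResultant k 1 τ ∈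
        nonZeroDivisors (Instanton.InstantonAlgebra k 1 τ) ∧
      ∃ D R : Instanton.EigenvalueAlgebra k,
        Instanton.toPolynomial k D = Instanton.eigenvalueDelta k ∧
        Instanton.toPolynomial k R = Instanton.eigenvalueResultant k ∧
        ∃ ψ : Instanton.LocalizedInstantonAlgebra k τ ≃ₐ[ℂ] Localization.Away (D * R),
          (∀ x y : Instanton.LocalizedInstantonAlgebra k τ,
            ψ (Instanton.localizedInstantonBracket k τ x y) =
              Instanton.localizeBracket (Instanton.eigenvalueBracket k) (D * R) (ψ x) (ψ y)) ∧
          (∀ i : ℕ, ψ (Instanton.toLocalized k τ (Instanton.traceA k 1 τ i)) =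
            Instanton.toLocalizedEigenvalue k (D * R) (Instanton.powerSumLeft k i)) ∧
          (∀ j : ℕ, ψ (Instanton.toLocalized k τ (Instanton.traceHatA k 1 τ j)) =
            Instanton.toLocalizedEigenvalue k (D * R) (Instanton.powerSumRight k j)) ∧
          (∀ f : Instanton.InstantonAlgebra k 1 τ,
            ∃ (n : ℕ) (g : Instanton.EigenvalueAlgebra k),
              ψ (Instanton.toLocalized k τ f) *
                  Instanton.toLocalizedEigenvalue k (D * R) (D ^ n) =
                Instanton.toLocalizedEigenvalue k (D * R) g)) := by
  refine ⟨⟨Instanton.isCompletelyIntegrable_integrals τ, Instanton.hamiltonian_bracket τ,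
    Instanton.ker_aeval_hamiltonian τ hk⟩,
    Instanton.discriminant_mul_mixedResultant_mem_nonZeroDivisors τ, ?_⟩
  obtain ⟨D, hD⟩ := Instanton.exists_eigenvalueDelta k
  obtain ⟨R, hR⟩ := Instanton.exists_eigenvalueResultant k
  have hd := Instanton.eigenRestrict_discriminant_mul_mixedResultant (k := k) τ
  obtain ⟨ψ, hbracket, hψ, hpole⟩ := Instanton.exists_away_equiv
    (d := Instanton.discriminant k 1 τ * Instanton.mixedResultant k 1 τ) (d' := D * R) (δ := D)
    (Instanton.instantonBracket k 1 τ)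
    (Instanton.eigenvalueBracket k) (Instanton.eigenBracket k) (Instanton.isUnit_eigenRestrict τ)
    (hd.trans (Instanton.eigenvalueHom_mul_eq hD hR).symm) ⟨R, rfl⟩
    (Instanton.eigenRestrict_injective τ)
    (Instanton.eigenvalueHom_injective k) (Instanton.eigenRestrict_bracket τ)
    Instanton.eigenvalueHom_bracket (Instanton.exists_eigenRestrict_mul_eq τ hD)
    fun S hS t htS ht => Instanton.eigenvalueHom_mem τ
      (fun f hf => hS (Instanton.toInstanton k 1 τ ⟨f, hf⟩)) htS (hd ▸ ht)
  refine ⟨D, R, hD, hR, ψ, hbracket, fun i => hψ _ _ ?_, fun j => hψ _ _ ?_, hpole⟩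
  · rw [Instanton.eigenRestrict_traceA, Instanton.eigenvalueHom_powerSumLeft]
  · rw [Instanton.eigenRestrict_traceHatA, Instanton.eigenvalueHom_powerSumRight]
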